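/- Identify $\mathbb{CP}^1=\mathbb C\cup\{\infty\}$ with the ideal boundary of hyperbolic space $\mathbb H^3$. For a Jordan curve $C\subset\mathbb{CP}^1$ let $\mathrm{CH}(C)\subset\mathbb H^3$ be its convex hull, let $\partial^+\mathrm{CH}(C)$ and $\partial^-\mathrm{CH}(C)$ be the boundaries in $\mathbb H^3$ of the two components of $\mathbb H^3\setminus\mathrm{CH}(C)$, and let $$w_\partial(C)=\max\Bigl(\sup_{x\in\partial^+\mathrm{CH}(C)}d(x,\partial^-\mathrm{CH}(C)),\ \sup_{x\in\partial^-\mathrm{CH}(C)}d(x,\partial^+\mathrm{CH}(C))\Bigr)\in[0,\infty]$$ be its boundary width. A quasicircle is the image of $\mathbb{RP}^1$ under a quasiconformal homeomorphism of $\mathbb{CP}^1$. Let $G=\{z\in\mathbb C:\ \mathrm{Re}\,z=0\text{ or }\mathrm{Im}\,z=0\}\cup\{\infty\}$. For an integer $n\ge 1$ let $G_n$ be the union of - the four segments $\{z\in G\setminus\{\infty\}:\ 1/n\le|z|\le n\}$; - the quarter circle of radius $1/n$ centred at $(1+i)/n$ that joins $1/n$ to $i/n$ (the short arc, near $0$),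 and its image under $z\mapsto -z$; - the three-quarter circle of radius $n$ centred at $n(-1+i)$ that joins $ni$ to $-n$ (the long arc, far from $0$), and its image under $z\mapsto -z$. Thus $G_n$ is obtained from $G$ by replacing neighbourhoods of $0$ and $\infty$ by arcs of circles tangent to the axes. Then: 1. Each $G_n$ is a Jordan curve, and $\lim_{n\to\infty}w_\partial(G_n)=\sinh^{-1}(\sqrt2)$. 2. The curves $G_n$ converge to $G$ in the Hausdorff topology on $\mathbb{CP}^1$, and $G$ is not a quasicircle. 3. If $w$ is a real number such that every Jordan curve $C\subset\mathbb{CP}^1$ with $w_\partial(C)<w$ is a quasicircle, then $w\le\sinh^{-1}(\sqrt2)$. -/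

import Mathlib

open Filter Topology MeasureTheory
open scoped ENNReal

/-! The Riemann sphere `ℂP¹` is `OnePoint ℂ`.  Hyperbolic three-space is the open unit ball of
`ℝ³` in the projective (Klein) model, whose ideal boundary is the unit sphere; in this model
geodesics are straight segments, so that hyperbolic convexity is ordinary convexity. -/

/-- Euclidean three-space. -/
abbrev E3 : Type := EuclideanSpace ℝ (Fin 3)

/-- Hyperbolic three-space, as the open unit ball (Klein model). -/
def hypSpace : Set E3 := Metric.ball 0 1

/-- The hyperbolic distance between two points of the Klein model:
`cosh d(x, y) = (1 - ⟨x, y⟩) / √((1 - |x|²) (1 - |y|²))`. -/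
noncomputable def hypDist (x y : E3) : ℝ :=
  Real.arcosh ((1 - inner ℝ x y) / Real.sqrt ((1 - ‖x‖ ^ 2) * (1 - ‖y‖ ^ 2)))

/-- The identification of `ℂP¹` with the ideal boundary of hyperbolic space: inverse
stereographic projection. -/
noncomputable def toSphere (p : OnePoint ℂ) : E3 :=
  p.elim !₂[0, 0, 1] fun z : ℂ =>
    !₂[2 * z.re / (‖z‖ ^ 2 + 1), 2 * z.im / (‖z‖ ^ 2 + 1), (‖z‖ ^ 2 - 1) / (‖z‖ ^ 2 + 1)]

/-- A Jordan curve in `ℂP¹`: a homeomorphic (equivalently, injective continuous) image of the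
circle. -/
def IsJordanCurve (C : Set (OnePoint ℂ)) : Prop :=
  ∃ γ : Circle → OnePoint ℂ, Continuous γ ∧ Function.Injective γ ∧ Set.range γ = C

/-- The convex hull in hyperbolic space of a set of ideal points. -/
def hypHull (C : Set (OnePoint ℂ)) : Set E3 :=
  convexHull ℝ (toSphere '' C) ∩ hypSpace

/-- The connected components of the complement of the convex hull in hyperbolic space.  For a
Jordan curve there are exactly two of them, one facing each complementary region of the curve. -/
def hullSides (C : Set (OnePoint ℂ)) : Set (Set E3) :=
  {W | ∃ x ∈ hypSpace \ hypHull C, W = connectedComponentIn (hypSpace \ hypHull C) x}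

/-- The piece of the boundary of the convex hull that faces the side `W`, that is, the boundary
of `W` in hyperbolic space.  The two sides of the hull of a Jordan curve give the two discs
`∂⁺ CH(C)` and `∂⁻ CH(C)`; both are equal to the hull itself if the curve is a round circle. -/
def facingBoundary (W : Set E3) : Set E3 := frontier W ∩ hypSpace

/-- The boundary width of a Jordan curve: the maximum, over the two ways of calling the boundary
discs `A` and `B`, of `sup_{x ∈ A} d(x, B)`.  It may be infinite. -/
noncomputable def boundaryWidth (C : Set (OnePoint ℂ)) : ℝ≥0∞ :=
  ⨆ W ∈ hullSides C, ⨆ W' ∈ hullSides C, ⨆ (_ : W ≠ W'),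
    ⨆ x ∈ facingBoundary W, ⨅ y ∈ facingBoundary W', ENNReal.ofReal (hypDist x y)

/-- A (compact, nondegenerate, simple) arc in the plane. -/
def IsArc (A : Set ℂ) : Prop :=
  ∃ γ : unitInterval → ℂ, Continuous γ ∧ Function.Injective γ ∧ Set.range γ = A

/-- The conformal modulus of a family of plane arcs: the infimum of `∫ ρ²` over the Borel
densities `ρ ≥ 0` that give every arc of the family `ρ`-length at least one.  (One-dimensional
Hausdorff measure on an arc is its arc length; the arcs of infinite length are a family of
modulus zero.) -/
noncomputable def modulus (Γ : Set (Set ℂ)) : ℝ≥0∞ :=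
  ⨅ (ρ : ℂ → ℝ≥0∞) (_ : Measurable ρ)
    (_ : ∀ A ∈ Γ, 1 ≤ ∫⁻ z in A, ρ z ∂(Measure.hausdorffMeasure 1)), ∫⁻ z, ρ z ^ 2

/-- The geometric definition of a `K`-quasiconformal homeomorphism of `ℂP¹`: it distorts the
modulus of every family of arcs at most by the factor `K`.  As the arcs through one given point
have modulus zero, it is enough to test families of arcs in `ℂ` whose images lie in `ℂ`.  (The
map is allowed to reverse the orientation; this does not change the notion of a quasicircle, as
complex conjugation preserves the real projective line.) -/
def IsQuasiconformal (K : ℝ) (f : OnePoint ℂ ≃ₜ OnePoint ℂ) : Prop :=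
  1 ≤ K ∧ ∀ Γ Γ' : Set (Set ℂ), (∀ A ∈ Γ, IsArc A) →
    (∀ A ∈ Γ, ∀ z ∈ A, f (z : OnePoint ℂ) ≠ OnePoint.infty) →
    Γ' = {B : Set ℂ | ∃ A ∈ Γ,
      ((↑) : ℂ → OnePoint ℂ) '' B = f '' (((↑) : ℂ → OnePoint ℂ) '' A)} →
    modulus Γ' ≤ ENNReal.ofReal K * modulus Γ ∧ modulus Γ ≤ ENNReal.ofReal K * modulus Γ'

/-- The real projective line in `ℂP¹`. -/
def realLine : Set (OnePoint ℂ) :=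
  insert OnePoint.infty (((↑) : ℂ → OnePoint ℂ) '' {z : ℂ | z.im = 0})

/-- A quasicircle: the image of the real projective line under a quasiconformal homeomorphism
of `ℂP¹`. -/
def IsQuasicircle (C : Set (OnePoint ℂ)) : Prop :=
  ∃ (K : ℝ) (f : OnePoint ℂ ≃ₜ OnePoint ℂ), IsQuasiconformal K f ∧ f '' realLine = C

/-- The union of the two coordinate axes in the plane. -/
def axes : Set ℂ := {z : ℂ | z.re = 0 ∨ z.im = 0}

/-- The curve `G` in `ℂP¹`: the union of the two coordinate axes, together with `∞`. -/
def crossCurve : Set (OnePoint ℂ) :=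
  insert OnePoint.infty (((↑) : ℂ → OnePoint ℂ) '' axes)

/-- The part of the axes that is kept, namely the points with `1/n ≤ |z| ≤ n`. -/
def truncatedAxes (n : ℕ) : Set ℂ :=
  axes \ {z : ℂ | (|z.re| < 1 / (n : ℝ) ∨ (n : ℝ) < |z.re|) ∧
    (|z.im| < 1 / (n : ℝ) ∨ (n : ℝ) < |z.im|)}

/-- The two quarter circles near the origin: they lie in the first and in the third quadrant,
are tangent to the axes, and join `1/n` to `i/n` and `-1/n` to `-i/n`. -/
def innerArcs (n : ℕ) : Set ℂ :=
  {z : ℂ | ‖z - (1 + Complex.I) / (n : ℂ)‖ = 1 / (n : ℝ) ∧ z.re + z.im ≤ 1 / (n : ℝ)} ∪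
  {z : ℂ | ‖z + (1 + Complex.I) / (n : ℂ)‖ = 1 / (n : ℝ) ∧ -(1 / (n : ℝ)) ≤ z.re + z.im}

/-- The two three-quarter circles far from the origin: they lie in the second and in the fourth
quadrant, are tangent to the axes, and join `ni` to `-n` and `-ni` to `n`. -/
def outerArcs (n : ℕ) : Set ℂ :=
  {z : ℂ | ‖z - (n : ℂ) * (-1 + Complex.I)‖ = (n : ℝ) ∧ (n : ℝ) ≤ z.im - z.re} ∪
  {z : ℂ | ‖z + (n : ℂ) * (-1 + Complex.I)‖ = (n : ℝ) ∧ z.im - z.re ≤ -(n : ℝ)}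

/-- The curve `G_n`. -/
def smoothedCross (n : ℕ) : Set (OnePoint ℂ) :=
  ((↑) : ℂ → OnePoint ℂ) '' (truncatedAxes n ∪ innerArcs n ∪ outerArcs n)

/-! ### Inverse stereographic projection -/

/-! A half-space disjoint from the hull has an ideal cap that misses the curve; being connected,
this cap lies in one of the two sides of the curve. So the two components of the complement of the
hull are the unions of the half-spaces over caps in either side (`IsSides.compl_hull_eq`), and the
width becomes a question about caps. `Deep Ω` says that a point lies over a cap in `Ω`, `Reach Ω k`
that it is within `arsinh k` of a half-space over such a cap. If every point is deep in one side or
within reach of the other, both ways round, the width is at most `arsinh k`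
(`IsSides.boundaryWidth_le`).

For the cross, let `(x, y, t)` be a point of upper half-space and `s² = x² + y² + t²`. The height
polynomials of the discs of radius `s` tangent to both axes are `2s(s - |x ± y|)`, and `|x + y| ≤ s`
forces `s - |x - y| ≤ √2 t`. This is the origin of the constant (`CrossDiscs.nearBoth_mid`).
Smoothing costs nothing. Within radius `e = 1/n` of the origin, discs tangent to both inner circles
do the job (`CrossDiscs.throat_plus`, `CrossDiscs.throat_minus`), and `z ↦ 1/z`, which exchanges the
two sides, takes care of the outer end. The midpoint of the geodesic from `2` to `2i` attains the
bound, so the width is exactly `arsinh √2` as soon as `n ≥ 60`.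

The cross itself is not a quasicircle because its complement falls into four quadrants, whereas the
complement of the image of the real line is covered by two connected sets.

The last assertion needs a single Jordan curve with arbitrarily narrow necks and width as close to
`arsinh √2` as desired. It follows the real line and carries at each integer `k` a small copy of a
smoothed cross with parameter `neck k`, which tends to infinity with `|k|`. Given `κ > √2`, the
estimates for the cross hold away from `-1` with caps that avoid a neighbourhood of `-1` whose size
depends only on `κ` (`exists_nearBoth_cross`). The copy is inserted with `-1` in the place of
infinity, so sufficiently small copies do not notice each other, and the width is at most `arsinh
κ`.

If this chain were the image of the real line under a `K`-quasiconformal `f`, then `f ∘ conj ∘ f⁻¹`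
would distort moduli by at most `K²`, fix the curve pointwise and exchange its sides. It would carry
arcs that join two strands of the curve beside a neck, a family of modulus at least `1/(2π)`, to
sets that have the same endpoints but must squeeze through the neck, a family of modulus at most `2π
/ log (neck k / 8)` (`IsQuasiconformal.neck_bound`). This fails for large `|k|`. -/

theorem norm_sq_eq_re_im (z : ℂ) : ‖z‖ ^ 2 = z.re ^ 2 + z.im ^ 2 := by
  rw [← Complex.normSq_eq_norm_sq, Complex.normSq_apply]; ring

theorem toSphere_coe_zero (z : ℂ) :
    toSphere z 0 = 2 * z.re / (z.re ^ 2 + z.im ^ 2 + 1) := by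
  rw [← norm_sq_eq_re_im]; rfl

theorem toSphere_coe_one (z : ℂ) :
    toSphere z 1 = 2 * z.im / (z.re ^ 2 + z.im ^ 2 + 1) := by
  rw [← norm_sq_eq_re_im]; rfl

theorem toSphere_coe_two (z : ℂ) :
    toSphere z 2 = (z.re ^ 2 + z.im ^ 2 - 1) / (z.re ^ 2 + z.im ^ 2 + 1) := by
  rw [← norm_sq_eq_re_im]; rfl

theorem toSphere_infty_zero : toSphere OnePoint.infty 0 = 0 := rfl
theorem toSphere_infty_one : toSphere OnePoint.infty 1 = 0 := rfl
theorem toSphere_infty_two : toSphere OnePoint.infty 2 = 1 := rfl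

theorem E3.norm_sq (p : E3) : ‖p‖ ^ 2 = p 0 ^ 2 + p 1 ^ 2 + p 2 ^ 2 := by
  rw [EuclideanSpace.real_norm_sq_eq, Fin.sum_univ_three]

theorem E3.inner_eq (p q : E3) : inner ℝ p q = p 0 * q 0 + p 1 * q 1 + p 2 * q 2 := by
  simp [PiLp.inner_apply, Fin.sum_univ_three, mul_comm]

theorem E3.ext_iff' {p q : E3} : p = q ↔ p 0 = q 0 ∧ p 1 = q 1 ∧ p 2 = q 2 := by
  constructor
  · rintro rfl; simp
  · rintro ⟨h0, h1, h2⟩; ext i; fin_cases i <;> assumption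

theorem mem_hypSpace {p : E3} : p ∈ hypSpace ↔ p 0 ^ 2 + p 1 ^ 2 + p 2 ^ 2 < 1 := by
  rw [← E3.norm_sq, hypSpace, mem_ball_zero_iff]
  constructor
  · intro h; nlinarith [norm_nonneg p]
  · intro h; nlinarith [norm_nonneg p]

theorem norm_toSphere (q : OnePoint ℂ) : ‖toSphere q‖ = 1 := by
  have : ‖toSphere q‖ ^ 2 = 1 := by
    rw [E3.norm_sq]
    induction q using OnePoint.rec with
    | infty => simp [toSphere_infty_zero, toSphere_infty_one, toSphere_infty_two]
    | coe z =>
      rw [toSphere_coe_zero, toSphere_coe_one, toSphere_coe_two]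
      have : z.re ^ 2 + z.im ^ 2 + 1 ≠ 0 := by positivity
      field_simp; ring
  nlinarith [norm_nonneg (toSphere q)]

theorem exists_toSphere_eq {p : E3} (hp : ‖p‖ = 1) : ∃ q, toSphere q = p := by
  have h1 : p 0 ^ 2 + p 1 ^ 2 + p 2 ^ 2 = 1 := by rw [← E3.norm_sq, hp, one_pow]
  by_cases h : p 2 = 1
  · refine ⟨OnePoint.infty, E3.ext_iff'.2 ?_⟩
    rw [toSphere_infty_zero, toSphere_infty_one, toSphere_infty_two]
    rw [h] at h1
    refine ⟨?_, ?_, h.symm⟩ <;> nlinarith [sq_nonneg (p 0), sq_nonneg (p 1)]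
  · have h2 : p 2 < 1 := lt_of_le_of_ne
      (by nlinarith [sq_nonneg (p 0), sq_nonneg (p 1), sq_nonneg (p 2 - 1)]) h
    have h3 : 1 - p 2 ≠ 0 := by linarith
    have h4 : (p 0 / (1 - p 2)) ^ 2 + (p 1 / (1 - p 2)) ^ 2 = (1 + p 2) / (1 - p 2) := by
      field_simp; nlinarith
    have h5 : (1 + p 2) / (1 - p 2) + 1 = 2 / (1 - p 2) := by field_simp; ring
    refine ⟨((⟨p 0 / (1 - p 2), p 1 / (1 - p 2)⟩ : ℂ) : OnePoint ℂ), E3.ext_iff'.2 ?_⟩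
    rw [toSphere_coe_zero, toSphere_coe_one, toSphere_coe_two]
    simp only [h4, h5]
    refine ⟨?_, ?_, ?_⟩ <;> field_simp
    ring

theorem toSphere_injective : Function.Injective toSphere := by
  have key : ∀ z : ℂ, 1 - toSphere z 2 = 2 / (z.re ^ 2 + z.im ^ 2 + 1) := by
    intro z
    rw [toSphere_coe_two]
    have : z.re ^ 2 + z.im ^ 2 + 1 ≠ 0 := by positivity
    field_simp; ring
  have key2 : ∀ z : ℂ, toSphere z 2 ≠ 1 := by
    intro z h
    have := key z
    rw [h, sub_self] at this
    have h2 : (0 : ℝ) < 2 / (z.re ^ 2 + z.im ^ 2 + 1) := by positivity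
    linarith
  have key0 : ∀ z : ℂ, z.re = toSphere z 0 / (1 - toSphere z 2) := by
    intro z
    rw [key, toSphere_coe_zero]
    have : z.re ^ 2 + z.im ^ 2 + 1 ≠ 0 := by positivity
    field_simp
  have key1 : ∀ z : ℂ, z.im = toSphere z 1 / (1 - toSphere z 2) := by
    intro z
    rw [key, toSphere_coe_one]
    have : z.re ^ 2 + z.im ^ 2 + 1 ≠ 0 := by positivity
    field_simp
  intro a b hab
  induction a using OnePoint.rec with
  | infty =>
    induction b using OnePoint.rec with
    | infty => rfl
    | coe w => exact absurd (by rw [← hab]; rfl) (key2 w)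
  | coe z =>
    induction b using OnePoint.rec with
    | infty => exact absurd (by rw [hab]; rfl) (key2 z)
    | coe w =>
      congr 1
      apply Complex.ext
      · rw [key0 z, key0 w, hab]
      · rw [key1 z, key1 w, hab]

theorem continuous_toSphere_coe : Continuous (fun z : ℂ => toSphere z) := by
  have h : ∀ z : ℂ, toSphere z = !₂[2 * z.re / (‖z‖ ^ 2 + 1), 2 * z.im / (‖z‖ ^ 2 + 1),
      (‖z‖ ^ 2 - 1) / (‖z‖ ^ 2 + 1)] := fun z => rfl
  simp_rw [h]
  apply (PiLp.continuous_toLp 2 _).comp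
  refine continuous_pi fun i => ?_
  have hz : ∀ z : ℂ, ‖z‖ ^ 2 + 1 ≠ 0 := fun z => by positivity
  fin_cases i <;> simp <;> refine Continuous.div (by fun_prop) (by fun_prop) hz

theorem dist_toSphere_infty_sq (z : ℂ) :
    dist (toSphere z) (toSphere OnePoint.infty) ^ 2 = 4 / (‖z‖ ^ 2 + 1) := by
  rw [EuclideanSpace.dist_eq, Real.sq_sqrt (by positivity), Fin.sum_univ_three]
  simp only [Real.dist_eq, sq_abs]
  rw [toSphere_coe_zero, toSphere_coe_one, toSphere_coe_two, toSphere_infty_zero,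
    toSphere_infty_one, toSphere_infty_two, norm_sq_eq_re_im]
  have : z.re ^ 2 + z.im ^ 2 + 1 ≠ 0 := by positivity
  field_simp; ring

theorem dist_toSphere_zero_sq (z : ℂ) :
    dist (toSphere z) (toSphere (0 : ℂ)) ^ 2 = 4 * ‖z‖ ^ 2 / (‖z‖ ^ 2 + 1) := by
  rw [EuclideanSpace.dist_eq, Real.sq_sqrt (by positivity), Fin.sum_univ_three]
  simp only [Real.dist_eq, sq_abs]
  rw [toSphere_coe_zero, toSphere_coe_one, toSphere_coe_two, toSphere_coe_zero,
    toSphere_coe_one, toSphere_coe_two, norm_sq_eq_re_im]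
  have : z.re ^ 2 + z.im ^ 2 + 1 ≠ 0 := by positivity
  simp
  field_simp; ring

theorem dist_toSphere_infty_le {z : ℂ} (hz : z ≠ 0) :
    dist (toSphere z) (toSphere OnePoint.infty) ≤ 2 / ‖z‖ := by
  have h0 : 0 < ‖z‖ := norm_pos_iff.2 hz
  refine abs_le_of_sq_le_sq' ?_ (by positivity) |>.2
  rw [dist_toSphere_infty_sq, div_pow, div_le_div_iff₀ (by positivity) (by positivity)]
  nlinarith

theorem dist_toSphere_zero_le (z : ℂ) :
    dist (toSphere z) (toSphere (0 : ℂ)) ≤ 2 * ‖z‖ := by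
  refine abs_le_of_sq_le_sq' ?_ (by positivity) |>.2
  rw [dist_toSphere_zero_sq, div_le_iff₀ (by positivity)]
  nlinarith [sq_nonneg ‖z‖, sq_nonneg (‖z‖ ^ 2)]

theorem continuous_toSphere : Continuous toSphere := by
  rw [OnePoint.continuous_iff]
  refine ⟨?_, continuous_toSphere_coe⟩
  rw [tendsto_iff_dist_tendsto_zero, coclosedCompact_eq_cocompact]
  have h1 : Tendsto (fun z : ℂ => 2 / ‖z‖) (cocompact ℂ) (𝓝 0) :=
    (tendsto_norm_cocompact_atTop).const_div_atTop 2
  refine squeeze_zero' (Eventually.of_forall fun _ => dist_nonneg) ?_ h1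
  have : ∀ᶠ z : ℂ in cocompact ℂ, z ≠ 0 := by
    have := (isCompact_singleton (x := (0 : ℂ))).compl_mem_cocompact
    filter_upwards [this] with z hz using hz
  filter_upwards [this] with z hz using dist_toSphere_infty_le hz

theorem isEmbedding_toSphere : IsEmbedding toSphere :=
  (continuous_toSphere.isClosedEmbedding toSphere_injective).isEmbedding

/-! ### Affine functions on the ball and the caps they cut off -/

/-- A real affine function on three-space, written in the coordinates in which its restriction to
the sphere is, up to a positive factor, `A |z|² - 2 (c x + d y) + B`. -/
structure CapForm where
  A : ℝ
  c : ℝ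
  d : ℝ
  B : ℝ

namespace CapForm

variable (Q : CapForm)

/-- The affine function. -/
noncomputable def val (p : E3) : ℝ := (Q.A * (1 + p 2) + Q.B * (1 - p 2)) / 2 - Q.c * p 0 - Q.d * p 1

/-- The discriminant. -/
def disc : ℝ := Q.c ^ 2 + Q.d ^ 2 - Q.A * Q.B

/-- The open cap of the sphere on which the affine function is negative. -/
def cap : Set (OnePoint ℂ) := {q | Q.val (toSphere q) < 0}

/-- The affine function in the half-space model, at the point over `x + i y` with
`v = x² + y² + t²`. -/
def poly (x y v : ℝ) : ℝ := Q.A * v - 2 * (Q.c * x + Q.d * y) + Q.B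

theorem val_toSphere_coe (z : ℂ) : Q.val (toSphere z) =
    Q.poly z.re z.im (z.re ^ 2 + z.im ^ 2) / (z.re ^ 2 + z.im ^ 2 + 1) := by
  rw [val, poly, toSphere_coe_zero, toSphere_coe_one, toSphere_coe_two]
  have : z.re ^ 2 + z.im ^ 2 + 1 ≠ 0 := by positivity
  field_simp; ring

theorem val_toSphere_infty : Q.val (toSphere OnePoint.infty) = Q.A := by
  rw [val, toSphere_infty_zero, toSphere_infty_one, toSphere_infty_two]; ring

theorem coe_mem_cap {z : ℂ} :
    (z : OnePoint ℂ) ∈ Q.cap ↔ Q.poly z.re z.im (z.re ^ 2 + z.im ^ 2) < 0 := by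
  have h : 0 < z.re ^ 2 + z.im ^ 2 + 1 := by positivity
  rw [cap, Set.mem_ofPred_eq, val_toSphere_coe, div_lt_iff₀ h, zero_mul]

theorem infty_mem_cap : OnePoint.infty ∈ Q.cap ↔ Q.A < 0 := by
  rw [cap, Set.mem_ofPred_eq, val_toSphere_infty]

theorem continuous_val : Continuous Q.val := by
  unfold val; fun_prop

theorem val_convex_comb (p q : E3) {a b : ℝ} (h : a + b = 1) :
    Q.val (a • p + b • q) = a * Q.val p + b * Q.val q := by
  obtain rfl : a = 1 - b := by linarith
  simp only [val, PiLp.add_apply, PiLp.smul_apply, smul_eq_mul]; ring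

theorem isOpen_cap : IsOpen Q.cap :=
  isOpen_lt (Q.continuous_val.comp continuous_toSphere) continuous_const

/-- The open half-space of hyperbolic space on which the affine function is negative. -/
def half : Set E3 := {p ∈ hypSpace | Q.val p < 0}

theorem isOpen_half : IsOpen Q.half :=
  Metric.isOpen_ball.inter (isOpen_lt Q.continuous_val continuous_const)

theorem convex_half : Convex ℝ Q.half := by
  intro p hp q hq a b ha hb hab
  refine ⟨convex_ball _ _ hp.1 hq.1 ha hb hab, ?_⟩
  rw [Q.val_convex_comb _ _ hab]
  rcases ha.eq_or_lt with rfl | ha'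
  · obtain rfl : b = 1 := by linarith
    linarith [hq.2]
  · nlinarith [hp.2, hq.2]

end CapForm

/-- A plane set together with the point at infinity is connected if it is a union of rays that
emanate from a common centre. -/
theorem isPreconnected_insert_infty_of_rays {S : Set ℂ} {c : ℂ} (hc : ∀ z ∈ S, z ≠ c)
    (hS : ∀ z ∈ S, ∀ s : ℝ, 1 ≤ s → c + s * (z - c) ∈ S) :
    IsPreconnected (insert OnePoint.infty (((↑) : ℂ → OnePoint ℂ) '' S)) := by
  refine isPreconnected_of_forall OnePoint.infty ?_
  rintro y (rfl | ⟨z, hz, rfl⟩)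
  · exact ⟨{OnePoint.infty}, by simp, by simp, by simp, isPreconnected_singleton⟩
  · let g : ℝ → OnePoint ℂ := fun s => ((c + s * (z - c) : ℂ) : OnePoint ℂ)
    have hg : Continuous g := OnePoint.continuous_coe.comp (by fun_prop)
    have hlim : Tendsto g atTop (𝓝 OnePoint.infty) := by
      refine OnePoint.tendsto_coe_infty.comp ?_
      rw [coclosedCompact_eq_cocompact, ← Metric.cobounded_eq_cocompact, ← comap_norm_atTop,
        tendsto_comap_iff]
      have hpos : 0 < ‖z - c‖ := norm_pos_iff.2 (sub_ne_zero.2 (hc z hz))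
      have h2 : Tendsto (fun s : ℝ => s * ‖z - c‖ - ‖c‖) atTop atTop :=
        tendsto_atTop_add_const_right _ _ (tendsto_id.atTop_mul_const hpos)
      refine tendsto_atTop_mono' _ ?_ h2
      filter_upwards [eventually_ge_atTop (0 : ℝ)] with s hs
      have : ‖(s : ℂ) * (z - c)‖ = s * ‖z - c‖ := by
        rw [norm_mul, Complex.norm_real, Real.norm_of_nonneg hs]
      have h3 := norm_sub_le (c + s * (z - c)) c
      simp only [add_sub_cancel_left] at h3
      simp only [Function.comp]
      linarith
    refine ⟨insert OnePoint.infty (g '' Set.Ici 1), ?_, by simp, ?_, ?_⟩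
    · refine Set.insert_subset_insert ?_
      rintro _ ⟨s, hs, rfl⟩
      exact ⟨_, hS z hz s hs, rfl⟩
    · exact Or.inr ⟨1, by simp, by simp [g]⟩
    · refine (isPreconnected_Ici.image g hg.continuousOn).subset_closure
        (Set.subset_insert _ _) (Set.insert_subset ?_ subset_closure)
      refine mem_closure_of_tendsto hlim ?_
      filter_upwards [eventually_ge_atTop (1 : ℝ)] with s hs using ⟨s, hs, rfl⟩

namespace CapForm

variable (Q : CapForm)

theorem mul_poly (x y v : ℝ) : Q.A * Q.poly x y v =
    (Q.A * x - Q.c) ^ 2 + (Q.A * y - Q.d) ^ 2 + Q.A ^ 2 * (v - x ^ 2 - y ^ 2) - Q.disc := by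
  rw [poly, disc]; ring

/-- The sign of `A` decides the shape in the plane: a disc or half-plane for `A ≥ 0`, which is
convex, and the exterior of a circle together with infinity for `A < 0`, a union of rays from the
centre. In the last case a point off the cap gives `0 ≤ disc`, so the centre is off the cap too. -/
theorem isPreconnected_cap (h : ∃ q, q ∉ Q.cap) : IsPreconnected Q.cap := by
  rcases lt_trichotomy Q.A 0 with hA | hA | hA
  · have hcap : Q.cap = insert OnePoint.infty (((↑) : ℂ → OnePoint ℂ) ''
        {z | Q.poly z.re z.im (z.re ^ 2 + z.im ^ 2) < 0}) := by
      ext q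
      induction q using OnePoint.rec with
      | infty => simp [infty_mem_cap, hA]
      | coe z => simp [coe_mem_cap]
    have hiff : ∀ z : ℂ, Q.poly z.re z.im (z.re ^ 2 + z.im ^ 2) < 0 ↔
        Q.disc < (Q.A * z.re - Q.c) ^ 2 + (Q.A * z.im - Q.d) ^ 2 := by
      intro z
      have h1 := Q.mul_poly z.re z.im (z.re ^ 2 + z.im ^ 2)
      constructor
      · intro h; nlinarith
      · intro h; by_contra h'; push Not at h'; nlinarith
    obtain ⟨q, hq⟩ := h
    have hdisc : 0 ≤ Q.disc := by
      induction q using OnePoint.rec with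
      | infty => exact absurd ((infty_mem_cap Q).2 hA) hq
      | coe z =>
        rw [coe_mem_cap, hiff, not_lt] at hq
        exact le_trans (by positivity) hq
    rw [hcap]
    have hre : ∀ z : ℂ, ∀ s : ℝ, ((⟨Q.c / Q.A, Q.d / Q.A⟩ : ℂ) + s * (z - ⟨Q.c / Q.A, Q.d / Q.A⟩)).re
        = Q.c / Q.A + s * (z.re - Q.c / Q.A) := by intro z s; simp
    have him : ∀ z : ℂ, ∀ s : ℝ, ((⟨Q.c / Q.A, Q.d / Q.A⟩ : ℂ) + s * (z - ⟨Q.c / Q.A, Q.d / Q.A⟩)).im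
        = Q.d / Q.A + s * (z.im - Q.d / Q.A) := by intro z s; simp
    refine isPreconnected_insert_infty_of_rays (c := ⟨Q.c / Q.A, Q.d / Q.A⟩) ?_ ?_
    · rintro z hz rfl
      rw [Set.mem_ofPred_eq, hiff] at hz
      simp only [mul_div_cancel₀ _ hA.ne] at hz
      simp at hz; linarith
    · intro z hz s hs
      rw [Set.mem_ofPred_eq, hiff] at hz ⊢
      rw [hre, him]
      have e1 : Q.A * (Q.c / Q.A + s * (z.re - Q.c / Q.A)) - Q.c = s * (Q.A * z.re - Q.c) := by
        field_simp [hA.ne]; ring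
      have e2 : Q.A * (Q.d / Q.A + s * (z.im - Q.d / Q.A)) - Q.d = s * (Q.A * z.im - Q.d) := by
        field_simp [hA.ne]; ring
      rw [e1, e2]
      nlinarith [sq_nonneg (Q.A * z.re - Q.c), sq_nonneg (Q.A * z.im - Q.d),
        mul_nonneg (by nlinarith : 0 ≤ s ^ 2 - 1)
          (by positivity : 0 ≤ (Q.A * z.re - Q.c) ^ 2 + (Q.A * z.im - Q.d) ^ 2)]
  all_goals
    have hcap : Q.cap = ((↑) : ℂ → OnePoint ℂ) ''
        {z | Q.poly z.re z.im (z.re ^ 2 + z.im ^ 2) < 0} := by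
      ext q
      induction q using OnePoint.rec with
      | infty => simp [infty_mem_cap]; linarith
      | coe z => simp [coe_mem_cap]
    rw [hcap]
    refine IsPreconnected.image ?_ _ OnePoint.continuous_coe.continuousOn
    refine Convex.isPreconnected ?_
    intro z hz w hw a b ha hb hab
    rw [Set.mem_ofPred_eq] at hz hw ⊢
    obtain rfl : a = 1 - b := by linarith
    rw [poly] at *
    simp only [Complex.add_re, Complex.add_im, Complex.real_smul, Complex.re_ofReal_mul,
      Complex.im_ofReal_mul]
    have hcv : 0 ≤ Q.A * ((1 - b) * b * ((z.re - w.re) ^ 2 + (z.im - w.im) ^ 2)) :=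
      mul_nonneg (by linarith) (by positivity)
    have key : (1 - b) * (Q.A * (z.re ^ 2 + z.im ^ 2) - 2 * (Q.c * z.re + Q.d * z.im) + Q.B) +
        b * (Q.A * (w.re ^ 2 + w.im ^ 2) - 2 * (Q.c * w.re + Q.d * w.im) + Q.B) < 0 := by
      rcases hb.eq_or_lt with rfl | hb'
      · simpa using hz
      · nlinarith
    linarith

/-- Two affine functions take their values at a point of the ball simultaneously at some point of
the sphere. -/
theorem exists_val_toSphere_eq (Q Q' : CapForm) {p : E3} (hp : p ∈ hypSpace) :
    ∃ q, Q.val (toSphere q) = Q.val p ∧ Q'.val (toSphere q) = Q'.val p := by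
  let f : E3 →ₗ[ℝ] ℝ × ℝ :=
    { toFun := fun v => (Q.val v - Q.val 0, Q'.val v - Q'.val 0)
      map_add' := by
        intro v w; ext <;> simp [val] <;> ring
      map_smul' := by
        intro s v; ext <;> simp [val] <;> ring }
  -- Two linear functionals on three-space have a common nonzero kernel vector `v`. Both affine
  -- functions are constant along the line `p + s v`, and this line leaves the ball through the
  -- sphere.
  have hf : LinearMap.ker f ≠ ⊥ := LinearMap.ker_ne_bot_of_finrank_lt (by simp)
  obtain ⟨v, hv, hv0⟩ := (Submodule.ne_bot_iff _).1 hf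
  rw [LinearMap.mem_ker] at hv
  have hv1 : Q.val v - Q.val 0 = 0 := congrArg Prod.fst hv
  have hv2 : Q'.val v - Q'.val 0 = 0 := congrArg Prod.snd hv
  have hpos : 0 < ‖v‖ := norm_pos_iff.2 hv0
  have hp1 : ‖p‖ < 1 := by simpa [hypSpace] using hp
  have hcont : Continuous fun s : ℝ => ‖p + s • v‖ := by fun_prop
  have h1 : (1 : ℝ) ∈ (fun s : ℝ => ‖p + s • v‖) '' Set.Icc 0 (2 / ‖v‖) := by
    refine intermediate_value_Icc (by positivity) hcont.continuousOn ⟨by simpa using hp1.le, ?_⟩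
    have h2 : ‖(2 / ‖v‖) • v‖ = 2 := by
      rw [norm_smul, Real.norm_of_nonneg (by positivity)]; field_simp
    have h3 := norm_sub_le (p + (2 / ‖v‖) • v) p
    simp only [add_sub_cancel_left] at h3
    show (1 : ℝ) ≤ ‖p + (2 / ‖v‖) • v‖
    linarith
  obtain ⟨s, -, hs⟩ := h1
  obtain ⟨q, hq⟩ := exists_toSphere_eq hs
  refine ⟨q, ?_, ?_⟩
  · rw [hq]; simp [val] at hv1 ⊢; linear_combination s * hv1
  · rw [hq]; simp [val] at hv2 ⊢; linear_combination s * hv2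

theorem cap_nonempty {Q : CapForm} (h : Q.half.Nonempty) : Q.cap.Nonempty := by
  obtain ⟨p, hp, hv⟩ := h
  obtain ⟨q, hq, -⟩ := exists_val_toSphere_eq Q Q hp
  exact ⟨q, by rw [cap, Set.mem_ofPred_eq, hq]; exact hv⟩

/-- A common point of the half-spaces can be moved to the sphere without changing either value,
which would give a common point of the caps. -/
theorem disjoint_half {Q Q' : CapForm} (h : Disjoint Q.cap Q'.cap) :
    Disjoint Q.half Q'.half := by
  rw [Set.disjoint_left]
  rintro p ⟨hp, hv⟩ ⟨-, hv'⟩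
  obtain ⟨q, hq, hq'⟩ := exists_val_toSphere_eq Q Q' hp
  have h1 : q ∈ Q.cap := by rw [cap, Set.mem_ofPred_eq, hq]; exact hv
  have h2 : q ∈ Q'.cap := by rw [cap, Set.mem_ofPred_eq, hq']; exact hv'
  exact Set.disjoint_left.1 h h1 h2

/-- Strict inequalities at an ideal point persist when it is pushed slightly inwards along its
radius. -/
theorem half_inter_nonempty {Q Q' : CapForm} (h : (Q.cap ∩ Q'.cap).Nonempty) :
    (Q.half ∩ Q'.half).Nonempty := by
  obtain ⟨q, hq, hq'⟩ := h
  have key : ∀ Q : CapForm, q ∈ Q.cap → ∀ᶠ s : ℝ in 𝓝[<] 1, Q.val (s • toSphere q) < 0 := by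
    intro Q hQ
    have hc : Continuous fun s : ℝ => Q.val (s • toSphere q) :=
      Q.continuous_val.comp (by fun_prop)
    exact nhdsWithin_le_nhds
      (hc.continuousAt.eventually_lt continuousAt_const
        (by rw [one_smul]; exact hQ))
  have h0 : ∀ᶠ s : ℝ in 𝓝[<] 1, 0 < s :=
    nhdsWithin_le_nhds (lt_mem_nhds zero_lt_one)
  obtain ⟨s, ⟨⟨h1, h2⟩, h3⟩, h4⟩ :=
    (((key Q hq).and (key Q' hq')).and h0 |>.and self_mem_nhdsWithin).exists
  have hb : s • toSphere q ∈ hypSpace := by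
    rw [hypSpace, mem_ball_zero_iff, norm_smul, norm_toSphere, Real.norm_of_nonneg h3.le]
    simpa using h4
  exact ⟨_, ⟨hb, h1⟩, ⟨hb, h2⟩⟩

/-- The affine function `b - ⟨a, ·⟩`. -/
noncomputable def ofAffine (a : E3) (b : ℝ) : CapForm := ⟨b - a 2, a 0, a 1, b + a 2⟩

theorem val_ofAffine (a : E3) (b : ℝ) (p : E3) : (ofAffine a b).val p = b - inner ℝ a p := by
  rw [E3.inner_eq, val, ofAffine]; ring

/-- On the unit sphere, `⟨a, b⟩ > 1 - ε²/2` means chordal distance less than `ε`, so small metric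
balls are caps. -/
theorem exists_cap_subset {P : Set (OnePoint ℂ)} (hP : IsOpen P) {q : OnePoint ℂ} (hq : q ∈ P) :
    ∃ Q : CapForm, q ∈ Q.cap ∧ Q.cap ⊆ P := by
  obtain ⟨W, hW, rfl⟩ := isEmbedding_toSphere.isOpen_iff.1 hP
  obtain ⟨ε, hε, hb⟩ := Metric.isOpen_iff.1 hW _ hq
  refine ⟨ofAffine (toSphere q) (1 - ε ^ 2 / 2), ?_, ?_⟩
  · rw [cap, Set.mem_ofPred_eq, val_ofAffine, real_inner_self_eq_norm_sq, norm_toSphere]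
    nlinarith
  · intro r hr
    rw [cap, Set.mem_ofPred_eq, val_ofAffine] at hr
    refine hb ?_
    rw [mem_ball_iff_norm]
    have := norm_sub_sq_real (toSphere r) (toSphere q)
    rw [norm_toSphere, norm_toSphere, real_inner_comm] at this
    nlinarith [norm_nonneg (toSphere r - toSphere q)]

end CapForm

/-! ### The two sides of the hull -/

/-- The union of the half-spaces of hyperbolic space whose ideal boundary lies in `Ω`. -/
def domeRegion (Ω : Set (OnePoint ℂ)) : Set E3 :=
  {p | ∃ Q : CapForm, Q.cap ⊆ Ω ∧ p ∈ Q.half}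

theorem isOpen_domeRegion (Ω : Set (OnePoint ℂ)) : IsOpen (domeRegion Ω) := by
  have : domeRegion Ω = ⋃ (Q : CapForm) (_ : Q.cap ⊆ Ω), Q.half := by
    ext p; simp [domeRegion]
  rw [this]
  exact isOpen_iUnion fun Q => isOpen_iUnion fun _ => Q.isOpen_half

/-- A separation of the dome region puts every half-space into one of the two pieces. The caps of
the half-spaces in either piece form two open sets that cover `P`, and they are disjoint since
intersecting caps have intersecting half-spaces. Connectedness of `P` then leaves only one piece. -/
theorem isPreconnected_domeRegion {P : Set (OnePoint ℂ)} (hP : IsOpen P)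
    (hc : IsPreconnected P) : IsPreconnected (domeRegion P) := by
  rw [isPreconnected_iff_subset_of_disjoint]
  intro u v hu hv huv hd
  have hhalf : ∀ Q : CapForm, Q.cap ⊆ P → Q.half ⊆ u ∨ Q.half ⊆ v := by
    intro Q hQ
    have hsub : Q.half ⊆ domeRegion P := fun p hp => ⟨Q, hQ, hp⟩
    refine isPreconnected_iff_subset_of_disjoint.1 Q.convex_half.isPreconnected u v hu hv
      (hsub.trans huv) ?_
    exact Set.subset_eq_empty (Set.inter_subset_inter_left _ hsub) hd
  let T : Set E3 → Set (OnePoint ℂ) := fun w =>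
    ⋃ (Q : CapForm) (_ : Q.cap ⊆ P) (_ : Q.half ⊆ w), Q.cap
  have hT : ∀ w, IsOpen (T w) := fun w =>
    isOpen_iUnion fun Q => isOpen_iUnion fun _ => isOpen_iUnion fun _ => Q.isOpen_cap
  have hmem : ∀ w q, q ∈ T w ↔ ∃ Q : CapForm, Q.cap ⊆ P ∧ Q.half ⊆ w ∧ q ∈ Q.cap := by
    intro w q; simp [T, and_left_comm]
  have meet : ∀ Q Q' : CapForm, Q.cap ⊆ P → Q.half ⊆ u → Q'.half ⊆ v →
      (Q.cap ∩ Q'.cap).Nonempty → False := by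
    intro Q Q' hQ hQu hQv hne
    obtain ⟨r, hr, hr'⟩ := CapForm.half_inter_nonempty hne
    exact Set.eq_empty_iff_forall_notMem.1 hd r ⟨⟨Q, hQ, hr⟩, hQu hr, hQv hr'⟩
  have hcov : P ⊆ T u ∪ T v := by
    intro q hq
    obtain ⟨Q, hqQ, hQ⟩ := CapForm.exists_cap_subset hP hq
    rcases hhalf Q hQ with h1 | h1
    · exact Or.inl ((hmem u q).2 ⟨Q, hQ, h1, hqQ⟩)
    · exact Or.inr ((hmem v q).2 ⟨Q, hQ, h1, hqQ⟩)
  have hdis : P ∩ (T u ∩ T v) = ∅ := by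
    rw [Set.eq_empty_iff_forall_notMem]
    rintro q ⟨-, h1, h2⟩
    obtain ⟨Q, hQ, hu', hq⟩ := (hmem u q).1 h1
    obtain ⟨Q', hQ', hv', hq'⟩ := (hmem v q).1 h2
    exact meet Q Q' hQ hu' hv' ⟨q, hq, hq'⟩
  rcases isPreconnected_iff_subset_of_disjoint.1 hc (T u) (T v) (hT u) (hT v) hcov hdis with h | h
  · left
    rintro p ⟨Q, hQ, hp⟩
    rcases hhalf Q hQ with h1 | h1
    · exact h1 hp
    · obtain ⟨q, hq⟩ := CapForm.cap_nonempty ⟨p, hp⟩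
      obtain ⟨Q', hQ', hu', hq'⟩ := (hmem u q).1 (h (hQ hq))
      exact (meet Q' Q hQ' hu' h1 ⟨q, hq', hq⟩).elim
  · right
    rintro p ⟨Q, hQ, hp⟩
    rcases hhalf Q hQ with h1 | h1
    · obtain ⟨q, hq⟩ := CapForm.cap_nonempty ⟨p, hp⟩
      obtain ⟨Q', hQ', hu', hq'⟩ := (hmem v q).1 (h (hQ hq))
      exact (meet Q Q' hQ h1 hu' ⟨q, hq, hq'⟩).elim
    · exact h1 hp

theorem disjoint_domeRegion {P M : Set (OnePoint ℂ)} (h : Disjoint P M) :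
    Disjoint (domeRegion P) (domeRegion M) := by
  rw [Set.disjoint_left]
  rintro p ⟨Q, hQ, hp⟩ ⟨Q', hQ', hp'⟩
  exact Set.disjoint_left.1 (CapForm.disjoint_half (h.mono hQ hQ')) hp hp'

/-- By Carathéodory's theorem four points suffice in three-space, so the hull is a continuous image
of a simplex times `K⁴`. -/
theorem isCompact_convexHull {K : Set E3} (hK : IsCompact K) : IsCompact (convexHull ℝ K) := by
  rcases K.eq_empty_or_nonempty with rfl | ⟨z0, hz0⟩
  · simp
  let g : (Fin 4 → ℝ) × (Fin 4 → E3) → E3 := fun x => ∑ i, x.1 i • x.2 i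
  have hg : Continuous g := by fun_prop
  have himg : convexHull ℝ K = g '' (stdSimplex ℝ (Fin 4) ×ˢ Set.univ.pi fun _ => K) := by
    refine Set.Subset.antisymm ?_ ?_
    · intro x hx
      obtain ⟨ι, _, z, w, hz, hind, hw, hw1, hx⟩ := eq_pos_convex_span_of_mem_convexHull hx
      have hcard : Fintype.card ι ≤ Fintype.card (Fin 4) := by
        refine hind.card_le_finrank_succ.trans ?_
        refine (Nat.succ_le_succ (Submodule.finrank_le _)).trans ?_
        simp
      obtain ⟨e⟩ := Function.Embedding.nonempty_of_card_le hcard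
      have hsum : ∀ {F : Type} [AddCommMonoid F] (f : ι → F) (f' : Fin 4 → F),
          (∀ j ∉ Set.range e, f' j = 0) → (∀ i, f i = f' (e i)) → ∑ i, f i = ∑ j, f' j :=
        fun f f' h0 h1 => Fintype.sum_of_injective e e.injective f f' h0 h1
      -- Unused slots receive weight zero and an arbitrary point of `K`.
      refine ⟨(Function.extend e w 0, Function.extend e z fun _ => z0), ⟨⟨?_, ?_⟩, ?_⟩, ?_⟩
      · intro j
        by_cases hj : ∃ i, e i = j
        · obtain ⟨i, rfl⟩ := hj
          simpa [e.injective.extend_apply] using (hw i).le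
        · simp [Function.extend_apply' _ _ _ hj]
      · rw [← hw1]
        refine (hsum _ _ (fun j hj => ?_) fun i => ?_).symm
        · exact Function.extend_apply' _ _ _ hj
        · exact (e.injective.extend_apply _ _ _).symm
      · intro j _
        by_cases hj : ∃ i, e i = j
        · obtain ⟨i, rfl⟩ := hj
          simpa [e.injective.extend_apply] using hz ⟨i, rfl⟩
        · simpa [Function.extend_apply' _ _ _ hj] using hz0
      · rw [← hx]
        refine (hsum _ _ (fun j hj => ?_) fun i => ?_).symm
        · simp [Function.extend_apply' _ _ _ hj]
        · simp [e.injective.extend_apply]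
    · rintro _ ⟨⟨w, z⟩, ⟨⟨hw, hw1⟩, hz⟩, rfl⟩
      exact (convex_convexHull ℝ K).sum_mem (fun i _ => hw i) hw1
        fun i _ => subset_convexHull ℝ K (hz i trivial)
  rw [himg]
  exact ((isCompact_stdSimplex ℝ (Fin 4)).prod (isCompact_univ_pi fun _ => hK)).image hg

/-- `P` and `M` are the two complementary regions of the closed set `C` of ideal points. -/
structure IsSides (C P M : Set (OnePoint ℂ)) : Prop where
  isClosed : IsClosed C
  nonempty : C.Nonempty
  isOpen_left : IsOpen P
  isOpen_right : IsOpen M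
  disjoint : Disjoint P M
  isPreconnected_left : IsPreconnected P
  isPreconnected_right : IsPreconnected M
  union_eq : P ∪ M = Cᶜ

namespace IsSides

variable {C P M : Set (OnePoint ℂ)}

theorem symm (h : IsSides C P M) : IsSides C M P :=
  ⟨h.isClosed, h.nonempty, h.isOpen_right, h.isOpen_left, h.disjoint.symm, h.isPreconnected_right,
    h.isPreconnected_left, by rw [Set.union_comm, h.union_eq]⟩

theorem notMem_of_mem_curve (h : IsSides C P M) {q : OnePoint ℂ} (hq : q ∈ C) : q ∉ P := fun hP =>
  (h.union_eq ▸ Or.inl hP : q ∈ Cᶜ) hq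

theorem nonneg_of_cap_subset (h : IsSides C P M) {Q : CapForm} (hQ : Q.cap ⊆ P) {q : OnePoint ℂ}
    (hq : q ∈ C) : 0 ≤ Q.val (toSphere q) :=
  not_lt.1 fun hlt => h.notMem_of_mem_curve hq (hQ hlt)

theorem domeRegion_subset_compl (h : IsSides C P M) : domeRegion P ⊆ hypSpace \ hypHull C := by
  rintro p ⟨Q, hQ, hp⟩
  refine ⟨hp.1, fun hh => ?_⟩
  have hconv : Convex ℝ {p | 0 ≤ Q.val p} := by
    intro x hx y hy a b ha hb hab
    rw [Set.mem_ofPred_eq, Q.val_convex_comb _ _ hab]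
    exact add_nonneg (mul_nonneg ha hx) (mul_nonneg hb hy)
  have : p ∈ {p | 0 ≤ Q.val p} := by
    refine convexHull_min ?_ hconv hh.1
    rintro _ ⟨q, hq, rfl⟩
    exact h.nonneg_of_cap_subset hQ hq
  exact absurd hp.2 (not_lt.2 this)

/-- A point off the hull is separated from it by a plane. The cap cut off by that plane misses `C`
and is connected, so it lies entirely in `P` or in `M`. -/
theorem compl_hull_eq (h : IsSides C P M) :
    hypSpace \ hypHull C = domeRegion P ∪ domeRegion M := by
  refine Set.Subset.antisymm ?_
    (Set.union_subset h.domeRegion_subset_compl h.symm.domeRegion_subset_compl)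
  rintro p ⟨hp, hpC⟩
  have hcomp : IsCompact (convexHull ℝ (toSphere '' C)) :=
    isCompact_convexHull (h.isClosed.isCompact.image continuous_toSphere)
  obtain ⟨f, u, hfp, hfC⟩ := geometric_hahn_banach_point_closed (convex_convexHull ℝ _)
    hcomp.isClosed (fun hh => hpC ⟨hh, hp⟩)
  let a : E3 := (InnerProductSpace.toDual ℝ E3).symm f
  have ha : ∀ x, inner ℝ a x = f x := fun x => InnerProductSpace.toDual_symm_apply
  let Q := CapForm.ofAffine (-a) (-u)
  have hval : ∀ x, Q.val x = f x - u := by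
    intro x; rw [CapForm.val_ofAffine, inner_neg_left, ha]; ring
  have hpQ : p ∈ Q.half := ⟨hp, by rw [hval]; linarith⟩
  have hC : ∀ q ∈ C, q ∉ Q.cap := by
    intro q hq hlt
    have := hfC _ (subset_convexHull ℝ _ ⟨q, hq, rfl⟩)
    rw [CapForm.cap, Set.mem_ofPred_eq, hval] at hlt
    linarith
  obtain ⟨q0, hq0⟩ := h.nonempty
  have hsub : Q.cap ⊆ P ∪ M := by
    intro q hq
    rw [h.union_eq]
    exact fun hqC => hC q hqC hq
  rcases IsPreconnected.subset_or_subset h.isOpen_left h.isOpen_right h.disjoint hsub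
    (Q.isPreconnected_cap ⟨q0, hC q0 hq0⟩) with h1 | h1
  · exact Or.inl ⟨Q, h1, hpQ⟩
  · exact Or.inr ⟨Q, h1, hpQ⟩

/-- The two dome regions are open, disjoint and connected, and they cover the complement of the
hull, so they are its components as far as they are nonempty. -/
theorem component_eq (h : IsSides C P M) {x : E3} (hx : x ∈ domeRegion P) :
    connectedComponentIn (hypSpace \ hypHull C) x = domeRegion P := by
  refine Set.Subset.antisymm ?_ ?_
  · refine IsPreconnected.subset_left_of_subset_union (isOpen_domeRegion P)
      (isOpen_domeRegion M) (disjoint_domeRegion h.disjoint) ?_ ?_ isPreconnected_connectedComponentIn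
    · rw [← h.compl_hull_eq]; exact connectedComponentIn_subset _ _
    · exact ⟨x, mem_connectedComponentIn (h.domeRegion_subset_compl hx), hx⟩
  · exact (isPreconnected_domeRegion h.isOpen_left h.isPreconnected_left).subset_connectedComponentIn
      hx h.domeRegion_subset_compl

theorem hullSides_subset (h : IsSides C P M) : hullSides C ⊆ {domeRegion P, domeRegion M} := by
  rintro W ⟨x, hx, rfl⟩
  rw [h.compl_hull_eq] at hx
  rcases hx with hx | hx
  · exact Or.inl (h.component_eq hx)
  · exact Or.inr (h.symm.component_eq hx)

theorem domeRegion_mem_hullSides (h : IsSides C P M) (hne : (domeRegion P).Nonempty) :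
    domeRegion P ∈ hullSides C := by
  obtain ⟨x, hx⟩ := hne
  exact ⟨x, h.domeRegion_subset_compl hx, (h.component_eq hx).symm⟩

end IsSides

/-! ### Distances in the Klein model -/

theorem one_sub_norm_sq_pos {p : E3} (hp : p ∈ hypSpace) : 0 < 1 - ‖p‖ ^ 2 := by
  have : ‖p‖ < 1 := by simpa [hypSpace] using hp
  nlinarith [norm_nonneg p]

/-- The reversed Cauchy–Schwarz inequality for timelike vectors. -/
theorem sqrt_mul_sqrt_le_of_timelike {a b : E3} {s t : ℝ} (hs : ‖a‖ ≤ s) (ht : ‖b‖ ≤ t) :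
    √(s ^ 2 - ‖a‖ ^ 2) * √(t ^ 2 - ‖b‖ ^ 2) ≤ s * t - inner ℝ a b := by
  have h1 : inner ℝ a b ≤ ‖a‖ * ‖b‖ := real_inner_le_norm a b
  have ha := norm_nonneg a
  have hb := norm_nonneg b
  have h2 : ‖a‖ * ‖b‖ ≤ s * t := mul_le_mul hs ht hb (ha.trans hs)
  rw [← Real.sqrt_mul (by nlinarith)]
  refine le_trans (Real.sqrt_le_sqrt (y := (s * t - ‖a‖ * ‖b‖) ^ 2) ?_) ?_
  -- The difference of the two sides is the square `(s‖b‖ - t‖a‖)²`.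
  · nlinarith [sq_nonneg (s * ‖b‖ - t * ‖a‖)]
  · rw [Real.sqrt_sq (by linarith)]; linarith

theorem arcosh_sqrt_one_add_sq {k : ℝ} (hk : 0 ≤ k) :
    Real.arcosh (√(1 + k ^ 2)) = Real.arsinh k := by
  rw [← Real.cosh_arsinh, Real.arcosh_cosh (Real.arsinh_nonneg_iff.2 hk)]

theorem one_sub_inner_pos {p y : E3} (hp : p ∈ hypSpace) (hy : y ∈ hypSpace) :
    0 < 1 - inner ℝ p y := by
  have h1 : ‖p‖ < 1 := by simpa [hypSpace] using hp
  have h2 : ‖y‖ < 1 := by simpa [hypSpace] using hy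
  have := real_inner_le_norm p y
  nlinarith [norm_nonneg p, norm_nonneg y]

/-- Since `cosh (arsinh k) = √(1 + k²)`, comparing a distance with `arsinh k` needs no hyperbolic
functions. -/
theorem hypDist_le_arsinh {p y : E3} (hp : p ∈ hypSpace) (hy : y ∈ hypSpace) {k : ℝ} (hk : 0 ≤ k)
    (h : 1 - inner ℝ p y ≤ √(1 + k ^ 2) * √((1 - ‖p‖ ^ 2) * (1 - ‖y‖ ^ 2))) :
    hypDist p y ≤ Real.arsinh k := by
  have h1 := one_sub_norm_sq_pos hp
  have h2 := one_sub_norm_sq_pos hy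
  have h3 : 0 < √((1 - ‖p‖ ^ 2) * (1 - ‖y‖ ^ 2)) := Real.sqrt_pos.2 (by positivity)
  rw [← arcosh_sqrt_one_add_sq hk, hypDist, Real.arcosh_le_arcosh
    (div_pos (one_sub_inner_pos hp hy) h3) (by positivity), div_le_iff₀ h3]
  exact h

theorem arsinh_le_hypDist {p y : E3} (hp : p ∈ hypSpace) (hy : y ∈ hypSpace) {k : ℝ} (hk : 0 ≤ k)
    (h : √(1 + k ^ 2) * √((1 - ‖p‖ ^ 2) * (1 - ‖y‖ ^ 2)) ≤ 1 - inner ℝ p y) :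
    Real.arsinh k ≤ hypDist p y := by
  have h1 := one_sub_norm_sq_pos hp
  have h2 := one_sub_norm_sq_pos hy
  have h3 : 0 < √((1 - ‖p‖ ^ 2) * (1 - ‖y‖ ^ 2)) := Real.sqrt_pos.2 (by positivity)
  rw [← arcosh_sqrt_one_add_sq hk, hypDist, Real.arcosh_le_arcosh (by positivity)
    (div_pos (one_sub_inner_pos hp hy) h3), le_div_iff₀ h3]
  exact h

/-- Metric balls of the Klein model are convex. -/
theorem one_sub_inner_segment_le {p y : E3} (hp : p ∈ hypSpace) (hy : y ∈ hypSpace) {k : ℝ}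
    (hk : 1 ≤ k) (h : 1 - inner ℝ p y ≤ k * √((1 - ‖p‖ ^ 2) * (1 - ‖y‖ ^ 2)))
    {z : E3} (hz : z ∈ segment ℝ p y) :
    1 - inner ℝ p z ≤ k * √((1 - ‖p‖ ^ 2) * (1 - ‖z‖ ^ 2)) := by
  obtain ⟨a, b, ha, hb, hab, rfl⟩ := hz
  have h1 := one_sub_norm_sq_pos hp
  have h2 := one_sub_norm_sq_pos hy
  rw [Real.sqrt_mul h1.le] at h ⊢
  have hcs : √(1 - ‖p‖ ^ 2) * √(1 - ‖y‖ ^ 2) ≤ 1 - inner ℝ p y := by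
    have := sqrt_mul_sqrt_le_of_timelike (a := p) (b := y) (s := 1) (t := 1)
      (by nlinarith [norm_nonneg p]) (by nlinarith [norm_nonneg y])
    simpa using this
  set α := √(1 - ‖p‖ ^ 2) with hα
  set β := √(1 - ‖y‖ ^ 2) with hβ
  have hα2 : α ^ 2 = 1 - ‖p‖ ^ 2 := Real.sq_sqrt h1.le
  have hβ2 : β ^ 2 = 1 - ‖y‖ ^ 2 := Real.sq_sqrt h2.le
  have hα0 : 0 ≤ α := Real.sqrt_nonneg _
  have hβ0 : 0 ≤ β := Real.sqrt_nonneg _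
  -- The Lorentz norm `√(1 - ‖z‖²)` is concave along segments; this is the reversed Cauchy–Schwarz
  -- inequality.
  have hconc : a * α + b * β ≤ √(1 - ‖a • p + b • y‖ ^ 2) := by
    refine Real.le_sqrt_of_sq_le ?_
    rw [norm_add_sq_real, norm_smul, norm_smul, real_inner_smul_left, real_inner_smul_right,
      Real.norm_of_nonneg ha, Real.norm_of_nonneg hb]
    obtain rfl : a = 1 - b := by linarith
    have h0 := mul_nonneg (mul_nonneg ha hb) (sub_nonneg.2 hcs)
    linear_combination 2 * h0 + (1 - b) ^ 2 * hα2 + b ^ 2 * hβ2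
  have hin : 1 - inner ℝ p (a • p + b • y) = a * α ^ 2 + b * (1 - inner ℝ p y) := by
    rw [inner_add_right, real_inner_smul_right, real_inner_smul_right,
      real_inner_self_eq_norm_sq, hα2]
    linear_combination -(hab : a + b = 1)
  rw [hin]
  calc a * α ^ 2 + b * (1 - inner ℝ p y) ≤ k * (a * α ^ 2) + b * (k * (α * β)) := by
        refine add_le_add ?_ (mul_le_mul_of_nonneg_left h hb)
        nlinarith [mul_nonneg ha (sq_nonneg α)]
    _ = k * (α * (a * α + b * β)) := by ring
    _ ≤ _ := by gcongr

namespace CapForm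

variable (Q : CapForm)

/-- The gradient of the affine function, up to sign. -/
noncomputable def normal : E3 := !₂[Q.c, Q.d, (Q.B - Q.A) / 2]

theorem val_eq (p : E3) : Q.val p = (Q.A + Q.B) / 2 - inner ℝ Q.normal p := by
  rw [E3.inner_eq, val, normal]; simp; ring

theorem norm_normal_sq : ‖Q.normal‖ ^ 2 = Q.disc + ((Q.A + Q.B) / 2) ^ 2 := by
  rw [E3.norm_sq, disc, normal]; simp; ring

/-- A positive discriminant makes `normal` nonzero, and a small step along it from the plane enters
the half-space. -/
theorem mem_closure_half {y : E3} (hy : y ∈ hypSpace) (hv : Q.val y = 0) (hd : 0 < Q.disc) :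
    y ∈ closure Q.half := by
  have hc : Continuous fun s : ℝ => y + s • Q.normal := by fun_prop
  have h0 : Tendsto (fun s : ℝ => y + s • Q.normal) (𝓝[>] 0) (𝓝 y) := by
    have := hc.tendsto 0
    simp only [zero_smul, add_zero] at this
    exact this.mono_left nhdsWithin_le_nhds
  refine mem_closure_of_tendsto h0 ?_
  filter_upwards [h0.eventually (Metric.isOpen_ball.mem_nhds hy), self_mem_nhdsWithin] with s hs hs0
  refine ⟨hs, ?_⟩
  have h1 : Q.val (y + s • Q.normal) = - (s * ‖Q.normal‖ ^ 2) := by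
    rw [val_eq] at hv ⊢
    rw [inner_add_right, real_inner_smul_right, real_inner_self_eq_norm_sq]
    linear_combination hv
  rw [h1, norm_normal_sq]
  have : 0 < s := hs0
  have : 0 < s * (Q.disc + ((Q.A + Q.B) / 2) ^ 2) := by positivity
  linarith

/-- The foot of the perpendicular from a point to a plane. -/
theorem exists_foot {p : E3} (hp : p ∈ hypSpace) (hd : 0 < Q.disc) {k : ℝ}
    (hk : Q.val p ^ 2 ≤ k ^ 2 * (Q.disc * (1 - ‖p‖ ^ 2))) :
    ∃ y ∈ hypSpace, Q.val y = 0 ∧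
      1 - inner ℝ p y ≤ √(1 + k ^ 2) * √((1 - ‖p‖ ^ 2) * (1 - ‖y‖ ^ 2)) := by
  have h1 := one_sub_norm_sq_pos hp
  have hpn : ‖p‖ < 1 := by simpa [hypSpace] using hp
  set b := (Q.A + Q.B) / 2 with hb
  set v := Q.val p with hv
  have hve : v = b - inner ℝ Q.normal p := Q.val_eq p
  have hN : ‖Q.normal‖ ^ 2 = Q.disc + b ^ 2 := Q.norm_normal_sq
  have hcs : |inner ℝ Q.normal p| ≤ ‖Q.normal‖ * ‖p‖ := abs_real_inner_le_norm _ _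
  -- This is the positivity of the time coordinate of the projection below, which allows it to be
  -- rescaled back into the ball.
  have hDpos : 0 < Q.disc + v * b := by
    have h2 : (b * inner ℝ Q.normal p) ^ 2 ≤ (‖Q.normal‖ ^ 2) ^ 2 := by
      rw [mul_pow]
      have : (inner ℝ Q.normal p) ^ 2 ≤ ‖Q.normal‖ ^ 2 := by
        rw [← sq_abs]
        refine pow_le_pow_left₀ (abs_nonneg _) (hcs.trans ?_) 2
        nlinarith [norm_nonneg Q.normal]
      have hb2 : b ^ 2 ≤ ‖Q.normal‖ ^ 2 := by rw [hN]; linarith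
      rw [pow_two (‖Q.normal‖ ^ 2)]
      exact mul_le_mul hb2 this (sq_nonneg _) (sq_nonneg _)
    have h3 : b * inner ℝ Q.normal p < ‖Q.normal‖ ^ 2 := by
      have h4 := abs_le_of_sq_le_sq h2 (sq_nonneg _)
      refine lt_of_le_of_ne ((le_abs_self _).trans h4) fun heq => ?_
      have h5 : (b * inner ℝ Q.normal p) ^ 2 ≤ b ^ 2 * (‖Q.normal‖ ^ 2 * ‖p‖ ^ 2) := by
        rw [mul_pow]
        refine mul_le_mul_of_nonneg_left ?_ (sq_nonneg _)
        rw [← sq_abs, ← mul_pow]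
        exact pow_le_pow_left₀ (abs_nonneg _) hcs 2
      rw [heq, hN] at h5
      have hp2 : ‖p‖ ^ 2 ≤ 1 := by linarith
      nlinarith [mul_nonneg (sq_nonneg b) (by positivity : 0 ≤ Q.disc + b ^ 2),
        mul_nonneg (mul_nonneg (sq_nonneg b) (by positivity : 0 ≤ Q.disc + b ^ 2))
          (sub_nonneg.2 hp2)]
    rw [hN] at h3
    rw [hve]; nlinarith
  -- In Minkowski space `(1, p)` has product `v` with the normal vector `(b, normal)`, whose Lorentz
  -- square is `-disc`. The orthogonal projection of `(1, p)` is `(D, p + (v / disc) normal)`, with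
  -- Lorentz square `W`; the foot is this vector divided by `D`. In particular `v / (√disc √(1 -
  -- ‖p‖²))` is the hyperbolic sine of the signed distance.
  set D := 1 + v / Q.disc * b with hDdef
  have hD : 0 < D := by
    have : D = (Q.disc + v * b) / Q.disc := by rw [hDdef]; field_simp
    rw [this]; positivity
  set W := 1 - ‖p‖ ^ 2 + v ^ 2 / Q.disc with hW
  have hWpos : 0 < W := by positivity
  have hin : 1 - inner ℝ p (D⁻¹ • (p + (v / Q.disc) • Q.normal)) = W / D := by
    rw [real_inner_smul_right, inner_add_right, real_inner_smul_right, real_inner_self_eq_norm_sq,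
      real_inner_comm, eq_div_iff hD.ne', sub_mul, one_mul, mul_comm D⁻¹, mul_assoc,
      inv_mul_cancel₀ hD.ne', hDdef, hW, show inner ℝ Q.normal p = b - v by linarith]
    field_simp; ring
  have hnorm : 1 - ‖D⁻¹ • (p + (v / Q.disc) • Q.normal)‖ ^ 2 = W / D ^ 2 := by
    have e1 : ‖p + (v / Q.disc) • Q.normal‖ ^ 2 = D ^ 2 - W := by
      rw [norm_add_sq_real, real_inner_smul_right, norm_smul, mul_pow, hN, Real.norm_eq_abs,
        sq_abs, real_inner_comm, show inner ℝ Q.normal p = b - v by linarith, hDdef, hW]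
      field_simp; ring
    rw [norm_smul, mul_pow, e1, norm_inv, Real.norm_of_nonneg hD.le]
    field_simp; ring
  refine ⟨D⁻¹ • (p + (v / Q.disc) • Q.normal), ?_, ?_, ?_⟩
  · rw [hypSpace, mem_ball_zero_iff]
    have : 0 < W / D ^ 2 := by positivity
    nlinarith [norm_nonneg (D⁻¹ • (p + (v / Q.disc) • Q.normal))]
  · rw [val_eq, real_inner_smul_right, inner_add_right, real_inner_smul_right,
      real_inner_self_eq_norm_sq, hN, show inner ℝ Q.normal p = b - v by linarith]
    field_simp
    rw [hDdef]; field_simp; ring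
  · rw [hin, hnorm, ← Real.sqrt_mul (by positivity)]
    refine Real.le_sqrt_of_sq_le ?_
    have e2 : (W / D) ^ 2 = W / D ^ 2 * W := by field_simp
    rw [e2, show (1 + k ^ 2) * ((1 - ‖p‖ ^ 2) * (W / D ^ 2)) =
      W / D ^ 2 * ((1 + k ^ 2) * (1 - ‖p‖ ^ 2)) by ring]
    refine mul_le_mul_of_nonneg_left ?_ (by positivity)
    have : v ^ 2 / Q.disc ≤ k ^ 2 * (1 - ‖p‖ ^ 2) := by
      rw [div_le_iff₀ hd]; nlinarith
    rw [hW]; linarith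

/-- Points on the two sides of a plane are at least as far apart as one of them and the plane. -/
theorem le_one_sub_inner {p y : E3} (hp : p ∈ hypSpace) (hy : y ∈ hypSpace) (hd : 0 < Q.disc)
    {k : ℝ} (hk : 0 ≤ k) (hpv : k * √Q.disc * √(1 - ‖p‖ ^ 2) ≤ Q.val p) (hyv : Q.val y ≤ 0) :
    √(1 + k ^ 2) * √((1 - ‖p‖ ^ 2) * (1 - ‖y‖ ^ 2)) ≤ 1 - inner ℝ p y := by
  have h1 := one_sub_norm_sq_pos hp
  have h2 := one_sub_norm_sq_pos hy
  have hpn : ‖p‖ < 1 := by simpa [hypSpace] using hp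
  set b := (Q.A + Q.B) / 2 with hb
  set v := Q.val p with hv
  set u := Q.val y with hu
  have hve : v = b - inner ℝ Q.normal p := Q.val_eq p
  have hue : u = b - inner ℝ Q.normal y := Q.val_eq y
  have hv0 : 0 ≤ v := le_trans (by positivity) hpv
  have hk2 : k ^ 2 * (1 - ‖p‖ ^ 2) ≤ v ^ 2 / Q.disc := by
    rw [le_div_iff₀ hd]
    have := pow_le_pow_left₀ (by positivity) hpv 2
    rw [mul_pow, mul_pow, Real.sq_sqrt hd.le, Real.sq_sqrt h1.le] at this
    linarith
  have hN : ‖Q.normal‖ ^ 2 = Q.disc + b ^ 2 := Q.norm_normal_sq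
  -- Lorentz-orthogonal projection to the plane: the Lorentz square of the result and its causal
  -- character, as needed to compare the projections of `p` and `y` by the reversed Cauchy–Schwarz
  -- inequality.
  have key : ∀ q : E3, q ∈ hypSpace → ∀ w, w = b - inner ℝ Q.normal q →
      ‖q + (w / Q.disc) • Q.normal‖ ^ 2 =
        (1 + w / Q.disc * b) ^ 2 - (1 - ‖q‖ ^ 2 + w ^ 2 / Q.disc) ∧
      ‖q + (w / Q.disc) • Q.normal‖ ≤ 1 + w / Q.disc * b := by
    intro q hq w hw
    have h0 := one_sub_norm_sq_pos hq
    have hqn : ‖q‖ < 1 := by simpa [hypSpace] using hq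
    have e1 : ‖q + (w / Q.disc) • Q.normal‖ ^ 2 =
        (1 + w / Q.disc * b) ^ 2 - (1 - ‖q‖ ^ 2 + w ^ 2 / Q.disc) := by
      rw [norm_add_sq_real, real_inner_smul_right, norm_smul, mul_pow, hN, Real.norm_eq_abs,
        sq_abs, real_inner_comm, show inner ℝ Q.normal q = b - w by linarith]
      field_simp; ring
    refine ⟨e1, ?_⟩
    have hpos : 0 ≤ 1 + w / Q.disc * b := by
      have hcs : |inner ℝ Q.normal q| ≤ ‖Q.normal‖ * ‖q‖ := abs_real_inner_le_norm _ _
      have h2 : (b * inner ℝ Q.normal q) ^ 2 ≤ (‖Q.normal‖ ^ 2) ^ 2 := by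
        rw [mul_pow]
        have : (inner ℝ Q.normal q) ^ 2 ≤ ‖Q.normal‖ ^ 2 := by
          rw [← sq_abs]
          refine pow_le_pow_left₀ (abs_nonneg _) (hcs.trans ?_) 2
          nlinarith [norm_nonneg Q.normal]
        have hb2 : b ^ 2 ≤ ‖Q.normal‖ ^ 2 := by rw [hN]; linarith
        rw [pow_two (‖Q.normal‖ ^ 2)]
        exact mul_le_mul hb2 this (sq_nonneg _) (sq_nonneg _)
      have h4 := (le_abs_self _).trans (abs_le_of_sq_le_sq h2 (sq_nonneg _))
      have : 1 + w / Q.disc * b = (Q.disc + w * b) / Q.disc := by field_simp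
      rw [this]
      refine div_nonneg ?_ hd.le
      rw [hN] at h4
      rw [hw]; nlinarith
    have : 0 ≤ w ^ 2 / Q.disc := by positivity
    exact abs_le_of_sq_le_sq' (by rw [e1]; linarith) hpos |>.2
  obtain ⟨p1, p2⟩ := key p hp v hve
  obtain ⟨y1, y2⟩ := key y hy u hue
  have hcs := sqrt_mul_sqrt_le_of_timelike p2 y2
  have hin : (1 + v / Q.disc * b) * (1 + u / Q.disc * b) -
      inner ℝ (p + (v / Q.disc) • Q.normal) (y + (u / Q.disc) • Q.normal) =
      1 - inner ℝ p y + u * v / Q.disc := by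
    rw [inner_add_left, inner_add_right, inner_add_right, real_inner_smul_left,
      real_inner_smul_left, real_inner_smul_right, real_inner_smul_right,
      real_inner_self_eq_norm_sq, hN, real_inner_comm Q.normal p,
      show inner ℝ Q.normal p = b - v by linarith, show inner ℝ Q.normal y = b - u by linarith]
    field_simp; ring
  rw [hin, p1, y1, sub_sub_cancel, sub_sub_cancel] at hcs
  -- As the points are on opposite sides, their normal components only increase the distance.
  have h3 : u * v / Q.disc ≤ 0 :=
    div_nonpos_of_nonpos_of_nonneg (mul_nonpos_of_nonpos_of_nonneg hyv hv0) hd.le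
  have h4 : √(1 + k ^ 2) * √((1 - ‖p‖ ^ 2) * (1 - ‖y‖ ^ 2)) ≤
      √(1 - ‖p‖ ^ 2 + v ^ 2 / Q.disc) * √(1 - ‖y‖ ^ 2 + u ^ 2 / Q.disc) := by
    rw [Real.sqrt_mul h1.le, ← mul_assoc, ← Real.sqrt_mul (by positivity)]
    refine mul_le_mul (Real.sqrt_le_sqrt (by linarith)) (Real.sqrt_le_sqrt ?_) (by positivity)
      (by positivity)
    have : 0 ≤ u ^ 2 / Q.disc := by positivity
    linarith
  linarith

end CapForm

/-! ### Bounds for the boundary width -/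

theorem notMem_of_mem_facingBoundary {P M : Set (OnePoint ℂ)} (h : Disjoint P M) {x : E3}
    (hx : x ∈ facingBoundary (domeRegion P)) : x ∉ domeRegion P ∧ x ∉ domeRegion M := by
  have hf := hx.1
  rw [frontier, (isOpen_domeRegion P).interior_eq] at hf
  refine ⟨hf.2, fun hM => ?_⟩
  obtain ⟨y, hy, hy'⟩ := mem_closure_iff.1 hf.1 _ (isOpen_domeRegion M) hM
  exact Set.disjoint_left.1 (disjoint_domeRegion h) hy' hy

/-- The foot of the perpendicular on the plane of `Q` lies in the closure of the dome region, but
possibly inside it because of other caps. The segment from `x` to the foot then meets the frontier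
earlier, and convexity of balls keeps that point within the same distance. -/
theorem iInf_hypDist_le {M : Set (OnePoint ℂ)} {x : E3} (hx : x ∈ hypSpace)
    (hxM : x ∉ domeRegion M) {k : ℝ} (hk : 0 ≤ k) {Q : CapForm} (hQ : Q.cap ⊆ M)
    (hd : 0 < Q.disc) (hv : Q.val x ≤ k * √Q.disc * √(1 - ‖x‖ ^ 2)) :
    ⨅ y ∈ facingBoundary (domeRegion M), ENNReal.ofReal (hypDist x y) ≤
      ENNReal.ofReal (Real.arsinh k) := by
  have h1 := one_sub_norm_sq_pos hx
  have hv0 : 0 ≤ Q.val x := not_lt.1 fun hlt => hxM ⟨Q, hQ, hx, hlt⟩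
  have hk2 : Q.val x ^ 2 ≤ k ^ 2 * (Q.disc * (1 - ‖x‖ ^ 2)) := by
    have := pow_le_pow_left₀ hv0 hv 2
    rwa [mul_pow, mul_pow, Real.sq_sqrt hd.le, Real.sq_sqrt h1.le, mul_assoc] at this
  obtain ⟨y, hy, hy0, hxy⟩ := Q.exists_foot hx hd hk2
  have hycl : y ∈ closure (domeRegion M) :=
    closure_mono (s := Q.half) (t := domeRegion M) (fun p hp => ⟨Q, hQ, hp⟩)
      (Q.mem_closure_half hy hy0 hd)
  have hfr : ∃ z ∈ segment ℝ x y, z ∈ frontier (domeRegion M) := by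
    by_cases hyM : y ∈ domeRegion M
    · have hcon : IsPreconnected (segment ℝ x y) := (convex_segment x y).isPreconnected
      by_contra! hno
      have hcov : ∀ z ∈ segment ℝ x y, z ∈ closure (domeRegion M) → z ∈ domeRegion M := by
        intro z hz hzc
        by_contra hzM
        refine hno z hz ?_
        rw [frontier, (isOpen_domeRegion M).interior_eq]
        exact ⟨hzc, hzM⟩
      obtain ⟨z, -, hz, hz'⟩ := hcon (domeRegion M) (closure (domeRegion M))ᶜ
        (isOpen_domeRegion M) isClosed_closure.isOpen_compl
        (fun z hz => or_iff_not_imp_right.2 fun h => hcov z hz (not_not.1 h))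
        ⟨y, right_mem_segment _ _ _, hyM⟩
        ⟨x, left_mem_segment _ _ _, fun h => hxM (hcov x (left_mem_segment _ _ _) h)⟩
      exact hz' (subset_closure hz)
    · exact ⟨y, right_mem_segment _ _ _, by
        rw [frontier, (isOpen_domeRegion M).interior_eq]; exact ⟨hycl, hyM⟩⟩
  obtain ⟨z, hz, hzf⟩ := hfr
  have hzb : z ∈ hypSpace := (convex_ball _ _).segment_subset hx hy hz
  refine iInf₂_le_of_le z ⟨hzf, hzb⟩ (ENNReal.ofReal_le_ofReal ?_)
  refine hypDist_le_arsinh hx hzb hk (one_sub_inner_segment_le hx hy ?_ hxy hz)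
  exact Real.one_le_sqrt.2 (by nlinarith)

/-- The distance inequality is a closed condition on `y`. It holds on each half-space over a cap in
`M`, hence on the closure of their union, which contains the facing boundary. -/
theorem arsinh_le_iInf_hypDist {M : Set (OnePoint ℂ)} {x : E3}
    (hx : x ∈ hypSpace) {k : ℝ} (hk : 0 ≤ k)
    (h : ∀ Q : CapForm, Q.cap ⊆ M → Q.half.Nonempty →
      0 < Q.disc ∧ k * √Q.disc * √(1 - ‖x‖ ^ 2) ≤ Q.val x) :
    ENNReal.ofReal (Real.arsinh k) ≤
      ⨅ y ∈ facingBoundary (domeRegion M), ENNReal.ofReal (hypDist x y) := by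
  refine le_iInf₂ fun y hy => ENNReal.ofReal_le_ofReal (arsinh_le_hypDist hx hy.2 hk ?_)
  have hclosed : IsClosed {y : E3 | √(1 + k ^ 2) * √((1 - ‖x‖ ^ 2) * (1 - ‖y‖ ^ 2)) ≤
      1 - inner ℝ x y} :=
    isClosed_le (by fun_prop) (by fun_prop)
  refine closure_minimal ?_ hclosed (frontier_subset_closure hy.1)
  rintro y ⟨Q, hQ, hyQ⟩
  obtain ⟨hd, hv⟩ := h Q hQ ⟨y, hyQ⟩
  exact Q.le_one_sub_inner hx hyQ.1 hd hk hv hyQ.2.le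

/-! ### The half-space model -/

/-- The point of the half-space model with coordinates `(x, y, t)` lies over a cap in `Ω`. -/
def Deep (Ω : Set (OnePoint ℂ)) (x y t : ℝ) : Prop :=
  ∃ Q : CapForm, Q.cap ⊆ Ω ∧ Q.poly x y (x ^ 2 + y ^ 2 + t ^ 2) < 0

/-- The point of the half-space model with coordinates `(x, y, t)` is at distance at most
`arsinh k` from a half-space over a cap in `Ω`. -/
def Reach (Ω : Set (OnePoint ℂ)) (k x y t : ℝ) : Prop :=
  ∃ Q : CapForm, Q.cap ⊆ Ω ∧ 0 < Q.disc ∧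
    Q.poly x y (x ^ 2 + y ^ 2 + t ^ 2) ≤ 2 * k * t * √Q.disc

/-- Extends stereographic projection to the interior. Passing between the models multiplies each
affine function by the positive factor `s`, so signs survive and the sinh-distance to a plane
becomes `poly / (2 t √disc)`. -/
theorem exists_halfSpace_coords {p : E3} (hp : p ∈ hypSpace) :
    ∃ x y t s : ℝ, 0 < t ∧ 0 < s ∧ √(1 - ‖p‖ ^ 2) = 2 * t * s ∧
      ∀ Q : CapForm, Q.val p = s * Q.poly x y (x ^ 2 + y ^ 2 + t ^ 2) := by
  have h1 := one_sub_norm_sq_pos hp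
  have h2 : 0 < 1 - p 2 := by
    rw [E3.norm_sq] at h1
    nlinarith [sq_nonneg (p 0), sq_nonneg (p 1), sq_nonneg (p 2 - 1)]
  refine ⟨p 0 / (1 - p 2), p 1 / (1 - p 2), √(1 - ‖p‖ ^ 2) / (1 - p 2), (1 - p 2) / 2,
    by positivity, by positivity, by field_simp, fun Q => ?_⟩
  have : (p 0 / (1 - p 2)) ^ 2 + (p 1 / (1 - p 2)) ^ 2 + (√(1 - ‖p‖ ^ 2) / (1 - p 2)) ^ 2 =
      (1 + p 2) / (1 - p 2) := by
    rw [div_pow (√(1 - ‖p‖ ^ 2)), Real.sq_sqrt h1.le, E3.norm_sq]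
    field_simp; ring
  rw [this, CapForm.poly, CapForm.val]
  field_simp; ring

/-- Points of the facing boundary of a side belong to no half-space of that side, so for them only
the second alternative remains. -/
theorem iSup_iInf_hypDist_le {P M : Set (OnePoint ℂ)} (h : Disjoint P M) {k : ℝ} (hk : 0 ≤ k)
    (hw : ∀ x y t : ℝ, 0 < t → Deep P x y t ∨ Reach M k x y t) :
    ⨆ x ∈ facingBoundary (domeRegion P), ⨅ y ∈ facingBoundary (domeRegion M),
      ENNReal.ofReal (hypDist x y) ≤ ENNReal.ofReal (Real.arsinh k) := by
  refine iSup₂_le fun p hp => ?_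
  obtain ⟨hpP, hpM⟩ := notMem_of_mem_facingBoundary h hp
  obtain ⟨x, y, t, s, ht, hs, hsq, hval⟩ := exists_halfSpace_coords hp.2
  rcases hw x y t ht with ⟨Q, hQ, hv⟩ | ⟨Q, hQ, hd, hv⟩
  · exact (hpP ⟨Q, hQ, hp.2, by rw [hval]; exact mul_neg_of_pos_of_neg hs hv⟩).elim
  · refine iInf_hypDist_le hp.2 hpM hk hQ hd ?_
    rw [hval, hsq]
    nlinarith

theorem IsSides.boundaryWidth_le {C P M : Set (OnePoint ℂ)} (h : IsSides C P M) {k : ℝ}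
    (hk : 0 ≤ k) (hPM : ∀ x y t : ℝ, 0 < t → Deep P x y t ∨ Reach M k x y t)
    (hMP : ∀ x y t : ℝ, 0 < t → Deep M x y t ∨ Reach P k x y t) :
    boundaryWidth C ≤ ENNReal.ofReal (Real.arsinh k) := by
  refine iSup₂_le fun W hW => iSup₂_le fun W' hW' => iSup_le fun hne => ?_
  rcases h.hullSides_subset hW with rfl | rfl <;> rcases h.hullSides_subset hW' with rfl | rfl
  · exact (hne rfl).elim
  · exact iSup_iInf_hypDist_le h.disjoint hk hPM
  · exact iSup_iInf_hypDist_le h.disjoint.symm hk hMP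
  · exact (hne rfl).elim

theorem IsSides.le_boundaryWidth {C P M : Set (OnePoint ℂ)} (h : IsSides C P M) {k : ℝ}
    (hk : 0 ≤ k) {p : E3} (hp : p ∈ facingBoundary (domeRegion P))
    (hM : (domeRegion M).Nonempty)
    (hlow : ∀ Q : CapForm, Q.cap ⊆ M → Q.half.Nonempty →
      0 < Q.disc ∧ k * √Q.disc * √(1 - ‖p‖ ^ 2) ≤ Q.val p) :
    ENNReal.ofReal (Real.arsinh k) ≤ boundaryWidth C := by
  have hPne : (domeRegion P).Nonempty :=
    closure_nonempty_iff.1 ⟨p, frontier_subset_closure hp.1⟩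
  have hne : domeRegion P ≠ domeRegion M := by
    intro heq
    obtain ⟨y, hy⟩ := hM
    exact Set.disjoint_left.1 (disjoint_domeRegion h.disjoint) (heq ▸ hy) hy
  refine (arsinh_le_iInf_hypDist hp.2 hk hlow).trans ?_
  unfold boundaryWidth
  refine le_iSup₂_of_le _ (h.domeRegion_mem_hullSides hPne) ?_
  refine le_iSup₂_of_le _ (h.symm.domeRegion_mem_hullSides hM) ?_
  refine le_iSup_of_le hne ?_
  exact le_iSup₂_of_le (f := fun x _ => ⨅ y ∈ facingBoundary (domeRegion M),
    ENNReal.ofReal (hypDist x y)) p hp le_rfl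

/-! ### The two sides of the smoothed cross -/

/-- The side of the smoothed cross with radii `e` and `n` that contains the origin. -/
def zeroSide (e n : ℝ) : Set ℂ :=
  {z | (|z.re| < e ∧ |z.im| < e ∧ e ^ 2 < (z.re - e) ^ 2 + (z.im - e) ^ 2 ∧
      e ^ 2 < (z.re + e) ^ 2 + (z.im + e) ^ 2) ∨
    (z.re * z.im < 0 ∧
      ((|z.re| < n ∧ |z.im| < n) ∨ (|z.re| - n) ^ 2 + (|z.im| - n) ^ 2 < n ^ 2))}

/-- The side of the smoothed cross with radii `e` and `n` that contains infinity, without that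
point. -/
def farSide (e n : ℝ) : Set ℂ :=
  {z | (0 < z.re * z.im ∧
      (e < |z.re| ∨ e < |z.im| ∨ (|z.re| - e) ^ 2 + (|z.im| - e) ^ 2 < e ^ 2)) ∨
    ((n < |z.re| ∨ n < |z.im|) ∧ n ^ 2 < (z.re - n) ^ 2 + (z.im + n) ^ 2 ∧
      n ^ 2 < (z.re + n) ^ 2 + (z.im - n) ^ 2)}

/-- The finite points of the smoothed cross with radii `e` and `n`. -/
def crossSet (e n : ℝ) : Set ℂ :=
  {z | ((z.re = 0 ∨ z.im = 0) ∧ ¬((|z.re| < e ∨ n < |z.re|) ∧ (|z.im| < e ∨ n < |z.im|))) ∨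
    ((z.re - e) ^ 2 + (z.im - e) ^ 2 = e ^ 2 ∧ z.re + z.im ≤ e) ∨
    ((z.re + e) ^ 2 + (z.im + e) ^ 2 = e ^ 2 ∧ -e ≤ z.re + z.im) ∨
    ((z.re + n) ^ 2 + (z.im - n) ^ 2 = n ^ 2 ∧ n ≤ z.im - z.re) ∨
    ((z.re - n) ^ 2 + (z.im + n) ^ 2 = n ^ 2 ∧ z.im - z.re ≤ -n)}

/-! ### Symmetries of the smoothed cross and its sides in each quadrant. -/

section
variable {e n : ℝ} {z : ℂ}

theorem neg_mem_zeroSide : -z ∈ zeroSide e n ↔ z ∈ zeroSide e n := by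
  simp only [zeroSide, Set.mem_ofPred_eq, Complex.neg_re, Complex.neg_im, abs_neg]
  rw [show (-z.re - e) ^ 2 + (-z.im - e) ^ 2 = (z.re + e) ^ 2 + (z.im + e) ^ 2 by ring,
    show (-z.re + e) ^ 2 + (-z.im + e) ^ 2 = (z.re - e) ^ 2 + (z.im - e) ^ 2 by ring, neg_mul_neg]
  tauto

theorem neg_mem_farSide : -z ∈ farSide e n ↔ z ∈ farSide e n := by
  simp only [farSide, Set.mem_ofPred_eq, Complex.neg_re, Complex.neg_im, abs_neg]
  rw [show (-z.re - n) ^ 2 + (-z.im + n) ^ 2 = (z.re + n) ^ 2 + (z.im - n) ^ 2 by ring,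
    show (-z.re + n) ^ 2 + (-z.im - n) ^ 2 = (z.re - n) ^ 2 + (z.im + n) ^ 2 by ring, neg_mul_neg]
  tauto

theorem neg_mem_crossSet : -z ∈ crossSet e n ↔ z ∈ crossSet e n := by
  simp only [crossSet, Set.mem_ofPred_eq, Complex.neg_re, Complex.neg_im, abs_neg, neg_eq_zero]
  rw [show (-z.re - n) ^ 2 + (-z.im + n) ^ 2 = (z.re + n) ^ 2 + (z.im - n) ^ 2 by ring,
    show (-z.re + n) ^ 2 + (-z.im - n) ^ 2 = (z.re - n) ^ 2 + (z.im + n) ^ 2 by ring,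
    show (-z.re - e) ^ 2 + (-z.im - e) ^ 2 = (z.re + e) ^ 2 + (z.im + e) ^ 2 by ring,
    show (-z.re + e) ^ 2 + (-z.im + e) ^ 2 = (z.re - e) ^ 2 + (z.im - e) ^ 2 by ring]
  constructor
  · rintro (h | ⟨h, h'⟩ | ⟨h, h'⟩ | ⟨h, h'⟩ | ⟨h, h'⟩)
    · exact Or.inl h
    · exact Or.inr (Or.inr (Or.inl ⟨h, by linarith⟩))
    · exact Or.inr (Or.inl ⟨h, by linarith⟩)
    · exact Or.inr (Or.inr (Or.inr (Or.inr ⟨h, by linarith⟩)))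
    · exact Or.inr (Or.inr (Or.inr (Or.inl ⟨h, by linarith⟩)))
  · rintro (h | ⟨h, h'⟩ | ⟨h, h'⟩ | ⟨h, h'⟩ | ⟨h, h'⟩)
    · exact Or.inl h
    · exact Or.inr (Or.inr (Or.inl ⟨h, by linarith⟩))
    · exact Or.inr (Or.inl ⟨h, by linarith⟩)
    · exact Or.inr (Or.inr (Or.inr (Or.inr ⟨h, by linarith⟩)))
    · exact Or.inr (Or.inr (Or.inr (Or.inl ⟨h, by linarith⟩)))

theorem mem_zeroSide_of_pos (he : 0 < e) (hx : 0 < z.re) (hy : 0 < z.im) :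
    z ∈ zeroSide e n ↔ z.re < e ∧ z.im < e ∧ e ^ 2 < (z.re - e) ^ 2 + (z.im - e) ^ 2 := by
  have h := mul_pos hx hy
  rw [zeroSide, Set.mem_ofPred_eq, abs_of_pos hx, abs_of_pos hy]
  constructor
  · rintro (⟨h1, h2, h3, -⟩ | ⟨h1, -⟩)
    · exact ⟨h1, h2, h3⟩
    · linarith
  · rintro ⟨h1, h2, h3⟩
    exact Or.inl ⟨h1, h2, h3, by nlinarith⟩

theorem mem_farSide_of_pos (hen : e ≤ n) (hx : 0 < z.re) (hy : 0 < z.im) :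
    z ∈ farSide e n ↔ e < z.re ∨ e < z.im ∨ (z.re - e) ^ 2 + (z.im - e) ^ 2 < e ^ 2 := by
  have h := mul_pos hx hy
  rw [farSide, Set.mem_ofPred_eq, abs_of_pos hx, abs_of_pos hy]
  constructor
  · rintro (⟨-, h1⟩ | ⟨h1 | h1, -⟩)
    · exact h1
    · exact Or.inl (hen.trans_lt h1)
    · exact Or.inr (Or.inl (hen.trans_lt h1))
  · exact fun h1 => Or.inl ⟨h, h1⟩

theorem mem_crossSet_of_pos (he : 0 < e) (hen : e ≤ n) (hx : 0 < z.re) (hy : 0 < z.im) :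
    z ∈ crossSet e n ↔ (z.re - e) ^ 2 + (z.im - e) ^ 2 = e ^ 2 ∧ z.re + z.im ≤ e := by
  rw [crossSet, Set.mem_ofPred_eq]
  constructor
  · rintro (⟨h | h, -⟩ | h | ⟨h, -⟩ | ⟨h, -⟩ | ⟨h, -⟩)
    · linarith
    · linarith
    · exact h
    · nlinarith
    · nlinarith [sq_nonneg (z.im - n)]
    · nlinarith [sq_nonneg (z.re - n)]
  · exact fun h => Or.inr (Or.inl h)

theorem mem_zeroSide_of_pos_neg (hen : e ≤ n) (hx : 0 < z.re) (hy : z.im < 0) :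
    z ∈ zeroSide e n ↔ (z.re < n ∧ -n < z.im) ∨ (z.re - n) ^ 2 + (z.im + n) ^ 2 < n ^ 2 := by
  have h := mul_neg_of_pos_of_neg hx hy
  rw [zeroSide, Set.mem_ofPred_eq, abs_of_pos hx, abs_of_neg hy,
    show (-z.im - n) ^ 2 = (z.im + n) ^ 2 by ring]
  constructor
  · rintro (⟨h1, h2, -⟩ | ⟨-, ⟨h1, h2⟩ | h1⟩)
    · exact Or.inl ⟨by linarith, by linarith⟩
    · exact Or.inl ⟨h1, by linarith⟩
    · exact Or.inr h1
  · rintro (⟨h1, h2⟩ | h1)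
    · exact Or.inr ⟨h, Or.inl ⟨h1, by linarith⟩⟩
    · exact Or.inr ⟨h, Or.inr h1⟩

theorem mem_farSide_of_pos_neg (hn : 0 < n) (hx : 0 < z.re) (hy : z.im < 0) :
    z ∈ farSide e n ↔ (n < z.re ∨ z.im < -n) ∧ n ^ 2 < (z.re - n) ^ 2 + (z.im + n) ^ 2 := by
  have h := mul_neg_of_pos_of_neg hx hy
  rw [farSide, Set.mem_ofPred_eq, abs_of_pos hx, abs_of_neg hy, show n < -z.im ↔ z.im < -n from lt_neg]
  constructor
  · rintro (⟨h1, -⟩ | ⟨h1, h2, -⟩)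
    · linarith
    · exact ⟨h1, h2⟩
  · rintro ⟨h1, h2⟩
    exact Or.inr ⟨h1, h2, by nlinarith⟩

theorem mem_crossSet_of_pos_neg (he : 0 < e) (hen : e ≤ n) (hx : 0 < z.re) (hy : z.im < 0) :
    z ∈ crossSet e n ↔ (z.re - n) ^ 2 + (z.im + n) ^ 2 = n ^ 2 ∧ z.im - z.re ≤ -n := by
  rw [crossSet, Set.mem_ofPred_eq]
  constructor
  · rintro (⟨h | h, -⟩ | ⟨h, -⟩ | ⟨h, -⟩ | ⟨h, -⟩ | h)
    · linarith
    · linarith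
    · nlinarith [sq_nonneg (z.re - e)]
    · nlinarith [sq_nonneg (z.im + e)]
    · nlinarith
    · exact h
  · exact fun h => Or.inr (Or.inr (Or.inr (Or.inr h)))

theorem mem_zeroSide_of_im_eq_zero (he : 0 < e) (hy : z.im = 0) :
    z ∈ zeroSide e n ↔ |z.re| < e := by
  rw [zeroSide, Set.mem_ofPred_eq, hy, abs_zero, mul_zero]
  constructor
  · rintro (⟨h1, -⟩ | ⟨h1, -⟩)
    · exact h1
    · linarith
  · intro h
    obtain ⟨h1, h2⟩ := abs_lt.1 h
    exact Or.inl ⟨h, he, by nlinarith, by nlinarith⟩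

theorem mem_farSide_of_im_eq_zero (hn : 0 < n) (hy : z.im = 0) :
    z ∈ farSide e n ↔ n < |z.re| := by
  rw [farSide, Set.mem_ofPred_eq, hy, abs_zero, mul_zero]
  constructor
  · rintro (⟨h1, -⟩ | ⟨h1 | h1, -⟩)
    · linarith
    · exact h1
    · linarith
  · intro h
    refine Or.inr ⟨Or.inl h, ?_, ?_⟩ <;> rcases lt_abs.1 h with h | h <;> nlinarith

theorem mem_crossSet_of_im_eq_zero (he : 0 < e) (hen : e ≤ n) (hy : z.im = 0) :
    z ∈ crossSet e n ↔ e ≤ |z.re| ∧ |z.re| ≤ n := by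
  rw [crossSet, Set.mem_ofPred_eq, hy, abs_zero]
  have aux : ∀ x s : ℝ, (x - s) ^ 2 + s ^ 2 = s ^ 2 → x = s := by
    intro x s h
    have : x - s = 0 := by
      have : (x - s) ^ 2 = 0 := by linarith
      exact pow_eq_zero_iff (two_ne_zero) |>.1 this
    linarith
  constructor
  · rintro (⟨-, h⟩ | ⟨h, -⟩ | ⟨h, -⟩ | ⟨h, -⟩ | ⟨h, -⟩)
    · constructor
      · by_contra hlt; exact h ⟨Or.inl (not_le.1 hlt), Or.inl he⟩
      · by_contra hlt; exact h ⟨Or.inr (not_le.1 hlt), Or.inl he⟩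
    · rw [aux z.re e (by linarith), abs_of_pos he]; exact ⟨le_rfl, hen⟩
    · rw [aux z.re (-e) (by linarith), abs_neg, abs_of_pos he]; exact ⟨le_rfl, hen⟩
    · rw [aux z.re (-n) (by linarith), abs_neg, abs_of_pos (he.trans_le hen)]
      exact ⟨hen, le_rfl⟩
    · rw [aux z.re n (by linarith), abs_of_pos (he.trans_le hen)]; exact ⟨hen, le_rfl⟩
  · rintro ⟨h1, h2⟩
    refine Or.inl ⟨Or.inr rfl, ?_⟩
    rintro ⟨h | h, -⟩ <;> linarith

/-- Reflection in the diagonal of the second and fourth quadrants composed with `z ↦ -z`. -/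
theorem swap_mem_zeroSide {x y : ℝ} :
    (⟨y, x⟩ : ℂ) ∈ zeroSide e n ↔ (⟨x, y⟩ : ℂ) ∈ zeroSide e n := by
  simp only [zeroSide, Set.mem_ofPred_eq]
  rw [mul_comm y x, add_comm ((y - e) ^ 2), add_comm ((y + e) ^ 2), add_comm ((|y| - n) ^ 2)]
  tauto

theorem swap_mem_farSide {x y : ℝ} :
    (⟨y, x⟩ : ℂ) ∈ farSide e n ↔ (⟨x, y⟩ : ℂ) ∈ farSide e n := by
  simp only [farSide, Set.mem_ofPred_eq]
  rw [mul_comm y x, add_comm ((|y| - e) ^ 2), add_comm ((y - n) ^ 2), add_comm ((y + n) ^ 2)]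
  tauto

theorem swap_mem_crossSet {x y : ℝ} :
    (⟨y, x⟩ : ℂ) ∈ crossSet e n ↔ (⟨x, y⟩ : ℂ) ∈ crossSet e n := by
  simp only [crossSet, Set.mem_ofPred_eq]
  rw [add_comm ((y - e) ^ 2), add_comm ((y + e) ^ 2), add_comm ((y - n) ^ 2),
    add_comm ((y + n) ^ 2), add_comm y x, or_comm (a := y = 0),
    show x - y ≤ -n ↔ n ≤ y - x from ⟨fun h => by linarith, fun h => by linarith⟩,
    show n ≤ x - y ↔ y - x ≤ -n from ⟨fun h => by linarith, fun h => by linarith⟩]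
  tauto

/-- A property of points of the plane that is invariant under `z ↦ -z` and under reflection in
the diagonal may be tested in a closed half-quadrant configuration. -/
theorem cross_induction {p : ℂ → Prop} (hneg : ∀ z, p (-z) → p z)
    (hswap : ∀ x y : ℝ, p ⟨y, x⟩ → p ⟨x, y⟩) (h0 : ∀ z : ℂ, z.im = 0 → p z)
    (hpp : ∀ z : ℂ, 0 < z.re → 0 < z.im → p z) (hpn : ∀ z : ℂ, 0 < z.re → z.im < 0 → p z)
    (z : ℂ) : p z := by
  rcases lt_trichotomy z.im 0 with hy | hy | hy
  · rcases lt_trichotomy z.re 0 with hx | hx | hx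
    · exact hneg _ (hpp _ (by simpa using hx) (by simpa using hy))
    · exact hswap _ _ (h0 _ hx)
    · exact hpn _ hx hy
  · exact h0 _ hy
  · rcases lt_trichotomy z.re 0 with hx | hx | hx
    · exact hneg _ (hpn _ (by simpa using hx) (by simpa using hy))
    · exact hswap _ _ (h0 _ hx)
    · exact hpp _ hx hy

/-- The three explicit descriptions partition the plane. By symmetry only the real axis, the first
and the fourth quadrant have to be inspected, each according to the position relative to one circle.
-/
theorem mem_cross_trichotomy (he : 0 < e) (hen : e ≤ n) (z : ℂ) :
    (z ∈ zeroSide e n ∧ z ∉ farSide e n ∧ z ∉ crossSet e n) ∨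
    (z ∉ zeroSide e n ∧ z ∈ farSide e n ∧ z ∉ crossSet e n) ∨
    (z ∉ zeroSide e n ∧ z ∉ farSide e n ∧ z ∈ crossSet e n) := by
  have hn := he.trans_le hen
  revert z
  refine cross_induction ?_ ?_ ?_ ?_ ?_
  · intro z; rw [neg_mem_zeroSide, neg_mem_farSide, neg_mem_crossSet]; exact id
  · intro x y; rw [swap_mem_zeroSide, swap_mem_farSide, swap_mem_crossSet]; exact id
  · intro z hz
    rw [mem_zeroSide_of_im_eq_zero he hz, mem_farSide_of_im_eq_zero hn hz,
      mem_crossSet_of_im_eq_zero he hen hz]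
    rcases lt_or_ge |z.re| e with h | h
    · exact Or.inl ⟨h, by linarith, fun h' => by linarith⟩
    · rcases lt_or_ge n |z.re| with h' | h'
      · exact Or.inr (Or.inl ⟨by linarith, h', fun h' => by linarith⟩)
      · exact Or.inr (Or.inr ⟨by linarith, by linarith, h, h'⟩)
  · intro z hx hy
    rw [mem_zeroSide_of_pos he hx hy, mem_farSide_of_pos hen hx hy,
      mem_crossSet_of_pos he hen hx hy]
    rcases lt_trichotomy ((z.re - e) ^ 2 + (z.im - e) ^ 2) (e ^ 2) with h | h | h
    · exact Or.inr (Or.inl ⟨fun h' => by linarith, Or.inr (Or.inr h), fun h' => by linarith⟩)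
    · by_cases h1 : z.re + z.im ≤ e
      · refine Or.inr (Or.inr ⟨fun h' => by linarith, ?_, h, h1⟩)
        rintro (h2 | h2 | h2) <;> linarith
      · refine Or.inr (Or.inl ⟨fun h' => by linarith, ?_, fun h' => h1 h'.2⟩)
        by_contra! h2
        nlinarith
    · by_cases h1 : z.re < e ∧ z.im < e
      · refine Or.inl ⟨⟨h1.1, h1.2, h⟩, ?_, fun h' => by linarith⟩
        rintro (h2 | h2 | h2) <;> linarith
      · refine Or.inr (Or.inl ⟨fun h' => h1 ⟨h'.1, h'.2.1⟩, ?_, fun h' => by linarith⟩)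
        by_contra! h2
        rcases not_and_or.1 h1 with h3 | h3 <;> nlinarith
  · intro z hx hy
    rw [mem_zeroSide_of_pos_neg hen hx hy, mem_farSide_of_pos_neg hn hx hy,
      mem_crossSet_of_pos_neg he hen hx hy]
    rcases lt_trichotomy ((z.re - n) ^ 2 + (z.im + n) ^ 2) (n ^ 2) with h | h | h
    · exact Or.inl ⟨Or.inr h, fun h' => by linarith, fun h' => by linarith⟩
    · by_cases h1 : z.im - z.re ≤ -n
      · refine Or.inr (Or.inr ⟨?_, fun h' => by linarith, h, h1⟩)
        rintro (⟨h2, h3⟩ | h2)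
        · nlinarith
        · linarith
      · refine Or.inl ⟨Or.inl ⟨by linarith, by linarith⟩, fun h' => by linarith, fun h' => h1 h'.2⟩
    · by_cases h1 : n < z.re ∨ z.im < -n
      · refine Or.inr (Or.inl ⟨?_, ⟨h1, h⟩, fun h' => by linarith⟩)
        rintro (⟨h2, h3⟩ | h2)
        · rcases h1 with h1 | h1 <;> linarith
        · linarith
      · push Not at h1
        refine Or.inl ⟨Or.inl ⟨lt_of_le_of_ne h1.1 ?_, lt_of_le_of_ne h1.2 ?_⟩,
          fun h' => ?_, fun h' => by linarith⟩
        · intro h2; nlinarith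
        · intro h2; nlinarith
        · rcases h'.1 with h2 | h2 <;> linarith

/-- In the annulus `e ≤ |z| ≤ n` the sides are the open quadrants. -/
theorem mem_sides_of_annulus (he : 0 < e) (hen : e ≤ n) (h1 : e ^ 2 ≤ z.re ^ 2 + z.im ^ 2)
    (h2 : z.re ^ 2 + z.im ^ 2 ≤ n ^ 2) :
    (z ∈ zeroSide e n ↔ z.re * z.im < 0) ∧ (z ∈ farSide e n ↔ 0 < z.re * z.im) ∧
      (z ∈ crossSet e n ↔ z.re * z.im = 0) := by
  have hn := he.trans_le hen
  have key : (z.re * z.im < 0 → z ∈ zeroSide e n) ∧ (0 < z.re * z.im → z ∈ farSide e n) ∧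
      (z.re * z.im = 0 → z ∈ crossSet e n) := by
    revert h1 h2
    refine cross_induction (p := fun z => e ^ 2 ≤ z.re ^ 2 + z.im ^ 2 →
      z.re ^ 2 + z.im ^ 2 ≤ n ^ 2 → (z.re * z.im < 0 → z ∈ zeroSide e n) ∧
        (0 < z.re * z.im → z ∈ farSide e n) ∧ (z.re * z.im = 0 → z ∈ crossSet e n))
      ?_ ?_ ?_ ?_ ?_ z
    · intro z h h1 h2
      rw [neg_mem_zeroSide, neg_mem_farSide, neg_mem_crossSet] at h
      simpa using h (by simpa using h1) (by simpa using h2)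
    · intro x y h h1 h2
      rw [swap_mem_zeroSide, swap_mem_farSide, swap_mem_crossSet] at h
      simpa [mul_comm] using h (by simpa [add_comm] using h1) (by simpa [add_comm] using h2)
    · intro z hz h1 h2
      rw [mem_crossSet_of_im_eq_zero he hen hz]
      simp only [hz, mul_zero, lt_irrefl, false_implies, true_and]
      intro _
      rw [hz] at h1 h2
      exact ⟨by nlinarith [sq_abs z.re, abs_nonneg z.re],
        by nlinarith [sq_abs z.re, abs_nonneg z.re]⟩
    · intro z hx hy h1 h2
      have h := mul_pos hx hy
      refine ⟨fun h' => by linarith, fun _ => ?_, fun h' => by linarith⟩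
      rw [mem_farSide_of_pos hen hx hy]
      by_contra! h'
      nlinarith
    · intro z hx hy h1 h2
      have h := mul_neg_of_pos_of_neg hx hy
      refine ⟨fun _ => ?_, fun h' => by linarith, fun h' => by linarith⟩
      rw [mem_zeroSide_of_pos_neg hen hx hy]
      exact Or.inl ⟨by nlinarith, by nlinarith⟩
  have tri := mem_cross_trichotomy he hen z
  rcases lt_trichotomy (z.re * z.im) 0 with h | h | h
  · have := key.1 h
    refine ⟨by tauto, ?_, ?_⟩
    · exact ⟨fun h' => by tauto, fun h' => by linarith⟩
    · exact ⟨fun h' => by tauto, fun h' => by linarith⟩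
  · have := key.2.2 h
    refine ⟨?_, ?_, by tauto⟩
    · exact ⟨fun h' => by tauto, fun h' => by linarith⟩
    · exact ⟨fun h' => by tauto, fun h' => by linarith⟩
  · have := key.2.1 h
    refine ⟨?_, by tauto, ?_⟩
    · exact ⟨fun h' => by tauto, fun h' => by linarith⟩
    · exact ⟨fun h' => by tauto, fun h' => by linarith⟩

end

/-! ### Inversion, openness and connectedness of the two sides. -/

section
variable {e n : ℝ} {z : ℂ}

theorem inv_re' (z : ℂ) : z⁻¹.re = z.re / (z.re ^ 2 + z.im ^ 2) := by
  rw [Complex.inv_re, Complex.normSq_apply]; ring_nf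

theorem inv_im' (z : ℂ) : z⁻¹.im = -z.im / (z.re ^ 2 + z.im ^ 2) := by
  rw [Complex.inv_im, Complex.normSq_apply]; ring_nf

theorem swap_inv (x y : ℝ) :
    (⟨y, x⟩ : ℂ)⁻¹ = -⟨((⟨x, y⟩ : ℂ)⁻¹).im, ((⟨x, y⟩ : ℂ)⁻¹).re⟩ := by
  apply Complex.ext
  · rw [Complex.neg_re, inv_re', inv_im']; simp only; rw [add_comm (y ^ 2)]; ring
  · rw [Complex.neg_im, inv_re', inv_im']; simp only; rw [add_comm (y ^ 2)]; ring

/-- For `e n = 1` inversion maps the circle around `e(1 + i)` of radius `e` to the circle around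
`n(1 - i)` of radius `n`, and the axes to themselves. So it preserves the curve and exchanges its
sides. -/
theorem inv_mem_farSide (he : 0 < e) (hen : e ≤ n) (h1 : e * n = 1) (hz : z ∈ zeroSide e n)
    (hz0 : z ≠ 0) : z⁻¹ ∈ farSide e n := by
  have hn := he.trans_le hen
  revert hz hz0
  refine cross_induction (p := fun z => z ∈ zeroSide e n → z ≠ 0 → z⁻¹ ∈ farSide e n)
    ?_ ?_ ?_ ?_ ?_ z
  · intro z h hz hz0
    rw [← neg_mem_zeroSide] at hz
    have := h hz (neg_ne_zero.2 hz0)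
    rwa [inv_neg, neg_mem_farSide] at this
  · intro x y h hz hz0
    rw [← swap_mem_zeroSide] at hz
    have := h hz (fun h0 => hz0 (by
      rw [Complex.ext_iff] at h0 ⊢; exact ⟨h0.2, h0.1⟩))
    rw [swap_inv, neg_mem_farSide, swap_mem_farSide] at this
    exact this
  · intro z hy hz hz0
    have hx : z.re ≠ 0 := fun h => hz0 (Complex.ext h hy)
    rw [mem_zeroSide_of_im_eq_zero he hy] at hz
    have hi : z⁻¹.im = 0 := by rw [inv_im', hy]; simp
    rw [mem_farSide_of_im_eq_zero hn hi, inv_re', hy, abs_div, lt_div_iff₀ (by positivity),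
      abs_of_nonneg (by positivity : 0 ≤ z.re ^ 2 + 0 ^ 2)]
    have : 0 < |z.re| := abs_pos.2 hx
    rw [← sq_abs]
    nlinarith [mul_pos this hn, mul_lt_mul_of_pos_right hz (mul_pos hn this)]
  · intro z hx hy hz _
    rw [mem_zeroSide_of_pos he hx hy] at hz
    obtain ⟨ha, hb, hc⟩ := hz
    have hm : 0 < z.re ^ 2 + z.im ^ 2 := by positivity
    have hx' : 0 < z⁻¹.re := by rw [inv_re']; positivity
    have hy' : z⁻¹.im < 0 := by rw [inv_im', neg_div]; exact neg_neg_of_pos (by positivity)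
    rw [mem_farSide_of_pos_neg hn hx' hy', inv_re', inv_im']
    set m := z.re ^ 2 + z.im ^ 2 with hmd
    constructor
    · by_contra! h
      rw [div_le_iff₀ hm, le_div_iff₀ hm] at h
      have i1 : e * z.re ≤ m := by nlinarith [mul_le_mul_of_nonneg_left h.1 he.le]
      have i2 : e * z.im ≤ m := by nlinarith [mul_le_mul_of_nonneg_left h.2 he.le]
      have i3 : e * m ≤ m * (z.re + z.im) := by nlinarith
      have i4 : e ≤ z.re + z.im := by nlinarith
      nlinarith
    · have : (z.re / m - n) ^ 2 + (-z.im / m + n) ^ 2 - n ^ 2 =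
          n ^ 2 * ((z.re - e) ^ 2 + (z.im - e) ^ 2 - e ^ 2) / m := by
        have e1 : (z.re / m - n) ^ 2 + (-z.im / m + n) ^ 2 - n ^ 2 =
            ((z.re ^ 2 + z.im ^ 2) / m - 2 * n * (z.re + z.im) + n ^ 2 * m) / m := by
          field_simp; ring
        rw [e1, ← hmd, div_self hm.ne', hmd]
        congr 1
        linear_combination (2 * n * (z.re + z.im) - e * n - 1) * h1
      have h2 : 0 < n ^ 2 * ((z.re - e) ^ 2 + (z.im - e) ^ 2 - e ^ 2) / m :=
        div_pos (mul_pos (by positivity) (by linarith)) hm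
      linarith
  · intro z hx hy hz _
    rw [mem_zeroSide_of_pos_neg hen hx hy] at hz
    have hm : 0 < z.re ^ 2 + z.im ^ 2 := by positivity
    have hx' : 0 < z⁻¹.re := by rw [inv_re']; positivity
    have hy' : 0 < z⁻¹.im := by rw [inv_im']; exact div_pos (by linarith) hm
    rw [mem_farSide_of_pos hen hx' hy', inv_re', inv_im']
    set m := z.re ^ 2 + z.im ^ 2 with hmd
    by_contra! h
    rw [div_le_iff₀ hm, div_le_iff₀ hm] at h
    obtain ⟨i1, i2, i3⟩ := h
    have e2 : (z.re / m - e) ^ 2 + (-z.im / m - e) ^ 2 - e ^ 2 =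
          e ^ 2 * ((z.re - n) ^ 2 + (z.im + n) ^ 2 - n ^ 2) / m := by
      have e1 : (z.re / m - e) ^ 2 + (-z.im / m - e) ^ 2 - e ^ 2 =
          ((z.re ^ 2 + z.im ^ 2) / m - 2 * e * (z.re - z.im) + e ^ 2 * m) / m := by
        field_simp; ring
      rw [e1, ← hmd, div_self hm.ne', hmd]
      congr 1
      linear_combination (2 * e * (z.re - z.im) - e * n - 1) * h1
    have h3 : 0 ≤ (z.re - n) ^ 2 + (z.im + n) ^ 2 - n ^ 2 := by
      by_contra! hlt
      have : e ^ 2 * ((z.re - n) ^ 2 + (z.im + n) ^ 2 - n ^ 2) / m < 0 :=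
        div_neg_of_neg_of_pos (mul_neg_of_pos_of_neg (by positivity) hlt) hm
      linarith
    rcases hz with ⟨j1, j2⟩ | j1
    · have i4 : m ≤ e * m * (z.re - z.im) := by nlinarith
      have i5 : n ≤ z.re - z.im := by
        have : m * 1 ≤ m * (e * (z.re - z.im)) := by linarith
        have := le_of_mul_le_mul_left this hm
        nlinarith [mul_le_mul_of_nonneg_left this hn.le]
      nlinarith
    · linarith

theorem inv_mem_zeroSide (he : 0 < e) (hen : e ≤ n) (h1 : e * n = 1) (hz : z ∈ farSide e n) :
    z⁻¹ ∈ zeroSide e n := by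
  have hn := he.trans_le hen
  revert hz
  refine cross_induction (p := fun z => z ∈ farSide e n → z⁻¹ ∈ zeroSide e n)
    ?_ ?_ ?_ ?_ ?_ z
  · intro z h hz
    rw [← neg_mem_farSide] at hz
    have := h hz
    rwa [inv_neg, neg_mem_zeroSide] at this
  · intro x y h hz
    rw [← swap_mem_farSide] at hz
    have := h hz
    rw [swap_inv, neg_mem_zeroSide, swap_mem_zeroSide] at this
    exact this
  · intro z hy hz
    rw [mem_farSide_of_im_eq_zero hn hy] at hz
    have hi : z⁻¹.im = 0 := by rw [inv_im', hy]; simp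
    have hx : 0 < |z.re| := hn.trans hz
    have hx0 : z.re ≠ 0 := abs_pos.1 hx
    rw [mem_zeroSide_of_im_eq_zero he hi, inv_re', hy, abs_div, div_lt_iff₀ (by positivity),
      abs_of_nonneg (by positivity : 0 ≤ z.re ^ 2 + 0 ^ 2)]
    rw [← sq_abs]
    nlinarith [mul_lt_mul_of_pos_right hz (mul_pos he hx)]
  · intro z hx hy hz
    rw [mem_farSide_of_pos hen hx hy] at hz
    have hm : 0 < z.re ^ 2 + z.im ^ 2 := by positivity
    have hx' : 0 < z⁻¹.re := by rw [inv_re']; positivity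
    have hy' : z⁻¹.im < 0 := by rw [inv_im', neg_div]; exact neg_neg_of_pos (by positivity)
    rw [mem_zeroSide_of_pos_neg hen hx' hy', inv_re', inv_im']
    set m := z.re ^ 2 + z.im ^ 2 with hmd
    have sq : e * z.re < m → e * z.im < m → z.re / m < n ∧ -n < -z.im / m := by
      intro h2 h3
      rw [div_lt_iff₀ hm, lt_div_iff₀ hm]
      constructor
      · nlinarith [mul_lt_mul_of_pos_left h2 hn]
      · nlinarith [mul_lt_mul_of_pos_left h3 hn]
    rcases hz with h | h | h
    · exact Or.inl (sq (by nlinarith) (by nlinarith [sq_nonneg (e - z.im)]))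
    · exact Or.inl (sq (by nlinarith [sq_nonneg (e - z.re)]) (by nlinarith))
    · right
      have : (z.re / m - n) ^ 2 + (-z.im / m + n) ^ 2 - n ^ 2 =
          n ^ 2 * ((z.re - e) ^ 2 + (z.im - e) ^ 2 - e ^ 2) / m := by
        have e1 : (z.re / m - n) ^ 2 + (-z.im / m + n) ^ 2 - n ^ 2 =
            ((z.re ^ 2 + z.im ^ 2) / m - 2 * n * (z.re + z.im) + n ^ 2 * m) / m := by
          field_simp; ring
        rw [e1, ← hmd, div_self hm.ne', hmd]
        congr 1
        linear_combination (2 * n * (z.re + z.im) - e * n - 1) * h1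
      have h2 : n ^ 2 * ((z.re - e) ^ 2 + (z.im - e) ^ 2 - e ^ 2) / m < 0 :=
        div_neg_of_neg_of_pos (mul_neg_of_pos_of_neg (by positivity) (by linarith)) hm
      linarith
  · intro z hx hy hz
    rw [mem_farSide_of_pos_neg hn hx hy] at hz
    obtain ⟨hz, hd⟩ := hz
    have hm : 0 < z.re ^ 2 + z.im ^ 2 := by positivity
    have hx' : 0 < z⁻¹.re := by rw [inv_re']; positivity
    have hy' : 0 < z⁻¹.im := by rw [inv_im']; exact div_pos (by linarith) hm
    rw [mem_zeroSide_of_pos he hx' hy', inv_re', inv_im']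
    set m := z.re ^ 2 + z.im ^ 2 with hmd
    have e2 : (z.re / m - e) ^ 2 + (-z.im / m - e) ^ 2 - e ^ 2 =
          e ^ 2 * ((z.re - n) ^ 2 + (z.im + n) ^ 2 - n ^ 2) / m := by
      have e1 : (z.re / m - e) ^ 2 + (-z.im / m - e) ^ 2 - e ^ 2 =
          ((z.re ^ 2 + z.im ^ 2) / m - 2 * e * (z.re - z.im) + e ^ 2 * m) / m := by
        field_simp; ring
      rw [e1, ← hmd, div_self hm.ne', hmd]
      congr 1
      linear_combination (2 * e * (z.re - z.im) - e * n - 1) * h1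
    have h3 : 0 < e ^ 2 * ((z.re - n) ^ 2 + (z.im + n) ^ 2 - n ^ 2) / m :=
      div_pos (mul_pos (by positivity) (by linarith)) hm
    have sq : n * z.re < m → -(n * z.im) < m → z.re / m < e ∧ -z.im / m < e := by
      intro h2 h3
      rw [div_lt_iff₀ hm, div_lt_iff₀ hm]
      constructor
      · nlinarith [mul_lt_mul_of_pos_left h2 he]
      · nlinarith [mul_lt_mul_of_pos_left h3 he]
    have hs : z.re / m < e ∧ -z.im / m < e := by
      rcases hz with h | h
      · exact sq (by nlinarith) (by nlinarith [sq_nonneg (n + z.im)])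
      · exact sq (by nlinarith [sq_nonneg (n - z.re)]) (by nlinarith)
    exact ⟨hs.1, hs.2, by linarith⟩

theorem isOpen_setOf_or {p q : ℂ → Prop} (hp : IsOpen {z | p z}) (hq : IsOpen {z | q z}) :
    IsOpen {z | p z ∨ q z} := by
  have : {z | p z ∨ q z} = {z | p z} ∪ {z | q z} := rfl
  rw [this]; exact hp.union hq

theorem isOpen_zeroSide : IsOpen (zeroSide e n) := by
  unfold zeroSide
  refine isOpen_setOf_or (IsOpen.and ?_ (IsOpen.and ?_ (IsOpen.and ?_ ?_)))
    (IsOpen.and ?_ (isOpen_setOf_or (IsOpen.and ?_ ?_) ?_)) <;>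
  exact isOpen_lt (by fun_prop) (by fun_prop)

theorem isOpen_farSide : IsOpen (farSide e n) := by
  unfold farSide
  refine isOpen_setOf_or (IsOpen.and ?_ (isOpen_setOf_or ?_ (isOpen_setOf_or ?_ ?_)))
    (IsOpen.and (isOpen_setOf_or ?_ ?_) (IsOpen.and ?_ ?_)) <;>
  exact isOpen_lt (by fun_prop) (by fun_prop)

theorem zero_mem_zeroSide (he : 0 < e) : (0 : ℂ) ∈ zeroSide e n := by
  rw [mem_zeroSide_of_im_eq_zero he (by simp)]; simpa using he

/-- The side of zero is star-shaped about the origin, which yields its connectedness. -/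
theorem smul_mem_zeroSide (he : 0 < e) (hen : e ≤ n) (hz : z ∈ zeroSide e n) {s : ℝ} (hs : 0 < s)
    (hs1 : s ≤ 1) : (s : ℂ) * z ∈ zeroSide e n := by
  have hn := he.trans_le hen
  revert hz
  refine cross_induction (p := fun z => z ∈ zeroSide e n → (s : ℂ) * z ∈ zeroSide e n)
    ?_ ?_ ?_ ?_ ?_ z
  · intro z h hz
    rw [← neg_mem_zeroSide] at hz
    have := h hz
    rwa [mul_neg, neg_mem_zeroSide] at this
  · intro x y h hz
    rw [← swap_mem_zeroSide] at hz
    have := h hz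
    have e1 : ∀ a b : ℝ, (s : ℂ) * ⟨a, b⟩ = ⟨s * a, s * b⟩ := by
      intro a b; apply Complex.ext <;> simp
    rw [e1, swap_mem_zeroSide] at this
    rwa [e1]
  · intro z hy hz
    rw [mem_zeroSide_of_im_eq_zero he hy] at hz
    rw [mem_zeroSide_of_im_eq_zero he (by simp [hy]), Complex.re_ofReal_mul, abs_mul, abs_of_pos hs]
    nlinarith [abs_nonneg z.re]
  · intro z hx hy hz
    rw [mem_zeroSide_of_pos he hx hy] at hz
    obtain ⟨ha, hb, hc⟩ := hz
    rw [mem_zeroSide_of_pos he (by simp; positivity) (by simp; positivity),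
      Complex.re_ofReal_mul, Complex.im_ofReal_mul]
    refine ⟨by nlinarith, by nlinarith, ?_⟩
    -- This is the increase of the equation of the inner circle from `z` to `s z`; it is nonnegative
    -- because `|z|² ≤ e (re z + im z)` inside the square.
    have h1 : 0 ≤ (1 - s) * (2 * (e * (z.re + z.im)) - (1 + s) * (z.re ^ 2 + z.im ^ 2)) := by
      refine mul_nonneg (by linarith) ?_
      nlinarith [mul_pos hx (sub_pos.2 ha), mul_pos hy (sub_pos.2 hb), sq_nonneg z.re,
        sq_nonneg z.im, mul_nonneg (sub_nonneg.2 hs1) (by positivity : 0 ≤ z.re ^ 2 + z.im ^ 2)]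
    nlinarith
  · intro z hx hy hz
    rw [mem_zeroSide_of_pos_neg hen hx hy] at hz
    rw [mem_zeroSide_of_pos_neg hen (by simp; positivity)
      (by simpa using mul_neg_of_pos_of_neg hs hy),
      Complex.re_ofReal_mul, Complex.im_ofReal_mul]
    rcases hz with ⟨h1, h2⟩ | h1
    · exact Or.inl ⟨by nlinarith, by nlinarith⟩
    · by_cases h2 : s * z.re < n ∧ -n < s * z.im
      · exact Or.inl h2
      -- With `g(s) = |s z|² - 2 n s (re z - im z) + n²`, the equation of the outer circle, one has
      -- `g(s) = s g(1) + (1 - s)(n² - s |z|²)`. Leaving the square makes the last factor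
      -- nonpositive; then `z` is in the disc and `g(1) < 0`.
      · right
        have h3 : n ^ 2 ≤ s * (z.re ^ 2 + z.im ^ 2) := by
          rcases not_and_or.1 h2 with h3 | h3
          · have h3 := not_lt.1 h3
            have h4 : n ≤ z.re := h3.trans (by nlinarith)
            nlinarith [mul_le_mul h3 h4 hn.le (by positivity), mul_nonneg hs.le (sq_nonneg z.im)]
          · have h3 : n ≤ s * (-z.im) := by linarith [not_lt.1 h3]
            have h4 : n ≤ -z.im := h3.trans (by nlinarith)
            nlinarith [mul_le_mul h3 h4 hn.le (by nlinarith), mul_nonneg hs.le (sq_nonneg z.re)]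
        have h4 := mul_nonneg (sub_nonneg.2 hs1) (sub_nonneg.2 h3)
        have h5 := mul_pos hs (sub_pos.2 h1)
        nlinarith

/-- Conjugating star-shapedness of the side of zero by inversion makes the far side star-shaped
about infinity. -/
theorem smul_mem_farSide (he : 0 < e) (hen : e ≤ n) (h1 : e * n = 1) (hz : z ∈ farSide e n)
    {s : ℝ} (hs : 1 ≤ s) : (s : ℂ) * z ∈ farSide e n := by
  have hn := he.trans_le hen
  have hz0 : z ≠ 0 := by
    rintro rfl
    rw [mem_farSide_of_im_eq_zero hn (by simp)] at hz
    simp at hz; linarith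
  have hs0 : (s : ℂ) ≠ 0 := by exact_mod_cast (by linarith : s ≠ 0)
  have h2 := smul_mem_zeroSide he hen (inv_mem_zeroSide he hen h1 hz) (s := s⁻¹)
    (by positivity) (inv_le_one_of_one_le₀ hs)
  have h3 := inv_mem_farSide he hen h1 h2 (by simp [hs0, hz0])
  simpa [mul_comm] using h3

/-- The outer circles reach only to distance `(1 + √2) n < √8 n` from the origin. -/
theorem mem_farSide_of_large (hen : e ≤ n) (hn : 0 < n)
    (hz : 8 * n ^ 2 < z.re ^ 2 + z.im ^ 2) : z ∈ farSide e n := by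
  revert hz
  refine cross_induction (p := fun z => 8 * n ^ 2 < z.re ^ 2 + z.im ^ 2 → z ∈ farSide e n)
    ?_ ?_ ?_ ?_ ?_ z
  · intro z h hz; rw [← neg_mem_farSide]; exact h (by simpa using hz)
  · intro x y h hz; rw [← swap_mem_farSide]; exact h (by simpa [add_comm] using hz)
  · intro z hy hz
    rw [mem_farSide_of_im_eq_zero hn hy]
    rw [hy, ← sq_abs z.re] at hz
    nlinarith [abs_nonneg z.re]
  · intro z hx hy hz
    rw [mem_farSide_of_pos hen hx hy]
    by_contra! h
    nlinarith
  · intro z hx hy hz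
    rw [mem_farSide_of_pos_neg hn hx hy]
    constructor
    · by_contra! h; nlinarith
    · by_contra! h
      have h2 : z.re ≤ 2 * n := by nlinarith [sq_nonneg (z.im + n)]
      have h3 : -(2 * n) ≤ z.im := by nlinarith [sq_nonneg (z.re - n)]
      nlinarith

/-- The side of the smoothed cross that contains infinity. -/
def crossPlus (e n : ℝ) : Set (OnePoint ℂ) :=
  insert OnePoint.infty (((↑) : ℂ → OnePoint ℂ) '' farSide e n)

/-- The side of the smoothed cross that contains the origin. -/
def crossMinus (e n : ℝ) : Set (OnePoint ℂ) := ((↑) : ℂ → OnePoint ℂ) '' zeroSide e n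

theorem coe_mem_crossPlus : (z : OnePoint ℂ) ∈ crossPlus e n ↔ z ∈ farSide e n := by
  simp [crossPlus]

theorem infty_mem_crossPlus : OnePoint.infty ∈ crossPlus e n := Or.inl rfl

theorem coe_mem_crossMinus : (z : OnePoint ℂ) ∈ crossMinus e n ↔ z ∈ zeroSide e n := by
  simp [crossMinus]

theorem infty_notMem_crossMinus : OnePoint.infty ∉ crossMinus e n :=
  OnePoint.infty_notMem_image_coe

theorem isOpen_crossMinus : IsOpen (crossMinus e n) :=
  OnePoint.isOpen_image_coe.2 isOpen_zeroSide

theorem isOpen_crossPlus (hen : e ≤ n) (hn : 0 < n) : IsOpen (crossPlus e n) := by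
  rw [OnePoint.isOpen_iff_of_mem infty_mem_crossPlus]
  have hpre : ((↑) : ℂ → OnePoint ℂ) ⁻¹' crossPlus e n = farSide e n := by
    ext z; exact coe_mem_crossPlus
  rw [hpre]
  have hcl : IsClosed (farSide e n)ᶜ := isOpen_farSide.isClosed_compl
  refine ⟨hcl, (isCompact_closedBall (0 : ℂ) (3 * n)).of_isClosed_subset hcl ?_⟩
  intro z hz
  by_contra h
  rw [mem_closedBall_zero_iff, not_le] at h
  refine hz (mem_farSide_of_large hen hn ?_)
  rw [← norm_sq_eq_re_im]; nlinarith

theorem isPreconnected_crossMinus (he : 0 < e) (hen : e ≤ n) :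
    IsPreconnected (crossMinus e n) := by
  refine IsPreconnected.image ?_ _ OnePoint.continuous_coe.continuousOn
  refine isPreconnected_of_forall 0 fun z hz => ⟨segment ℝ 0 z, ?_, left_mem_segment _ _ _,
    right_mem_segment _ _ _, (convex_segment _ _).isPreconnected⟩
  rw [segment_eq_image]
  rintro _ ⟨s, ⟨hs, hs1⟩, rfl⟩
  rcases hs.eq_or_lt with rfl | hs
  · simpa using zero_mem_zeroSide he
  · simpa using smul_mem_zeroSide he hen hz hs hs1

theorem isPreconnected_crossPlus (he : 0 < e) (hen : e ≤ n) (h1 : e * n = 1) :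
    IsPreconnected (crossPlus e n) := by
  refine isPreconnected_insert_infty_of_rays (c := 0) ?_ ?_
  · rintro z hz rfl
    rw [mem_farSide_of_im_eq_zero (he.trans_le hen) (by simp)] at hz
    simp at hz; linarith
  · intro z hz s hs
    simpa using smul_mem_farSide he hen h1 hz hs

theorem isSides_cross (he : 0 < e) (hen : e ≤ n) (h1 : e * n = 1) :
    IsSides (((↑) : ℂ → OnePoint ℂ) '' crossSet e n) (crossPlus e n) (crossMinus e n) := by
  have hn := he.trans_le hen
  have hP := isOpen_crossPlus hen hn
  have hM : IsOpen (crossMinus e n) := isOpen_crossMinus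
  have hunion : crossPlus e n ∪ crossMinus e n = (((↑) : ℂ → OnePoint ℂ) '' crossSet e n)ᶜ := by
    ext q
    induction q using OnePoint.rec with
    | infty => simp [infty_mem_crossPlus]
    | coe z =>
      have := mem_cross_trichotomy he hen z
      simp only [Set.mem_union, coe_mem_crossPlus, coe_mem_crossMinus, Set.mem_compl_iff,
        Set.mem_image, OnePoint.coe_eq_coe, exists_eq_right]
      tauto
  refine ⟨?_, ?_, hP, hM, ?_, isPreconnected_crossPlus he hen h1, isPreconnected_crossMinus he hen,
    hunion⟩
  · rw [← isOpen_compl_iff, ← hunion]; exact hP.union hM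
  · refine ⟨_, (n : ℂ), ?_, rfl⟩
    rw [mem_crossSet_of_im_eq_zero he hen (by simp)]
    simp [abs_of_pos hn, hen]
  · rw [Set.disjoint_left]
    intro q hq hq'
    induction q using OnePoint.rec with
    | infty => exact infty_notMem_crossMinus hq'
    | coe z =>
      rw [coe_mem_crossPlus] at hq
      rw [coe_mem_crossMinus] at hq'
      have := mem_cross_trichotomy he hen z
      tauto

theorem smoothedCross_eq (n : ℕ) :
    smoothedCross n = ((↑) : ℂ → OnePoint ℂ) '' crossSet (1 / (n : ℝ)) n := by
  have hsq : ∀ w : ℂ, ∀ r : ℝ, 0 ≤ r → (‖w‖ = r ↔ w.re ^ 2 + w.im ^ 2 = r ^ 2) := by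
    intro w r hr
    rw [← norm_sq_eq_re_im]
    exact ⟨fun h => by rw [h], fun h => by
      rwa [pow_left_inj₀ (norm_nonneg _) hr two_ne_zero] at h⟩
  have hd : ∀ w : ℂ, ((w / (n : ℂ)).re = w.re / n) ∧ ((w / (n : ℂ)).im = w.im / n) := by
    intro w
    rw [show ((n : ℂ)) = ((n : ℝ) : ℂ) by simp, Complex.div_ofReal_re, Complex.div_ofReal_im]
    exact ⟨rfl, rfl⟩
  have hm : ∀ w : ℂ, (((n : ℂ) * w).re = n * w.re) ∧ (((n : ℂ) * w).im = n * w.im) := by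
    intro w
    rw [show ((n : ℂ)) = ((n : ℝ) : ℂ) by simp, Complex.re_ofReal_mul, Complex.im_ofReal_mul]
    exact ⟨rfl, rfl⟩
  rw [smoothedCross]
  congr 1
  ext z
  simp only [truncatedAxes, axes, innerArcs, outerArcs, crossSet, Set.mem_union, Set.mem_sdiff,
    Set.mem_ofPred_eq, hsq _ _ (by positivity : (0 : ℝ) ≤ 1 / n),
    hsq _ _ (by positivity : (0 : ℝ) ≤ n), Complex.add_re, Complex.add_im, Complex.sub_re,
    Complex.sub_im, hd, hm, Complex.neg_re, Complex.neg_im, Complex.one_re, Complex.one_im,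
    Complex.I_re, Complex.I_im]
  norm_num
  rw [← sub_eq_add_neg z.re]
  tauto

end

/-! ### Round discs -/

/-- The open round disc with centre `(c, d)` and radius `r` lies in `Ω`. -/
def RoundDisc (Ω : Set (OnePoint ℂ)) (c d r : ℝ) : Prop :=
  ∀ z : ℂ, (z.re - c) ^ 2 + (z.im - d) ^ 2 < r ^ 2 → (z : OnePoint ℂ) ∈ Ω

section
variable {Ω Ω' : Set (OnePoint ℂ)} {c d r x y t k : ℝ}

theorem RoundDisc.cap_subset (h : RoundDisc Ω c d r) :
    (CapForm.mk 1 c d (c ^ 2 + d ^ 2 - r ^ 2)).cap ⊆ Ω := by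
  intro q hq
  induction q using OnePoint.rec with
  | infty => rw [CapForm.infty_mem_cap] at hq; norm_num at hq
  | coe z =>
    rw [CapForm.coe_mem_cap, CapForm.poly] at hq
    exact h z (by simp only at hq; linarith)

theorem RoundDisc.deep (h : RoundDisc Ω c d r) (hv : (x - c) ^ 2 + (y - d) ^ 2 + t ^ 2 < r ^ 2) :
    Deep Ω x y t :=
  ⟨_, h.cap_subset, by rw [CapForm.poly]; simp only; linarith⟩

/-- The plane over a round disc is a hemisphere. Its discriminant is `r²`, so the hyperbolic sine of
the distance to it is `((x - c)² + (y - d)² + t² - r²) / (2 t r)`. -/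
theorem RoundDisc.reach (h : RoundDisc Ω c d r) (hr : 0 < r)
    (hv : (x - c) ^ 2 + (y - d) ^ 2 + t ^ 2 - r ^ 2 ≤ 2 * k * t * r) : Reach Ω k x y t := by
  have hd : (CapForm.mk 1 c d (c ^ 2 + d ^ 2 - r ^ 2)).disc = r ^ 2 := by
    rw [CapForm.disc]; ring
  refine ⟨_, h.cap_subset, by rw [hd]; positivity, ?_⟩
  rw [hd, Real.sqrt_sq hr.le, CapForm.poly]; simp only; linarith

theorem Reach.mono {k' : ℝ} (h : Reach Ω k x y t) (hk : k ≤ k') (ht : 0 < t) :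
    Reach Ω k' x y t := by
  obtain ⟨Q, hQ, hd, hv⟩ := h
  refine ⟨Q, hQ, hd, hv.trans ?_⟩
  gcongr

/-- Inversion `z ↦ 1/z` on the Riemann sphere. -/
noncomputable def sphereInv (q : OnePoint ℂ) : OnePoint ℂ :=
  q.elim ((0 : ℂ) : OnePoint ℂ) fun z => if z = 0 then OnePoint.infty else ((z⁻¹ : ℂ) : OnePoint ℂ)

theorem sphereInv_infty : sphereInv OnePoint.infty = ((0 : ℂ) : OnePoint ℂ) := rfl

theorem sphereInv_zero : sphereInv ((0 : ℂ) : OnePoint ℂ) = OnePoint.infty := if_pos rfl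

theorem sphereInv_coe {z : ℂ} (hz : z ≠ 0) : sphereInv z = ((z⁻¹ : ℂ) : OnePoint ℂ) := if_neg hz

theorem sphereInv_sphereInv (q : OnePoint ℂ) : sphereInv (sphereInv q) = q := by
  induction q using OnePoint.rec with
  | infty => rw [sphereInv_infty, sphereInv_zero]
  | coe z =>
    by_cases hz : z = 0
    · rw [hz, sphereInv_zero, sphereInv_infty]
    · rw [sphereInv_coe hz, sphereInv_coe (inv_ne_zero hz), inv_inv]

/-- The pullback of an affine function under inversion. -/
def CapForm.inv (Q : CapForm) : CapForm := ⟨Q.B, Q.c, -Q.d, Q.A⟩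

theorem CapForm.mem_cap_inv (Q : CapForm) (q : OnePoint ℂ) :
    q ∈ Q.inv.cap ↔ sphereInv q ∈ Q.cap := by
  induction q using OnePoint.rec with
  | infty =>
    rw [sphereInv_infty, infty_mem_cap, coe_mem_cap]
    simp [CapForm.inv, CapForm.poly]
  | coe z =>
    by_cases hz : z = 0
    · rw [hz, sphereInv_zero, infty_mem_cap, coe_mem_cap]
      simp [CapForm.inv, CapForm.poly]
    · rw [sphereInv_coe hz, coe_mem_cap, coe_mem_cap, inv_re', inv_im', poly, poly]
      have hm : 0 < z.re ^ 2 + z.im ^ 2 := by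
        rw [← norm_sq_eq_re_im]; positivity
      set m := z.re ^ 2 + z.im ^ 2 with hmd
      have e1 : (z.re / m) ^ 2 + (-z.im / m) ^ 2 = 1 / m := by
        rw [div_pow, div_pow, neg_sq, ← add_div, ← hmd]; field_simp
      rw [e1, CapForm.inv]
      have e2 : Q.A * (1 / m) - 2 * (Q.c * (z.re / m) + Q.d * (-z.im / m)) + Q.B =
          (Q.B * m - 2 * (Q.c * z.re + -Q.d * z.im) + Q.A) / m := by field_simp; ring
      rw [e2, div_lt_iff₀ hm, zero_mul]

theorem CapForm.inv_cap_subset {Q : CapForm} (hQ : Q.cap ⊆ Ω)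
    (hΩ : ∀ q ∈ Ω, sphereInv q ∈ Ω') : Q.inv.cap ⊆ Ω' := fun q hq => by
  have := hΩ _ (hQ ((Q.mem_cap_inv q).1 hq))
  rwa [sphereInv_sphereInv] at this

/-- Inversion extends to the isometry `(x, y, t) ↦ (x, -y, t) / (x² + y² + t²)` of the half-space
model. -/
theorem CapForm.poly_inv (Q : CapForm) {v : ℝ} (hv : 0 < v) :
    Q.inv.poly x y v = v * Q.poly (x / v) (-y / v) v⁻¹ := by
  rw [CapForm.inv, poly, poly]; field_simp; ring

theorem inv_coords (ht : 0 < t) :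
    (x / (x ^ 2 + y ^ 2 + t ^ 2)) ^ 2 + (-y / (x ^ 2 + y ^ 2 + t ^ 2)) ^ 2 +
      (t / (x ^ 2 + y ^ 2 + t ^ 2)) ^ 2 = (x ^ 2 + y ^ 2 + t ^ 2)⁻¹ := by
  have : 0 < x ^ 2 + y ^ 2 + t ^ 2 := by positivity
  field_simp

theorem Deep.of_inv (ht : 0 < t) (hΩ : ∀ q ∈ Ω, sphereInv q ∈ Ω')
    (h : Deep Ω (x / (x ^ 2 + y ^ 2 + t ^ 2)) (-y / (x ^ 2 + y ^ 2 + t ^ 2))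
      (t / (x ^ 2 + y ^ 2 + t ^ 2))) : Deep Ω' x y t := by
  have hv : 0 < x ^ 2 + y ^ 2 + t ^ 2 := by positivity
  obtain ⟨Q, hQ, h⟩ := h
  rw [inv_coords ht] at h
  refine ⟨Q.inv, CapForm.inv_cap_subset hQ hΩ, ?_⟩
  rw [Q.poly_inv hv]
  exact mul_neg_of_pos_of_neg hv h

theorem Reach.of_inv (ht : 0 < t) (hΩ : ∀ q ∈ Ω, sphereInv q ∈ Ω')
    (h : Reach Ω k (x / (x ^ 2 + y ^ 2 + t ^ 2)) (-y / (x ^ 2 + y ^ 2 + t ^ 2))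
      (t / (x ^ 2 + y ^ 2 + t ^ 2))) : Reach Ω' k x y t := by
  have hv : 0 < x ^ 2 + y ^ 2 + t ^ 2 := by positivity
  obtain ⟨Q, hQ, hd, h⟩ := h
  rw [inv_coords ht] at h
  have hdisc : Q.inv.disc = Q.disc := by rw [CapForm.disc, CapForm.disc, CapForm.inv]; ring
  refine ⟨Q.inv, CapForm.inv_cap_subset hQ hΩ, by rwa [hdisc], ?_⟩
  rw [Q.poly_inv hv, hdisc]
  calc _ ≤ (x ^ 2 + y ^ 2 + t ^ 2) * (2 * k * (t / (x ^ 2 + y ^ 2 + t ^ 2)) * √Q.disc) := by gcongr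
    _ = _ := by field_simp

end

/-! ### Round discs in the sides of the smoothed cross -/

section
variable {e n s r : ℝ} {z : ℂ}

/-- The disc of radius `s` around `s(1 + i)` is tangent to both axes; the smoothing takes away
nothing from it if `s ≥ e`. -/
theorem mem_farSide_of_disc (he : 0 < e) (hen : e ≤ n) (hs : e ≤ s)
    (hz : (z.re - s) ^ 2 + (z.im - s) ^ 2 < s ^ 2) : z ∈ farSide e n := by
  have hx : 0 < z.re := by nlinarith [sq_nonneg (z.im - s)]
  have hy : 0 < z.im := by nlinarith [sq_nonneg (z.re - s)]
  rw [mem_farSide_of_pos hen hx hy]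
  by_contra! h
  obtain ⟨h1, h2, h3⟩ := h
  have h4 : z.re + z.im ≤ e := by
    by_contra! h4; nlinarith
  nlinarith

/-- The corresponding disc in the fourth quadrant, where `s ≤ n` keeps it inside the outer circle or
the square. -/
theorem mem_zeroSide_of_disc (hen : e ≤ n) (hs : 0 < s) (hsn : s ≤ n)
    (hz : (z.re - s) ^ 2 + (z.im + s) ^ 2 < s ^ 2) : z ∈ zeroSide e n := by
  have hx : 0 < z.re := by nlinarith [sq_nonneg (z.im + s)]
  have hy : z.im < 0 := by nlinarith [sq_nonneg (z.re - s)]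
  rw [mem_zeroSide_of_pos_neg hen hx hy]
  by_cases h : z.re < n ∧ -n < z.im
  · exact Or.inl h
  · right
    have h1 : n ≤ z.re - z.im := by
      rcases not_and_or.1 h with h | h <;> linarith [not_lt.1 h]
    nlinarith

/-- The disc centred on the second diagonal that is tangent to both inner circles. -/
theorem mem_zeroSide_of_throat (he : 0 < e) (hen : 2 * e ≤ n) (hs : |s| ≤ e) (hr : 0 ≤ r)
    (hr2 : r ^ 2 = 2 * s ^ 2 + 2 * e ^ 2)
    (hz : (z.re + s) ^ 2 + (z.im - s) ^ 2 < (r - e) ^ 2) : z ∈ zeroSide e n := by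
  -- Swapping the coordinates or negating both replaces `s` by `-s`, so the induction has to be
  -- uniform in `s`.
  revert s
  refine cross_induction (p := fun z => ∀ {s : ℝ}, |s| ≤ e → r ^ 2 = 2 * s ^ 2 + 2 * e ^ 2 →
    (z.re + s) ^ 2 + (z.im - s) ^ 2 < (r - e) ^ 2 → z ∈ zeroSide e n) ?_ ?_ ?_ ?_ ?_ z
  · intro z h s hs hr2 hz
    rw [← neg_mem_zeroSide]
    refine h (s := -s) (by rwa [abs_neg]) (by rw [hr2]; ring) ?_
    rw [Complex.neg_re, Complex.neg_im]; nlinarith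
  · intro x y h s hs hr2 hz
    rw [← swap_mem_zeroSide]
    refine h (s := -s) (by rwa [abs_neg]) (by rw [hr2]; ring) ?_
    simp only at hz ⊢; nlinarith
  · intro z hy s hs hr2 hz
    obtain ⟨h1, h2⟩ := abs_le.1 hs
    rw [mem_zeroSide_of_im_eq_zero he hy, abs_lt]
    rw [hy] at hz
    have h3 : e + s ≤ r := by nlinarith [sq_nonneg (e - s)]
    have h4 : e - s ≤ r := by nlinarith [sq_nonneg (e + s)]
    constructor <;> by_contra! h <;> nlinarith
  · intro z hx hy s hs hr2 hz
    obtain ⟨h1, h2⟩ := abs_le.1 hs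
    have h3 : e + s ≤ r := by nlinarith [sq_nonneg (e - s)]
    have h4 : e - s ≤ r := by nlinarith [sq_nonneg (e + s)]
    have hre : e < r := by nlinarith
    rw [mem_zeroSide_of_pos he hx hy]
    refine ⟨?_, ?_, ?_⟩
    · by_contra! h
      rcases le_total s 0 with h5 | h5 <;> nlinarith
    · by_contra! h
      rcases le_total s 0 with h5 | h5 <;> nlinarith
    · by_contra! h
      -- The centres are at distance `r = (r - e) + e`. A point in both discs would contradict the
      -- triangle inequality, here in the form of Cauchy–Schwarz.
      have hcs : ((z.re + s) * (e - z.re) + (z.im - s) * (e - z.im)) ^ 2 ≤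
          ((z.re + s) ^ 2 + (z.im - s) ^ 2) * ((z.re - e) ^ 2 + (z.im - e) ^ 2) := by
        nlinarith [sq_nonneg ((z.re + s) * (e - z.im) - (z.im - s) * (e - z.re))]
      have h5 : ((z.re + s) * (e - z.re) + (z.im - s) * (e - z.im)) ^ 2 ≤ ((r - e) * e) ^ 2 := by
        refine hcs.trans ?_
        rw [mul_pow]
        exact mul_le_mul hz.le h (by positivity) (by positivity)
      have h6 := abs_le_of_sq_le_sq' h5 (by nlinarith) |>.2
      nlinarith
  · intro z hx hy s hs hr2 hz
    obtain ⟨h1, h2⟩ := abs_le.1 hs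
    have hre : e < r := by nlinarith
    have hr3 : r - e ≤ e := by nlinarith [abs_le.1 hs]
    rw [mem_zeroSide_of_pos_neg (by linarith) hx hy]
    left
    have h5 := abs_le_of_sq_le_sq' (a := z.re + s) (b := r - e)
      (by nlinarith [sq_nonneg (z.im - s)]) (by linarith)
    have h6 := abs_le_of_sq_le_sq' (a := z.im - s) (b := r - e)
      (by nlinarith [sq_nonneg (z.re + s)]) (by linarith)
    constructor
    · by_contra! h
      nlinarith [sq_nonneg (z.im - s)]
    · by_contra! h
      nlinarith [sq_nonneg (z.re + s)]

end

/-! ### Staying away from `-1` -/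

/-- The complement of a closed disc around `-1` that is invariant under inversion. -/
def awayFromNegOne (L : ℝ) : Set (OnePoint ℂ) :=
  (CapForm.mk (1 - L ^ 2) (1 + L ^ 2) 0 (1 - L ^ 2)).cap

section
variable {L η : ℝ} {z : ℂ}

theorem coe_mem_awayFromNegOne : (z : OnePoint ℂ) ∈ awayFromNegOne L ↔
    (z.re - 1) ^ 2 + z.im ^ 2 < L ^ 2 * ((z.re + 1) ^ 2 + z.im ^ 2) := by
  rw [awayFromNegOne, CapForm.coe_mem_cap, CapForm.poly]
  simp only
  constructor <;> intro h <;> linarith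

theorem sphereInv_mem_awayFromNegOne {q : OnePoint ℂ} (h : q ∈ awayFromNegOne L) :
    sphereInv q ∈ awayFromNegOne L := by
  rw [awayFromNegOne, ← CapForm.mem_cap_inv]
  simpa [CapForm.inv, awayFromNegOne] using h

/-- From `|z - 1| ≤ |z + 1| + 2` follows `|z - 1|² ≤ 3 |z + 1|² + 6`, so a lower bound for `|z + 1|`
suffices once `L` is large. -/
theorem mem_awayFromNegOne_of_le (hη : η ≤ (z.re + 1) ^ 2 + z.im ^ 2)
    (hη0 : 0 < η) (hL : 6 < (L ^ 2 - 3) * η) : (z : OnePoint ℂ) ∈ awayFromNegOne L := by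
  rw [coe_mem_awayFromNegOne]
  have hL3 : 0 < L ^ 2 - 3 := by
    by_contra! h; nlinarith
  nlinarith [sq_nonneg (z.re + 1 + 1), sq_nonneg z.im, mul_le_mul_of_nonneg_left hη hL3.le]

theorem mem_awayFromNegOne_of_re_pos (hz : 0 < z.re) (hL : 1 ≤ L) :
    (z : OnePoint ℂ) ∈ awayFromNegOne L := by
  rw [coe_mem_awayFromNegOne]
  nlinarith [mul_le_mul_of_nonneg_right (by nlinarith : 1 ≤ L ^ 2)
    (by positivity : 0 ≤ (z.re + 1) ^ 2 + z.im ^ 2)]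

/-- The disc touches the real axis at `-s`. If `s` differs from `1` by at least `a`, its boundary
has risen above the axis near `-1` by an amount quadratic in `a`, which leaves a definite gap. -/
theorem disc_away_of_abs_sub_one {a s σ : ℝ} (ha : 0 < a) (ha1 : a ≤ 1) (hs : 0 < s)
    (hsa : a ≤ |s - 1|) (hσ : |σ| = s) (hz : (z.re + s) ^ 2 + (z.im - σ) ^ 2 < s ^ 2) :
    a ^ 4 / 36 ≤ (z.re + 1) ^ 2 + z.im ^ 2 := by
  by_contra! h
  have hσ2 : σ ^ 2 = s ^ 2 := by rw [← hσ, sq_abs]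
  have h1 := abs_le_of_sq_le_sq (a := z.re + 1) (b := a ^ 2 / 6)
    (by nlinarith [sq_nonneg z.im]) (by positivity)
  have h2 := abs_le_of_sq_le_sq (a := z.im) (b := a ^ 2 / 6)
    (by nlinarith [sq_nonneg (z.re + 1)]) (by positivity)
  have h3 : (s - 1) ^ 2 < 2 * (σ * z.im) - 2 * ((z.re + 1) * (s - 1)) := by
    nlinarith [sq_nonneg (z.re + 1), sq_nonneg z.im]
  have h4 : σ * z.im ≤ s * (a ^ 2 / 6) := by
    refine (le_abs_self _).trans ?_
    rw [abs_mul, hσ]; gcongr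
  have h5 : -((z.re + 1) * (s - 1)) ≤ (a ^ 2 / 6) * |s - 1| := by
    refine (neg_le_abs _).trans ?_
    rw [abs_mul]; gcongr
  have h6 : |s - 1| ^ 2 < a ^ 2 / 3 * (s + |s - 1|) := by rw [sq_abs]; linarith
  rcases le_total s 1 with h7 | h7
  · have : |s - 1| = 1 - s := by rw [abs_of_nonpos (by linarith)]; ring
    rw [this] at h6 hsa; nlinarith
  · have : |s - 1| = s - 1 := abs_of_nonneg (by linarith)
    rw [this] at h6 hsa
    have h0 : a ^ 2 ≤ s - 1 := by nlinarith
    have h8 : a ^ 2 * (s - 1) ≤ (s - 1) ^ 2 := by nlinarith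
    nlinarith

end

/-! ### Upper bounds for the width near a smoothed cross -/

/-- A supply of round discs in two disjoint regions that look like the two sides of a smoothed
cross. -/
structure CrossDiscs (a e n : ℝ) (P M : Set (OnePoint ℂ)) : Prop where
  plus : ∀ s, e ≤ s → a ≤ |s - 1| → RoundDisc P s s s ∧ RoundDisc P (-s) (-s) s
  minus : ∀ s, 0 < s → s ≤ n → a ≤ |s - 1| → RoundDisc M s (-s) s ∧ RoundDisc M (-s) s s
  throat : ∀ s r, |s| ≤ e → 0 ≤ r → r ^ 2 = 2 * s ^ 2 + 2 * e ^ 2 → RoundDisc M (-s) s (r - e)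
  east : ∀ c, |c - 1| ≤ 1 / 100 → RoundDisc P c (1 / 4) (1 / 4) ∧ RoundDisc M c (-(1 / 4)) (1 / 4)
  north : ∀ c, |c - 1| ≤ 1 / 100 → RoundDisc P (1 / 4) c (1 / 4) ∧ RoundDisc M (-(1 / 4)) c (1 / 4)
  south : ∀ c, |c - 1| ≤ 1 / 100 →
    RoundDisc P (-(1 / 4)) (-c) (1 / 4) ∧ RoundDisc M (1 / 4) (-c) (1 / 4)

/-- The point of upper half space is either deep inside `P` or close to `M`, and vice versa. -/
def NearBoth (P M : Set (OnePoint ℂ)) (k x y t : ℝ) : Prop :=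
  (Deep P x y t ∨ Reach M k x y t) ∧ (Deep M x y t ∨ Reach P k x y t)

section
variable {a e n k x y t s : ℝ} {P M : Set (OnePoint ℂ)}

theorem NearBoth.mono {k' : ℝ} (h : NearBoth P M k x y t) (hk : k ≤ k') (ht : 0 < t) :
    NearBoth P M k' x y t :=
  ⟨h.1.imp_right fun h => h.mono hk ht, h.2.imp_right fun h => h.mono hk ht⟩

theorem CrossDiscs.deep_plus (h : CrossDiscs a e n P M) (hs : e ≤ s) (hsa : a ≤ |s - 1|)
    (hv : x ^ 2 + y ^ 2 + t ^ 2 + s ^ 2 < 2 * s * |x + y|) : Deep P x y t := by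
  obtain ⟨h1, h2⟩ := h.plus s hs hsa
  rcases abs_cases (x + y) with ⟨h3, _⟩ | ⟨h3, _⟩ <;> rw [h3] at hv
  · exact h1.deep (by linarith)
  · exact h2.deep (by linarith)

theorem CrossDiscs.reach_plus (h : CrossDiscs a e n P M) (hs : e ≤ s) (hs0 : 0 < s)
    (hsa : a ≤ |s - 1|)
    (hv : x ^ 2 + y ^ 2 + t ^ 2 + s ^ 2 - 2 * s * |x + y| ≤ 2 * k * t * s) : Reach P k x y t := by
  obtain ⟨h1, h2⟩ := h.plus s hs hsa
  rcases abs_cases (x + y) with ⟨h3, _⟩ | ⟨h3, _⟩ <;> rw [h3] at hv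
  · exact h1.reach hs0 (by linarith)
  · exact h2.reach hs0 (by linarith)

theorem CrossDiscs.deep_minus (h : CrossDiscs a e n P M) (hs : 0 < s) (hsn : s ≤ n)
    (hsa : a ≤ |s - 1|)
    (hv : x ^ 2 + y ^ 2 + t ^ 2 + s ^ 2 < 2 * s * |x - y|) : Deep M x y t := by
  obtain ⟨h1, h2⟩ := h.minus s hs hsn hsa
  rcases abs_cases (x - y) with ⟨h3, _⟩ | ⟨h3, _⟩ <;> rw [h3] at hv
  · exact h1.deep (by linarith)
  · exact h2.deep (by linarith)

theorem CrossDiscs.reach_minus (h : CrossDiscs a e n P M) (hs : 0 < s) (hsn : s ≤ n)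
    (hsa : a ≤ |s - 1|)
    (hv : x ^ 2 + y ^ 2 + t ^ 2 + s ^ 2 - 2 * s * |x - y| ≤ 2 * k * t * s) : Reach M k x y t := by
  obtain ⟨h1, h2⟩ := h.minus s hs hsn hsa
  rcases abs_cases (x - y) with ⟨h3, _⟩ | ⟨h3, _⟩ <;> rw [h3] at hv
  · exact h1.reach hs (by linarith)
  · exact h2.reach hs (by linarith)

/-- The two discs of radius `√(x² + y² + t²)` suffice in the middle range. -/
theorem CrossDiscs.nearBoth_mid (h : CrossDiscs a e n P M) (ht : 0 < t)
    (hk : √2 ≤ k) (hs : 0 < s) (hs2 : s ^ 2 = x ^ 2 + y ^ 2 + t ^ 2) (hes : e ≤ s) (hsn : s ≤ n)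
    (hsa : a ≤ |s - 1|) : NearBoth P M k x y t := by
  have h2 : √2 ^ 2 = 2 := Real.sq_sqrt (by norm_num)
  -- The height polynomial for the disc of radius `s` is `2s(s - |x ± y|)`. From `p ≤ s` and `p² +
  -- q² = 2(s² - t²)` one gets `s² ≤ 2t² + q² ≤ (√2 t + q)²`. This is where the width of the cross
  -- comes from.
  have key : ∀ p q : ℝ, 0 ≤ p → 0 ≤ q → p ^ 2 + q ^ 2 = 2 * (x ^ 2 + y ^ 2) → p ≤ s →
      s - q ≤ k * t := fun p q hp hq hpq hps => by
    have : s ≤ √2 * t + q := by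
      refine abs_le_of_sq_le_sq' (b := √2 * t + q) ?_ (by positivity) |>.2
      have h3 : 0 ≤ √2 * t * q := by positivity
      have h4 : (√2 * t + q) ^ 2 = 2 * t ^ 2 + q ^ 2 + 2 * (√2 * t * q) := by
        linear_combination t ^ 2 * h2
      have h5 : p ^ 2 ≤ s ^ 2 := by gcongr
      linarith
    have := mul_le_mul_of_nonneg_right hk ht.le
    linarith
  have hpq : |x + y| ^ 2 + |x - y| ^ 2 = 2 * (x ^ 2 + y ^ 2) := by rw [sq_abs, sq_abs]; ring
  constructor
  · rcases lt_or_ge s |x + y| with h1 | h1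
    · exact Or.inl (h.deep_plus hes hsa (by linarith [mul_lt_mul_of_pos_left h1 hs]))
    · refine Or.inr (h.reach_minus hs hsn hsa ?_)
      have := mul_le_mul_of_nonneg_left (key _ _ (abs_nonneg _) (abs_nonneg _) hpq h1) hs.le
      linarith
  · rcases lt_or_ge s |x - y| with h1 | h1
    · exact Or.inl (h.deep_minus hs hsn hsa (by linarith [mul_lt_mul_of_pos_left h1 hs]))
    · refine Or.inr (h.reach_plus hes hs hsa ?_)
      have := mul_le_mul_of_nonneg_left
        (key _ _ (abs_nonneg _) (abs_nonneg _) (by rw [add_comm]; exact hpq) h1) hs.le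
      linarith

/-- The inequality left over in `CrossDiscs.throat_plus` once the throat disc has been chosen
optimally; `2 e β` is the minimal value found there. -/
theorem throat_aux {e t q p v α β : ℝ} (he : 0 ≤ e) (ht : 0 ≤ t) (hq : 0 ≤ q)
    (hβ : β ^ 2 = α ^ 2 - q ^ 2) (hα : α = √2 * e - 2 * t)
    (h4 : 2 * √2 * (t * e) + 2 * e * q < v + e ^ 2) (h1 : 2 * e * p ≤ v + e ^ 2) (hp0 : 0 ≤ p)
    (hpq : p ^ 2 + q ^ 2 = 2 * (v - t ^ 2)) (hv : v < e ^ 2) :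
    2 * e * β ≤ 3 * e ^ 2 - 2 * √2 * (t * e) - v := by
  have h2 : √2 ^ 2 = 2 := Real.sq_sqrt (by norm_num)
  have h20 : 0 ≤ √2 := Real.sqrt_nonneg _
  have hte : 0 ≤ t * e := by positivity
  have heq : 0 ≤ 2 * e * q := by positivity
  refine abs_le_of_sq_le_sq' ?_ (by linarith) |>.2
  have h9 : (2 * e * p) ^ 2 ≤ (v + e ^ 2) ^ 2 := by gcongr
  have h10 : (2 * e * β) ^ 2 = 4 * e ^ 2 * (α ^ 2 - q ^ 2) := by rw [mul_pow, hβ]; ring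
  have h11 : q ^ 2 = 2 * (v - t ^ 2) - p ^ 2 := by linarith
  have h12 : α ^ 2 = 2 * e ^ 2 - 4 * √2 * (t * e) + 4 * t ^ 2 := by
    rw [hα]; linear_combination e ^ 2 * h2
  have h13 : (3 * e ^ 2 - 2 * √2 * (t * e) - v) ^ 2 = 9 * e ^ 4 + 8 * (t * e) ^ 2 + v ^ 2
    - 12 * √2 * (t * e) * e ^ 2 - 6 * e ^ 2 * v + 4 * √2 * (t * e) * v := by
    linear_combination 4 * (t * e) ^ 2 * h2
  have h14 : 0 ≤ (t * e) * (√2 * (e ^ 2 + v) - 4 * (t * e)) := by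
    refine mul_nonneg hte ?_
    have h15 : 0 ≤ √2 * (e ^ 2 + v - 2 * √2 * (t * e)) := mul_nonneg h20 (by linarith)
    have h16 : √2 * (e ^ 2 + v - 2 * √2 * (t * e)) =
        √2 * (e ^ 2 + v) - 4 * (t * e) := by linear_combination -2 * (t * e) * h2
    rwa [h16] at h15
  rw [h10, h11, h12, h13]
  linarith

/-- In the throat, `P` is deep or `M` is close. -/
theorem CrossDiscs.throat_plus (h : CrossDiscs a e n P M) (he : 0 < e) (ht : 0 < t)
    (hk : √2 ≤ k) (hen : e ≤ n) (hea : a ≤ |e - 1|) (hv : x ^ 2 + y ^ 2 + t ^ 2 < e ^ 2) :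
    Deep P x y t ∨ Reach M k x y t := by
  have h2 : √2 ^ 2 = 2 := Real.sq_sqrt (by norm_num)
  have h20 : 0 ≤ √2 := Real.sqrt_nonneg _
  have h21 : 1 < √2 := by nlinarith
  set v := x ^ 2 + y ^ 2 + t ^ 2 with hvd
  have hpq : |x + y| ^ 2 + |x - y| ^ 2 = 2 * (v - t ^ 2) := by rw [sq_abs, sq_abs, hvd]; ring
  rcases lt_or_ge (v + e ^ 2) (2 * e * |x + y|) with h1 | h1
  · exact Or.inl (h.deep_plus le_rfl hea h1)
  right
  rcases le_or_gt (v + e ^ 2 - 2 * e * |x - y|) (2 * k * t * e) with h3 | h3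
  · exact h.reach_minus he hen hea h3
  have hkt : √2 * t ≤ k * t := mul_le_mul_of_nonneg_right hk ht.le
  set q := |x - y| with hq
  have hq0 : 0 ≤ q := abs_nonneg _
  have hp0 : 0 ≤ |x + y| := abs_nonneg _
  have h4 : 2 * √2 * (t * e) + 2 * e * q < v + e ^ 2 := by
    have := mul_le_mul_of_nonneg_right hkt he.le
    linarith
  have h5 : √2 * t + q < e := by
    refine lt_of_mul_lt_mul_left (a := 2 * e) ?_ (by positivity)
    linarith
  -- For the throat disc with parameter `s`, placed on the side of the point, reaching with constant
  -- `√2` means `v - 3e² + 2√2 t e + 2(α √(s² + e²) - q |s|) ≤ 0`. The bracket is minimal at `|s| =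
  -- e q / β`, where `β² = α² - q²`; its value there is `e β` and `r = √2 e α / β`.
  set α := √2 * e - 2 * t with hα
  have h6 : √2 * q < α := by
    have : √2 * (√2 * t + q) < √2 * e := by gcongr
    have h7 : √2 * (√2 * t + q) = 2 * t + √2 * q := by linear_combination t * h2
    linarith
  have hα0 : 0 < α := lt_of_le_of_lt (by positivity) h6
  have h7 : 2 * q ^ 2 ≤ α ^ 2 := by
    have : (√2 * q) ^ 2 ≤ α ^ 2 := by gcongr
    rwa [mul_pow, h2] at this
  have hαq : 0 < α ^ 2 - q ^ 2 := by
    have : 0 < α ^ 2 := by positivity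
    linarith
  obtain ⟨β, hβ0, hβ⟩ : ∃ β, 0 < β ∧ β ^ 2 = α ^ 2 - q ^ 2 :=
    ⟨√(α ^ 2 - q ^ 2), Real.sqrt_pos.2 hαq, Real.sq_sqrt hαq.le⟩
  have hqβ : q ≤ β := abs_le_of_sq_le_sq' (by linarith) hβ0.le |>.2
  have h8 := throat_aux he.le ht.le hq0 hβ hα h4 h1 hp0 hpq hv
  obtain ⟨s, hs, hsx⟩ : ∃ s, |s| = e * q / β ∧ s * (y - x) = |s| * q := by
    rcases abs_cases (x - y) with ⟨h9, _⟩ | ⟨h9, _⟩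
    · refine ⟨-(e * q / β), ?_, ?_⟩
      · rw [abs_neg, abs_of_nonneg (by positivity)]
      · rw [abs_neg, abs_of_nonneg (by positivity), hq, h9]; ring
    · refine ⟨e * q / β, ?_, ?_⟩
      · rw [abs_of_nonneg (by positivity)]
      · rw [abs_of_nonneg (by positivity), hq, h9]; ring
  have hs2 : s ^ 2 = (e * q / β) ^ 2 := by rw [← hs, sq_abs]
  have hr2 : (√2 * e * α / β) ^ 2 = 2 * s ^ 2 + 2 * e ^ 2 := by
    have : α ^ 2 = β ^ 2 + q ^ 2 := by linarith
    rw [hs2, div_pow, mul_pow, mul_pow, h2, this]; field_simp; ring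
  have hre : e < √2 * e * α / β := by
    rw [lt_div_iff₀ hβ0]
    have : β ≤ α := abs_le_of_sq_le_sq' (by linarith [sq_nonneg q]) hα0.le |>.2
    have : e * β ≤ e * α := by gcongr
    have : 0 < (√2 - 1) * (e * α) := mul_pos (by linarith) (by positivity)
    linarith
  refine (h.throat s _ ?_ (by positivity) hr2).reach (by linarith) ?_
  · rw [hs, div_le_iff₀ hβ0]; gcongr
  set r := √2 * e * α / β with hr
  have h15 : √2 * t * (r - e) ≤ k * t * (r - e) := by
    gcongr
  have h16 : v - 2 * (e * q / β) * q - 3 * e ^ 2 + 2 * r * e ≤ 2 * (√2 * t * (r - e)) := by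
    have : v - 2 * (e * q / β) * q - 3 * e ^ 2 + 2 * r * e - 2 * (√2 * t * (r - e)) =
        v - 3 * e ^ 2 + 2 * √2 * (t * e) + 2 * e * (α * (√2 * e - √2 ^ 2 * t) - q ^ 2) / β := by
      rw [hr]; field_simp; ring
    have h17 : v - 3 * e ^ 2 + 2 * √2 * (t * e) + 2 * e * (α * (√2 * e - √2 ^ 2 * t) - q ^ 2) / β
        = v - 3 * e ^ 2 + 2 * √2 * (t * e) + 2 * e * β := by
      rw [h2, ← hα, ← sq, ← hβ]; field_simp
    linarith
  have : (x - -s) ^ 2 + (y - s) ^ 2 + t ^ 2 - (r - e) ^ 2 =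
      v - 2 * (e * q / β) * q - 3 * e ^ 2 + 2 * r * e := by
    rw [← hs, hvd]; linear_combination -2 * hsx - hr2
  linarith

/-- In the throat, `M` is deep or `P` is close. -/
theorem CrossDiscs.throat_minus (h : CrossDiscs a e n P M) (he : 0 < e) (ht : 0 < t)
    (hk : √2 ≤ k) (hen : e ≤ n) (hea : a ≤ |e - 1|) (hv : x ^ 2 + y ^ 2 + t ^ 2 < e ^ 2) :
    Deep M x y t ∨ Reach P k x y t := by
  have h2 : √2 ^ 2 = 2 := Real.sq_sqrt (by norm_num)
  have h20 : 0 ≤ √2 := Real.sqrt_nonneg _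
  set v := x ^ 2 + y ^ 2 + t ^ 2 with hvd
  have hv0 : 0 < v := by positivity
  have hpq : |x + y| ^ 2 + |x - y| ^ 2 = 2 * (v - t ^ 2) := by rw [sq_abs, sq_abs, hvd]; ring
  rcases lt_or_ge (v + e ^ 2) (2 * e * |x - y|) with h1 | h1
  · exact Or.inl (h.deep_minus he hen hea h1)
  set q := |x - y| with hq
  have hq0 : 0 ≤ q := abs_nonneg _
  have hp0 : 0 ≤ |x + y| := abs_nonneg _
  have hqe : q < e := by
    refine lt_of_mul_lt_mul_left (a := 2 * e) ?_ (by positivity)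
    linarith
  have hqe2 : q ^ 2 < e ^ 2 := by gcongr
  have he2 : 0 < e ^ 2 := by positivity
  -- The same optimisation at distance zero, with `√2 e` in the place of `α`: the throat disc under
  -- which the point lies deepest.
  obtain ⟨β, hβ0, hβ⟩ : ∃ β, 0 < β ∧ β ^ 2 = 2 * e ^ 2 - q ^ 2 :=
    ⟨√(2 * e ^ 2 - q ^ 2), Real.sqrt_pos.2 (by linarith), Real.sq_sqrt (by linarith)⟩
  have hqβ : q ≤ β := abs_le_of_sq_le_sq' (by linarith) hβ0.le |>.2
  obtain ⟨s, hs, hsx⟩ : ∃ s, |s| = e * q / β ∧ s * (y - x) = |s| * q := by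
    rcases abs_cases (x - y) with ⟨h9, _⟩ | ⟨h9, _⟩
    · refine ⟨-(e * q / β), ?_, ?_⟩
      · rw [abs_neg, abs_of_nonneg (by positivity)]
      · rw [abs_neg, abs_of_nonneg (by positivity), hq, h9]; ring
    · refine ⟨e * q / β, ?_, ?_⟩
      · rw [abs_of_nonneg (by positivity)]
      · rw [abs_of_nonneg (by positivity), hq, h9]; ring
  have hs2 : s ^ 2 = (e * q / β) ^ 2 := by rw [← hs, sq_abs]
  have hr2 : (2 * e ^ 2 / β) ^ 2 = 2 * s ^ 2 + 2 * e ^ 2 := by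
    have : q ^ 2 = 2 * e ^ 2 - β ^ 2 := by linarith
    rw [hs2, div_pow, div_pow, mul_pow, mul_pow, this]; field_simp; ring
  have hD := h.throat s _ (by rw [hs, div_le_iff₀ hβ0]; gcongr) (by positivity) hr2
  have hval : (x - -s) ^ 2 + (y - s) ^ 2 + t ^ 2 - (2 * e ^ 2 / β - e) ^ 2 =
      v - 3 * e ^ 2 + 2 * e * β := by
    have h3 : (x - -s) ^ 2 + (y - s) ^ 2 + t ^ 2 - (2 * e ^ 2 / β - e) ^ 2 =
        v - 3 * e ^ 2 + 2 * e * (2 * e ^ 2 - q ^ 2) / β := by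
      have : v - 3 * e ^ 2 + 2 * e * (2 * e ^ 2 - q ^ 2) / β =
        v - 2 * (e * q / β) * q - 3 * e ^ 2 + 2 * (2 * e ^ 2 / β) * e := by field_simp; ring
      rw [this, ← hs, hvd]; linear_combination -2 * hsx - hr2
    rw [h3, ← hβ]; field_simp
  rcases lt_or_ge (v - 3 * e ^ 2 + 2 * e * β) 0 with h4 | h4
  · exact Or.inl (hD.deep (by linarith))
  refine Or.inr (h.reach_plus le_rfl he hea ?_)
  -- Failure of the throat disc gives `3e² - v ≤ 2eβ`. Squared and rewritten by the parallelogram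
  -- law this reads `(v + e²)² ≤ 8e²t² + 4e²|x + y|²`.
  have h5 : (3 * e ^ 2 - v) ^ 2 ≤ (2 * e * β) ^ 2 := by
    gcongr <;> linarith
  have h6 : v + e ^ 2 ≤ 2 * √2 * e * t + 2 * e * |x + y| := by
    refine abs_le_of_sq_le_sq' ?_ (by positivity) |>.2
    have h7 : (2 * e * β) ^ 2 = 4 * e ^ 2 * (2 * e ^ 2 - q ^ 2) := by rw [mul_pow, hβ]; ring
    have h8 : (2 * √2 * e * t + 2 * e * |x + y|) ^ 2 = 8 * e ^ 2 * t ^ 2 + 4 * e ^ 2 * |x + y| ^ 2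
        + 8 * √2 * e ^ 2 * t * |x + y| := by linear_combination 4 * e ^ 2 * t ^ 2 * h2
    have h9 : 0 ≤ 8 * √2 * e ^ 2 * t * |x + y| := by positivity
    have h11 : q ^ 2 = 2 * (v - t ^ 2) - |x + y| ^ 2 := by linarith
    rw [h7, h11] at h5
    rw [h8]; linarith
  have : √2 * (t * e) ≤ k * (t * e) := by gcongr
  linarith

/-- Here `h` is the signed distance of the foot point from an axis with tangent discs of radius
`1/4` on its two sides. Near the axis `h²` and `t²` are negligible, and one of the discs serves both
purposes or both are in reach. -/
theorem nearBoth_of_tangent_discs {c d c' d' h : ℝ} (hP : RoundDisc P c d (1 / 4))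
    (hM : RoundDisc M c' d' (1 / 4)) (hc : (x - c) ^ 2 + (y - d) ^ 2 = (h - 1 / 4) ^ 2)
    (hc' : (x - c') ^ 2 + (y - d') ^ 2 = (h + 1 / 4) ^ 2) (hh : |h| ≤ 1 / 1000) (ht : 0 < t)
    (ht1 : t < 1 / 1000) (hk : 1 ≤ k) : NearBoth P M k x y t := by
  have hkt : t ≤ k * t := by nlinarith
  have ht2 : t ^ 2 ≤ t / 1000 := by nlinarith
  have h0 : h ^ 2 ≤ |h| / 1000 := by
    rw [← sq_abs]; nlinarith [abs_nonneg h]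
  constructor
  · rcases lt_or_ge (h ^ 2 + t ^ 2) (h / 2) with h3 | h3
    · exact Or.inl (hP.deep (by rw [hc]; linarith))
    · refine Or.inr (hM.reach (by norm_num) ?_)
      rw [hc']
      rcases abs_cases h with ⟨h4, _⟩ | ⟨h4, _⟩ <;> rw [h4] at h0 <;> linarith
  · rcases lt_or_ge (h ^ 2 + t ^ 2) (-h / 2) with h3 | h3
    · exact Or.inl (hM.deep (by rw [hc']; linarith))
    · refine Or.inr (hP.reach (by norm_num) ?_)
      rw [hc]
      rcases abs_cases h with ⟨h4, _⟩ | ⟨h4, _⟩ <;> rw [h4] at h0 <;> linarith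

/-- The key inequality of `CrossDiscs.nearBoth_mid` when the bound `p ≤ s` is relaxed to `p ≤ s +
2a²`; the price is the term `6a`. -/
theorem sub_le_of_sq_add_sq {a p q s t u v : ℝ} (ha0 : 0 ≤ a) (ha1 : a ≤ 1 / 6000) (ht : 0 ≤ t)
    (hq : 0 ≤ q) (hp : 0 ≤ p) (hs : s ≤ 1 + a) (hs2 : s ^ 2 = v + t ^ 2) (hu : u = s + 2 * a ^ 2)
    (hpq : p ^ 2 + q ^ 2 = 2 * v) (hpu : p ≤ u) : u - q ≤ √2 * t + 6 * a := by
  have h2 : √2 ^ 2 = 2 := Real.sq_sqrt (by norm_num)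
  have ha2 : a ^ 2 ≤ a / 6000 := by nlinarith
  have : u ≤ (√2 * t + 6 * a) + q := by
    refine abs_le_of_sq_le_sq' (b := (√2 * t + 6 * a) + q) ?_ (by positivity) |>.2
    have h3 : 0 ≤ √2 * t * q := by positivity
    have h4 : 0 ≤ a * q := by positivity
    have h5 : 0 ≤ √2 * t * a := by positivity
    have h6 : (√2 * t) ^ 2 = 2 * t ^ 2 := by rw [mul_pow, h2]
    have h7 : p ^ 2 ≤ u ^ 2 := by gcongr
    have h8 : s ^ 2 = u ^ 2 - 4 * a ^ 2 * u + 4 * a ^ 4 := by rw [hu]; ring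
    have h9 : a ^ 2 * u ≤ a ^ 2 * 2 := by gcongr; rw [hu]; linarith
    have h10 : 0 ≤ a ^ 4 := by positivity
    have h11 : (√2 * t + 6 * a + q) ^ 2 = (√2 * t) ^ 2 + 36 * a ^ 2 + q ^ 2 + 12 * (√2 * t * a)
      + 12 * (a * q) + 2 * (√2 * t * q) := by ring
    rw [h11, h6]
    have h12 : 0 ≤ a ^ 2 := by positivity
    linarith
  linarith

/-- A point close to the unit circle and to the coordinate axes, away from `-1`. -/
theorem CrossDiscs.nearBoth_of_small (h : CrossDiscs a e n P M) (ht : 0 < t)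
    (hk : 1 ≤ k) (ht1 : t < 1 / 1000) (ht2 : t ^ 2 ≤ 1 / 1000000)
    (hxy : (x * y) ^ 2 ≤ 1 / 1000000000000) (hsq1 : x ^ 2 + y ^ 2 ≤ 1001 / 1000)
    (hsq2 : 999 / 1000 ≤ x ^ 2 + y ^ 2)
    (hX : (x - 1) ^ 2 + y ^ 2 + t ^ 2 < 100 ^ 2 * ((x + 1) ^ 2 + y ^ 2 + t ^ 2)) :
    NearBoth P M k x y t := by
  have aux : ∀ {x y : ℝ}, y ^ 2 ≤ x ^ 2 → (x * y) ^ 2 ≤ 1 / 1000000000000 →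
      x ^ 2 + y ^ 2 ≤ 1001 / 1000 → 999 / 1000 ≤ x ^ 2 + y ^ 2 →
      y ^ 2 ≤ 1 / 100000000000 ∧ |y| ≤ 1 / 1000 ∧ (0 ≤ x → |x - 1| ≤ 1 / 500) := by
    intro x y hyx hxy hsq1 hsq2
    have hy2 : y ^ 2 ≤ 1 / 100000000000 := by
      rw [mul_pow] at hxy; nlinarith [sq_nonneg y]
    refine ⟨hy2, abs_le_of_sq_le_sq (by linarith) (by norm_num), fun hx => ?_⟩
    have hx2 : 998 / 1000 ≤ x ^ 2 := by linarith
    have hx2' : x ^ 2 ≤ 1001 / 1000 := by nlinarith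
    rw [abs_le]; constructor <;> nlinarith
  rcases le_total (y ^ 2) (x ^ 2) with hyx | hyx
  · obtain ⟨hy2, hy, h1⟩ := aux hyx hxy hsq1 hsq2
    rcases le_total 0 x with hx | hx
    · obtain ⟨hP, hM⟩ := h.east x ((h1 hx).trans (by norm_num))
      exact nearBoth_of_tangent_discs (h := y) hP hM (by ring) (by ring) hy ht ht1 hk
    -- The excluded point `-1`, where no tangent discs are available.
    · exfalso
      have h2 := (aux (x := -x) (y := y) (by rwa [neg_sq]) (by rwa [neg_mul, neg_sq])
        (by rwa [neg_sq]) (by rwa [neg_sq])).2.2 (by linarith)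
      have h3 : |x + 1| ≤ 1 / 500 := by rw [← abs_neg]; convert h2 using 2; ring
      have h4 : (x + 1) ^ 2 ≤ (1 / 500) ^ 2 := by rw [← sq_abs]; gcongr
      have h5 := (abs_le.1 h3).2
      nlinarith
  · obtain ⟨hx2, hx, h1⟩ := aux hyx (by rwa [mul_comm]) (by linarith) (by linarith)
    rcases le_total 0 y with hy | hy
    · obtain ⟨hP, hM⟩ := h.north y ((h1 hy).trans (by norm_num))
      exact nearBoth_of_tangent_discs (h := x) hP hM (by ring) (by ring) hx ht ht1 hk
    · have h2 := (aux (x := -y) (y := x) (by rwa [neg_sq]) (by rwa [neg_mul, neg_sq, mul_comm])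
        (by rw [neg_sq]; linarith) (by rw [neg_sq]; linarith)).2.2 (by linarith)
      obtain ⟨hP, hM⟩ := h.south (-y) (h2.trans (by norm_num))
      rw [neg_neg] at hP hM
      exact nearBoth_of_tangent_discs (h := -x) hP hM (by ring) (by ring)
        (by rwa [abs_neg]) ht ht1 hk

/-- Near the unit sphere, away from `-1`. -/
theorem CrossDiscs.nearBoth_unit (h : CrossDiscs a e n P M) (he : e ≤ 1 / 2)
    (hn : 2 ≤ n) (ht : 0 < t) (hk : √2 < k) (hk1 : k ≤ √2 + 1) (ha : a = (k - √2) / 6000)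
    (hs : 0 < s) (hs2 : s ^ 2 = x ^ 2 + y ^ 2 + t ^ 2) (hsa : |s - 1| < a)
    (hX : (x - 1) ^ 2 + y ^ 2 + t ^ 2 < 100 ^ 2 * ((x + 1) ^ 2 + y ^ 2 + t ^ 2)) :
    NearBoth P M k x y t := by
  have h2 : √2 ^ 2 = 2 := Real.sq_sqrt (by norm_num)
  have h20 : 0 ≤ √2 := Real.sqrt_nonneg _
  have h21 : 1 < √2 := by nlinarith
  have ha0 : 0 < a := by rw [ha]; linarith
  have ha1 : a ≤ 1 / 6000 := by rw [ha]; linarith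
  have hka : k = √2 + 6000 * a := by rw [ha]; ring
  obtain ⟨hs3, hs4⟩ := abs_lt.1 hsa
  have hpq : |x + y| ^ 2 + |x - y| ^ 2 = 2 * (x ^ 2 + y ^ 2) := by rw [sq_abs, sq_abs]; ring
  have ea : a ≤ |(1 + a) - 1| := by rw [add_sub_cancel_left]; exact le_abs_self _
  -- Radii within `a` of `1` are forbidden, so the discs of radius `1 + a` replace those of radius
  -- `s`. As `(s - 1 - a)² ≤ 4a²`, their height polynomials are at most `2(1 + a)(u - |x ± y|)`.
  set u := s + 2 * a ^ 2 with hu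
  have hval : x ^ 2 + y ^ 2 + t ^ 2 + (1 + a) ^ 2 ≤ 2 * (1 + a) * u := by
    have h3 : (s - (1 + a)) ^ 2 ≤ (2 * a) ^ 2 := by
      rw [← sq_abs (s - _)]
      have : |s - (1 + a)| ≤ 2 * a := by rw [abs_le]; constructor <;> linarith
      gcongr
    have h4 : 0 ≤ a ^ 3 := by positivity
    rw [← hs2, hu]; linarith
  have ha2 : a ^ 2 ≤ a / 6000 := by nlinarith
  have key : ∀ p q : ℝ, 0 ≤ p → 0 ≤ q → p ^ 2 + q ^ 2 = 2 * (x ^ 2 + y ^ 2) → p ≤ u →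
      u - q ≤ √2 * t + 6 * a := fun p q hp hq hpq hpu =>
    sub_le_of_sq_add_sq ha0.le ha1 ht.le hq hp (by linarith) hs2 hu hpq hpu
  have hcmp : ∀ p, u < p → x ^ 2 + y ^ 2 + t ^ 2 + (1 + a) ^ 2 < 2 * (1 + a) * p := fun p hp =>
    hval.trans_lt (by gcongr)
  have hkt0 : 0 ≤ 2 * k * t * (1 + a) := by
    have : 0 < k := by linarith
    positivity
  rcases lt_or_ge u |x + y| with hp | hp
  · refine ⟨Or.inl (h.deep_plus (s := 1 + a) (by linarith) ea ?_),
      Or.inr (h.reach_plus (s := 1 + a) (by linarith) (by linarith) ea ?_)⟩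
    · exact hcmp _ hp
    · linarith [hcmp _ hp]
  rcases lt_or_ge u |x - y| with hq | hq
  · refine ⟨Or.inr (h.reach_minus (s := 1 + a) (by linarith) (by linarith) ea ?_),
      Or.inl (h.deep_minus (s := 1 + a) (by linarith) (by linarith) ea ?_)⟩
    · linarith [hcmp _ hq]
    · exact hcmp _ hq
  -- As `k = √2 + 6000 a`, the error `6a` is absorbed by `(k - √2) t` when `t ≥ 1/1000`. Lower
  -- points are treated by small discs tangent to the axes.
  rcases le_or_gt (1 / 1000) t with ht1 | ht1
  · have hkt : √2 * t + 6 * a ≤ k * t := by rw [hka]; nlinarith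
    have hfin : ∀ q, u - q ≤ √2 * t + 6 * a →
        x ^ 2 + y ^ 2 + t ^ 2 + (1 + a) ^ 2 - 2 * (1 + a) * q ≤ 2 * k * t * (1 + a) := fun q hq => by
      have : 2 * (1 + a) * (u - q) ≤ 2 * (1 + a) * (k * t) := by
        gcongr; exact hq.trans hkt
      linarith
    refine ⟨Or.inr (h.reach_minus (s := 1 + a) (by linarith) (by linarith) ea ?_),
      Or.inr (h.reach_plus (s := 1 + a) (by linarith) (by linarith) ea ?_)⟩
    · exact hfin _ (key _ _ (abs_nonneg _) (abs_nonneg _) hpq hp)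
    · exact hfin _ (key _ _ (abs_nonneg _) (abs_nonneg _) (by rw [add_comm]; exact hpq) hq)
  -- If both `(x + y)²` and `(x - y)²` are at most `u²`, which nearly equals `x² + y²`, then `x y`
  -- is tiny and the point is close to one of the axes.
  have hp2 : (x + y) ^ 2 ≤ u ^ 2 := by rw [← sq_abs]; gcongr
  have hq2 : (x - y) ^ 2 ≤ u ^ 2 := by rw [← sq_abs]; gcongr
  have ha4 : a ^ 2 ≤ 1 / 36000000 := by linarith
  have ha5 := sq_nonneg a
  have hs5 : s ^ 2 ≤ (1 + a) ^ 2 := by gcongr; linarith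
  have hs6 : (1 - a) ^ 2 ≤ s ^ 2 := by gcongr <;> linarith
  have hu2 : u ^ 2 ≤ s ^ 2 + 1 / 1000000 := by
    have h3 : u ^ 2 = s ^ 2 + 4 * (a ^ 2 * s) + 4 * (a ^ 2 * a ^ 2) := by rw [hu]; ring
    have h4 : a ^ 2 * s ≤ 1 / 36000000 * 2 := by gcongr; linarith
    have h5 : a ^ 2 * a ^ 2 ≤ 1 / 36000000 * 1 := by gcongr; linarith
    linarith
  have ht2 : t ^ 2 ≤ 1 / 1000000 := by
    have : t ^ 2 ≤ (1 / 1000) ^ 2 := by gcongr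
    linarith
  have hxy3 : (x * y) ^ 2 ≤ (1 / 1000000) ^ 2 := by
    rw [← sq_abs]
    have : |x * y| ≤ 1 / 1000000 := by rw [abs_le]; constructor <;> linarith
    gcongr
  exact h.nearBoth_of_small ht (by linarith) ht1 ht2 (by linarith) (by linarith) (by linarith) hX

end

/-! ### Discs of the smoothed cross that avoid `-1`, and the uniform estimate. -/

section
variable {a e n k x y t s c L : ℝ} {P M Ω Ω' : Set (OnePoint ℂ)}

theorem Deep.mono (h : Deep Ω x y t) (hΩ : Ω ⊆ Ω') : Deep Ω' x y t := by
  obtain ⟨Q, hQ, h⟩ := h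
  exact ⟨Q, hQ.trans hΩ, h⟩

theorem Reach.mono_set (h : Reach Ω k x y t) (hΩ : Ω ⊆ Ω') : Reach Ω' k x y t := by
  obtain ⟨Q, hQ, h⟩ := h
  exact ⟨Q, hQ.trans hΩ, h⟩

theorem NearBoth.mono_set {P' M' : Set (OnePoint ℂ)} (h : NearBoth P M k x y t) (hP : P ⊆ P')
    (hM : M ⊆ M') : NearBoth P' M' k x y t :=
  ⟨h.1.imp (fun h => h.mono hP) fun h => h.mono_set hM,
    h.2.imp (fun h => h.mono hM) fun h => h.mono_set hP⟩

theorem throat_away {z : ℂ} {r : ℝ} (he : 0 < e) (he2 : e ≤ 1 / 2) (hs : |s| ≤ e) (hr : 0 ≤ r)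
    (hr2 : r ^ 2 = 2 * s ^ 2 + 2 * e ^ 2)
    (hz : (z.re - -s) ^ 2 + (z.im - s) ^ 2 < (r - e) ^ 2) :
    1 / 36 ≤ (z.re + 1) ^ 2 + z.im ^ 2 := by
  by_contra! h
  have hs2 : s ^ 2 ≤ e ^ 2 := by rw [← sq_abs]; gcongr
  have hr3 : r ≤ 2 * e := abs_le_of_sq_le_sq' (by linarith) (by positivity) |>.2
  have hr4 : e ≤ r := abs_le_of_sq_le_sq' (by nlinarith [sq_nonneg s]) hr |>.2
  have h1 : (r - e) ^ 2 ≤ (1 / 2) ^ 2 := by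
    gcongr <;> linarith
  have h2 : (z.re + 1) + z.im ≤ 1 / 4 :=
    abs_le_of_sq_le_sq' (by linarith [sq_nonneg (z.re + 1 - z.im)]) (by norm_num) |>.2
  have h3 : (3 / 4) ^ 2 ≤ (-z.re - z.im) ^ 2 := by
    gcongr; linarith
  linarith [sq_nonneg (z.re - -s - (z.im - s))]

theorem quarter_disc {p q : ℝ} (hc : |c - 1| ≤ 1 / 100)
    (h : (p - c) ^ 2 + (q - 1 / 4) ^ 2 < (1 / 4) ^ 2) :
    1 / 2 < p ∧ 0 < q ∧ q < 1 / 2 ∧ 1 / 4 < p ^ 2 + q ^ 2 ∧ p ^ 2 + q ^ 2 < 4 := by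
  obtain ⟨hc1, hc2⟩ := abs_le.1 hc
  obtain ⟨h1, h2⟩ := abs_lt_of_sq_lt_sq' (a := p - c) (b := 1 / 4)
    (by linarith [sq_nonneg (q - 1 / 4)]) (by norm_num)
  obtain ⟨h3, h4⟩ := abs_lt_of_sq_lt_sq' (a := q - 1 / 4) (b := 1 / 4)
    (by linarith [sq_nonneg (p - c)]) (by norm_num)
  refine ⟨by linarith, by linarith, by linarith, by nlinarith, by nlinarith⟩

/-- Supplies all the discs from the actual sides. The parameter `L` depends on `a` alone and not on
the radii `e` and `n`, which makes the later bound uniform in the neck. -/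
theorem crossDiscs (he : 0 < e) (he2 : e ≤ 1 / 2) (hn : 2 ≤ n) (ha : 0 < a) (ha1 : a ≤ 1)
    (hL : 1 ≤ L) (hLa : 6 < (L ^ 2 - 3) * (a ^ 4 / 36)) :
    CrossDiscs a e n (crossPlus e n ∩ awayFromNegOne L) (crossMinus e n ∩ awayFromNegOne L) := by
  have hen : e ≤ n := by linarith
  have ha4 : a ^ 4 / 36 ≤ 1 / 36 := by
    have : a ^ 4 ≤ 1 := pow_le_one₀ ha.le ha1
    linarith
  have away : ∀ z : ℂ, 1 / 36 ≤ (z.re + 1) ^ 2 + z.im ^ 2 → (z : OnePoint ℂ) ∈ awayFromNegOne L :=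
    fun z hz => mem_awayFromNegOne_of_le (ha4.trans hz) (by positivity) hLa
  have ann : ∀ z : ℂ, 1 / 4 < z.re ^ 2 + z.im ^ 2 → z.re ^ 2 + z.im ^ 2 < 4 →
      (0 < z.re * z.im → z ∈ farSide e n) ∧ (z.re * z.im < 0 → z ∈ zeroSide e n) := fun z h1 h2 => by
    have := mem_sides_of_annulus (z := z) he hen (by nlinarith) (by nlinarith)
    exact ⟨this.2.1.2, this.1.2⟩
  refine ⟨fun s hs hsa => ⟨fun z hz => ⟨?_, ?_⟩, fun z hz => ⟨?_, ?_⟩⟩,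
    fun s hs hsn hsa => ⟨fun z hz => ⟨?_, ?_⟩, fun z hz => ⟨?_, ?_⟩⟩,
    fun s r hs hr hr2 z hz => ⟨?_, ?_⟩,
    fun c hc => ⟨fun z hz => ?_, fun z hz => ?_⟩, fun c hc => ⟨fun z hz => ?_, fun z hz => ?_⟩,
    fun c hc => ⟨fun z hz => ?_, fun z hz => ?_⟩⟩
  · rw [coe_mem_crossPlus]; exact mem_farSide_of_disc he hen hs hz
  · exact mem_awayFromNegOne_of_re_pos (by nlinarith [sq_nonneg (z.im - s)]) hL
  · rw [coe_mem_crossPlus, ← neg_mem_farSide]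
    refine mem_farSide_of_disc he hen hs ?_
    rw [Complex.neg_re, Complex.neg_im]; linarith
  · refine mem_awayFromNegOne_of_le (disc_away_of_abs_sub_one (σ := -s) ha ha1 (by linarith) hsa
      (by rw [abs_neg, abs_of_pos (by linarith)]) (by linarith)) (by positivity) hLa
  · rw [coe_mem_crossMinus]
    exact mem_zeroSide_of_disc hen hs hsn (by linarith)
  · exact mem_awayFromNegOne_of_re_pos (by nlinarith [sq_nonneg (z.im - -s)]) hL
  · rw [coe_mem_crossMinus, ← neg_mem_zeroSide]
    refine mem_zeroSide_of_disc hen hs hsn ?_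
    rw [Complex.neg_re, Complex.neg_im]; linarith
  · refine mem_awayFromNegOne_of_le (disc_away_of_abs_sub_one (σ := s) ha ha1 (by linarith) hsa
      (by rw [abs_of_pos (by linarith)]) (by linarith)) (by positivity) hLa
  · rw [coe_mem_crossMinus]
    exact mem_zeroSide_of_throat he (by linarith) hs hr hr2 (by linarith)
  · exact away _ (throat_away he he2 hs hr hr2 hz)
  · obtain ⟨h1, h2, h3, h4, h5⟩ := quarter_disc hc hz
    exact ⟨coe_mem_crossPlus.2 ((ann z h4 h5).1 (mul_pos (by linarith) h2)),
      mem_awayFromNegOne_of_re_pos (by linarith) hL⟩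
  · obtain ⟨h1, h2, h3, h4, h5⟩ := quarter_disc (p := z.re) (q := -z.im) hc (by linarith)
    rw [neg_sq] at h4 h5
    exact ⟨coe_mem_crossMinus.2 ((ann z h4 h5).2 (mul_neg_of_pos_of_neg (by linarith)
      (by linarith))), mem_awayFromNegOne_of_re_pos (by linarith) hL⟩
  · obtain ⟨h1, h2, h3, h4, h5⟩ := quarter_disc (p := z.im) (q := z.re) hc (by linarith)
    exact ⟨coe_mem_crossPlus.2 ((ann z (by linarith) (by linarith)).1 (mul_pos h2 (by linarith))),
      mem_awayFromNegOne_of_re_pos (by linarith) hL⟩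
  · obtain ⟨h1, h2, h3, h4, h5⟩ := quarter_disc (p := z.im) (q := -z.re) hc (by linarith)
    rw [neg_sq] at h4 h5
    exact ⟨coe_mem_crossMinus.2 ((ann z (by linarith) (by linarith)).2
      (mul_neg_of_neg_of_pos (by linarith) (by linarith))), away _ (by nlinarith)⟩
  · obtain ⟨h1, h2, h3, h4, h5⟩ := quarter_disc (p := -z.im) (q := -z.re) hc (by linarith)
    rw [neg_sq, neg_sq] at h4 h5
    exact ⟨coe_mem_crossPlus.2 ((ann z (by linarith) (by linarith)).1
      (mul_pos_of_neg_of_neg (by linarith) (by linarith))), away _ (by nlinarith)⟩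
  · obtain ⟨h1, h2, h3, h4, h5⟩ := quarter_disc (p := -z.im) (q := z.re) hc (by linarith)
    rw [neg_sq] at h4 h5
    exact ⟨coe_mem_crossMinus.2 ((ann z (by linarith) (by linarith)).2
      (mul_neg_of_pos_of_neg (by linarith) (by linarith))),
      mem_awayFromNegOne_of_re_pos (by linarith) hL⟩

theorem inv_mem_crossMinus (he : 0 < e) (hen : e ≤ n) (h1 : e * n = 1) :
    ∀ q ∈ crossPlus e n ∩ awayFromNegOne L, sphereInv q ∈ crossMinus e n ∩ awayFromNegOne L := by
  rintro q ⟨hq, hq'⟩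
  refine ⟨?_, sphereInv_mem_awayFromNegOne hq'⟩
  induction q using OnePoint.rec with
  | infty =>
    rw [sphereInv_infty, coe_mem_crossMinus]
    exact zero_mem_zeroSide he
  | coe z =>
    rw [coe_mem_crossPlus] at hq
    have hz : z ≠ 0 := by
      rintro rfl
      rcases mem_cross_trichotomy he hen 0 with h | h | h
      · exact h.2.1 hq
      · exact h.1 (zero_mem_zeroSide he)
      · exact h.2.1 hq
    rw [sphereInv_coe hz, coe_mem_crossMinus]
    exact inv_mem_zeroSide he hen h1 hq

theorem inv_mem_crossPlus (he : 0 < e) (hen : e ≤ n) (h1 : e * n = 1) :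
    ∀ q ∈ crossMinus e n ∩ awayFromNegOne L, sphereInv q ∈ crossPlus e n ∩ awayFromNegOne L := by
  rintro q ⟨hq, hq'⟩
  refine ⟨?_, sphereInv_mem_awayFromNegOne hq'⟩
  induction q using OnePoint.rec with
  | infty => exact (infty_notMem_crossMinus hq).elim
  | coe z =>
    rw [coe_mem_crossMinus] at hq
    by_cases hz : z = 0
    · rw [hz, sphereInv_zero]; exact infty_mem_crossPlus
    · rw [sphereInv_coe hz, coe_mem_crossPlus]
      exact inv_mem_farSide he hen h1 hq hz

/-- The bound `√2` holds everywhere along a smoothed cross, except near `-1`, using only caps that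
avoid a small neighbourhood of `-1`. -/
theorem exists_nearBoth_cross (hk : √2 < k) : ∃ L₀, 1 ≤ L₀ ∧ ∀ L, L₀ ≤ L → ∀ e n x y t : ℝ, 0 < e →
    e ≤ 1 / 2 → e * n = 1 → 0 < t →
    (x - 1) ^ 2 + y ^ 2 + t ^ 2 < 100 ^ 2 * ((x + 1) ^ 2 + y ^ 2 + t ^ 2) →
    NearBoth (crossPlus e n ∩ awayFromNegOne L) (crossMinus e n ∩ awayFromNegOne L) k x y t := by
  wlog hk1 : k ≤ √2 + 1 generalizing k
  · obtain ⟨L₀, h1, h⟩ := this (k := √2 + 1) (by linarith) le_rfl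
    exact ⟨L₀, h1, fun L hL e n x y t he he2 hen ht hX =>
      (h L hL e n x y t he he2 hen ht hX).mono (by linarith) ht⟩
  -- The excess of `k` over `√2` pays for the gap of forbidden radii around `1`.
  obtain ⟨a, ha⟩ : ∃ a, a = (k - √2) / 6000 := ⟨_, rfl⟩
  have ha0 : 0 < a := by rw [ha]; linarith
  have ha1 : a ≤ 1 / 6000 := by rw [ha]; linarith
  have hL1 : 1 ≤ 20 / a ^ 2 := by
    rw [le_div_iff₀ (by positivity)]; nlinarith
  -- With this bound `L² a⁴ ≥ 400`, so `(L² - 3) a⁴ / 36` exceeds `6`.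
  refine ⟨20 / a ^ 2, hL1, fun L hL e n x y t he he2 hen ht hX => ?_⟩
  have hn : 2 ≤ n := by
    by_contra! h; nlinarith
  have hLa : 6 < (L ^ 2 - 3) * (a ^ 4 / 36) := by
    have h1 : (20 / a ^ 2) ^ 2 ≤ L ^ 2 := by gcongr
    have h2 : (20 / a ^ 2) ^ 2 * a ^ 4 = 400 := by field_simp; norm_num
    have h3 : (20 / a ^ 2) ^ 2 * a ^ 4 ≤ L ^ 2 * a ^ 4 := by gcongr
    have h4 : a ^ 4 ≤ 1 := pow_le_one₀ ha0.le (by linarith)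
    linarith
  have hD := crossDiscs (e := e) (n := n) he he2 hn ha0 (by linarith) (hL1.trans hL) hLa
  have hea : a ≤ |e - 1| := by rw [abs_of_nonpos (by linarith)]; linarith
  obtain ⟨s, hs0, hs⟩ : ∃ s, 0 < s ∧ s ^ 2 = x ^ 2 + y ^ 2 + t ^ 2 :=
    ⟨√(x ^ 2 + y ^ 2 + t ^ 2), by positivity, Real.sq_sqrt (by positivity)⟩
  rcases lt_or_ge s e with h1 | h1
  · have h2 : x ^ 2 + y ^ 2 + t ^ 2 < e ^ 2 := by rw [← hs]; gcongr
    exact ⟨hD.throat_plus he ht hk.le (by linarith) hea h2,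
      hD.throat_minus he ht hk.le (by linarith) hea h2⟩
  -- Points outside radius `n` are inverted into the throat. Since inversion exchanges the sides,
  -- the two throat lemmas change places.
  rcases lt_or_ge n s with h3 | h3
  · have hv : 0 < x ^ 2 + y ^ 2 + t ^ 2 := by positivity
    have ht' : 0 < t / (x ^ 2 + y ^ 2 + t ^ 2) := by positivity
    have h4 : (x ^ 2 + y ^ 2 + t ^ 2)⁻¹ < e ^ 2 := by
      have : e = n⁻¹ := eq_inv_of_mul_eq_one_left hen
      rw [this, inv_pow, ← hs]
      gcongr
    rw [← inv_coords ht] at h4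
    have hP := inv_mem_crossPlus (L := L) he (by linarith) hen
    have hM := inv_mem_crossMinus (L := L) he (by linarith) hen
    exact ⟨(hD.throat_minus he ht' hk.le (by linarith) hea h4).imp
        (fun h => h.of_inv ht hP) fun h => h.of_inv ht hM,
      (hD.throat_plus he ht' hk.le (by linarith) hea h4).imp
        (fun h => h.of_inv ht hM) fun h => h.of_inv ht hP⟩
  rcases lt_or_ge |s - 1| a with h4 | h4
  · exact hD.nearBoth_unit he2 hn ht hk hk1 ha hs0 hs h4 hX
  · exact hD.nearBoth_mid ht hk.le hs0 hs h1 h3 h4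
end

/-! ### Transport along Möbius transformations -/

/-- Caps pull back under `g`, and the induced isometry of the half-space model maps the point
`(x, y, t)` to `(x', y', t')`. -/
def Transport (g : OnePoint ℂ → OnePoint ℂ) (x y t x' y' t' : ℝ) : Prop :=
  ∀ Q : CapForm, ∃ (Q' : CapForm) (m l : ℝ), 0 < m ∧ 0 < l ∧ (∀ q, q ∈ Q'.cap ↔ g q ∈ Q.cap) ∧
    Q'.disc = m ^ 2 * Q.disc ∧ m * t = l * t' ∧
    Q'.poly x y (x ^ 2 + y ^ 2 + t ^ 2) = l * Q.poly x' y' (x' ^ 2 + y' ^ 2 + t' ^ 2)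

section
variable {g g' : OnePoint ℂ → OnePoint ℂ} {x y t x' y' t' x'' y'' t'' k : ℝ}
  {P M P' M' Ω Ω' : Set (OnePoint ℂ)}

theorem Transport.comp (h : Transport g x y t x' y' t') (h' : Transport g' x' y' t' x'' y'' t'') :
    Transport (g' ∘ g) x y t x'' y'' t'' := by
  intro Q
  obtain ⟨Q', m', l', hm', hl', hc', hd', ht', hp'⟩ := h' Q
  obtain ⟨Q₂, m, l, hm, hl, hc, hd, ht, hp⟩ := h Q'
  refine ⟨Q₂, m * m', l * l', by positivity, by positivity, fun q => (hc q).trans (hc' _), ?_, ?_, ?_⟩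
  · rw [hd, hd']; ring
  · linear_combination m' * ht + l * ht'
  · rw [hp, hp']; ring

theorem Deep.of_transport (h : Transport g x y t x' y' t') (hΩ : ∀ q, g q ∈ Ω → q ∈ Ω')
    (hD : Deep Ω x' y' t') : Deep Ω' x y t := by
  obtain ⟨Q, hQ, hv⟩ := hD
  obtain ⟨Q', m, l, hm, hl, hc, hd, ht, hp⟩ := h Q
  exact ⟨Q', fun q hq => hΩ q (hQ ((hc q).1 hq)), hp ▸ mul_neg_of_pos_of_neg hl hv⟩

/-- The relations between `m`, `l` and the heights say precisely that the pullback preserves the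
sinh-distance to the plane. -/
theorem Reach.of_transport (h : Transport g x y t x' y' t') (hΩ : ∀ q, g q ∈ Ω → q ∈ Ω')
    (hR : Reach Ω k x' y' t') : Reach Ω' k x y t := by
  obtain ⟨Q, hQ, hd0, hv⟩ := hR
  obtain ⟨Q', m, l, hm, hl, hc, hd, ht, hp⟩ := h Q
  refine ⟨Q', fun q hq => hΩ q (hQ ((hc q).1 hq)), by rw [hd]; positivity, ?_⟩
  rw [hp, hd, Real.sqrt_mul (sq_nonneg m), Real.sqrt_sq hm.le]
  calc _ ≤ l * (2 * k * t' * √Q.disc) := by gcongr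
    _ = _ := by linear_combination (-2 * k * √Q.disc) * ht

theorem NearBoth.of_transport (h : Transport g x y t x' y' t') (hP : ∀ q, g q ∈ P → q ∈ P')
    (hM : ∀ q, g q ∈ M → q ∈ M') (hN : NearBoth P M k x' y' t') : NearBoth P' M' k x y t :=
  ⟨hN.1.imp (fun hD => hD.of_transport h hP) fun hR => hR.of_transport h hM,
    hN.2.imp (fun hD => hD.of_transport h hM) fun hR => hR.of_transport h hP⟩

/-- The map `z ↦ a z + b` of the Riemann sphere. -/
noncomputable def sphereAffine (a b : ℝ) : OnePoint ℂ → OnePoint ℂ :=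
  OnePoint.map fun z : ℂ => (a : ℂ) * z + (b : ℂ)

theorem sphereAffine_coe (a b : ℝ) (z : ℂ) :
    sphereAffine a b z = ((((a : ℂ) * z + (b : ℂ) : ℂ)) : OnePoint ℂ) := rfl

theorem sphereAffine_infty (a b : ℝ) : sphereAffine a b OnePoint.infty = OnePoint.infty := rfl

theorem transport_sphereAffine {a : ℝ} (ha : a ≠ 0) (b : ℝ) :
    Transport (sphereAffine a b) x y t (a * x + b) (a * y) (|a| * t) := by
  intro Q
  have h2 : |a| ^ 2 = a ^ 2 := sq_abs a
  refine ⟨⟨Q.A * a ^ 2, a * (Q.c - Q.A * b), a * Q.d, Q.A * b ^ 2 - 2 * (Q.c * b) + Q.B⟩, |a|, 1,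
    abs_pos.2 ha, one_pos, fun q => ?_, ?_, by ring, ?_⟩
  · induction q using OnePoint.rec with
    | infty =>
      rw [sphereAffine_infty, CapForm.infty_mem_cap, CapForm.infty_mem_cap]
      exact ⟨fun h => by simp only at h; nlinarith [sq_nonneg a],
        fun h => mul_neg_of_neg_of_pos h (by positivity)⟩
    | coe z =>
      rw [sphereAffine_coe, CapForm.coe_mem_cap, CapForm.coe_mem_cap]
      have h : ∀ r s : ℝ, r = s → (r < 0 ↔ s < 0) := by rintro r s rfl; rfl
      refine h _ _ ?_
      simp only [CapForm.poly, Complex.add_re, Complex.add_im, Complex.mul_re, Complex.mul_im,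
        Complex.ofReal_re, Complex.ofReal_im]
      ring
  · rw [h2]; simp only [CapForm.disc]; ring
  · simp only [CapForm.poly]; linear_combination -Q.A * t ^ 2 * h2

end

/-! ### The width of the smoothed cross -/

section
variable {e n x y t k : ℝ}

theorem sphereAffine_neg_one_coe (z : ℂ) : sphereAffine (-1) 0 z = ((-z : ℂ) : OnePoint ℂ) := by
  rw [sphereAffine_coe]; simp

theorem neg_mem_crossPlus (q : OnePoint ℂ) :
    sphereAffine (-1) 0 q ∈ crossPlus e n ↔ q ∈ crossPlus e n := by
  induction q using OnePoint.rec with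
  | infty => rw [sphereAffine_infty]
  | coe z => rw [sphereAffine_neg_one_coe, coe_mem_crossPlus, coe_mem_crossPlus, neg_mem_farSide]

theorem neg_mem_crossMinus (q : OnePoint ℂ) :
    sphereAffine (-1) 0 q ∈ crossMinus e n ↔ q ∈ crossMinus e n := by
  induction q using OnePoint.rec with
  | infty => rw [sphereAffine_infty]
  | coe z => rw [sphereAffine_neg_one_coe, coe_mem_crossMinus, coe_mem_crossMinus, neg_mem_zeroSide]

/-- The region near `-1` omitted so far is reached by the symmetry `z ↦ -z`, as every point with `x
≥ 0` satisfies the condition. -/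
theorem nearBoth_cross (he : 0 < e) (he2 : e ≤ 1 / 2) (hen : e * n = 1) (ht : 0 < t) (hk : √2 < k) :
    NearBoth (crossPlus e n) (crossMinus e n) k x y t := by
  obtain ⟨L, -, h⟩ := exists_nearBoth_cross hk
  have key : ∀ x y : ℝ, 0 ≤ x → NearBoth (crossPlus e n) (crossMinus e n) k x y t := fun x y hx =>
    (h L le_rfl e n x y t he he2 hen ht (by nlinarith [sq_nonneg y])).mono_set
      Set.inter_subset_left Set.inter_subset_left
  rcases le_total 0 x with hx | hx
  · exact key x y hx
  · refine NearBoth.of_transport (transport_sphereAffine (a := -1) (by norm_num) 0)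
      (fun q => (neg_mem_crossPlus q).1) (fun q => (neg_mem_crossMinus q).1) ?_
    have := key (-1 * x + 0) (-1 * y) (by linarith)
    rwa [abs_neg, abs_one, one_mul]

theorem boundaryWidth_cross_le (he : 0 < e) (he2 : e ≤ 1 / 2) (hen : e * n = 1) :
    boundaryWidth (((↑) : ℂ → OnePoint ℂ) '' crossSet e n) ≤ ENNReal.ofReal (Real.arsinh √2) := by
  have hn : e ≤ n := by by_contra! h; nlinarith
  have hc : Tendsto (fun k => ENNReal.ofReal (Real.arsinh k)) (𝓝[>] √2)
      (𝓝 (ENNReal.ofReal (Real.arsinh √2))) :=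
    ((ENNReal.continuous_ofReal.comp Real.continuous_arsinh).tendsto _).mono_left
      nhdsWithin_le_nhds
  -- The estimate holds for all `k > √2`; continuity of `arsinh` gives the endpoint.
  refine ge_of_tendsto hc ?_
  filter_upwards [self_mem_nhdsWithin] with k hk
  have hk : √2 < k := hk
  exact (isSides_cross he hn hen).boundaryWidth_le ((Real.sqrt_nonneg _).trans hk.le)
    (fun x y t ht => (nearBoth_cross he he2 hen ht hk).1)
    (fun x y t ht => (nearBoth_cross he he2 hen ht hk).2)

/-- A round disc in the side of zero is at distance at least `arsinh √2` from the point
`(1, 1, √2)`. -/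
theorem four_mul_radius_le {u w R : ℝ} (he : 0 < e) (hn : 60 ≤ n) (hen : e * n = 1) (hR : 0 < R)
    (h : RoundDisc (crossMinus e n) u w R) :
    4 * R ≤ 4 - 2 * (u + w) + (u ^ 2 + w ^ 2 - R ^ 2) := by
  have he2 : e ≤ 1 / 60 := by by_contra! h; nlinarith
  -- Points of the annulus in the closed first and third quadrants are not on the side of zero, so
  -- they are outside the disc.
  have hout : ∀ a b : ℝ, e ^ 2 ≤ a ^ 2 + b ^ 2 → a ^ 2 + b ^ 2 ≤ n ^ 2 → 0 ≤ a * b →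
      0 ≤ a ^ 2 + b ^ 2 - 2 * (a * u + b * w) + (u ^ 2 + w ^ 2 - R ^ 2) := by
    intro a b h1 h2 h3
    by_contra! h4
    have h5 := coe_mem_crossMinus.1 (h ⟨a, b⟩ (by simp only; linarith))
    have := (mem_sides_of_annulus (z := ⟨a, b⟩) he (by linarith) h1 h2).1.1 h5
    exact absurd this (not_lt.2 h3)
  -- `β` is the power of the origin with respect to the circle. If it is below `e²` the disc is
  -- tiny, and if it is above `n²` it dominates everything else. In between, the circle `|z| = √β`
  -- lies in the annulus and can be used for testing.
  obtain ⟨β, hβ⟩ : ∃ β, β = u ^ 2 + w ^ 2 - R ^ 2 := ⟨_, rfl⟩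
  rw [← hβ] at hout ⊢
  have haxes : ∀ r, e ≤ r → r ≤ n → 2 * r * |u| ≤ r ^ 2 + β ∧ 2 * r * |w| ≤ r ^ 2 + β := by
    intro r h1 h2
    have h3 : e ^ 2 ≤ r ^ 2 := by gcongr
    have h4 : r ^ 2 ≤ n ^ 2 := by gcongr; linarith
    have := hout r 0 (by linarith) (by linarith) (by linarith)
    have := hout (-r) 0 (by linarith) (by linarith) (by linarith)
    have := hout 0 r (by linarith) (by linarith) (by linarith)
    have := hout 0 (-r) (by linarith) (by linarith) (by linarith)
    constructor
    · rcases abs_cases u with ⟨h5, _⟩ | ⟨h5, _⟩ <;> rw [h5] <;> linarith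
    · rcases abs_cases w with ⟨h5, _⟩ | ⟨h5, _⟩ <;> rw [h5] <;> linarith
  rcases lt_or_ge β (e ^ 2) with h1 | h1
  · obtain ⟨h2, h3⟩ := haxes e le_rfl (by linarith)
    have hu : |u| ≤ e := by nlinarith
    have hw : |w| ≤ e := by nlinarith
    have hu2 : u ^ 2 ≤ e ^ 2 := by rw [← sq_abs]; gcongr
    have hw2 : w ^ 2 ≤ e ^ 2 := by rw [← sq_abs]; gcongr
    have hβ1 : -e ^ 2 ≤ β := by nlinarith [abs_nonneg u]
    have hR2 : R ≤ 2 * e := abs_le_of_sq_le_sq' (by linarith) (by positivity) |>.2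
    have := le_abs_self u
    have := le_abs_self w
    have : e ^ 2 ≤ 1 := by nlinarith
    linarith
  rcases lt_or_ge (n ^ 2) β with h2 | h2
  -- The disc lies within distance `3n` of the origin, so `2(u + w) ≤ 12n` and `4R ≤ 48n`. Their sum
  -- `60n` is at most `n²`, which is the reason for the assumption on `n`.
  · have hb : ∀ z : ℂ, (z.re - u) ^ 2 + (z.im - w) ^ 2 < R ^ 2 →
        z.re ^ 2 + z.im ^ 2 ≤ 8 * n ^ 2 := by
      intro z hz
      by_contra! h3
      have h4 := coe_mem_crossMinus.1 (h z hz)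
      have h5 := mem_farSide_of_large (e := e) (n := n) (by linarith) (by linarith) h3
      rcases mem_cross_trichotomy he (by linarith : e ≤ n) z with h | h | h
      · exact h.2.1 h5
      · exact h.1 h4
      · exact h.2.1 h5
    have h3 := hb ⟨u, w⟩ (by simp only; nlinarith)
    have h4 := hb ⟨u + R / 2, w⟩ (by simp only; nlinarith)
    simp only at h3 h4
    have hu := abs_le_of_sq_le_sq' (a := u) (b := 3 * n) (by nlinarith) (by linarith)
    have hw := abs_le_of_sq_le_sq' (a := w) (b := 3 * n) (by nlinarith) (by linarith)
    have huR := abs_le_of_sq_le_sq' (a := u + R / 2) (b := 3 * n) (by nlinarith) (by linarith)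
    nlinarith
  obtain ⟨r, hr0, hr⟩ : ∃ r, 0 < r ∧ r ^ 2 = β :=
    ⟨√β, Real.sqrt_pos.2 (lt_of_lt_of_le (by positivity) h1),
      Real.sq_sqrt ((sq_nonneg e).trans h1)⟩
  rw [← hr] at h1 h2
  obtain ⟨h3, h4⟩ := haxes r (abs_le_of_sq_le_sq' h1 hr0.le |>.2)
    (abs_le_of_sq_le_sq' h2 (by linarith) |>.2)
  have hu : |u| ≤ r := by nlinarith
  have hw : |w| ≤ r := by nlinarith
  have hu2 : u ^ 2 ≤ r ^ 2 := by rw [← sq_abs]; gcongr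
  have hw2 : w ^ 2 ≤ r ^ 2 := by rw [← sq_abs]; gcongr
  -- Otherwise the point of modulus `r` in the direction of the centre is off the disc. This forces
  -- the centre to have modulus at most `r`, contrary to `R² = u² + w² - r² > 0`.
  have huw : u * w ≤ 0 := by
    by_contra! h5
    obtain ⟨m, hm0, hm⟩ : ∃ m, 0 < m ∧ m ^ 2 = u ^ 2 + w ^ 2 := by
      have : 0 < u ^ 2 + w ^ 2 := by nlinarith [sq_nonneg (u - w)]
      exact ⟨√(u ^ 2 + w ^ 2), by positivity, Real.sq_sqrt this.le⟩
    have h6 : (r / m * u) ^ 2 + (r / m * w) ^ 2 = r ^ 2 := by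
      have : (r / m * u) ^ 2 + (r / m * w) ^ 2 = r ^ 2 * (u ^ 2 + w ^ 2) / m ^ 2 := by ring
      rw [this, ← hm]; field_simp
    have h7 := hout (r / m * u) (r / m * w) (by rwa [h6]) (by rwa [h6]) (by
      have : r / m * u * (r / m * w) = (r / m) ^ 2 * (u * w) := by ring
      rw [this]; positivity)
    have h8 : r / m * u * u + r / m * w * w = r * m := by
      have : r / m * u * u + r / m * w * w = r * (u ^ 2 + w ^ 2) / m := by ring
      rw [this, ← hm]; field_simp
    rw [h6, h8, ← hr] at h7
    have h9 : m ≤ r := by nlinarith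
    have : m ^ 2 ≤ r ^ 2 := by gcongr
    have : 0 < R ^ 2 := by positivity
    linarith
  have hRu : R ≤ |u| := abs_le_of_sq_le_sq' (by rw [sq_abs]; linarith) (abs_nonneg u) |>.2
  have hRw : R ≤ |w| := abs_le_of_sq_le_sq' (by rw [sq_abs]; linarith) (abs_nonneg w) |>.2
  -- The coordinates of the centre have opposite signs, modulus at most `r` and at least `R`. Hence
  -- the right side is at least `4 - 2r + 2R + r²`, and `4 - 2r + r² ≥ 2r ≥ 2R`.
  have h9 := sq_nonneg (r - 2)
  rw [← hr]
  rcases abs_cases u with ⟨h5, h7⟩ | ⟨h5, h7⟩ <;> rcases abs_cases w with ⟨h6, h8⟩ | ⟨h6, h8⟩ <;>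
    rw [h5] at hu hRu <;> rw [h6] at hw hRw
  · nlinarith
  · linarith
  · linarith
  · nlinarith

end

/-! ### The lower bound, attained at the midpoint of the geodesic from `2` to `2i`. -/

section
variable {e n : ℝ}

/-- The side of zero is bounded, so a nonempty cap in it is a genuine round disc, not a half-plane
or a neighbourhood of infinity. -/
theorem disc_pos_of_cap_subset {Q : CapForm} (he : 0 < e) (hen : e ≤ n)
    (hQ : Q.cap ⊆ crossMinus e n) (hne : Q.cap.Nonempty) : 0 < Q.A ∧ 0 < Q.disc := by
  have hn : 0 < n := he.trans_le hen
  have hinf : 0 ≤ Q.A := by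
    by_contra! h
    exact infty_notMem_crossMinus (hQ (Q.infty_mem_cap.2 h))
  obtain ⟨q, hq⟩ := hne
  induction q using OnePoint.rec with
  | infty => exact absurd (Q.infty_mem_cap.1 hq) (not_lt.2 hinf)
  | coe z =>
  rw [CapForm.coe_mem_cap] at hq
  have hlarge : ∀ x y : ℝ, 8 * n ^ 2 < x ^ 2 + y ^ 2 → 0 ≤ Q.poly x y (x ^ 2 + y ^ 2) := by
    intro x y h
    by_contra! h1
    have h2 := coe_mem_crossMinus.1 (hQ (Q.coe_mem_cap (z := ⟨x, y⟩) |>.2 h1))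
    have h3 := mem_farSide_of_large (e := e) (n := n) (z := ⟨x, y⟩) hen hn h
    rcases mem_cross_trichotomy he hen ⟨x, y⟩ with h | h | h
    · exact h.2.1 h3
    · exact h.1 h2
    · exact h.2.1 h3
  have hA : 0 < Q.A := by
    refine lt_of_le_of_ne hinf fun hA => ?_
    simp only [CapForm.poly, ← hA, zero_mul, zero_sub] at hq hlarge
    have hn2 : 0 < n ^ 2 := by positivity
    rcases (add_nonneg (sq_nonneg Q.c) (sq_nonneg Q.d)).eq_or_lt with h0 | h0
    · have hc : Q.c = 0 := by nlinarith [sq_nonneg Q.d]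
      have hd : Q.d = 0 := by nlinarith [sq_nonneg Q.c]
      have := hlarge (3 * n) 0 (by nlinarith)
      rw [hc, hd] at this hq
      linarith
    -- For `A = 0` the cap is a half-plane. Moving by length `3n` parallel to its boundary, in the
    -- direction in which the modulus does not decrease, leads into the far side.
    · obtain ⟨N, hN, hN2⟩ : ∃ N, N ^ 2 * (Q.c ^ 2 + Q.d ^ 2) = 9 * n ^ 2 ∧
          0 ≤ N * (z.im * Q.c - z.re * Q.d) := by
        have h1 : (3 * n / √(Q.c ^ 2 + Q.d ^ 2)) ^ 2 * (Q.c ^ 2 + Q.d ^ 2) = 9 * n ^ 2 := by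
          rw [div_pow, Real.sq_sqrt h0.le]; field_simp; norm_num
        have h2 : 0 ≤ 3 * n / √(Q.c ^ 2 + Q.d ^ 2) := by positivity
        rcases le_total 0 (z.im * Q.c - z.re * Q.d) with h3 | h3
        · exact ⟨_, h1, mul_nonneg h2 h3⟩
        · exact ⟨-(3 * n / √(Q.c ^ 2 + Q.d ^ 2)), by rw [neg_sq, h1],
            mul_nonneg_of_nonpos_of_nonpos (by linarith) h3⟩
      have := hlarge (z.re - N * Q.d) (z.im + N * Q.c)
        (by nlinarith [sq_nonneg z.re, sq_nonneg z.im])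
      linarith
  refine ⟨hA, ?_⟩
  have := mul_neg_of_pos_of_neg hA hq
  rw [Q.mul_poly] at this
  nlinarith [sq_nonneg (Q.A * z.re - Q.c), sq_nonneg (Q.A * z.im - Q.d)]

theorem four_mul_sqrt_disc_le {Q : CapForm} (he : 0 < e) (hn : 60 ≤ n) (hen : e * n = 1)
    (hQ : Q.cap ⊆ crossMinus e n) (hA : 0 < Q.A) (hd : 0 < Q.disc) :
    4 * √Q.disc ≤ 4 * Q.A - 2 * (Q.c + Q.d) + Q.B := by
  have hR : (√Q.disc / Q.A) ^ 2 = (Q.c / Q.A) ^ 2 + (Q.d / Q.A) ^ 2 - Q.B / Q.A := by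
    rw [div_pow, Real.sq_sqrt hd.le, CapForm.disc]; field_simp
  have hD : RoundDisc (crossMinus e n) (Q.c / Q.A) (Q.d / Q.A) (√Q.disc / Q.A) := by
    intro z hz
    refine hQ (Q.coe_mem_cap.2 ?_)
    rw [hR] at hz
    have h1 : z.re ^ 2 + z.im ^ 2 - 2 * (Q.c / Q.A * z.re + Q.d / Q.A * z.im) + Q.B / Q.A < 0 := by
      linarith
    have h2 : Q.poly z.re z.im (z.re ^ 2 + z.im ^ 2) = Q.A *
        (z.re ^ 2 + z.im ^ 2 - 2 * (Q.c / Q.A * z.re + Q.d / Q.A * z.im) + Q.B / Q.A) := by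
      rw [CapForm.poly]; field_simp
    rw [h2]; exact mul_neg_of_pos_of_neg hA h1
  have h := four_mul_radius_le he hn hen (by positivity) hD
  rw [hR] at h
  have h1 := mul_le_mul_of_nonneg_left h hA.le
  have h2 : Q.A * (4 * (√Q.disc / Q.A)) = 4 * √Q.disc := by field_simp
  have h3 : Q.A * (4 - 2 * (Q.c / Q.A + Q.d / Q.A) + ((Q.c / Q.A) ^ 2 + (Q.d / Q.A) ^ 2 -
      ((Q.c / Q.A) ^ 2 + (Q.d / Q.A) ^ 2 - Q.B / Q.A))) = 4 * Q.A - 2 * (Q.c + Q.d) + Q.B := by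
    field_simp; ring
  rwa [h2, h3] at h1

/-- The point of the Klein model on the geodesic that joins `2` and `2 i`, halfway. -/
noncomputable def midPoint : E3 := !₂[2 / 5, 2 / 5, 3 / 5]

theorem val_midPoint (Q : CapForm) : Q.val midPoint = (4 * Q.A - 2 * (Q.c + Q.d) + Q.B) / 5 := by
  simp [CapForm.val, midPoint]; ring

/-- The point lies on the hemisphere over the disc tangent to the axes at `2` and `2i`, hence in the
closure of the dome region. It is also the midpoint of the images of these two points of the curve,
so no half-space over a cap off the curve contains it. -/
theorem midPoint_mem_facingBoundary (he : 0 < e) (hn : 2 ≤ n) (hen : e * n = 1) :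
    midPoint ∈ facingBoundary (domeRegion (crossPlus e n)) := by
  have he2 : e ≤ 1 / 2 := by by_contra! h; nlinarith
  have hmem : midPoint ∈ hypSpace := by rw [mem_hypSpace]; simp [midPoint]; norm_num
  refine ⟨⟨?_, ?_⟩, hmem⟩
  · rw [mem_closure_iff_seq_limit]
    obtain ⟨v, hv⟩ : ∃ v : E3, v = !₂[1, 1, 0] := ⟨_, rfl⟩
    have hlim : Tendsto (fun s : ℝ => midPoint + s • v) (𝓝[>] 0) (𝓝 midPoint) := by
      have : Continuous fun s : ℝ => midPoint + s • v := by fun_prop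
      have := this.tendsto 0
      rw [zero_smul, add_zero] at this
      exact this.mono_left nhdsWithin_le_nhds
    have hev : ∀ᶠ s : ℝ in 𝓝[>] 0, midPoint + s • v ∈ domeRegion (crossPlus e n) := by
      filter_upwards [hlim (Metric.isOpen_ball.mem_nhds hmem), self_mem_nhdsWithin] with s hs hs0
      have hs0 : 0 < s := hs0
      have hD : RoundDisc (crossPlus e n) 2 2 2 := fun z hz =>
        coe_mem_crossPlus.2 (mem_farSide_of_disc he (by linarith) (by linarith) hz)
      refine ⟨_, hD.cap_subset, hs, ?_⟩
      simp [CapForm.val, midPoint, hv]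
      linarith
    obtain ⟨u, hu⟩ := exists_seq_tendsto (𝓝[>] (0 : ℝ))
    obtain ⟨N, hN⟩ := eventually_atTop.1 (hu.eventually hev)
    exact ⟨fun i => midPoint + u (i + N) • v, fun i => hN _ (by omega),
      hlim.comp (hu.comp (tendsto_add_atTop_nat N))⟩
  · rw [(isOpen_domeRegion _).interior_eq]
    rintro ⟨Q, hQ, -, hv⟩
    have h := isSides_cross he (by linarith : e ≤ n) hen
    have hC : ∀ a b : ℝ, a ^ 2 + b ^ 2 = 4 → a * b = 0 → 0 ≤ Q.poly a b 4 := by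
      intro a b h1 h2
      by_contra! h3
      have h4 : ((⟨a, b⟩ : ℂ) : OnePoint ℂ) ∈ crossPlus e n := hQ (Q.coe_mem_cap.2 (by
        simp only; rwa [h1]))
      have h5 := (mem_sides_of_annulus (z := ⟨a, b⟩) he (by linarith : e ≤ n)
        (by simp only; rw [h1]; nlinarith) (by simp only; rw [h1]; nlinarith)).2.1.1
          (coe_mem_crossPlus.1 h4)
      exact h5.ne' h2
    have h1 := hC 2 0 (by norm_num) (by norm_num)
    have h2 := hC 0 2 (by norm_num) (by norm_num)
    rw [CapForm.poly] at h1 h2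
    rw [val_midPoint] at hv
    linarith

theorem le_boundaryWidth_cross (he : 0 < e) (hn : 60 ≤ n) (hen : e * n = 1) :
    ENNReal.ofReal (Real.arsinh √2) ≤ boundaryWidth (((↑) : ℂ → OnePoint ℂ) '' crossSet e n) := by
  have he2 : e ≤ 1 / 60 := by by_contra! h; nlinarith
  have hen' : e ≤ n := by linarith
  refine (isSides_cross he hen' hen).le_boundaryWidth (Real.sqrt_nonneg _)
    (midPoint_mem_facingBoundary he (by linarith) hen) ?_ ?_
  · have hD : RoundDisc (crossMinus e n) 1 (-1) 1 := fun z hz =>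
      coe_mem_crossMinus.2 (mem_zeroSide_of_disc hen' one_pos (by linarith) (by linarith))
    refine ⟨!₂[8 / 13, -(8 / 13), 5 / 13], _, hD.cap_subset, ?_, ?_⟩
    · rw [mem_hypSpace]; simp; norm_num
    · norm_num [CapForm.val]
  · intro Q hQ hne
    obtain ⟨hA, hd⟩ := disc_pos_of_cap_subset he hen' hQ (CapForm.cap_nonempty hne)
    refine ⟨hd, ?_⟩
    have h1 : √2 * √(1 - ‖midPoint‖ ^ 2) = 4 / 5 := by
      have h2 : ‖midPoint‖ ^ 2 = 17 / 25 := by rw [E3.norm_sq]; simp [midPoint]; norm_num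
      rw [h2, ← Real.sqrt_mul (by norm_num), show (2 * (1 - 17 / 25) : ℝ) = (4 / 5) ^ 2 by norm_num]
      exact Real.sqrt_sq (by norm_num)
    rw [val_midPoint, mul_right_comm, h1]
    linarith [four_mul_sqrt_disc_le he hn hen hQ hA hd]

/-- The sequence is constant from `n = 60` on, since upper and lower bound coincide. -/
theorem tendsto_boundaryWidth_smoothedCross :
    Tendsto (fun n : ℕ => boundaryWidth (smoothedCross n)) atTop
      (𝓝 (ENNReal.ofReal (Real.arsinh √2))) := by
  refine tendsto_const_nhds.congr' ?_
  filter_upwards [eventually_ge_atTop 60] with n hn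
  have hn' : (60 : ℝ) ≤ n := by exact_mod_cast hn
  have hen : 1 / (n : ℝ) * n = 1 := by field_simp
  rw [smoothedCross_eq]
  refine le_antisymm (le_boundaryWidth_cross (by positivity) hn' hen)
    (boundaryWidth_cross_le (by positivity) ?_ hen)
  rw [div_le_div_iff₀ (by linarith) (by norm_num)]; linarith

end

/-! ### Bounds for the modulus -/

theorem lintegral_inv_Icc {a b : ℝ} (ha : 0 < a) (hab : a ≤ b) :
    ∫⁻ s in Set.Icc a b, ENNReal.ofReal s⁻¹ = ENNReal.ofReal (Real.log (b / a)) := by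
  have hb := ha.trans_le hab
  rw [← ofReal_integral_eq_lintegral_ofReal, integral_Icc_eq_integral_Ioc,
    ← intervalIntegral.integral_of_le hab, integral_inv_of_pos ha hb]
  · refine ContinuousOn.integrableOn_Icc ?_
    exact continuousOn_id.inv₀ fun s hs => (ha.trans_le hs.1).ne'
  · filter_upwards [ae_restrict_mem measurableSet_Icc] with s hs
    exact inv_nonneg.2 (ha.le.trans hs.1)

/-- A function of the distance to `q` has at least its one-dimensional integral over every set
that meets all circles around `q` with radii in `I`. -/
theorem le_lintegral_hausdorffMeasure_of_radial {A : Set ℂ} {q : ℂ} {I : Set ℝ}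
    (hA : I ⊆ (fun z => ‖z - q‖) '' A) (u : ℝ → ℝ≥0∞) (hu : Measurable u) :
    ∫⁻ s in I, u s ≤ ∫⁻ z in A, u ‖z - q‖ ∂(Measure.hausdorffMeasure 1) := by
  have hφ : Measurable fun z : ℂ => ‖z - q‖ := by fun_prop
  rw [← lintegral_map (μ := (Measure.hausdorffMeasure 1).restrict A) hu hφ]
  refine lintegral_mono' (Measure.le_iff.2 fun E hE => ?_) le_rfl
  rw [Measure.map_apply hφ hE, Measure.restrict_apply (hφ hE), Measure.restrict_apply hE,
    ← hausdorffMeasure_real]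
  -- Distance to `q` is `1`-Lipschitz and so does not increase one-dimensional Hausdorff measure.
  have hL : LipschitzWith 1 fun z : ℂ => ‖z - q‖ := by
    refine LipschitzWith.of_dist_le_mul fun z w => ?_
    rw [NNReal.coe_one, one_mul, Real.dist_eq, dist_eq_norm]
    simpa using abs_norm_sub_norm_le (z - q) (w - q)
  have h1 := hL.lipschitzOnWith (s := (fun z => ‖z - q‖) ⁻¹' E ∩ A) |>.hausdorffMeasure_image_le
    (d := 1) zero_le_one
  rw [ENNReal.coe_one, ENNReal.one_rpow, one_mul] at h1
  refine (measure_mono ?_).trans h1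
  rintro s ⟨hs, hsI⟩
  obtain ⟨z, hz, rfl⟩ := hA hsI
  exact ⟨z, ⟨hs, hz⟩, rfl⟩

theorem lintegral_polar (q : ℂ) {f : ℂ → ℝ≥0∞} (hf : Measurable f) :
    ∫⁻ z : ℂ, f z = ∫⁻ r in Set.Ioi (0 : ℝ), ENNReal.ofReal r *
      ∫⁻ θ in Set.Ioo (-Real.pi) Real.pi, f (q + r * Complex.exp (θ * Complex.I)) := by
  rw [← lintegral_add_left_eq_self f q, ← Complex.lintegral_comp_polarCoord_symm, polarCoord_target,
    Measure.volume_eq_prod, ← Measure.prod_restrict, lintegral_prod]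
  · refine lintegral_congr fun r => ?_
    rw [← lintegral_const_mul]
    · refine lintegral_congr fun θ => ?_
      rw [Complex.polarCoord_symm_apply, Complex.exp_mul_I, smul_eq_mul]
      simp
    · fun_prop
  · refine Measurable.aemeasurable ?_
    have : Measurable fun p : ℝ × ℝ => Complex.polarCoord.symm p := by
      simp only [Complex.polarCoord_symm_apply]; fun_prop
    simp only [smul_eq_mul]
    exact (by fun_prop : Measurable fun p : ℝ × ℝ => ENNReal.ofReal p.1).mul
      (hf.comp (this.const_add q))

theorem lintegral_radial (q : ℂ) {u : ℝ → ℝ≥0∞} (hu : Measurable u) :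
    ∫⁻ z : ℂ, u ‖z - q‖ = ENNReal.ofReal (2 * Real.pi) * ∫⁻ r in Set.Ioi 0, ENNReal.ofReal r * u r := by
  rw [lintegral_polar q (f := fun z => u ‖z - q‖) (by fun_prop), ← lintegral_const_mul _ (by fun_prop)]
  refine setLIntegral_congr_fun measurableSet_Ioi fun r hr => ?_
  have hr : 0 < r := hr
  have : ∀ θ : ℝ, ‖q + r * Complex.exp (θ * Complex.I) - q‖ = r := fun θ => by
    rw [add_sub_cancel_left, norm_mul, Complex.norm_exp_ofReal_mul_I, mul_one, Complex.norm_real,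
      Real.norm_of_nonneg hr.le]
  simp only [this]
  rw [lintegral_const, Measure.restrict_apply_univ, Real.volume_Ioo, ← mul_assoc, mul_comm]
  congr 3; ring

/-- The classical annulus estimate, with the density `1 / (|z - q| log (b / a))` on the annulus:
connected sets that cross it have length at least one, and its square integrates to `2π / log (b /
a)`. -/
theorem modulus_le_of_crossing {Γ : Set (Set ℂ)} {q : ℂ} {a b : ℝ} (ha : 0 < a) (hab : a < b)
    (hΓ : ∀ A ∈ Γ, IsPreconnected A ∧ (∃ z ∈ A, ‖z - q‖ ≤ a) ∧ ∃ z ∈ A, b ≤ ‖z - q‖) :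
    modulus Γ ≤ ENNReal.ofReal (2 * Real.pi / Real.log (b / a)) := by
  have hL : 0 < Real.log (b / a) := Real.log_pos (by rwa [one_lt_div ha])
  set L := Real.log (b / a) with hLd
  let u : ℝ → ℝ≥0∞ := (Set.Icc a b).indicator fun s => ENNReal.ofReal L⁻¹ * ENNReal.ofReal s⁻¹
  have hu : Measurable u := by
    refine Measurable.indicator ?_ measurableSet_Icc
    fun_prop
  have hint : ∫⁻ s in Set.Icc a b, ENNReal.ofReal L⁻¹ * ENNReal.ofReal s⁻¹ = 1 := by
    rw [lintegral_const_mul _ (by fun_prop), lintegral_inv_Icc ha hab.le,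
      ← ENNReal.ofReal_mul (by positivity), inv_mul_cancel₀ hL.ne', ENNReal.ofReal_one]
  refine (iInf₂_le (fun z => u ‖z - q‖) (hu.comp (by fun_prop))).trans (iInf_le_of_le ?_ ?_)
  · intro A hA
    obtain ⟨hc, ⟨z, hz, hza⟩, w, hw, hwb⟩ := hΓ A hA
    have hI : Set.Icc a b ⊆ (fun z => ‖z - q‖) '' A := by
      have := (hc.image (fun z => ‖z - q‖) (by fun_prop)).ordConnected.out
        (Set.mem_image_of_mem _ hz) (Set.mem_image_of_mem _ hw)
      exact (Set.Icc_subset_Icc hza hwb).trans this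
    refine le_trans (le_of_eq ?_) (le_lintegral_hausdorffMeasure_of_radial hI u hu)
    rw [← hint]
    refine setLIntegral_congr_fun measurableSet_Icc fun s hs => ?_
    simp only [u, Set.indicator_of_mem hs]
  · refine (lintegral_radial q (u := fun s => u s ^ 2) (hu.pow_const 2)).trans_le ?_
    have h1 : ∫⁻ r in Set.Ioi 0, ENNReal.ofReal r * u r ^ 2 ≤ ENNReal.ofReal L⁻¹ * 1 := by
      rw [← hint, ← lintegral_const_mul _ (by fun_prop), ← lintegral_indicator measurableSet_Icc]
      refine (lintegral_mono' Measure.restrict_le_self le_rfl).trans (lintegral_mono fun s => ?_)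
      by_cases hs : s ∈ Set.Icc a b
      · have h0 : 0 < s := ha.trans_le hs.1
        simp only [u, Set.indicator_of_mem hs]
        rw [← ENNReal.ofReal_mul (by positivity), ← ENNReal.ofReal_mul (by positivity), sq,
          ← ENNReal.ofReal_mul (by positivity), ← ENNReal.ofReal_mul (by positivity)]
        refine le_of_eq (congrArg _ ?_)
        field_simp
      · simp only [u, Set.indicator_of_notMem hs]
        simp
    refine (mul_le_mul_right h1 _).trans (le_of_eq ?_)
    rw [mul_one, ← ENNReal.ofReal_mul (by positivity), div_eq_mul_inv]

theorem lintegral_halfCircle_le {q : ℂ} {r : ℝ} (hr : 0 < r) {ρ : ℂ → ℝ≥0∞} (hρ : Measurable ρ)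
    {A : Set ℂ}
    (hA : A ⊆ (fun θ : ℝ => q + r * Complex.exp (θ * Complex.I)) '' Set.Icc 0 Real.pi) :
    ∫⁻ z in A, ρ z ∂(Measure.hausdorffMeasure 1) ≤ ENNReal.ofReal r *
      ∫⁻ θ in Set.Icc 0 Real.pi, ρ (q + r * Complex.exp (θ * Complex.I)) := by
  set F : ℝ → ℂ := fun θ => q + r * Complex.exp (θ * Complex.I) with hF
  have hFm : Measurable F := by fun_prop
  have hL : LipschitzWith r.toNNReal F := by
    refine LipschitzWith.of_dist_le_mul fun x y => ?_
    rw [dist_eq_norm, hF]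
    simp only
    rw [add_sub_add_left_eq_sub, ← mul_sub, norm_mul, Complex.norm_real,
      Real.norm_of_nonneg hr.le, Real.coe_toNNReal _ hr.le]
    gcongr
    have : Complex.exp (x * Complex.I) - Complex.exp (y * Complex.I) =
        Complex.exp (y * Complex.I) * (Complex.exp (Complex.I * (x - y : ℝ)) - 1) := by
      rw [mul_sub, ← Complex.exp_add, mul_one]; congr 2; push_cast; ring
    rw [this, norm_mul, Complex.norm_exp_ofReal_mul_I, one_mul, Real.dist_eq]
    exact Real.norm_exp_I_mul_ofReal_sub_one_le
  rw [← lintegral_map hρ hFm, ← smul_eq_mul, ← lintegral_smul_measure]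
  refine lintegral_mono' (Measure.le_iff.2 fun E hE => ?_) le_rfl
  rw [Measure.restrict_apply hE, Measure.smul_apply, Measure.map_apply hFm hE,
    Measure.restrict_apply (hFm hE), ← hausdorffMeasure_real, smul_eq_mul]
  have h1 := hL.lipschitzOnWith (s := F ⁻¹' E ∩ Set.Icc 0 Real.pi) |>.hausdorffMeasure_image_le
    (d := 1) zero_le_one
  rw [ENNReal.rpow_one] at h1
  refine (measure_mono ?_).trans h1
  rintro z ⟨hz, hzA⟩
  obtain ⟨θ, hθ, rfl⟩ := hA hzA
  exact ⟨θ, ⟨hz, hθ⟩, rfl⟩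

/-- A family that contains an arc of almost every half circle of radius between `r₀` and `2 r₀`
has large modulus. -/
theorem le_modulus_of_circles {Γ : Set (Set ℂ)} {q : ℂ} {r₀ r' : ℝ} (hr : 0 < r₀)
    {A : ℝ → Set ℂ}
    (hA : ∀ r, A r ⊆ (fun θ : ℝ => q + r * Complex.exp (θ * Complex.I)) '' Set.Icc 0 Real.pi)
    (hΓ : ∀ r ∈ Set.Ioo r₀ (2 * r₀), r ≠ r' → A r ∈ Γ) :
    ENNReal.ofReal (1 / (2 * Real.pi)) ≤ modulus Γ := by
  refine le_iInf₂ fun ρ hρ => le_iInf fun hadm => ?_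
  rw [lintegral_polar q (hρ.pow_const 2)]
  have hpi := Real.pi_pos
  -- On each half circle of length `π r`, Cauchy–Schwarz bounds the integral of `ρ²` along it from
  -- below by `1 / (π r)`. Integration over an interval of radii of length `r₀` gives `1/(2π)`.
  have key : ∀ r ∈ Set.Ioo r₀ (2 * r₀), r ≠ r' → ENNReal.ofReal (1 / (2 * Real.pi * r₀)) ≤
      ENNReal.ofReal r * ∫⁻ θ in Set.Ioo (-Real.pi) Real.pi,
        ρ (q + r * Complex.exp (θ * Complex.I)) ^ 2 := by
    intro r hr1 hr'
    have hr0 : 0 < r := hr.trans hr1.1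
    have h1 := (hadm _ (hΓ r hr1 hr')).trans (lintegral_halfCircle_le hr0 hρ (hA r))
    set G : ℝ → ℝ≥0∞ := fun θ => ρ (q + r * Complex.exp (θ * Complex.I)) with hG
    have hGm : Measurable G := hρ.comp (by fun_prop)
    -- Cauchy–Schwarz in the form `2 G c ≤ G² + c²` with the optimal constant `c = 1 / (π r)`.
    have h2 : ∫⁻ θ in Set.Icc 0 Real.pi, ENNReal.ofReal (2 / (Real.pi * r)) * G θ ≤
        ∫⁻ θ in Set.Icc 0 Real.pi, (G θ ^ 2 + ENNReal.ofReal (1 / (Real.pi * r) ^ 2)) := by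
      refine lintegral_mono fun θ => ?_
      rcases eq_or_ne (G θ) ⊤ with h | h
      · simp [h]
      · rw [← ENNReal.ofReal_toReal h, ← ENNReal.ofReal_mul (by positivity),
          ← ENNReal.ofReal_pow ENNReal.toReal_nonneg, ← ENNReal.ofReal_add (by positivity)
          (by positivity)]
        refine ENNReal.ofReal_le_ofReal ?_
        have h3 := sq_nonneg ((G θ).toReal - 1 / (Real.pi * r))
        have h4 : 2 / (Real.pi * r) * (G θ).toReal = 2 * (G θ).toReal * (1 / (Real.pi * r)) := by
          ring
        have h5 : 1 / (Real.pi * r) ^ 2 = (1 / (Real.pi * r)) ^ 2 := by ring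
        rw [h4, h5]; linarith
    rw [lintegral_const_mul _ hGm, lintegral_add_right _ measurable_const, lintegral_const,
      Measure.restrict_apply_univ, Real.volume_Icc, sub_zero, ← ENNReal.ofReal_mul (by positivity)]
      at h2
    have h6 : ENNReal.ofReal (1 / (Real.pi * r ^ 2)) ≤ ∫⁻ θ in Set.Icc 0 Real.pi, G θ ^ 2 := by
      have h7 : ENNReal.ofReal (2 / (Real.pi * r ^ 2)) ≤
          ENNReal.ofReal (2 / (Real.pi * r)) * ∫⁻ θ in Set.Icc 0 Real.pi, G θ := by
        calc _ = ENNReal.ofReal (2 / (Real.pi * r ^ 2)) * 1 := (mul_one _).symm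
          _ ≤ ENNReal.ofReal (2 / (Real.pi * r ^ 2)) *
              (ENNReal.ofReal r * ∫⁻ θ in Set.Icc 0 Real.pi, G θ) := by gcongr
          _ = _ := by
            rw [← mul_assoc, ← ENNReal.ofReal_mul (by positivity)]
            congr 2; field_simp
      have h8 := h7.trans h2
      have h9 : ENNReal.ofReal (2 / (Real.pi * r ^ 2)) = ENNReal.ofReal (1 / (Real.pi * r ^ 2)) +
          ENNReal.ofReal (1 / (Real.pi * r) ^ 2 * Real.pi) := by
        rw [← ENNReal.ofReal_add (by positivity) (by positivity)]
        congr 1; field_simp; norm_num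
      rw [h9] at h8
      exact (ENNReal.add_le_add_iff_right ENNReal.ofReal_ne_top).1 h8
    have h10 : ∫⁻ θ in Set.Icc 0 Real.pi, G θ ^ 2 ≤
        ∫⁻ θ in Set.Ioo (-Real.pi) Real.pi, G θ ^ 2 := by
      rw [setLIntegral_congr Ioo_ae_eq_Icc.symm]
      exact lintegral_mono_set (Set.Ioo_subset_Ioo_left (by linarith))
    calc _ ≤ ENNReal.ofReal (r * (1 / (Real.pi * r ^ 2))) := by
          refine ENNReal.ofReal_le_ofReal ?_
          have : r * (1 / (Real.pi * r ^ 2)) = 1 / (Real.pi * r) := by field_simp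
          rw [this]
          refine one_div_le_one_div_of_le (by positivity) ?_
          nlinarith [hr1.2]
      _ = ENNReal.ofReal r * ENNReal.ofReal (1 / (Real.pi * r ^ 2)) :=
          ENNReal.ofReal_mul hr0.le
      _ ≤ _ := by gcongr; exact h6.trans h10
  calc _ = ∫⁻ _ in Set.Ioo r₀ (2 * r₀), ENNReal.ofReal (1 / (2 * Real.pi * r₀)) := by
        rw [lintegral_const, Measure.restrict_apply_univ, Real.volume_Ioo,
          ← ENNReal.ofReal_mul (by positivity)]
        congr 1; field_simp; ring
    _ ≤ ∫⁻ r in Set.Ioo r₀ (2 * r₀), ENNReal.ofReal r * ∫⁻ θ in Set.Ioo (-Real.pi) Real.pi,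
        ρ (q + r * Complex.exp (θ * Complex.I)) ^ 2 := by
        refine lintegral_mono_ae ?_
        filter_upwards [ae_restrict_mem measurableSet_Ioo,
          ae_restrict_of_ae (Measure.ae_ne volume r')] with r h1 h2 using key r h1 h2
    _ ≤ _ := lintegral_mono_set fun r hr1 => hr.trans hr1.1

/-! ### Quasicircles -/

theorem IsArc.exists_image (h : OnePoint ℂ ≃ₜ OnePoint ℂ) {A : Set ℂ} (hA : IsArc A)
    (hinf : ∀ z ∈ A, h (z : OnePoint ℂ) ≠ OnePoint.infty) :
    ∃ B, IsArc B ∧ ((↑) : ℂ → OnePoint ℂ) '' B = h '' (((↑) : ℂ → OnePoint ℂ) '' A) := by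
  obtain ⟨γ, hγ, hinj, rfl⟩ := hA
  choose β hβ using fun t => OnePoint.ne_infty_iff_exists.1 (hinf (γ t) ⟨t, rfl⟩)
  refine ⟨Set.range β, ⟨β, ?_, fun s t hst => ?_, rfl⟩, ?_⟩
  · rw [OnePoint.isOpenEmbedding_coe.isEmbedding.continuous_iff]
    have : ((↑) : ℂ → OnePoint ℂ) ∘ β = fun t => h (γ t) := funext hβ
    rw [this]
    exact h.continuous.comp (OnePoint.continuous_coe.comp hγ)
  · refine hinj (OnePoint.coe_injective (h.injective ?_))
    rw [← hβ, ← hβ, hst]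
  · rw [← Set.range_comp, ← Set.range_comp, ← Set.range_comp]
    exact congrArg _ (funext hβ)

/-- Conjugation is an isometry of the plane, so it preserves both area and one-dimensional Hausdorff
measure and carries admissible densities back. -/
theorem modulus_le_modulus_conj (Γ : Set (Set ℂ)) :
    modulus Γ ≤ modulus ((fun A => (starRingEnd ℂ) '' A) '' Γ) := by
  have hconj : Measurable (starRingEnd ℂ) := Complex.continuous_conj.measurable
  refine le_iInf₂ fun ρ hρ => le_iInf fun hadm => ?_
  have hvol : ∫⁻ z, ρ ((starRingEnd ℂ) z) ^ 2 = ∫⁻ z, ρ z ^ 2 :=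
    (Complex.conjLIE.measurePreserving).lintegral_comp (hρ.pow_const 2)
  rw [← hvol]
  refine iInf₂_le_of_le (fun z => ρ ((starRingEnd ℂ) z)) (hρ.comp hconj) (iInf_le_of_le ?_ le_rfl)
  intro A hA
  refine (hadm _ ⟨A, hA, rfl⟩).trans (le_of_eq ?_)
  have h := Complex.conjLIE.toIsometryEquiv.measurePreserving_hausdorffMeasure 1
  have h2 := h.setLIntegral_comp_preimage_emb
    Complex.conjLIE.toHomeomorph.measurableEmbedding ρ ((starRingEnd ℂ) '' A)
  have h3 : (Complex.conjLIE.toIsometryEquiv) ⁻¹' ((starRingEnd ℂ) '' A) = A :=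
    Set.preimage_image_eq A (starRingEnd ℂ).injective
  rw [h3] at h2
  exact h2.symm

/-- Complex conjugation on the Riemann sphere. -/
noncomputable def sphereConj : OnePoint ℂ ≃ₜ OnePoint ℂ :=
  Complex.conjLIE.toHomeomorph.onePointCongr

theorem sphereConj_coe (z : ℂ) : sphereConj z = (((starRingEnd ℂ) z : ℂ) : OnePoint ℂ) := rfl

theorem sphereConj_of_mem_realLine {q : OnePoint ℂ} (hq : q ∈ realLine) : sphereConj q = q := by
  rcases hq with rfl | ⟨z, hz, rfl⟩
  · rfl
  · rw [sphereConj_coe, Complex.conj_eq_iff_im.2 hz]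

/-- The image of the half plane `0 < s * Im z`. -/
def halfPlane (s : ℝ) : Set (OnePoint ℂ) := ((↑) : ℂ → OnePoint ℂ) '' {z | 0 < s * z.im}

theorem isPreconnected_halfPlane (s : ℝ) : IsPreconnected (halfPlane s) := by
  refine IsPreconnected.image ?_ _ OnePoint.continuous_coe.continuousOn
  refine (convex_iff_forall_pos.2 fun x hx y hy a b ha hb hab => ?_ :
    Convex ℝ {z : ℂ | 0 < s * z.im}).isPreconnected
  have hx : 0 < s * x.im := hx
  have hy : 0 < s * y.im := hy
  simp only [Set.mem_ofPred_eq, Complex.add_im, Complex.real_smul, Complex.im_ofReal_mul]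
  nlinarith [mul_pos ha hx, mul_pos hb hy]

theorem compl_realLine_subset {q : OnePoint ℂ} (hq : q ∉ realLine) :
    q ∈ halfPlane 1 ∪ halfPlane (-1) := by
  induction q using OnePoint.rec with
  | infty => exact (hq (Or.inl rfl)).elim
  | coe z =>
    have hz : z.im ≠ 0 := fun h => hq (Or.inr ⟨z, h, rfl⟩)
    rcases lt_or_gt_of_ne hz with h | h
    · exact Or.inr ⟨z, by simpa using h, rfl⟩
    · exact Or.inl ⟨z, by simpa using h, rfl⟩

theorem halfPlane_subset_compl {s : ℝ} : halfPlane s ⊆ realLineᶜ := by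
  rintro _ ⟨z, hz, rfl⟩ (h | ⟨w, hw, h⟩)
  · exact OnePoint.coe_ne_infty _ h
  · rw [OnePoint.coe_injective h] at hw
    have hz : 0 < s * z.im := hz
    have hw : z.im = 0 := hw
    rw [hw, mul_zero] at hz
    exact hz.false

theorem sphereConj_mem_halfPlane {s : ℝ} {q : OnePoint ℂ} (hq : q ∈ halfPlane s) :
    sphereConj q ∈ halfPlane (-s) := by
  obtain ⟨z, hz, rfl⟩ := hq
  exact ⟨_, by simpa using hz, (sphereConj_coe z).symm⟩

/-! ### Reflection in a quasicircle and narrow necks. -/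

section
variable {C P M : Set (OnePoint ℂ)} {f : OnePoint ℂ ≃ₜ OnePoint ℂ}

theorem image_halfPlane_subset (h : IsSides C P M) (hf : f '' realLine = C) (s : ℝ) :
    f '' halfPlane s ⊆ P ∨ f '' halfPlane s ⊆ M := by
  refine isPreconnected_iff_subset_of_disjoint.1
    ((isPreconnected_halfPlane s).image f f.continuous.continuousOn) P M h.isOpen_left
      h.isOpen_right ?_ ?_
  · rw [h.union_eq, ← hf, ← Set.image_compl_eq f.bijective]
    exact Set.image_mono halfPlane_subset_compl
  · rw [h.disjoint.inter_eq, Set.inter_empty]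

/-- The reflection in a quasicircle exchanges the two sides. -/
theorem reflection_notMem (h : IsSides C P M) (hM : M.Nonempty) (hf : f '' realLine = C)
    {z : OnePoint ℂ} (hz : z ∈ P ∪ C) : f (sphereConj (f.symm z)) ∉ P := by
  intro hP
  rcases hz with hz | hz
  · have hr : f.symm z ∉ realLine := fun hr => by
      refine h.notMem_of_mem_curve (q := z) ?_ hz
      rw [← hf]; exact ⟨_, hr, f.apply_symm_apply z⟩
    have key : ∀ s : ℝ, f.symm z ∈ halfPlane s → f '' halfPlane s ⊆ P ∧ f '' halfPlane (-s) ⊆ P := by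
      intro s hs
      constructor
      · refine (image_halfPlane_subset h hf s).resolve_right fun hM => ?_
        exact Set.disjoint_left.1 h.disjoint hz (hM ⟨_, hs, f.apply_symm_apply z⟩)
      · refine (image_halfPlane_subset h hf (-s)).resolve_right fun hM => ?_
        exact Set.disjoint_left.1 h.disjoint hP (hM ⟨_, sphereConj_mem_halfPlane hs, rfl⟩)
    -- Both half planes would be mapped into `P`, and `M` would be empty.
    have h2 : f '' halfPlane 1 ⊆ P ∧ f '' halfPlane (-1) ⊆ P := by
      rcases compl_realLine_subset hr with hs | hs
      · exact key _ hs
      · have := key _ hs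
        rw [neg_neg] at this
        exact this.symm
    obtain ⟨m, hm⟩ := hM
    have hmr : f.symm m ∉ realLine := fun hr => by
      refine h.symm.notMem_of_mem_curve (q := m) ?_ hm
      rw [← hf]; exact ⟨_, hr, f.apply_symm_apply m⟩
    refine Set.disjoint_left.1 h.disjoint ?_ hm
    rcases compl_realLine_subset hmr with hs | hs
    · exact h2.1 ⟨_, hs, f.apply_symm_apply m⟩
    · exact h2.2 ⟨_, hs, f.apply_symm_apply m⟩
  · have : f.symm z ∈ realLine := by
      rw [← hf] at hz
      obtain ⟨r, hr, rfl⟩ := hz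
      rwa [f.symm_apply_apply]
    rw [sphereConj_of_mem_realLine this, f.apply_symm_apply] at hP
    exact h.notMem_of_mem_curve hz hP

/-- A quasicircle does not have arbitrarily narrow necks. -/
theorem IsQuasiconformal.neck_bound {K : ℝ} (hq : IsQuasiconformal K f) (hf : f '' realLine = C)
    (h : IsSides C P M) (hM : M.Nonempty) (hinf : OnePoint.infty ∈ C) {q : ℂ} {r₀ ε : ℝ}
    (hε : 0 < ε) (hr₀ : ε < r₀) {A : ℝ → Set ℂ}
    (hA : ∀ r, A r ⊆ (fun θ : ℝ => q + r * Complex.exp (θ * Complex.I)) '' Set.Icc 0 Real.pi)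
    (harc : ∀ r ∈ Set.Ioo r₀ (2 * r₀), IsArc (A r))
    (hAP : ∀ r ∈ Set.Ioo r₀ (2 * r₀), ∀ z ∈ A r, (z : OnePoint ℂ) ∈ P ∪ C)
    (hends : ∀ r ∈ Set.Ioo r₀ (2 * r₀), ∃ a ∈ A r, ∃ b ∈ A r, (a : OnePoint ℂ) ∈ C ∧
      (b : OnePoint ℂ) ∈ C ∧ ∀ S : Set ℂ, IsPreconnected S → a ∈ S → b ∈ S →
        (∀ z ∈ S, (z : OnePoint ℂ) ∉ P) → ∃ z ∈ S, ‖z - q‖ ≤ ε) :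
    ENNReal.ofReal (1 / (2 * Real.pi)) ≤
      ENNReal.ofReal K * (ENNReal.ofReal K * ENNReal.ofReal (2 * Real.pi / Real.log (r₀ / ε))) := by
  -- `Γ` consists of the given arcs, `Γ₀` of their preimages under `f`, `Γ₁` of the conjugates of
  -- these and `Γ₂` of the images of `Γ₁` under `f`. Each application of `f` costs a factor `K` in
  -- the modulus, conjugation costs nothing.
  let Γ : Set (Set ℂ) :=
    {B | ∃ r ∈ Set.Ioo r₀ (2 * r₀), A r = B ∧ ∀ z ∈ B, (z : OnePoint ℂ) ≠ f OnePoint.infty}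
  let Γ₀ : Set (Set ℂ) := {B | IsArc B ∧ ∃ B' ∈ Γ, ((↑) : ℂ → OnePoint ℂ) '' B =
    f.symm '' (((↑) : ℂ → OnePoint ℂ) '' B')}
  let Γ₁ : Set (Set ℂ) := (fun A => (starRingEnd ℂ) '' A) '' Γ₀
  let Γ₂ : Set (Set ℂ) := {B : Set ℂ | ∃ B' ∈ Γ₁,
      ((↑) : ℂ → OnePoint ℂ) '' B = f '' (((↑) : ℂ → OnePoint ℂ) '' B')}
  have hcoe := OnePoint.coe_injective (X := ℂ)
  have hnorm : ∀ r : ℝ, 0 < r → ∀ z ∈ A r, ‖z - q‖ = r := fun r hr z hz => by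
    obtain ⟨θ, -, rfl⟩ := hA r hz
    simp [abs_of_pos hr, Complex.norm_exp_ofReal_mul_I]
  have hr0 : 0 < r₀ := hε.trans hr₀
  have hfix : ∀ z ∈ C, f (sphereConj (f.symm z)) = z := fun z hz => by
    have : f.symm z ∈ realLine := by
      rw [← hf] at hz
      obtain ⟨r, hr, rfl⟩ := hz
      rwa [f.symm_apply_apply]
    rw [sphereConj_of_mem_realLine this, f.apply_symm_apply]
  have h1 : ENNReal.ofReal (1 / (2 * Real.pi)) ≤ modulus Γ := by
    -- An arc through `f ∞` would have infinity in its preimage. Arcs on different circles are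
    -- disjoint, so at most one radius is lost.
    obtain ⟨r', hr'⟩ : ∃ r' : ℝ, ∀ z : ℂ, (z : OnePoint ℂ) = f OnePoint.infty → ‖z - q‖ = r' := by
      by_cases hfi : f OnePoint.infty = OnePoint.infty
      · exact ⟨0, fun z hz => absurd (hz.trans hfi) (OnePoint.coe_ne_infty z)⟩
      · obtain ⟨w, hw⟩ := OnePoint.ne_infty_iff_exists.1 hfi
        refine ⟨‖w - q‖, fun z hz => ?_⟩
        rw [hcoe (hz.trans hw.symm)]
    refine le_modulus_of_circles (r' := r') hr0 hA fun r hr hne => ⟨r, hr, rfl, fun z hz he => hne ?_⟩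
    rw [← hr' z he, hnorm r (hr0.trans hr.1) z hz]
  have h2 : modulus Γ ≤ ENNReal.ofReal K * modulus Γ₀ := by
    refine (hq.2 Γ₀ Γ (fun B hB => hB.1) ?_ ?_).1
    · rintro B ⟨-, B', -, hB⟩ z hz hzf
      have : (z : OnePoint ℂ) ∈ f.symm '' (((↑) : ℂ → OnePoint ℂ) '' B') := hB ▸ ⟨z, hz, rfl⟩
      obtain ⟨_, ⟨w, -, rfl⟩, hw⟩ := this
      rw [← hw, f.apply_symm_apply] at hzf
      exact OnePoint.coe_ne_infty _ hzf
    · ext B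
      constructor
      · rintro ⟨r, hr, rfl, hB⟩
        obtain ⟨B₀, hB₀, he⟩ := (harc r hr).exists_image f.symm fun z hz hzf => by
          refine hB z hz ?_
          rw [← hzf, f.apply_symm_apply]
        refine ⟨B₀, ⟨hB₀, A r, ⟨r, hr, rfl, hB⟩, he⟩, ?_⟩
        rw [he, Homeomorph.image_symm, Set.image_preimage_eq _ f.surjective]
      · rintro ⟨B₀, ⟨-, B', hB', he⟩, hB⟩
        rw [he, Homeomorph.image_symm, Set.image_preimage_eq _ f.surjective] at hB
        rwa [hcoe.image_injective hB]
  have h3 : modulus Γ₁ ≤ ENNReal.ofReal K * modulus Γ₂ := by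
    refine (hq.2 Γ₁ Γ₂ ?_ ?_ rfl).2
    · rintro _ ⟨B, ⟨⟨γ, hγ, hinj, rfl⟩, -⟩, rfl⟩
      exact ⟨_, Complex.continuous_conj.comp hγ, (starRingEnd ℂ).injective.comp hinj,
        Set.range_comp _ _⟩
    · rintro _ ⟨B, ⟨-, B', -, hB⟩, rfl⟩ _ ⟨z, hz, rfl⟩ hzf
      have : (z : OnePoint ℂ) ∈ f.symm '' (((↑) : ℂ → OnePoint ℂ) '' B') := hB ▸ ⟨z, hz, rfl⟩
      obtain ⟨_, ⟨w, -, rfl⟩, hw⟩ := this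
      have h4 := hfix _ hinf
      rw [← sphereConj_coe, ← hw, ← h4] at hzf
      exact OnePoint.coe_ne_infty _ (f.symm.injective (sphereConj.injective (f.injective hzf)))
  -- The reflected sets keep their endpoints on `C` but avoid `P`. Hence they enter the `ε`-disc
  -- around `q`, while their endpoints are at distance at least `r₀`.
  have h4 : modulus Γ₂ ≤ ENNReal.ofReal (2 * Real.pi / Real.log (r₀ / ε)) := by
    refine modulus_le_of_crossing (q := q) hε hr₀ ?_
    rintro B ⟨_, ⟨B₀, ⟨⟨γ, hγ, -, rfl⟩, _, ⟨r, hr, rfl, -⟩, he⟩, rfl⟩, hB⟩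
    have hB' : ((↑) : ℂ → OnePoint ℂ) '' B =
        (fun z : OnePoint ℂ => f (sphereConj (f.symm z))) '' (((↑) : ℂ → OnePoint ℂ) '' A r) := by
      rw [hB]
      have : ((↑) : ℂ → OnePoint ℂ) '' ((starRingEnd ℂ) '' Set.range γ) =
          sphereConj '' (((↑) : ℂ → OnePoint ℂ) '' Set.range γ) := by
        rw [Set.image_image, Set.image_image]; rfl
      rw [this, he, Set.image_image, Set.image_image, Set.image_image]
    have hBc : IsPreconnected B := by
      rw [← OnePoint.isOpenEmbedding_coe.isInducing.isPreconnected_image, hB]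
      refine IsPreconnected.image ?_ _ f.continuous.continuousOn
      refine IsPreconnected.image ?_ _ OnePoint.continuous_coe.continuousOn
      exact (isPreconnected_range hγ).image _ Complex.continuous_conj.continuousOn
    have hmem : ∀ z ∈ A r, (z : OnePoint ℂ) ∈ C → z ∈ B := fun z hz hzC => by
      have : (z : OnePoint ℂ) ∈ ((↑) : ℂ → OnePoint ℂ) '' B := by
        rw [hB']; exact ⟨z, ⟨z, hz, rfl⟩, hfix _ hzC⟩
      obtain ⟨w, hw, hwz⟩ := this
      rwa [← hcoe hwz]
    obtain ⟨a, ha, b, hb, haC, hbC, hS⟩ := hends r hr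
    refine ⟨hBc, hS B hBc (hmem a ha haC) (hmem b hb hbC) fun z hz => ?_, a, hmem a ha haC, ?_⟩
    · have : (z : OnePoint ℂ) ∈ ((↑) : ℂ → OnePoint ℂ) '' B := ⟨z, hz, rfl⟩
      rw [hB'] at this
      obtain ⟨_, ⟨w, hw, rfl⟩, hwz⟩ := this
      rw [← hwz]
      exact reflection_notMem h hM hf (hAP r hr w hw)
    · rw [hnorm r (hr0.trans hr.1) a ha]; exact hr.1.le
  calc _ ≤ modulus Γ := h1
    _ ≤ ENNReal.ofReal K * modulus Γ₀ := h2
    _ ≤ ENNReal.ofReal K * modulus Γ₁ := by gcongr; exact modulus_le_modulus_conj Γ₀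
    _ ≤ _ := by gcongr; exact h3.trans (by gcongr)

end

/-! ### The cross is not a quasicircle -/

theorem preconnected_const_sign {S : Set (OnePoint ℂ)} (hS : IsPreconnected S) {u : ℂ → ℝ}
    (hu : Continuous u) (hS0 : ∀ q ∈ S, ∃ z : ℂ, (z : OnePoint ℂ) = q ∧ u z ≠ 0) {z w : ℂ}
    (hz : (z : OnePoint ℂ) ∈ S) (hw : (w : OnePoint ℂ) ∈ S) (hz0 : 0 < u z) : 0 < u w := by
  have h1 : IsPreconnected (((↑) : ℂ → OnePoint ℂ) ⁻¹' S) := by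
    rw [← OnePoint.isOpenEmbedding_coe.isInducing.isPreconnected_image, Set.image_preimage_eq_of_subset]
    · exact hS
    · intro q hq
      obtain ⟨z, hz, -⟩ := hS0 q hq
      exact ⟨z, hz⟩
  by_contra! h
  obtain ⟨x, hx, hx0⟩ := (h1.image u hu.continuousOn).ordConnected.out
    (Set.mem_image_of_mem _ (Set.mem_preimage.2 hw)) (Set.mem_image_of_mem _ (Set.mem_preimage.2 hz))
    ⟨h, hz0.le⟩
  obtain ⟨y, hy, hy0⟩ := hS0 x hx
  rw [OnePoint.coe_injective hy] at hy0
  exact hy0 hx0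

/-- Only the homeomorphism matters: the images of the two half planes are connected and miss the
axes, so each stays in one open quadrant, yet together they must cover all four. -/
theorem not_isQuasicircle_crossCurve : ¬ IsQuasicircle crossCurve := by
  rintro ⟨K, f, -, hf⟩
  have hsub : ∀ s : ℝ, f '' halfPlane s ⊆ crossCurveᶜ := fun s => by
    rw [← hf, ← Set.image_compl_eq f.bijective]
    exact Set.image_mono halfPlane_subset_compl
  have hS0 : ∀ s, ∀ q ∈ f '' halfPlane s, ∃ z : ℂ, (z : OnePoint ℂ) = q ∧ z.re ≠ 0 ∧ z.im ≠ 0 := by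
    intro s q hq
    have := hsub s hq
    induction q using OnePoint.rec with
    | infty => exact (this (Or.inl rfl)).elim
    | coe z =>
      refine ⟨z, rfl, fun h => this ?_, fun h => this ?_⟩
      · exact Or.inr ⟨z, Or.inl h, rfl⟩
      · exact Or.inr ⟨z, Or.inr h, rfl⟩
  have key : ∀ s : ℝ, ∀ z w : ℂ, (z : OnePoint ℂ) ∈ f '' halfPlane s →
      (w : OnePoint ℂ) ∈ f '' halfPlane s → (0 < z.re → 0 < w.re) ∧ (0 < z.im → 0 < w.im) := by
    intro s z w hz hw
    have hc := (isPreconnected_halfPlane s).image f f.continuous.continuousOn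
    constructor
    · refine preconnected_const_sign hc Complex.continuous_re (fun q hq => ?_) hz hw
      obtain ⟨z, h1, h2, -⟩ := hS0 s q hq
      exact ⟨z, h1, h2⟩
    · refine preconnected_const_sign hc Complex.continuous_im (fun q hq => ?_) hz hw
      obtain ⟨z, h1, -, h2⟩ := hS0 s q hq
      exact ⟨z, h1, h2⟩
  have hcov : ∀ z : ℂ, z.re ≠ 0 → z.im ≠ 0 →
      (z : OnePoint ℂ) ∈ f '' halfPlane 1 ∨ (z : OnePoint ℂ) ∈ f '' halfPlane (-1) := by
    intro z h1 h2
    have : (z : OnePoint ℂ) ∉ crossCurve := by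
      rintro (h | ⟨w, hw, h⟩)
      · exact OnePoint.coe_ne_infty _ h
      · rw [OnePoint.coe_injective h] at hw
        exact hw.elim h1 h2
    have hr : f.symm z ∉ realLine := fun hr => this (by
      rw [← hf]; exact ⟨_, hr, f.apply_symm_apply _⟩)
    exact (compl_realLine_subset hr).imp (fun hs => ⟨_, hs, f.apply_symm_apply _⟩)
      fun hs => ⟨_, hs, f.apply_symm_apply _⟩
  -- Three points in distinct quadrants cannot be placed in two connected sets.
  have h1 := hcov ⟨1, 1⟩ (by norm_num) (by norm_num)
  have h2 := hcov ⟨-1, 1⟩ (by norm_num) (by norm_num)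
  have h3 := hcov ⟨1, -1⟩ (by norm_num) (by norm_num)
  have n12 : ∀ s, ¬(((⟨1, 1⟩ : ℂ) : OnePoint ℂ) ∈ f '' halfPlane s ∧
      ((⟨-1, 1⟩ : ℂ) : OnePoint ℂ) ∈ f '' halfPlane s) := fun s h => by
    have := (key s _ _ h.1 h.2).1 one_pos
    norm_num at this
  have n13 : ∀ s, ¬(((⟨1, 1⟩ : ℂ) : OnePoint ℂ) ∈ f '' halfPlane s ∧
      ((⟨1, -1⟩ : ℂ) : OnePoint ℂ) ∈ f '' halfPlane s) := fun s h => by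
    have := (key s _ _ h.1 h.2).2 one_pos
    norm_num at this
  have n23 : ∀ s, ¬(((⟨-1, 1⟩ : ℂ) : OnePoint ℂ) ∈ f '' halfPlane s ∧
      ((⟨1, -1⟩ : ℂ) : OnePoint ℂ) ∈ f '' halfPlane s) := fun s h => by
    have := (key s _ _ h.2 h.1).1 one_pos
    norm_num at this
  have a1 := n12 1; have a2 := n12 (-1); have a3 := n13 1; have a4 := n13 (-1)
  have a5 := n23 1; have a6 := n23 (-1)
  tauto

/-! ### Hausdorff convergence -/

/-- The kept parts of the axes belong to the cross. The inner arcs are within `2/n` of the origin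
and the outer arcs beyond `n/2`, so the points `0` and infinity of the cross serve as neighbours. -/
theorem exists_crossCurve_near {n : ℕ} (hn : 1 ≤ n) {q : OnePoint ℂ} (hq : q ∈ smoothedCross n) :
    ∃ p ∈ crossCurve, dist (toSphere q) (toSphere p) ≤ 4 / n := by
  have hn0 : (0 : ℝ) < n := by exact_mod_cast hn
  have he0 : 0 < 1 / (n : ℝ) := by positivity
  have hinner : ∀ z : ℂ, ‖z - (1 + Complex.I) / n‖ = 1 / (n : ℝ) → z.re + z.im ≤ 1 / n →
      ‖z‖ ≤ 2 * (1 / n) := by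
    intro z h1 h2
    have h3 : ‖z - (1 + Complex.I) / n‖ ^ 2 = (z.re - 1 / n) ^ 2 + (z.im - 1 / n) ^ 2 := by
      have : (1 + Complex.I) / (n : ℂ) = ((1 / n : ℝ) : ℂ) + ((1 / n : ℝ) : ℂ) * Complex.I := by
        push_cast; ring
      rw [norm_sq_eq_re_im, this]; simp
    rw [h1] at h3
    refine abs_le_of_sq_le_sq' ?_ (by positivity) |>.2
    rw [norm_sq_eq_re_im]
    set e := 1 / (n : ℝ)
    nlinarith
  have houter : ∀ z : ℂ, ‖z - n * (-1 + Complex.I)‖ = n → n ≤ z.im - z.re → (n : ℝ) / 2 ≤ ‖z‖ := by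
    intro z h1 h2
    refine abs_le_of_sq_le_sq' ?_ (by positivity) |>.2
    rw [norm_sq_eq_re_im]
    nlinarith [sq_nonneg (z.im + z.re)]
  have hzero : ∀ z : ℂ, ‖z‖ ≤ 2 * (1 / n) →
      ∃ p ∈ crossCurve, dist (toSphere z) (toSphere p) ≤ 4 / n := fun z hz =>
    ⟨((0 : ℂ) : OnePoint ℂ), Or.inr ⟨0, Or.inl rfl, rfl⟩, (dist_toSphere_zero_le z).trans (by
      have : 2 * (2 * (1 / (n : ℝ))) = 4 / n := by ring
      linarith)⟩
  have hinf : ∀ z : ℂ, (n : ℝ) / 2 ≤ ‖z‖ →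
      ∃ p ∈ crossCurve, dist (toSphere z) (toSphere p) ≤ 4 / n := fun z hz => by
    have hz0 : 0 < ‖z‖ := lt_of_lt_of_le (by positivity) hz
    refine ⟨OnePoint.infty, Or.inl rfl, (dist_toSphere_infty_le (norm_pos_iff.1 hz0)).trans ?_⟩
    rw [div_le_div_iff₀ hz0 hn0]; linarith
  obtain ⟨z, ((⟨hz, -⟩ | hz | hz) | hz | hz), rfl⟩ := hq
  · exact ⟨z, Or.inr ⟨z, hz, rfl⟩, by rw [dist_self]; positivity⟩
  · exact hzero z (hinner z hz.1 hz.2)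
  · refine hzero z (norm_neg z ▸ hinner (-z) ?_ ?_)
    · rw [← hz.1, ← norm_neg]; congr 1; ring
    · rw [Complex.neg_re, Complex.neg_im]; linarith [hz.2]
  · exact hinf z (houter z hz.1 hz.2)
  · refine hinf z (norm_neg z ▸ houter (-z) ?_ ?_)
    · refine Eq.trans ?_ hz.1
      rw [← norm_neg]; congr 1; ring
    · rw [Complex.neg_re, Complex.neg_im]; linarith [hz.2]

theorem exists_smoothedCross_near {n : ℕ} (hn : 1 ≤ n) {q : OnePoint ℂ} (hq : q ∈ crossCurve) :
    ∃ p ∈ smoothedCross n, dist (toSphere q) (toSphere p) ≤ 4 / n := by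
  have hn1 : (1 : ℝ) ≤ n := by exact_mod_cast hn
  have hn0 : (0 : ℝ) < n := by linarith
  have he0 : 0 < 1 / (n : ℝ) := by positivity
  have hen : 1 / (n : ℝ) ≤ n := by rw [div_le_iff₀ hn0]; nlinarith
  have hmem : ∀ s : ℝ, 1 / (n : ℝ) ≤ s → s ≤ n → ((s : ℂ) : OnePoint ℂ) ∈ smoothedCross n := by
    intro s h1 h2
    refine ⟨s, Or.inl (Or.inl ⟨Or.inr (Complex.ofReal_im s), fun h => ?_⟩), rfl⟩
    rw [Set.mem_ofPred_eq, Complex.ofReal_re, abs_of_pos (he0.trans_le h1)] at h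
    rcases h.1 with h | h <;> linarith
  have hinf : dist (toSphere ((n : ℝ) : ℂ)) (toSphere OnePoint.infty) ≤ 2 / n := by
    refine (dist_toSphere_infty_le (by exact_mod_cast hn0.ne')).trans ?_
    rw [Complex.norm_real, Real.norm_of_nonneg hn0.le]
  have h24 : 2 / (n : ℝ) ≤ 4 / n := by gcongr; norm_num
  rcases hq with rfl | ⟨z, hz, rfl⟩
  · exact ⟨_, hmem n hen le_rfl, by rw [dist_comm]; exact hinf.trans h24⟩
  have habs : ‖z‖ = |z.re| + |z.im| := by
    have := norm_sq_eq_re_im z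
    rcases hz with hz | hz
    · have hz : z.re = 0 := hz
      rw [hz, abs_zero, zero_add]
      rw [hz] at this
      rw [← abs_norm z, ← sq_eq_sq_iff_abs_eq_abs, this]; ring
    · have hz : z.im = 0 := hz
      rw [hz, abs_zero, add_zero]
      rw [hz] at this
      rw [← abs_norm z, ← sq_eq_sq_iff_abs_eq_abs, this]; ring
  by_cases hT : z ∈ truncatedAxes n
  · exact ⟨z, ⟨z, Or.inl (Or.inl hT), rfl⟩, by rw [dist_self]; positivity⟩
  have hT2 : (|z.re| < 1 / (n : ℝ) ∨ (n : ℝ) < |z.re|) ∧ (|z.im| < 1 / (n : ℝ) ∨ (n : ℝ) < |z.im|) := by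
    by_contra h; exact hT ⟨hz, h⟩
  have h0 : ‖z‖ ≤ 1 / n ∨ (n : ℝ) ≤ ‖z‖ := by
    rw [habs]
    rcases hz with hz | hz
    · have hz : z.re = 0 := hz
      rw [hz, abs_zero, zero_add]
      exact hT2.2.imp le_of_lt le_of_lt
    · have hz : z.im = 0 := hz
      rw [hz, abs_zero, add_zero]
      exact hT2.1.imp le_of_lt le_of_lt
  rcases h0 with h0 | h0
  · refine ⟨_, hmem (1 / n) le_rfl hen, (dist_triangle_right _ _ (toSphere (0 : ℂ))).trans ?_⟩
    have h1 := dist_toSphere_zero_le z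
    have h2 := dist_toSphere_zero_le ((1 / n : ℝ) : ℂ)
    rw [Complex.norm_real, Real.norm_of_nonneg he0.le] at h2
    have : 2 * (1 / (n : ℝ)) + 2 * (1 / n) = 4 / n := by ring
    linarith
  · have hz0 : 0 < ‖z‖ := hn0.trans_le h0
    refine ⟨_, hmem n hen le_rfl, (dist_triangle_right _ _ (toSphere OnePoint.infty)).trans ?_⟩
    have h1 := dist_toSphere_infty_le (norm_pos_iff.1 hz0)
    have : 2 / ‖z‖ ≤ 2 / n := by gcongr
    have : 2 / (n : ℝ) + 2 / n = 4 / n := by ring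
    linarith

theorem tendsto_hausdorffEDist_smoothedCross :
    Tendsto (fun n : ℕ => Metric.hausdorffEDist (toSphere '' smoothedCross n)
      (toSphere '' crossCurve)) atTop (𝓝 0) := by
  have hlim : Tendsto (fun n : ℕ => ENNReal.ofReal (4 / n)) atTop (𝓝 0) := by
    rw [← ENNReal.ofReal_zero]
    exact (ENNReal.continuous_ofReal.tendsto 0).comp (tendsto_const_div_atTop_nhds_zero_nat 4)
  refine tendsto_of_tendsto_of_tendsto_of_le_of_le' tendsto_const_nhds hlim
    (Eventually.of_forall fun _ => zero_le) ?_
  filter_upwards [eventually_ge_atTop 1] with n hn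
  refine Metric.hausdorffEDist_le_of_mem_edist ?_ ?_
  · rintro _ ⟨q, hq, rfl⟩
    obtain ⟨p, hp, h⟩ := exists_crossCurve_near hn hq
    exact ⟨_, ⟨p, hp, rfl⟩, by rw [edist_dist]; exact ENNReal.ofReal_le_ofReal h⟩
  · rintro _ ⟨q, hq, rfl⟩
    obtain ⟨p, hp, h⟩ := exists_smoothedCross_near hn hq
    exact ⟨_, ⟨p, hp, rfl⟩, by rw [edist_dist]; exact ENNReal.ofReal_le_ofReal h⟩

/-! ### The Möbius transformation `z ↦ (1 + z) / (1 - z)` -/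

/-- The Möbius transformation `z ↦ (1 + z) / (1 - z)` of the Riemann sphere. -/
noncomputable def sphereMob (q : OnePoint ℂ) : OnePoint ℂ :=
  q.elim ((-1 : ℂ) : OnePoint ℂ) fun z =>
    if z = 1 then OnePoint.infty else (((1 + z) / (1 - z) : ℂ) : OnePoint ℂ)

theorem sphereMob_infty : sphereMob OnePoint.infty = ((-1 : ℂ) : OnePoint ℂ) := rfl

theorem sphereMob_one : sphereMob ((1 : ℂ) : OnePoint ℂ) = OnePoint.infty := if_pos rfl

theorem sphereMob_coe {z : ℂ} (hz : z ≠ 1) :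
    sphereMob z = (((1 + z) / (1 - z) : ℂ) : OnePoint ℂ) := if_neg hz

section
variable {z : ℂ}

theorem mob_denom_pos (hz : z ≠ 1) : 0 < (1 - z.re) ^ 2 + z.im ^ 2 := by
  by_contra! h
  refine hz (Complex.ext ?_ ?_)
  · rw [Complex.one_re]; nlinarith [sq_nonneg z.im, sq_nonneg (1 - z.re)]
  · rw [Complex.one_im]; nlinarith [sq_nonneg z.im, sq_nonneg (1 - z.re)]

theorem mob_re (z : ℂ) : ((1 + z) / (1 - z)).re =
    (1 - z.re ^ 2 - z.im ^ 2) / ((1 - z.re) ^ 2 + z.im ^ 2) := by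
  rw [Complex.div_re, Complex.normSq_apply, ← add_div]
  simp; congr 1 <;> ring_nf

theorem mob_im (z : ℂ) : ((1 + z) / (1 - z)).im = 2 * z.im / ((1 - z.re) ^ 2 + z.im ^ 2) := by
  rw [Complex.div_im, Complex.normSq_apply, ← sub_div]
  simp; congr 1 <;> ring_nf

theorem mob_norm_sq (hz : z ≠ 1) : ((1 + z) / (1 - z)).re ^ 2 + ((1 + z) / (1 - z)).im ^ 2 =
    ((1 + z.re) ^ 2 + z.im ^ 2) / ((1 - z.re) ^ 2 + z.im ^ 2) := by
  have := mob_denom_pos hz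
  rw [mob_re, mob_im]; field_simp; ring

/-- The map is a quarter turn of the sphere about its second axis, so continuity is evident and caps
pull back by a linear substitution. -/
theorem toSphere_sphereMob (q : OnePoint ℂ) : toSphere (sphereMob q) =
    !₂[-toSphere q 2, toSphere q 1, toSphere q 0] := by
  rw [E3.ext_iff']
  induction q using OnePoint.rec with
  | infty =>
    rw [sphereMob_infty, toSphere_coe_zero, toSphere_coe_one, toSphere_coe_two, toSphere_infty_zero,
      toSphere_infty_one, toSphere_infty_two]
    norm_num; rfl
  | coe z =>
    by_cases hz : z = 1
    · rw [hz, sphereMob_one, toSphere_coe_zero, toSphere_coe_one, toSphere_coe_two,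
        toSphere_infty_zero, toSphere_infty_one, toSphere_infty_two]
      norm_num; rfl
    · have h1 := mob_denom_pos hz
      have h2 : 0 < z.re ^ 2 + z.im ^ 2 + 1 := by positivity
      rw [sphereMob_coe hz, toSphere_coe_zero, toSphere_coe_one, toSphere_coe_two,
        toSphere_coe_zero, toSphere_coe_one, toSphere_coe_two, mob_norm_sq hz, mob_re, mob_im]
      have h3 : ((1 + z.re) ^ 2 + z.im ^ 2) / ((1 - z.re) ^ 2 + z.im ^ 2) + 1 =
          2 * (z.re ^ 2 + z.im ^ 2 + 1) / ((1 - z.re) ^ 2 + z.im ^ 2) := by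
        field_simp; ring
      rw [h3]
      simp
      refine ⟨?_, ?_, ?_⟩ <;> field_simp <;> ring_nf

theorem continuous_sphereMob : Continuous sphereMob := by
  rw [isEmbedding_toSphere.continuous_iff]
  have : toSphere ∘ sphereMob = fun q => !₂[-toSphere q 2, toSphere q 1, toSphere q 0] :=
    funext toSphere_sphereMob
  rw [this]
  have := continuous_toSphere
  refine (PiLp.continuous_toLp 2 _).comp (continuous_pi fun i => ?_)
  fin_cases i <;> simp <;> fun_prop

theorem continuous_sphereAffine {a : ℝ} (ha : a ≠ 0) (b : ℝ) : Continuous (sphereAffine a b) := by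
  have ha' : (a : ℂ) ≠ 0 := by exact_mod_cast ha
  exact ((Homeomorph.mulLeft₀ (a : ℂ) ha').trans (Homeomorph.addRight (b : ℂ))).onePointCongr.continuous

theorem transport_sphereMob {x y t : ℝ} (ht : 0 < t) :
    Transport sphereMob x y t ((1 - (x ^ 2 + y ^ 2 + t ^ 2)) / ((1 - x) ^ 2 + y ^ 2 + t ^ 2))
      (2 * y / ((1 - x) ^ 2 + y ^ 2 + t ^ 2)) (2 * t / ((1 - x) ^ 2 + y ^ 2 + t ^ 2)) := by
  intro Q
  have hN : 0 < (1 - x) ^ 2 + y ^ 2 + t ^ 2 := by positivity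
  refine ⟨⟨Q.A + Q.B + 2 * Q.c, Q.B - Q.A, 2 * Q.d, Q.A + Q.B - 2 * Q.c⟩, 2,
    (1 - x) ^ 2 + y ^ 2 + t ^ 2, two_pos, hN, fun q => ?_, ?_, ?_, ?_⟩
  · rw [CapForm.cap, CapForm.cap, Set.mem_ofPred_eq, Set.mem_ofPred_eq, toSphere_sphereMob]
    simp only [CapForm.val]
    have h : ∀ r s : ℝ, r = 2 * s → (r < 0 ↔ s < 0) := by
      rintro r s rfl; constructor <;> intro <;> linarith
    refine h _ _ ?_
    simp; ring
  · simp only [CapForm.disc]; ring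
  · field_simp
  · simp only [CapForm.poly]; field_simp; ring

end

/-! ### A chain of smoothed crosses -/

/-- The number of the smoothed cross that is inserted at the integer `k`. -/
def neck (k : ℤ) : ℝ := 6 + |(k : ℝ)|

/-- The coordinate in which the chain looks like a smoothed cross near the integer `k`. -/
noncomputable def gadgetMap (δ : ℝ) (k : ℤ) : OnePoint ℂ → OnePoint ℂ :=
  sphereMob ∘ sphereAffine (1 / δ) (-k / δ)

/-- The part below the chain. -/
def chainPlus (δ : ℝ) : Set (OnePoint ℂ) :=
  ((↑) : ℂ → OnePoint ℂ) '' {z | ∃ k : ℤ, |z.re - k| < 9 / 10 ∧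
    gadgetMap δ k z ∈ crossPlus (1 / neck k) (neck k)}

/-- The part above the chain. -/
def chainMinus (δ : ℝ) : Set (OnePoint ℂ) :=
  ((↑) : ℂ → OnePoint ℂ) '' {z | ∃ k : ℤ, |z.re - k| < 9 / 10 ∧
    gadgetMap δ k z ∈ crossMinus (1 / neck k) (neck k)}

/-- The Jordan curve that follows the real line, with smoothed crosses inserted at the integers. -/
def chainCurve (δ : ℝ) : Set (OnePoint ℂ) := (chainPlus δ ∪ chainMinus δ)ᶜ

theorem six_le_neck (k : ℤ) : 6 ≤ neck k := by
  rw [neck]; linarith [abs_nonneg (k : ℝ)]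

theorem neck_pos (k : ℤ) : 0 < neck k := by linarith [six_le_neck k]

theorem one_div_neck_pos (k : ℤ) : 0 < 1 / neck k := one_div_pos.2 (neck_pos k)

theorem one_div_neck_le (k : ℤ) : 1 / neck k ≤ 1 / 6 := by
  have := six_le_neck k; gcongr

theorem one_div_neck_le_neck (k : ℤ) : 1 / neck k ≤ neck k := by
  linarith [six_le_neck k, one_div_neck_le k]

theorem one_div_neck_mul (k : ℤ) : 1 / neck k * neck k = 1 := by
  have := (neck_pos k).ne'; field_simp

theorem crossPlus_or_crossMinus_or {e n : ℝ} (he : 0 < e) (hen : e ≤ n) (z : ℂ) :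
    ((z : OnePoint ℂ) ∈ crossPlus e n ∧ (z : OnePoint ℂ) ∉ crossMinus e n ∧ z ∉ crossSet e n) ∨
    ((z : OnePoint ℂ) ∉ crossPlus e n ∧ (z : OnePoint ℂ) ∈ crossMinus e n ∧ z ∉ crossSet e n) ∨
    ((z : OnePoint ℂ) ∉ crossPlus e n ∧ (z : OnePoint ℂ) ∉ crossMinus e n ∧ z ∈ crossSet e n) := by
  rw [coe_mem_crossPlus, coe_mem_crossMinus]
  have := mem_cross_trichotomy he hen z
  tauto

section
variable {e n δ x y t κ : ℝ} {z : ℂ} {k : ℤ}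

/-- `z ↦ (1 + z)/(1 - z)` sends infinity to `-1`, where the smoothed cross is the real axis. So
outside a disc the transplanted cross is the real line; the throats at `0` and infinity are moved to
`-1` and `1`. -/
theorem sphereMob_mem_iff (he : 0 < e) (he2 : e ≤ 1 / 3) (hn : 3 ≤ n)
    (hz : 9 < z.re ^ 2 + z.im ^ 2) :
    (sphereMob z ∈ crossPlus e n ↔ z.im < 0) ∧ (sphereMob z ∈ crossMinus e n ↔ 0 < z.im) := by
  have hz1 : z ≠ 1 := by rintro rfl; norm_num at hz
  have hN := mob_denom_pos hz1
  have hnorm := mob_norm_sq hz1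
  have h1 : 1 / 9 ≤ ((1 + z) / (1 - z)).re ^ 2 + ((1 + z) / (1 - z)).im ^ 2 := by
    rw [hnorm, div_le_div_iff₀ (by norm_num) hN]; nlinarith [sq_nonneg (z.re + 3)]
  have h2 : ((1 + z) / (1 - z)).re ^ 2 + ((1 + z) / (1 - z)).im ^ 2 ≤ 9 := by
    rw [hnorm, div_le_iff₀ hN]; nlinarith [sq_nonneg (z.re - 3)]
  obtain ⟨h3, h4, -⟩ := mem_sides_of_annulus he (by linarith : e ≤ n) (z := (1 + z) / (1 - z))
    (by nlinarith) (by nlinarith)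
  rw [sphereMob_coe hz1, coe_mem_crossPlus, coe_mem_crossMinus, h3, h4, mob_re, mob_im]
  set N := (1 - z.re) ^ 2 + z.im ^ 2
  have h5 : (1 - z.re ^ 2 - z.im ^ 2) / N * (2 * z.im / N) =
      -((z.re ^ 2 + z.im ^ 2 - 1) * 2 / N ^ 2) * z.im := by ring
  have h6 : 0 < (z.re ^ 2 + z.im ^ 2 - 1) * 2 / N ^ 2 := by
    have : 0 < z.re ^ 2 + z.im ^ 2 - 1 := by linarith
    positivity
  rw [h5]
  constructor
  · constructor <;> intro h <;> nlinarith
  · constructor <;> intro h <;> nlinarith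

/-- The affine coordinate near the integer `k`. -/
noncomputable def gadgetCoord (δ : ℝ) (k : ℤ) (z : ℂ) : ℂ :=
  ((1 / δ : ℝ) : ℂ) * z + ((-k / δ : ℝ) : ℂ)

theorem gadgetMap_coe (δ : ℝ) (k : ℤ) (z : ℂ) : gadgetMap δ k z = sphereMob (gadgetCoord δ k z) := rfl

theorem gadgetCoord_re (δ : ℝ) (k : ℤ) (z : ℂ) : (gadgetCoord δ k z).re = (z.re - k) / δ := by
  rw [gadgetCoord, Complex.add_re, Complex.re_ofReal_mul, Complex.ofReal_re]; ring

theorem gadgetCoord_im (δ : ℝ) (k : ℤ) (z : ℂ) : (gadgetCoord δ k z).im = z.im / δ := by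
  rw [gadgetCoord, Complex.add_im, Complex.im_ofReal_mul, Complex.ofReal_im]; ring

theorem gadgetMap_mem_iff (hδ : 0 < δ) (hz : 9 * δ ^ 2 < (z.re - k) ^ 2 + z.im ^ 2) :
    (gadgetMap δ k z ∈ crossPlus (1 / neck k) (neck k) ↔ z.im < 0) ∧
    (gadgetMap δ k z ∈ crossMinus (1 / neck k) (neck k) ↔ 0 < z.im) := by
  have h := sphereMob_mem_iff (z := gadgetCoord δ k z) (n := neck k) (one_div_neck_pos k)
    (by linarith [one_div_neck_le k]) (by linarith [six_le_neck k]) (by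
      rw [gadgetCoord_re, gadgetCoord_im, div_pow, div_pow, ← add_div, lt_div_iff₀ (by positivity)]
      exact hz)
  rw [gadgetMap_coe, h.1, h.2, gadgetCoord_im]
  exact ⟨by rw [div_lt_iff₀ hδ, zero_mul], by rw [lt_div_iff₀ hδ, zero_mul]⟩

/-- Neighbouring strips overlap, but there the point is at least `1/10` away from both integers, and
both local descriptions reduce to the sign of the imaginary part. -/
theorem gadgetMap_mem_iff_of_lt (hδ : 0 < δ) (hδ1 : δ ≤ 1 / 100) {j k : ℤ}
    (hj : |z.re - j| < 9 / 10) (hk : |z.re - k| < 9 / 10) :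
    (gadgetMap δ j z ∈ crossPlus (1 / neck j) (neck j) ↔
      gadgetMap δ k z ∈ crossPlus (1 / neck k) (neck k)) ∧
    (gadgetMap δ j z ∈ crossMinus (1 / neck j) (neck j) ↔
      gadgetMap δ k z ∈ crossMinus (1 / neck k) (neck k)) := by
  rcases eq_or_ne j k with rfl | hne
  · exact ⟨Iff.rfl, Iff.rfl⟩
  have h1 : (1 : ℝ) ≤ |(j : ℝ) - k| := by
    have : (1 : ℤ) ≤ |j - k| := Int.one_le_abs (sub_ne_zero.2 hne)
    exact_mod_cast this
  have far : ∀ {j k : ℤ}, (1 : ℝ) ≤ |(j : ℝ) - k| → |z.re - k| < 9 / 10 →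
      9 * δ ^ 2 < (z.re - j) ^ 2 + z.im ^ 2 := fun {j k} h1 hk => by
    have h2 : 1 / 10 ≤ |z.re - j| := by
      have : (j : ℝ) - k = (z.re - k) - (z.re - j) := by ring
      rw [this] at h1
      linarith [abs_sub (z.re - k) (z.re - j)]
    have h3 : (1 / 10) ^ 2 ≤ (z.re - j) ^ 2 := by rw [← sq_abs (z.re - j)]; gcongr
    have h4 : δ ^ 2 ≤ (1 / 100) ^ 2 := by gcongr
    linarith [sq_nonneg z.im]
  have a := gadgetMap_mem_iff hδ (far h1 hk)
  have b := gadgetMap_mem_iff hδ (far (by rwa [abs_sub_comm]) hj : 9 * δ ^ 2 < (z.re - k) ^ 2 + z.im ^ 2)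
  exact ⟨a.1.trans b.1.symm, a.2.trans b.2.symm⟩

theorem exists_abs_sub_le (x : ℝ) : ∃ k : ℤ, |x - k| ≤ 1 / 2 := ⟨round x, abs_sub_round x⟩

theorem coe_mem_chainPlus (hδ : 0 < δ) (hδ1 : δ ≤ 1 / 100) (hk : |z.re - k| < 9 / 10) :
    (z : OnePoint ℂ) ∈ chainPlus δ ↔ gadgetMap δ k z ∈ crossPlus (1 / neck k) (neck k) := by
  rw [chainPlus, OnePoint.coe_injective.mem_set_image]
  exact ⟨fun ⟨j, hj, h⟩ => (gadgetMap_mem_iff_of_lt hδ hδ1 hj hk).1.1 h, fun h => ⟨k, hk, h⟩⟩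

theorem coe_mem_chainMinus (hδ : 0 < δ) (hδ1 : δ ≤ 1 / 100) (hk : |z.re - k| < 9 / 10) :
    (z : OnePoint ℂ) ∈ chainMinus δ ↔ gadgetMap δ k z ∈ crossMinus (1 / neck k) (neck k) := by
  rw [chainMinus, OnePoint.coe_injective.mem_set_image]
  exact ⟨fun ⟨j, hj, h⟩ => (gadgetMap_mem_iff_of_lt hδ hδ1 hj hk).2.1 h, fun h => ⟨k, hk, h⟩⟩

/-- Away from the integers, the chain is the real line. -/
theorem coe_mem_chain_of_far (hδ : 0 < δ) (hδ1 : δ ≤ 1 / 100)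
    (hz : ∀ k : ℤ, 9 * δ ^ 2 < (z.re - k) ^ 2 + z.im ^ 2) :
    ((z : OnePoint ℂ) ∈ chainPlus δ ↔ z.im < 0) ∧ ((z : OnePoint ℂ) ∈ chainMinus δ ↔ 0 < z.im) := by
  obtain ⟨k, hk⟩ := exists_abs_sub_le z.re
  have hk' : |z.re - k| < 9 / 10 := by linarith
  rw [coe_mem_chainPlus hδ hδ1 hk', coe_mem_chainMinus hδ hδ1 hk']
  exact gadgetMap_mem_iff hδ (hz k)

/-- With `c` the affine coordinate of the point, the ratio of its squared distances to `1` and `-1`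
after `sphereMob` is `|c|²`. A point within `100 δ` of the integer therefore satisfies the condition
of `exists_nearBoth_cross`. -/
theorem transport_gadgetMap (hδ : 0 < δ) (ht : 0 < t) : ∃ x' y' t', 0 < t' ∧
    Transport (gadgetMap δ k) x y t x' y' t' ∧
    ((x - k) ^ 2 + y ^ 2 + t ^ 2 < (100 * δ) ^ 2 →
      (x' - 1) ^ 2 + y' ^ 2 + t' ^ 2 < 100 ^ 2 * ((x' + 1) ^ 2 + y' ^ 2 + t' ^ 2)) := by
  have h1 := transport_sphereAffine (x := x) (y := y) (t := t) (one_div_pos.2 hδ).ne' (-k / δ)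
  rw [abs_of_pos (one_div_pos.2 hδ)] at h1
  have ht1 : 0 < 1 / δ * t := by positivity
  refine ⟨_, _, _, ?_, h1.comp (transport_sphereMob ht1), fun h => ?_⟩
  · positivity
  obtain ⟨a, ha⟩ : ∃ a, a = 1 / δ * x + -k / δ := ⟨_, rfl⟩
  obtain ⟨b, hb⟩ : ∃ b, b = 1 / δ * y := ⟨_, rfl⟩
  obtain ⟨c, hc⟩ : ∃ c, c = 1 / δ * t := ⟨_, rfl⟩
  rw [← ha, ← hb, ← hc]
  have h2 : a ^ 2 + b ^ 2 + c ^ 2 < 100 ^ 2 := by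
    have : a ^ 2 + b ^ 2 + c ^ 2 = ((x - k) ^ 2 + y ^ 2 + t ^ 2) / δ ^ 2 := by
      rw [ha, hb, hc]; field_simp; ring
    rw [this, div_lt_iff₀ (by positivity)]; linarith
  have hN : 0 < (1 - a) ^ 2 + b ^ 2 + c ^ 2 := by
    have : 0 < c := hc ▸ ht1
    positivity
  have e1 : ((1 - (a ^ 2 + b ^ 2 + c ^ 2)) / ((1 - a) ^ 2 + b ^ 2 + c ^ 2) - 1) ^ 2 +
      (2 * b / ((1 - a) ^ 2 + b ^ 2 + c ^ 2)) ^ 2 + (2 * c / ((1 - a) ^ 2 + b ^ 2 + c ^ 2)) ^ 2 =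
      4 * (a ^ 2 + b ^ 2 + c ^ 2) / ((1 - a) ^ 2 + b ^ 2 + c ^ 2) := by
    field_simp; ring
  have e2 : ((1 - (a ^ 2 + b ^ 2 + c ^ 2)) / ((1 - a) ^ 2 + b ^ 2 + c ^ 2) + 1) ^ 2 +
      (2 * b / ((1 - a) ^ 2 + b ^ 2 + c ^ 2)) ^ 2 + (2 * c / ((1 - a) ^ 2 + b ^ 2 + c ^ 2)) ^ 2 =
      4 / ((1 - a) ^ 2 + b ^ 2 + c ^ 2) := by
    field_simp; ring
  rw [e1, e2, mul_div_assoc', div_lt_div_iff_of_pos_right hN]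
  linarith

/-- Being away from `-1` with constant `L` means that the affine coordinate is smaller than `L` in
modulus, so such caps stay in the strip of the integer `k`. -/
theorem abs_re_sub_le_of_gadgetMap_mem (hδ : 0 < δ) {q : OnePoint ℂ} {L : ℝ}
    (hL : L * δ ≤ 1 / 2) (hq : gadgetMap δ k q ∈ awayFromNegOne L) (hL0 : 1 ≤ L) :
    ∃ z : ℂ, (z : OnePoint ℂ) = q ∧ |z.re - k| ≤ 1 / 2 := by
  induction q using OnePoint.rec with
  | infty =>
    have : gadgetMap δ k OnePoint.infty = ((-1 : ℂ) : OnePoint ℂ) := rfl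
    rw [this, coe_mem_awayFromNegOne] at hq
    norm_num at hq
  | coe z =>
    refine ⟨z, rfl, ?_⟩
    rw [gadgetMap_coe] at hq
    have key : |(gadgetCoord δ k z).re| ≤ L := by
      set w := gadgetCoord δ k z
      by_cases hw : w = 1
      · rw [hw, Complex.one_re, abs_one]; exact hL0
      · have hN := mob_denom_pos hw
        rw [sphereMob_coe hw, coe_mem_awayFromNegOne, mob_re, mob_im] at hq
        have e1 : ((1 - w.re ^ 2 - w.im ^ 2) / ((1 - w.re) ^ 2 + w.im ^ 2) - 1) ^ 2 +
            (2 * w.im / ((1 - w.re) ^ 2 + w.im ^ 2)) ^ 2 =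
            4 * (w.re ^ 2 + w.im ^ 2) / ((1 - w.re) ^ 2 + w.im ^ 2) := by field_simp; ring
        have e2 : ((1 - w.re ^ 2 - w.im ^ 2) / ((1 - w.re) ^ 2 + w.im ^ 2) + 1) ^ 2 +
            (2 * w.im / ((1 - w.re) ^ 2 + w.im ^ 2)) ^ 2 = 4 / ((1 - w.re) ^ 2 + w.im ^ 2) := by
          field_simp; ring
        rw [e1, e2, mul_div_assoc', div_lt_div_iff_of_pos_right hN] at hq
        exact abs_le_of_sq_le_sq (by linarith [sq_nonneg w.im]) (by linarith)
    rw [gadgetCoord_re, abs_div, abs_of_pos hδ, div_le_iff₀ hδ] at key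
    linarith

/-- Round discs off the real axis, in the range of the curve where it is straight. -/
theorem roundDisc_chain {c d r : ℝ} (hδ : 0 < δ) (hδ1 : δ ≤ 1 / 100) (hr : 0 < r)
    (hD : ∀ k : ℤ, (r + 3 * δ) ^ 2 ≤ (c - k) ^ 2 + d ^ 2) :
    (r ≤ d → RoundDisc (chainMinus δ) c d r) ∧ (d ≤ -r → RoundDisc (chainPlus δ) c d r) := by
  have key : ∀ z : ℂ, (z.re - c) ^ 2 + (z.im - d) ^ 2 < r ^ 2 →
      ∀ k : ℤ, 9 * δ ^ 2 < (z.re - k) ^ 2 + z.im ^ 2 := by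
    intro z hz k
    by_contra! h
    have h1 := hD k
    obtain ⟨p, hp⟩ : ∃ p, p = (z.re - c) ^ 2 + (z.im - d) ^ 2 := ⟨_, rfl⟩
    have hcs : -((z.re - c) * (z.re - k) + (z.im - d) * z.im) ≤ r * (3 * δ) := by
      refine (neg_le_abs _).trans (abs_le_of_sq_le_sq ?_ (by positivity))
      calc ((z.re - c) * (z.re - k) + (z.im - d) * z.im) ^ 2 ≤
            ((z.re - c) ^ 2 + (z.im - d) ^ 2) * ((z.re - k) ^ 2 + z.im ^ 2) := by
              linarith [sq_nonneg ((z.re - c) * z.im - (z.im - d) * (z.re - k))]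
        _ ≤ r ^ 2 * (9 * δ ^ 2) := by gcongr
        _ = _ := by ring
    have h2 : (c - k) ^ 2 + d ^ 2 = ((z.re - c) ^ 2 + (z.im - d) ^ 2) +
      ((z.re - k) ^ 2 + z.im ^ 2) - 2 * ((z.re - c) * (z.re - k) + (z.im - d) * z.im) := by ring
    linarith
  refine ⟨fun hd z hz => (coe_mem_chain_of_far hδ hδ1 (key z hz)).2.2 ?_,
    fun hd z hz => (coe_mem_chain_of_far hδ hδ1 (key z hz)).1.2 ?_⟩
  · nlinarith [sq_nonneg (z.re - c)]
  · nlinarith [sq_nonneg (z.re - c)]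

theorem nearBoth_of_roundDisc {P M : Set (OnePoint ℂ)} {c d r : ℝ} (h : RoundDisc M c d r)
    (hr : 0 < r) (ht : 0 < t) (hκ : 0 < κ) (hv : (x - c) ^ 2 + (y - d) ^ 2 + t ^ 2 < r ^ 2) :
    NearBoth P M κ x y t :=
  ⟨Or.inr (h.reach hr (by
    have : 0 < 2 * κ * t * r := by positivity
    linarith)), Or.inl (h.deep hv)⟩

theorem NearBoth.symm {P M : Set (OnePoint ℂ)} (h : NearBoth P M κ x y t) : NearBoth M P κ x y t :=
  ⟨h.2, h.1⟩

theorem nearBoth_chain_of_far (hδ : 0 < δ) (hδ1 : δ ≤ 1 / 100) (ht : 0 < t) (hκ : 7 / 5 ≤ κ)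
    (hX : ∀ k : ℤ, (100 * δ) ^ 2 ≤ (x - k) ^ 2 + y ^ 2 + t ^ 2) :
    NearBoth (chainPlus δ) (chainMinus δ) κ x y t := by
  -- For `|y| < t/2` the discs of radius `t` around height `±11t/10` are both in reach, since
  -- `(8/5)² < 2 · 7/5`. Otherwise the disc of radius `3|y|` around height `16y/5` has the point
  -- under its hemisphere, since `(11/5)² + 2² < 3²`.
  rcases lt_or_ge |y| (t / 2) with h1 | h1
  · obtain ⟨h2, h3⟩ := abs_lt.1 h1
    have hy2 : y ^ 2 ≤ (t / 2) ^ 2 := by rw [← sq_abs]; gcongr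
    have hD : ∀ k : ℤ, (t + 3 * δ) ^ 2 ≤ (x - k) ^ 2 + (11 / 10 * t) ^ 2 := by
      intro k
      have := hX k
      rcases le_total t (80 * δ) with h4 | h4
      · nlinarith [mul_pos hδ ht]
      · nlinarith [sq_nonneg (x - k)]
    refine ⟨Or.inr (((roundDisc_chain hδ hδ1 ht hD).1 (by linarith)).reach ht ?_),
      Or.inr (((roundDisc_chain (d := -(11 / 10 * t)) hδ hδ1 ht (by simpa using hD)).2
        (by linarith)).reach ht ?_)⟩
    · nlinarith
    · nlinarith
  · have key : ∀ k : ℤ, (3 * |y| + 3 * δ) ^ 2 ≤ (x - k) ^ 2 + (16 / 5 * |y|) ^ 2 := by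
      intro k
      have := hX k
      have h2 : t ^ 2 ≤ (2 * |y|) ^ 2 := by gcongr; linarith
      rw [← sq_abs y] at this
      rcases le_total |y| (16 * δ) with h4 | h4
      · nlinarith [mul_nonneg hδ.le (abs_nonneg y)]
      · nlinarith [sq_nonneg (x - k)]
    have hy0 : 0 < |y| := by linarith
    rcases abs_cases y with ⟨h2, h3⟩ | ⟨h2, h3⟩ <;> rw [h2] at key h1 hy0
    · exact nearBoth_of_roundDisc ((roundDisc_chain hδ hδ1 (by linarith) key).1 (by linarith))
        (by linarith) ht (by linarith) (by nlinarith)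
    · refine (nearBoth_of_roundDisc ((roundDisc_chain (c := x) (d := 16 / 5 * y) hδ hδ1
        (by linarith : 0 < 3 * -y) ?_).2 (by linarith)) (by linarith) ht (by linarith)
        (by rw [sub_self]; nlinarith)).symm
      intro k
      have := key k
      rwa [show (16 / 5 * -y) ^ 2 = (16 / 5 * y) ^ 2 by ring] at this

/-- The choice `δ ≤ 1/(2L₀)` confines all caps used for one copy to its strip. Points farther than
`100 δ` from every integer see only a straight line, for which `7/5 < √2` is already enough. -/
theorem exists_nearBoth_chain (hκ : √2 < κ) : ∃ δ, 0 < δ ∧ δ ≤ 1 / 100 ∧ ∀ x y t : ℝ, 0 < t →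
    NearBoth (chainPlus δ) (chainMinus δ) κ x y t := by
  obtain ⟨L₀, hL₀, hL⟩ := exists_nearBoth_cross hκ
  have hδ : 0 < min (1 / 100) (1 / (2 * L₀)) := by positivity
  have hδL : L₀ * min (1 / 100) (1 / (2 * L₀)) ≤ 1 / 2 := by
    calc _ ≤ L₀ * (1 / (2 * L₀)) := by gcongr; exact min_le_right _ _
      _ = 1 / 2 := by field_simp
  have hδ1 : min (1 / 100) (1 / (2 * L₀)) ≤ (1 / 100 : ℝ) := min_le_left _ _
  set δ := min (1 / 100) (1 / (2 * L₀))
  refine ⟨δ, hδ, hδ1, fun x y t ht => ?_⟩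
  by_cases hX : ∀ k : ℤ, (100 * δ) ^ 2 ≤ (x - k) ^ 2 + y ^ 2 + t ^ 2
  · refine nearBoth_chain_of_far hδ hδ1 ht ?_ hX
    have : 7 / 5 ≤ √2 := Real.le_sqrt_of_sq_le (by norm_num)
    linarith
  · push Not at hX
    obtain ⟨k, hk⟩ := hX
    obtain ⟨x', y', t', ht', hT, hX'⟩ := transport_gadgetMap (k := k) (x := x) (y := y) hδ ht
    refine (hL L₀ le_rfl (1 / neck k) (neck k) x' y' t' (one_div_neck_pos k)
      (by linarith [one_div_neck_le k]) (one_div_neck_mul k) ht' (hX' hk)).of_transport hT ?_ ?_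
    · rintro q ⟨h1, h2⟩
      obtain ⟨z, rfl, hz⟩ := abs_re_sub_le_of_gadgetMap_mem hδ hδL h2 hL₀
      exact (coe_mem_chainPlus hδ hδ1 (by linarith)).2 h1
    · rintro q ⟨h1, h2⟩
      obtain ⟨z, rfl, hz⟩ := abs_re_sub_le_of_gadgetMap_mem hδ hδL h2 hL₀
      exact (coe_mem_chainMinus hδ hδ1 (by linarith)).2 h1
end

/-! ### The two sides of the chain -/

section
variable {e n L δ : ℝ} {z w : ℂ} {k : ℤ}

theorem segment_subset_zeroSide (he : 0 < e) (hen : e ≤ n) (hw : w ∈ zeroSide e n) :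
    segment ℝ 0 w ⊆ zeroSide e n := by
  rw [segment_eq_image]
  rintro _ ⟨s, ⟨hs0, hs1⟩, rfl⟩
  simp only [smul_zero, zero_add, Complex.real_smul]
  rcases hs0.eq_or_lt with rfl | hs0
  · simpa using zero_mem_zeroSide (n := n) he
  · exact smul_mem_zeroSide he hen hw hs0 hs1

/-- The part of the side of zero that stays away from `-1` is connected. -/
theorem isPreconnected_zeroSide_away (he : 0 < e) (he2 : e ≤ 1 / 6) (hn : 6 ≤ n) (hL : 4 ≤ L) :
    IsPreconnected {w : ℂ | w ∈ zeroSide e n ∧ (w : OnePoint ℂ) ∈ awayFromNegOne L} := by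
  have hen : e ≤ n := by linarith
  have hL2 : 16 ≤ L ^ 2 := by nlinarith
  have away : ∀ w : ℂ, 1 / 2 ≤ (w.re + 1) ^ 2 + w.im ^ 2 → (w : OnePoint ℂ) ∈ awayFromNegOne L :=
    fun w hw => mem_awayFromNegOne_of_le hw (by norm_num) (by linarith)
  have hre : ∀ w : ℂ, -(1 / 4) ≤ w.re → (w : OnePoint ℂ) ∈ awayFromNegOne L := fun w hw =>
    away w (by nlinarith [sq_nonneg w.im])
  set S := {w : ℂ | w ∈ zeroSide e n ∧ (w : OnePoint ℂ) ∈ awayFromNegOne L} with hS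
  have h0 : (0 : ℂ) ∈ S := ⟨zero_mem_zeroSide he, hre 0 (by norm_num)⟩
  -- the centre of the large disc
  have hc : (⟨-n, n⟩ : ℂ) ∈ zeroSide e n := by
    rw [← neg_mem_zeroSide]
    exact mem_zeroSide_of_disc hen (s := n) (by linarith) le_rfl (by simp; nlinarith)
  have hcS : segment ℝ 0 (⟨-n, n⟩ : ℂ) ⊆ S := fun w hw => by
    refine ⟨segment_subset_zeroSide he hen hc hw, away w ?_⟩
    rw [segment_eq_image] at hw
    obtain ⟨s, -, rfl⟩ := hw
    simp
    nlinarith [sq_nonneg (2 * (s * n) - 1)]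
  have hq : ∀ w : ℂ, w.re < 0 → 0 < w.im → (w ∈ zeroSide e n ↔
      (-n < w.re ∧ w.im < n) ∨ (w.re + n) ^ 2 + (w.im - n) ^ 2 < n ^ 2) := fun w h1 h2 => by
    rw [← neg_mem_zeroSide, mem_zeroSide_of_pos_neg hen (by simpa using h1) (by simpa using h2)]
    simp only [Complex.neg_re, Complex.neg_im, neg_lt_neg_iff]
    rw [show (-w.re - n) ^ 2 + (-w.im + n) ^ 2 = (w.re + n) ^ 2 + (w.im - n) ^ 2 by ring,
      neg_lt]
  -- points in the large disc, at height at least `n` or left of `-n`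
  have hdisc : ∀ w : ℂ, (w.re + n) ^ 2 + (w.im - n) ^ 2 < n ^ 2 → (n ≤ w.im ∨ w.re ≤ -n) →
      segment ℝ w ⟨-n, n⟩ ⊆ S := fun w h1 h2 v hv => by
    rw [segment_eq_image] at hv
    obtain ⟨s, ⟨hs0, hs1⟩, rfl⟩ := hv
    set v := (1 - s) • w + s • (⟨-n, n⟩ : ℂ)
    have e1 : v.re = (1 - s) * w.re + s * -n := by simp [v]
    have e2 : v.im = (1 - s) * w.im + s * n := by simp [v]
    have h3 : (v.re + n) ^ 2 + (v.im - n) ^ 2 < n ^ 2 := by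
      have : (v.re + n) ^ 2 + (v.im - n) ^ 2 = (1 - s) ^ 2 * ((w.re + n) ^ 2 + (w.im - n) ^ 2) := by
        rw [e1, e2]; ring
      rw [this]
      have : (1 - s) ^ 2 ≤ 1 := by nlinarith
      nlinarith [sq_nonneg (w.re + n), sq_nonneg (w.im - n), sq_nonneg (1 - s)]
    have h4 : v.re < 0 := by nlinarith [sq_nonneg (v.im - n)]
    have h5 : 0 < v.im := by nlinarith [sq_nonneg (v.re + n)]
    refine ⟨(hq v h4 h5).2 (Or.inr h3), away v ?_⟩
    rcases h2 with h2 | h2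
    · have : n ≤ v.im := by rw [e2]; nlinarith
      nlinarith [sq_nonneg (v.re + 1)]
    · have : v.re ≤ -n := by rw [e1]; nlinarith
      nlinarith [sq_nonneg v.im]
  have hseg : ∀ a b : ℂ, IsPreconnected (segment ℝ a b) := fun a b => (convex_segment a b).isPreconnected
  refine isPreconnected_of_forall 0 fun w hw => ?_
  by_cases hw1 : -(1 / 4) ≤ w.re
  · refine ⟨segment ℝ 0 w, fun v hv => ⟨segment_subset_zeroSide he hen hw.1 hv, hre v ?_⟩,
      left_mem_segment ℝ _ _, right_mem_segment ℝ _ _, hseg _ _⟩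
    rw [segment_eq_image] at hv
    obtain ⟨s, ⟨hs0, hs1⟩, rfl⟩ := hv
    simp only [smul_zero, zero_add, Complex.real_smul, Complex.re_ofReal_mul]
    nlinarith
  push Not at hw1
  have hre0 : w.re < 0 := by linarith
  have him : 0 < w.im := by
    rcases hw.1 with ⟨h1, -⟩ | ⟨h1, -⟩
    · rw [abs_lt] at h1; linarith
    · nlinarith
  have hbig : ∀ a : ℂ, (a.re + n) ^ 2 + (a.im - n) ^ 2 < n ^ 2 → (n ≤ a.im ∨ a.re ≤ -n) →
      IsPreconnected (segment ℝ a ⟨-n, n⟩ ∪ segment ℝ 0 (⟨-n, n⟩ : ℂ)) := fun a _ _ =>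
    (hseg _ _).union _ (right_mem_segment ℝ _ _) (right_mem_segment ℝ _ _) (hseg _ _)
  by_cases hsq : -n < w.re ∧ w.im < n
  -- Inside the square of the second quadrant the route goes vertically up to height `n`, which only
  -- increases the distance from `-1`, then to the centre of the large disc, and back to the origin
  -- along the diagonal.
  · have ha : ((⟨w.re, n⟩ : ℂ).re + n) ^ 2 + ((⟨w.re, n⟩ : ℂ).im - n) ^ 2 < n ^ 2 := by
      simp only; nlinarith
    refine ⟨segment ℝ w ⟨w.re, n⟩ ∪ (segment ℝ ⟨w.re, n⟩ ⟨-n, n⟩ ∪ segment ℝ 0 ⟨-n, n⟩),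
      Set.union_subset (fun v hv => ?_) (Set.union_subset (hdisc _ ha (Or.inl le_rfl)) hcS),
      Or.inr (Or.inr (left_mem_segment ℝ _ _)), Or.inl (left_mem_segment ℝ _ _),
      (hseg _ _).union _ (right_mem_segment ℝ _ _) (Or.inl (left_mem_segment ℝ _ _))
        (hbig _ ha (Or.inl le_rfl))⟩
    rw [segment_eq_image] at hv
    obtain ⟨s, ⟨hs0, hs1⟩, rfl⟩ := hv
    set v := (1 - s) • w + s • (⟨w.re, n⟩ : ℂ)
    have e1 : v.re = w.re := by simp [v]; ring
    have e2 : v.im = (1 - s) * w.im + s * n := by simp [v]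
    have e3 : w.im ≤ v.im := by rw [e2]; nlinarith
    have e4 : v.im ≤ n := by rw [e2]; nlinarith
    refine ⟨(hq v (by linarith) (by linarith)).2 ?_, ?_⟩
    · rw [e1]
      rcases e4.lt_or_eq with h | h
      · exact Or.inl ⟨hsq.1, h⟩
      · right; rw [h]; nlinarith
    · have := coe_mem_awayFromNegOne.1 hw.2
      rw [coe_mem_awayFromNegOne]
      change (v.re - 1) ^ 2 + v.im ^ 2 < L ^ 2 * ((v.re + 1) ^ 2 + v.im ^ 2)
      rw [e1]
      have : w.im ^ 2 ≤ v.im ^ 2 := by gcongr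
      nlinarith
  · have hd : (w.re + n) ^ 2 + (w.im - n) ^ 2 < n ^ 2 := ((hq w hre0 him).1 hw.1).resolve_left hsq
    have hor : n ≤ w.im ∨ w.re ≤ -n := by
      by_contra! h
      exact hsq ⟨h.2, h.1⟩
    exact ⟨_, Set.union_subset (hdisc w hd hor) hcS, Or.inr (left_mem_segment ℝ _ _),
      Or.inl (left_mem_segment ℝ _ _), hbig w hd hor⟩

/-- The inverse of `gadgetMap`. -/
noncomputable def gadgetInv (δ : ℝ) (k : ℤ) (w : ℂ) : ℂ := k + δ * ((w - 1) / (w + 1))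

theorem gadgetMap_gadgetInv (hδ : 0 < δ) (hw : w ≠ -1) :
    gadgetMap δ k (gadgetInv δ k w) = (w : OnePoint ℂ) := by
  have hw1 : w + 1 ≠ 0 := fun h => hw (eq_neg_of_add_eq_zero_left h)
  have hδ' : (δ : ℂ) ≠ 0 := by exact_mod_cast hδ.ne'
  have h1 : gadgetCoord δ k (gadgetInv δ k w) = (w - 1) / (w + 1) := by
    rw [gadgetCoord, gadgetInv]; push_cast; field_simp; ring
  have h2 : (w - 1) / (w + 1) ≠ 1 := by
    rw [Ne, div_eq_one_iff_eq hw1]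
    intro h
    have : (-1 : ℂ) = 1 := by linear_combination h
    norm_num at this
  have h3 : 1 - (w - 1) / (w + 1) = 2 / (w + 1) := by field_simp; ring
  rw [gadgetMap_coe, h1, sphereMob_coe h2, h3]
  congr 1; field_simp; ring

theorem gadgetInv_eq (hδ : 0 < δ) (h : gadgetMap δ k z = (w : OnePoint ℂ)) :
    gadgetInv δ k w = z := by
  have hδ' : (δ : ℂ) ≠ 0 := by exact_mod_cast hδ.ne'
  rw [gadgetMap_coe] at h
  have h1 : gadgetCoord δ k z ≠ 1 := fun h1 => by
    rw [h1, sphereMob_one] at h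
    exact OnePoint.coe_ne_infty _ h.symm
  rw [sphereMob_coe h1] at h
  have h2 := OnePoint.coe_injective h
  have h3 : 1 - gadgetCoord δ k z ≠ 0 := sub_ne_zero.2 h1.symm
  have h4 : (w - 1) / (w + 1) = gadgetCoord δ k z := by
    rw [← h2, div_add_one h3, div_sub_one h3, div_div_div_cancel_right₀ h3]
    ring
  rw [gadgetInv, h4, gadgetCoord]; push_cast; field_simp; ring

theorem isOpen_chain {S : ℤ → Set (OnePoint ℂ)} (hδ : 0 < δ) (hS : ∀ k, IsOpen (S k)) :
    IsOpen (((↑) : ℂ → OnePoint ℂ) '' {z | ∃ k : ℤ, |z.re - k| < 9 / 10 ∧ gadgetMap δ k z ∈ S k}) := by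
  refine OnePoint.isOpenEmbedding_coe.isOpenMap _ ?_
  have : {z : ℂ | ∃ k : ℤ, |z.re - k| < 9 / 10 ∧ gadgetMap δ k z ∈ S k} =
      ⋃ k : ℤ, {z : ℂ | |z.re - k| < 9 / 10} ∩ (fun z : ℂ => gadgetMap δ k z) ⁻¹' S k := by
    ext z; simp
  rw [this]
  refine isOpen_iUnion fun k => (isOpen_lt (by fun_prop) continuous_const).inter ((hS k).preimage ?_)
  exact (continuous_sphereMob.comp (continuous_sphereAffine (one_div_pos.2 hδ).ne' _)).comp
    OnePoint.continuous_coe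

/-- Moving straight up never approaches the excluded discs around the integers and ends in a
half-plane. -/
theorem isPreconnected_upper (hδ : 0 < δ) (hδ1 : δ ≤ 1 / 100) :
    IsPreconnected {z : ℂ | 0 < z.im ∧ ∀ k : ℤ, 9 * δ ^ 2 < (z.re - k) ^ 2 + z.im ^ 2} := by
  refine isPreconnected_of_forall Complex.I fun z hz => ?_
  have hH : {z : ℂ | 1 / 2 < z.im} ⊆
      {z : ℂ | 0 < z.im ∧ ∀ k : ℤ, 9 * δ ^ 2 < (z.re - k) ^ 2 + z.im ^ 2} := by
    intro z hz
    have hz : 1 / 2 < z.im := hz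
    exact ⟨by linarith, fun k => by nlinarith [sq_nonneg (z.re - k)]⟩
  have hconv : IsPreconnected {z : ℂ | 1 / 2 < z.im} := (convex_halfSpace_im_gt _).isPreconnected
  refine ⟨segment ℝ z (z + Complex.I) ∪ {z : ℂ | 1 / 2 < z.im}, Set.union_subset ?_ hH,
    Or.inr (by norm_num), Or.inl (left_mem_segment ℝ _ _),
    (convex_segment _ _).isPreconnected.union (z + Complex.I) (right_mem_segment ℝ _ _) ?_ hconv⟩
  · rintro v hv
    rw [segment_eq_image] at hv
    obtain ⟨s, ⟨hs0, hs1⟩, rfl⟩ := hv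
    have e1 : ((1 - s) • z + s • (z + Complex.I)).re = z.re := by simp; ring
    have e2 : ((1 - s) • z + s • (z + Complex.I)).im = z.im + s := by simp; ring
    refine ⟨by rw [e2]; linarith [hz.1], fun k => ?_⟩
    rw [e1, e2]
    nlinarith [hz.1, hz.2 k]
  · have := hz.1
    simp; linarith

/-- The upper side is the union of the upper half plane outside the small discs and of one piece for
each integer, the pullback of the side of zero away from `-1`. Each piece meets the first set at
height `1/4`. -/
theorem isPreconnected_chainMinus (hδ : 0 < δ) (hδ1 : δ ≤ 1 / 100) :
    IsPreconnected (chainMinus δ) := by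
  obtain ⟨U, hU⟩ : ∃ U, U = {z : ℂ | 0 < z.im ∧ ∀ k : ℤ, 9 * δ ^ 2 < (z.re - k) ^ 2 + z.im ^ 2} :=
    ⟨_, rfl⟩
  obtain ⟨W, hW⟩ : ∃ W : ℤ → Set ℂ, W = fun k => gadgetInv δ k ''
    {w : ℂ | w ∈ zeroSide (1 / neck k) (neck k) ∧ (w : OnePoint ℂ) ∈ awayFromNegOne (1 / (2 * δ))} :=
    ⟨_, rfl⟩
  have hL : 4 ≤ 1 / (2 * δ) := by rw [le_div_iff₀ (by positivity)]; linarith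
  have hLδ : 1 / (2 * δ) * δ ≤ 1 / 2 := by
    rw [one_div_mul_eq_div, div_le_iff₀ (by positivity)]; linarith
  have hne : ∀ w : ℂ, (w : OnePoint ℂ) ∈ awayFromNegOne (1 / (2 * δ)) → w ≠ -1 := by
    rintro w hw rfl
    rw [coe_mem_awayFromNegOne] at hw
    norm_num at hw
  have hUc : IsPreconnected U := hU ▸ isPreconnected_upper hδ hδ1
  have hWc : ∀ k, IsPreconnected (W k) := fun k => by
    rw [hW]
    refine (isPreconnected_zeroSide_away (one_div_neck_pos k) (one_div_neck_le k) (six_le_neck k)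
      hL).image _ fun w hw => ContinuousAt.continuousWithinAt ?_
    have : w + 1 ≠ 0 := fun h => hne w hw.2 (eq_neg_of_add_eq_zero_left h)
    unfold gadgetInv
    fun_prop (disch := assumption)
  have hWM : ∀ k, W k ⊆ {z : ℂ | (z : OnePoint ℂ) ∈ chainMinus δ} := by
    rintro k z hz
    rw [hW] at hz
    obtain ⟨w, ⟨hw1, hw2⟩, rfl⟩ := hz
    have h1 := gadgetMap_gadgetInv (k := k) hδ (hne w hw2)
    obtain ⟨v, hv, hvk⟩ := abs_re_sub_le_of_gadgetMap_mem (k := k) hδ hLδ (h1 ▸ hw2) (by linarith)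
    rw [OnePoint.coe_injective hv] at hvk
    rw [Set.mem_ofPred_eq, coe_mem_chainMinus (k := k) hδ hδ1 (by linarith), h1, coe_mem_crossMinus]
    exact hw1
  have hUM : U ⊆ {z : ℂ | (z : OnePoint ℂ) ∈ chainMinus δ} := by
    intro z hz
    rw [hU] at hz
    exact (coe_mem_chain_of_far hδ hδ1 hz.2).2.2 hz.1
  have hmemW : ∀ z : ℂ, ∀ k : ℤ, gadgetMap δ k z ∈ crossMinus (1 / neck k) (neck k) →
      (z.re - k) ^ 2 + z.im ^ 2 < (1 / 2) ^ 2 → z ∈ W k := by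
    intro z k hz hzk
    obtain ⟨w, hw, hwz⟩ := hz
    have h1 : (w : OnePoint ℂ) ∈ awayFromNegOne (1 / (2 * δ)) := by
      rw [gadgetMap_coe] at hwz
      have hc1 : gadgetCoord δ k z ≠ 1 := fun h1 => by
        rw [h1, sphereMob_one] at hwz
        exact OnePoint.coe_ne_infty _ hwz
      have hN := mob_denom_pos hc1
      rw [sphereMob_coe hc1] at hwz
      rw [OnePoint.coe_injective hwz, coe_mem_awayFromNegOne, mob_re, mob_im]
      have hc2 : (gadgetCoord δ k z).re ^ 2 + (gadgetCoord δ k z).im ^ 2 < (1 / (2 * δ)) ^ 2 := by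
        rw [gadgetCoord_re, gadgetCoord_im, div_pow, div_pow, ← add_div, div_lt_iff₀ (by positivity)]
        calc _ < (1 / 2 : ℝ) ^ 2 := hzk
          _ = _ := by field_simp
      set c := gadgetCoord δ k z
      have e1 : ((1 - c.re ^ 2 - c.im ^ 2) / ((1 - c.re) ^ 2 + c.im ^ 2) - 1) ^ 2 +
          (2 * c.im / ((1 - c.re) ^ 2 + c.im ^ 2)) ^ 2 =
          4 * (c.re ^ 2 + c.im ^ 2) / ((1 - c.re) ^ 2 + c.im ^ 2) := by field_simp; ring
      have e2 : ((1 - c.re ^ 2 - c.im ^ 2) / ((1 - c.re) ^ 2 + c.im ^ 2) + 1) ^ 2 +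
          (2 * c.im / ((1 - c.re) ^ 2 + c.im ^ 2)) ^ 2 = 4 / ((1 - c.re) ^ 2 + c.im ^ 2) := by
        field_simp; ring
      rw [e1, e2, mul_div_assoc', div_lt_div_iff_of_pos_right hN]
      linarith
    rw [hW]
    exact ⟨w, ⟨hw, h1⟩, gadgetInv_eq hδ hwz.symm⟩
  have hcover : ∀ z : ℂ, (z : OnePoint ℂ) ∈ chainMinus δ → z ∈ U ∪ ⋃ k, W k := by
    intro z hz
    by_cases h : ∀ k : ℤ, 9 * δ ^ 2 < (z.re - k) ^ 2 + z.im ^ 2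
    · left
      rw [hU]
      exact ⟨(coe_mem_chain_of_far hδ hδ1 h).2.1 hz, h⟩
    · push Not at h
      obtain ⟨k, hk⟩ := h
      have h1 : (z.re - k) ^ 2 + z.im ^ 2 < (1 / 2) ^ 2 := by nlinarith
      have h2 : |z.re - k| < 1 / 2 := abs_lt_of_sq_lt_sq (by linarith [sq_nonneg z.im]) (by norm_num)
      rw [coe_mem_chainMinus (k := k) hδ hδ1 (by linarith)] at hz
      exact Or.inr (Set.mem_iUnion.2 ⟨k, hmemW z k hz h1⟩)
  have heq : chainMinus δ = ((↑) : ℂ → OnePoint ℂ) '' (U ∪ ⋃ k, W k) := by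
    refine Set.Subset.antisymm ?_ ?_
    · rintro q hq
      obtain ⟨z, -, rfl⟩ := id hq
      exact ⟨z, hcover z hq, rfl⟩
    · rintro _ ⟨z, hz | hz, rfl⟩
      · exact hUM hz
      · obtain ⟨k, hk⟩ := Set.mem_iUnion.1 hz
        exact hWM k hk
  rw [heq]
  refine IsPreconnected.image ?_ _ OnePoint.continuous_coe.continuousOn
  rw [Set.union_iUnion]
  refine isPreconnected_iUnion ⟨Complex.I, Set.mem_iInter.2 fun k => Or.inl ?_⟩ fun k => ?_
  · rw [hU]
    exact ⟨by norm_num, fun k => by rw [Complex.I_im]; nlinarith [sq_nonneg (Complex.I.re - k)]⟩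
  · -- a common point of the upper region and the neighbourhood of the integer `k`
    have hp : (⟨k, 1 / 4⟩ : ℂ) ∈ U := by
      rw [hU]
      refine ⟨by norm_num, fun j => ?_⟩
      simp only
      nlinarith [sq_nonneg ((k : ℝ) - j)]
    refine hUc.union _ hp (hmemW _ k ?_ ?_) (hWc k)
    · rw [← coe_mem_chainMinus hδ hδ1 (by simp)]
      exact hUM hp
    · norm_num

theorem neck_neg (k : ℤ) : neck (-k) = neck k := by rw [neck, neck]; push_cast; rw [abs_neg]

/-- Negation in the affine coordinate becomes inversion in the coordinate of the cross. -/
theorem gadgetMap_neg (δ : ℝ) (k : ℤ) (z : ℂ) :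
    gadgetMap δ (-k) ((-z : ℂ) : OnePoint ℂ) = sphereInv (gadgetMap δ k z) := by
  have h : gadgetCoord δ (-k) (-z) = -gadgetCoord δ k z := by
    rw [gadgetCoord, gadgetCoord]; push_cast; ring
  rw [gadgetMap_coe, gadgetMap_coe, h]
  set c := gadgetCoord δ k z
  by_cases hc : c = 1
  · rw [hc, sphereMob_one, sphereInv_infty, sphereMob_coe (by norm_num)]; norm_num
  by_cases hc' : c = -1
  · rw [hc', neg_neg, sphereMob_one, sphereMob_coe (by norm_num)]
    norm_num [sphereInv_zero]
  have h1 : -c ≠ 1 := fun h => hc' (by rw [← h, neg_neg])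
  have h2 : 1 + c ≠ 0 := fun h => hc' (eq_neg_of_add_eq_zero_right h)
  have h3 : 1 - c ≠ 0 := sub_ne_zero.2 (Ne.symm hc)
  rw [sphereMob_coe hc, sphereMob_coe h1, sphereInv_coe (div_ne_zero h2 h3), inv_div, sub_neg_eq_add,
    ← sub_eq_add_neg]

theorem sphereInv_mem_crossPlus_iff {e n : ℝ} (he : 0 < e) (hen : e ≤ n) (h1 : e * n = 1)
    (q : OnePoint ℂ) : sphereInv q ∈ crossPlus e n ↔ q ∈ crossMinus e n := by
  have hM : ∀ q ∈ crossMinus e n, sphereInv q ∈ crossPlus e n := fun q hq => by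
    obtain ⟨z, hz, rfl⟩ := hq
    by_cases hz0 : z = 0
    · rw [hz0, sphereInv_zero]; exact infty_mem_crossPlus
    · rw [sphereInv_coe hz0, coe_mem_crossPlus]
      exact inv_mem_farSide he hen h1 hz hz0
  have hP : ∀ q ∈ crossPlus e n, sphereInv q ∈ crossMinus e n := fun q hq => by
    rcases hq with rfl | ⟨z, hz, rfl⟩
    · rw [sphereInv_infty, coe_mem_crossMinus]; exact zero_mem_zeroSide he
    · have hz0 : z ≠ 0 := by
        rintro rfl
        rcases mem_cross_trichotomy he hen 0 with h | h | h
        · exact h.2.1 hz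
        · exact h.1 (zero_mem_zeroSide he)
        · exact h.2.1 hz
      rw [sphereInv_coe hz0, coe_mem_crossMinus]
      exact inv_mem_zeroSide he hen h1 hz
  exact ⟨fun h => sphereInv_sphereInv q ▸ hP _ h, hM q⟩

/-- Negation maps the copy at `k` to the copy at `-k`, which has the same neck parameter, and the
resulting inversion exchanges the sides of the cross. This spares a second proof of connectedness.
-/
theorem chainPlus_eq (hδ : 0 < δ) (hδ1 : δ ≤ 1 / 100) :
    chainPlus δ = sphereAffine (-1) 0 '' chainMinus δ := by
  have key : ∀ z : ℂ, ((-z : ℂ) : OnePoint ℂ) ∈ chainPlus δ ↔ (z : OnePoint ℂ) ∈ chainMinus δ := by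
    intro z
    obtain ⟨k, hk⟩ := exists_abs_sub_le z.re
    have hk' : |(-z).re - ((-k : ℤ) : ℝ)| < 9 / 10 := by
      rw [Complex.neg_re]; push_cast
      rw [← abs_neg, show -(-z.re - -(k : ℝ)) = z.re - k by ring]; linarith
    rw [coe_mem_chainPlus hδ hδ1 hk', coe_mem_chainMinus hδ hδ1 (by linarith : |z.re - k| < 9 / 10),
      gadgetMap_neg, neck_neg, sphereInv_mem_crossPlus_iff (one_div_neck_pos k)
      (one_div_neck_le_neck k) (one_div_neck_mul k)]
  refine Set.Subset.antisymm ?_ ?_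
  · intro q hq
    obtain ⟨z, -, rfl⟩ := id hq
    refine ⟨((-z : ℂ) : OnePoint ℂ), (key (-z)).1 (by rwa [neg_neg]), ?_⟩
    rw [sphereAffine_neg_one_coe, neg_neg]
  · rintro _ ⟨q, hq, rfl⟩
    obtain ⟨z, -, rfl⟩ := id hq
    rw [sphereAffine_neg_one_coe]
    exact (key z).2 hq

theorem infty_mem_chainCurve (δ : ℝ) : OnePoint.infty ∈ chainCurve δ := by
  rintro (⟨z, -, h⟩ | ⟨z, -, h⟩) <;> exact OnePoint.coe_ne_infty _ h

theorem isSides_chain (hδ : 0 < δ) (hδ1 : δ ≤ 1 / 100) :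
    IsSides (chainCurve δ) (chainPlus δ) (chainMinus δ) := by
  have hP : IsOpen (chainPlus δ) := isOpen_chain hδ fun k =>
    isOpen_crossPlus (one_div_neck_le_neck k) (neck_pos k)
  have hM : IsOpen (chainMinus δ) := isOpen_chain hδ fun k => isOpen_crossMinus
  refine ⟨(hP.union hM).isClosed_compl, ⟨_, infty_mem_chainCurve δ⟩, hP, hM, ?_, ?_,
    isPreconnected_chainMinus hδ hδ1, by rw [chainCurve, compl_compl]⟩
  · rw [Set.disjoint_left]
    rintro q hq hq'
    obtain ⟨z, -, rfl⟩ := id hq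
    obtain ⟨k, hk⟩ := exists_abs_sub_le z.re
    have hk' : |z.re - k| < 9 / 10 := by linarith
    rw [coe_mem_chainPlus hδ hδ1 hk'] at hq
    rw [coe_mem_chainMinus hδ hδ1 hk'] at hq'
    exact Set.disjoint_left.1 (isSides_cross (one_div_neck_pos k)
      (one_div_neck_le_neck k) (one_div_neck_mul k)).disjoint hq hq'
  · rw [chainPlus_eq hδ hδ1]
    exact (isPreconnected_chainMinus hδ hδ1).image _
      (continuous_sphereAffine (by norm_num) 0).continuousOn

theorem coe_mem_chainCurve (hδ : 0 < δ) (hδ1 : δ ≤ 1 / 100) (hk : |z.re - k| < 9 / 10) :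
    (z : OnePoint ℂ) ∈ chainCurve δ ↔
      ∃ w ∈ crossSet (1 / neck k) (neck k), (w : OnePoint ℂ) = gadgetMap δ k z := by
  rw [chainCurve, Set.mem_compl_iff, Set.mem_union, coe_mem_chainPlus hδ hδ1 hk,
    coe_mem_chainMinus hδ hδ1 hk]
  induction gadgetMap δ k z using OnePoint.rec with
  | infty =>
    constructor
    · intro h; exact (h (Or.inl infty_mem_crossPlus)).elim
    · rintro ⟨w, -, h⟩; exact (OnePoint.coe_ne_infty _ h).elim
  | coe w =>
    have := crossPlus_or_crossMinus_or (one_div_neck_pos k) (one_div_neck_le_neck k) w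
    constructor
    · intro h
      refine ⟨w, ?_, rfl⟩
      rcases this with h1 | h1 | h1
      exacts [(h (Or.inl h1.1)).elim, (h (Or.inr h1.2.1)).elim, h1.2.2]
    · rintro ⟨v, hv, h⟩
      rw [OnePoint.coe_injective h] at hv
      rintro (h' | h')
      all_goals rcases this with h1 | h1 | h1
      exacts [h1.2.2 hv, h1.1 h', h1.1 h', h1.2.2 hv, h1.2.2 hv, h1.2.1 h']

end

theorem exists_chainCurve_boundaryWidth_le {κ : ℝ} (hκ : √2 < κ) : ∃ δ, 0 < δ ∧ δ ≤ 1 / 100 ∧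
    boundaryWidth (chainCurve δ) ≤ ENNReal.ofReal (Real.arsinh κ) := by
  obtain ⟨δ, hδ, hδ1, h⟩ := exists_nearBoth_chain hκ
  exact ⟨δ, hδ, hδ1, (isSides_chain hδ hδ1).boundaryWidth_le ((Real.sqrt_nonneg 2).trans hκ.le)
    (fun x y t ht => (h x y t ht).1) (fun x y t ht => (h x y t ht).2)⟩

/-! ### The necks of the chain. -/

section
variable {δ r : ℝ} {z : ℂ} {k : ℤ}

theorem isArc_circle_image (q : ℂ) {r α : ℝ} (hr : 0 < r) (hα : 0 < α) (hαπ : α ≤ Real.pi) :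
    IsArc ((fun θ : ℝ => q + r * Complex.exp (θ * Complex.I)) '' Set.Icc 0 α) := by
  refine ⟨fun t => q + r * Complex.exp (((t * α : ℝ) : ℂ) * Complex.I), by fun_prop, ?_, ?_⟩
  · intro s t hst
    have h1 : Complex.exp (((s * α : ℝ) : ℂ) * Complex.I) =
        Complex.exp (((t * α : ℝ) : ℂ) * Complex.I) :=
      mul_left_cancel₀ (by exact_mod_cast hr.ne' : (r : ℂ) ≠ 0) (add_left_cancel hst)
    have h2 := congrArg Complex.re h1
    rw [Complex.exp_ofReal_mul_I_re, Complex.exp_ofReal_mul_I_re] at h2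
    have hI : ∀ u : unitInterval, (u : ℝ) * α ∈ Set.Icc 0 Real.pi := fun u =>
      ⟨mul_nonneg u.2.1 hα.le, by nlinarith [u.2.1, u.2.2]⟩
    exact Subtype.ext (mul_right_cancel₀ hα.ne' (Real.injOn_cos (hI s) (hI t) h2))
  · ext z
    constructor
    · rintro ⟨t, rfl⟩
      exact ⟨t * α, ⟨mul_nonneg t.2.1 hα.le, by nlinarith [t.2.1, t.2.2]⟩, rfl⟩
    · rintro ⟨θ, hθ, rfl⟩
      refine ⟨⟨θ / α, by have := hθ.1; positivity, (div_le_one hα).2 hθ.2⟩, ?_⟩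
      simp only
      rw [div_mul_cancel₀ _ hα.ne']

/-- In the coordinate of the cross the half disc becomes the closed first quadrant: the real axis
and the circle of radius `δ` around `k` go to the two axes, and `k - δ` goes to the throat at `0`.
The bounds on the distance from `k - δ` keep the image in the annulus. -/
theorem mem_chainPlus_of_mem_lens (hδ : 0 < δ) (hδ1 : δ ≤ 1 / 100) (hy : 0 ≤ z.im)
    (h1 : (z.re - k) ^ 2 + z.im ^ 2 ≤ δ ^ 2)
    (h2 : (1 / 2 * δ) ^ 2 ≤ (z.re - k + δ) ^ 2 + z.im ^ 2)
    (h3 : (z.re - k + δ) ^ 2 + z.im ^ 2 < δ ^ 2) :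
    ((z : OnePoint ℂ) ∈ chainPlus δ ∪ chainCurve δ) ∧
    ((z.im = 0 ∨ (z.re - k) ^ 2 + z.im ^ 2 = δ ^ 2) → (z : OnePoint ℂ) ∈ chainCurve δ) := by
  have hzk : |z.re - k| < 9 / 10 := by
    rw [abs_lt]; constructor <;> nlinarith [sq_nonneg z.im]
  obtain ⟨c, hc⟩ : ∃ c, c = gadgetCoord δ k z := ⟨_, rfl⟩
  have e1 : z.re - k = δ * c.re := by rw [hc, gadgetCoord_re]; field_simp
  have e2 : z.im = δ * c.im := by rw [hc, gadgetCoord_im]; field_simp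
  have hδ2 : 0 < δ ^ 2 := by positivity
  have i0 : 0 ≤ c.im := by rw [e2] at hy; exact nonneg_of_mul_nonneg_right hy hδ
  have i1 : c.re ^ 2 + c.im ^ 2 ≤ 1 := by
    rw [e1, e2] at h1
    exact le_of_mul_le_mul_left (by linarith) hδ2
  have i2 : 1 / 4 ≤ (1 + c.re) ^ 2 + c.im ^ 2 := by
    rw [e1, e2] at h2
    exact le_of_mul_le_mul_left (by linarith) hδ2
  have i3 : (1 + c.re) ^ 2 + c.im ^ 2 < 1 := by
    rw [e1, e2] at h3
    exact lt_of_mul_lt_mul_left (by linarith) hδ2.le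
  have hc1 : c ≠ 1 := by rintro rfl; norm_num at i3
  have hN := mob_denom_pos hc1
  have hw := mob_norm_sq hc1
  have hN1 : (1 - c.re) ^ 2 + c.im ^ 2 ≤ 4 := by nlinarith [sq_nonneg (c.re + 1)]
  have hN2 : 1 ≤ (1 - c.re) ^ 2 + c.im ^ 2 := by nlinarith
  have hg : gadgetMap δ k z = (((1 + c) / (1 - c) : ℂ) : OnePoint ℂ) := by
    rw [gadgetMap_coe, ← hc, sphereMob_coe hc1]
  have hneck := one_div_neck_le k
  have hneck' := six_le_neck k
  have hann := mem_sides_of_annulus (z := (1 + c) / (1 - c)) (one_div_neck_pos k)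
    (one_div_neck_le_neck k)
    (by
      rw [hw]
      calc (1 / neck k) ^ 2 ≤ (1 / 6) ^ 2 := by gcongr
        _ ≤ _ := by rw [le_div_iff₀ hN]; nlinarith)
    (by
      rw [hw]
      calc _ ≤ (1 : ℝ) := by rw [div_le_iff₀ hN]; linarith
        _ ≤ _ := by nlinarith)
  have hre : ((1 + c) / (1 - c)).re = (1 - c.re ^ 2 - c.im ^ 2) / ((1 - c.re) ^ 2 + c.im ^ 2) := mob_re c
  have him : ((1 + c) / (1 - c)).im = 2 * c.im / ((1 - c.re) ^ 2 + c.im ^ 2) := mob_im c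
  have hcurve : ((1 + c) / (1 - c)).re * ((1 + c) / (1 - c)).im = 0 →
      (z : OnePoint ℂ) ∈ chainCurve δ := fun h =>
    (coe_mem_chainCurve hδ hδ1 hzk).2 ⟨_, hann.2.2.2 h, hg.symm⟩
  have hre0 : 0 ≤ ((1 + c) / (1 - c)).re := by rw [hre]; exact div_nonneg (by linarith) hN.le
  have him0 : 0 ≤ ((1 + c) / (1 - c)).im := by rw [him]; positivity
  refine ⟨?_, ?_⟩
  · rcases (mul_nonneg hre0 him0).eq_or_lt with h | h
    · exact Or.inr (hcurve h.symm)
    · left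
      rw [coe_mem_chainPlus hδ hδ1 hzk, hg, coe_mem_crossPlus]
      exact hann.2.1.2 h
  · rintro (h | h)
    · apply hcurve
      have : c.im = 0 := by rw [e2] at h; exact (mul_eq_zero.1 h).resolve_left hδ.ne'
      rw [him, this]; simp
    · apply hcurve
      rw [e1, e2] at h
      have : c.re ^ 2 + c.im ^ 2 = 1 := mul_left_cancel₀ hδ2.ne' (by linarith)
      rw [hre, show 1 - c.re ^ 2 - c.im ^ 2 = 0 by linarith]; simp

/-- The circle is the diagonal through the first and third quadrants in the coordinate of the cross.
Off the far side a point of the diagonal is in the throat, and `|w| ≤ √2 / neck k` there; returning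
to `z` costs a bounded factor. -/
theorem norm_le_of_notMem_chainPlus (hδ : 0 < δ) (hδ1 : δ ≤ 1 / 100)
    (h : (z.re - k) ^ 2 + (z.im + δ) ^ 2 = 2 * δ ^ 2) (hz : (z : OnePoint ℂ) ∉ chainPlus δ) :
    (z.re - k + δ) ^ 2 + z.im ^ 2 ≤ (4 * δ / neck k) ^ 2 := by
  have hzk : |z.re - k| < 9 / 10 := by
    rw [abs_lt]; constructor <;> nlinarith [sq_nonneg (z.im + δ)]
  rw [coe_mem_chainPlus hδ hδ1 hzk, gadgetMap_coe] at hz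
  obtain ⟨c, hc⟩ : ∃ c, c = gadgetCoord δ k z := ⟨_, rfl⟩
  have e1 : z.re - k = δ * c.re := by rw [hc, gadgetCoord_re]; field_simp
  have e2 : z.im = δ * c.im := by rw [hc, gadgetCoord_im]; field_simp
  have hδ2 : 0 < δ ^ 2 := by positivity
  rw [← hc] at hz
  have i1 : c.re ^ 2 + (c.im + 1) ^ 2 = 2 := by
    rw [e1, e2] at h
    exact mul_left_cancel₀ hδ2.ne' (by linarith)
  have hc1 : c ≠ 1 := by
    rintro rfl
    rw [sphereMob_one] at hz
    exact hz infty_mem_crossPlus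
  rw [sphereMob_coe hc1, coe_mem_crossPlus] at hz
  have hN := mob_denom_pos hc1
  have hw := mob_norm_sq hc1
  have hN1 : (1 - c.re) ^ 2 + c.im ^ 2 ≤ 8 := by
    nlinarith [sq_nonneg (c.re + 1), sq_nonneg (c.im + 2), sq_nonneg (c.re - c.im)]
  have hri : ((1 + c) / (1 - c)).re = ((1 + c) / (1 - c)).im := by
    rw [mob_re, mob_im, show 1 - c.re ^ 2 - c.im ^ 2 = 2 * c.im by linarith]
  set w := (1 + c) / (1 - c)
  have hpos := one_div_neck_pos k
  have hw1 : |w.re| ≤ 1 / neck k := by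
    by_contra! h'
    refine hz (Or.inl ⟨?_, Or.inl h'⟩)
    rw [← hri]
    exact mul_self_pos.2 fun h0 => by rw [h0, abs_zero] at h'; linarith
  have hw2 : w.re ^ 2 ≤ (1 / neck k) ^ 2 := by rw [← sq_abs]; gcongr
  rw [← hri] at hw
  have hw3 : (1 + c.re) ^ 2 + c.im ^ 2 ≤ 16 * (1 / neck k) ^ 2 := by
    have := (eq_div_iff hN.ne').1 hw
    rw [← this]
    nlinarith [sq_nonneg w.re]
  calc _ = δ ^ 2 * ((1 + c.re) ^ 2 + c.im ^ 2) := by rw [e1, e2]; ring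
    _ ≤ δ ^ 2 * (16 * (1 / neck k) ^ 2) := by gcongr
    _ = _ := by ring

theorem chainMinus_nonempty (hδ : 0 < δ) (hδ1 : δ ≤ 1 / 100) : (chainMinus δ).Nonempty := by
  refine ⟨(Complex.I : ℂ), (coe_mem_chain_of_far hδ hδ1 fun k => ?_).2.2 (by norm_num)⟩
  rw [Complex.I_im]
  nlinarith [sq_nonneg (Complex.I.re - k)]

/-- The arcs lie on circles around `k - δ`, with radii between `δ/2` and `δ`, and run from the real
axis to the circle of radius `δ` around `k`. They are compared with the throat of radius `4δ / neck
k`. -/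
theorem chainCurve_neck_bound (hδ : 0 < δ) (hδ1 : δ ≤ 1 / 100) {K : ℝ} {f : OnePoint ℂ ≃ₜ OnePoint ℂ}
    (hq : IsQuasiconformal K f) (hf : f '' realLine = chainCurve δ) (hk : 8 < neck k) :
    ENNReal.ofReal (1 / (2 * Real.pi)) ≤
      ENNReal.ofReal K * (ENNReal.ofReal K * ENNReal.ofReal (2 * Real.pi / Real.log (neck k / 8))) := by
  have hn := neck_pos k
  have e0 : neck k / 8 = δ / 2 / (4 * δ / neck k) := by field_simp; norm_num
  have hre : ∀ r θ : ℝ, ((k - δ : ℂ) + r * Complex.exp (θ * Complex.I)).re - k + δ =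
      r * Real.cos θ := by
    intro r θ
    rw [Complex.add_re, Complex.re_ofReal_mul, Complex.exp_ofReal_mul_I_re]
    simp; ring
  have him : ∀ r θ : ℝ, ((k - δ : ℂ) + r * Complex.exp (θ * Complex.I)).im = r * Real.sin θ := by
    intro r θ
    rw [Complex.add_im, Complex.im_ofReal_mul, Complex.exp_ofReal_mul_I_im]
    simp
  rw [e0]
  -- The angle `arccos (r / (2δ))` is where the circle of radius `r` around `k - δ` meets the circle
  -- of radius `δ` around `k`.
  have hcos : ∀ r ∈ Set.Ioo (δ / 2) (2 * (δ / 2)), Real.cos (Real.arccos (r / (2 * δ))) = r / (2 * δ) :=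
    fun r hr => Real.cos_arccos
      (by have : 0 < r := by linarith [hr.1]
          linarith [show 0 ≤ r / (2 * δ) by positivity])
      (by rw [div_le_one (by positivity)]; linarith [hr.2])
  have hmem : ∀ r ∈ Set.Ioo (δ / 2) (2 * (δ / 2)), ∀ θ ∈ Set.Icc 0 (Real.arccos (r / (2 * δ))),
      (((k - δ : ℂ) + r * Complex.exp (θ * Complex.I) : ℂ) : OnePoint ℂ) ∈
        chainPlus δ ∪ chainCurve δ ∧
      ((θ = 0 ∨ θ = Real.arccos (r / (2 * δ))) →
        (((k - δ : ℂ) + r * Complex.exp (θ * Complex.I) : ℂ) : OnePoint ℂ) ∈ chainCurve δ) := by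
    intro r hr θ hθ
    obtain ⟨z, hz⟩ : ∃ z : ℂ, z = (k - δ : ℂ) + r * Complex.exp (θ * Complex.I) := ⟨_, rfl⟩
    have h1 := hre r θ
    have h2 := him r θ
    rw [← hz] at h1 h2 ⊢
    have hr0 : 0 < r := by linarith [hr.1]
    have h3 : r / (2 * δ) ≤ Real.cos θ := by
      rw [← hcos r hr]
      exact Real.cos_le_cos_of_nonneg_of_le_pi hθ.1 (Real.arccos_le_pi _) hθ.2
    have h4 : r ≤ Real.cos θ * (2 * δ) := (div_le_iff₀ (by positivity)).1 h3
    have h5 : 0 ≤ Real.sin θ := Real.sin_nonneg_of_nonneg_of_le_pi hθ.1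
      (hθ.2.trans (Real.arccos_le_pi _))
    have h6 : z.re - k = r * Real.cos θ - δ := by linarith
    have h7 : (z.re - k) ^ 2 + z.im ^ 2 = δ ^ 2 + r * (r - Real.cos θ * (2 * δ)) := by
      rw [h6, h2]; linear_combination r ^ 2 * Real.sin_sq_add_cos_sq θ
    have h8 : (z.re - k + δ) ^ 2 + z.im ^ 2 = r ^ 2 := by
      rw [h1, h2]; linear_combination r ^ 2 * Real.sin_sq_add_cos_sq θ
    have := mem_chainPlus_of_mem_lens (k := k) (z := z) hδ hδ1 (by rw [h2]; positivity)
      (by rw [h7]; nlinarith) (by rw [h8]; nlinarith [hr.1]) (by rw [h8]; nlinarith [hr.2])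
    refine ⟨this.1, fun h => this.2 (h.imp (fun h0 => ?_) fun h0 => ?_)⟩
    · rw [h2, h0]; simp
    · rw [h7, h0, hcos r hr]; field_simp; ring
  refine hq.neck_bound hf (isSides_chain hδ hδ1) (chainMinus_nonempty hδ hδ1) (infty_mem_chainCurve δ)
    (q := k - δ) (by positivity) ?_ (A := fun r => (fun θ : ℝ => (k - δ : ℂ) + r * Complex.exp (θ * Complex.I)) ''
      Set.Icc 0 (Real.arccos (r / (2 * δ)))) ?_ ?_ ?_ ?_
  · rw [div_lt_iff₀ hn]; nlinarith
  · intro r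
    exact Set.image_mono (Set.Icc_subset_Icc_right (Real.arccos_le_pi _))
  · intro r hr
    refine isArc_circle_image _ (by linarith [hr.1]) (Real.arccos_pos.2 ?_) (Real.arccos_le_pi _)
    rw [div_lt_one (by positivity)]; linarith [hr.2]
  · rintro r hr _ ⟨θ, hθ, rfl⟩
    exact (hmem r hr θ hθ).1
  · intro r hr
    have h0 : (0 : ℝ) ∈ Set.Icc 0 (Real.arccos (r / (2 * δ))) := ⟨le_rfl, Real.arccos_nonneg _⟩
    have h1 : Real.arccos (r / (2 * δ)) ∈ Set.Icc 0 (Real.arccos (r / (2 * δ))) :=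
      ⟨Real.arccos_nonneg _, le_rfl⟩
    refine ⟨_, ⟨0, h0, rfl⟩, _, ⟨_, h1, rfl⟩, (hmem r hr _ h0).2 (Or.inl rfl),
      (hmem r hr _ h1).2 (Or.inr rfl), fun S hS ha hb hSP => ?_⟩
    -- The level `2δ²` of `u` is the diagonal circle, which separates the endpoints `a` and `b`. A
    -- connected set joining them meets it, and off the lower side it can do so only in the throat.
    obtain ⟨u, hu⟩ : ∃ u : ℂ → ℝ, u = fun z => (z.re - k) ^ 2 + (z.im + δ) ^ 2 := ⟨_, rfl⟩
    have hr0 : 0 < r := by linarith [hr.1]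
    have huc : Continuous u := by rw [hu]; fun_prop
    have hval : ∀ θ : ℝ, u ((k - δ : ℂ) + r * Complex.exp (θ * Complex.I)) =
        (r * Real.cos θ - δ) ^ 2 + (r * Real.sin θ + δ) ^ 2 := fun θ => by
      rw [hu]
      simp only
      rw [him, ← hre r θ]; ring
    have ha' : u ((k - δ : ℂ) + r * Complex.exp (((0 : ℝ) : ℂ) * Complex.I)) ≤ 2 * δ ^ 2 := by
      rw [hval, Real.cos_zero, Real.sin_zero]; nlinarith [hr.2]
    have hb' : 2 * δ ^ 2 ≤
        u ((k - δ : ℂ) + r * Complex.exp ((Real.arccos (r / (2 * δ)) : ℂ) * Complex.I)) := by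
      rw [hval]
      have h5 : 0 ≤ Real.sin (Real.arccos (r / (2 * δ))) :=
        Real.sin_nonneg_of_nonneg_of_le_pi h1.1 (Real.arccos_le_pi _)
      have h6 := Real.sin_sq_add_cos_sq (Real.arccos (r / (2 * δ)))
      have h7 : 2 * δ * Real.cos (Real.arccos (r / (2 * δ))) = r := by
        rw [hcos r hr]; field_simp
      have h8 : 0 ≤ r * δ * Real.sin (Real.arccos (r / (2 * δ))) := by positivity
      set C := Real.cos (Real.arccos (r / (2 * δ)))
      set D := Real.sin (Real.arccos (r / (2 * δ)))
      have : (r * C - δ) ^ 2 + (r * D + δ) ^ 2 = r ^ 2 * (D ^ 2 + C ^ 2) - r * (2 * δ * C) +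
        2 * δ ^ 2 + 2 * (r * δ * D) := by ring
      rw [this, h6, h7]; nlinarith
    obtain ⟨z, hz, hz0⟩ := (hS.image u huc.continuousOn).ordConnected.out
      (Set.mem_image_of_mem u ha) (Set.mem_image_of_mem u hb) ⟨ha', hb'⟩
    refine ⟨z, hz, ?_⟩
    rw [hu] at hz0
    have h9 := norm_le_of_notMem_chainPlus hδ hδ1 hz0 (hSP z hz)
    refine abs_le_of_sq_le_sq' ?_ (by positivity) |>.2
    rw [Complex.sq_norm, Complex.normSq_apply]
    simp only [Complex.sub_re, Complex.sub_im, Complex.intCast_re, Complex.intCast_im,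
      Complex.ofReal_re, Complex.ofReal_im]
    nlinarith

theorem not_isQuasicircle_chainCurve (hδ : 0 < δ) (hδ1 : δ ≤ 1 / 100) :
    ¬ IsQuasicircle (chainCurve δ) := by
  rintro ⟨K, f, hq, hf⟩
  have hK : 0 ≤ K := zero_le_one.trans hq.1
  have hpi := Real.pi_pos
  -- The neck bound says `log (neck k / 8) ≤ 4π²K²`; a neck with larger logarithm contradicts it.
  set B := 4 * Real.pi ^ 2 * K ^ 2 + 1 with hB
  have hB1 : 1 ≤ B := by rw [hB]; nlinarith [sq_nonneg (Real.pi * K)]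
  obtain ⟨m, hm⟩ := exists_nat_gt (8 * Real.exp B)
  have hexp : 1 < Real.exp B := by linarith [Real.add_one_le_exp B]
  have hm' : 8 * Real.exp B < neck (m : ℤ) := by
    rw [neck]; push_cast; linarith [le_abs_self (m : ℝ)]
  have h := chainCurve_neck_bound (k := m) hδ hδ1 hq hf (by linarith)
  rw [← ENNReal.ofReal_mul hK, ← ENNReal.ofReal_mul hK] at h
  have hlog : B < Real.log (neck (m : ℤ) / 8) := by
    rw [Real.lt_log_iff_exp_lt (by have := neck_pos m; positivity)]; linarith
  have hlog0 : 0 < Real.log (neck (m : ℤ) / 8) := by linarith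
  rw [ENNReal.ofReal_le_ofReal_iff (by positivity)] at h
  rw [div_le_iff₀ (by positivity)] at h
  have : K * (K * (2 * Real.pi / Real.log (neck (m : ℤ) / 8))) * (2 * Real.pi) =
      4 * Real.pi ^ 2 * K ^ 2 / Real.log (neck (m : ℤ) / 8) := by ring
  rw [this, le_div_iff₀ hlog0] at h
  linarith

end

/-! ### Arcs and their concatenation -/

/-- The set `S` is a simple arc from `a` to `b`, or consists of the single point `a = b`. -/
def ArcFromTo (a b : ℂ) (S : Set ℂ) : Prop :=
  ∃ (γ : ℝ → ℂ) (l : ℝ), 0 ≤ l ∧ ContinuousOn γ (Set.Icc 0 l) ∧ Set.InjOn γ (Set.Icc 0 l) ∧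
    γ '' Set.Icc 0 l = S ∧ γ 0 = a ∧ γ l = b

section
variable {a b c : ℂ} {S T : Set ℂ}

theorem ArcFromTo.trans (h₁ : ArcFromTo a b S) (h₂ : ArcFromTo b c T) (hST : S ∩ T ⊆ {b}) :
    ArcFromTo a c (S ∪ T) := by
  obtain ⟨γ, l, hl, hγ, hinj, rfl, rfl, rfl⟩ := h₁
  obtain ⟨β, m, hm, hβ, hinj', rfl, hβ0, rfl⟩ := h₂
  set F : ℝ → ℂ := fun t => if t ≤ l then γ t else β (t - l)
  have hF1 : Set.EqOn F γ (Set.Icc 0 l) := fun t ht => if_pos ht.2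
  have hF2 : Set.EqOn F (fun t => β (t - l)) (Set.Icc l (l + m)) := fun t ht => by
    rcases ht.1.eq_or_lt with rfl | h
    · simp [F, hβ0]
    · exact if_neg h.not_ge
  have hU : Set.Icc 0 (l + m) = Set.Icc 0 l ∪ Set.Icc l (l + m) :=
    (Set.Icc_union_Icc_eq_Icc hl (by linarith)).symm
  have hsub : Set.MapsTo (fun t => t - l) (Set.Icc l (l + m)) (Set.Icc 0 m) := fun t ht =>
    ⟨by linarith [ht.1], by linarith [ht.2]⟩
  have hsub' : (fun t => t - l) '' Set.Icc l (l + m) = Set.Icc 0 m := by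
    simp
  have cross : ∀ s ∈ Set.Icc 0 l, ∀ t ∈ Set.Icc l (l + m), F s = F t → s = t := by
    intro s hs t ht hst
    have h1 := hst
    rw [hF1 hs, hF2 ht] at h1
    have h2 : γ s = γ l := hST ⟨⟨s, hs, rfl⟩, h1 ▸ ⟨_, hsub ht, rfl⟩⟩
    have h3 : s = l := hinj hs ⟨hl, le_rfl⟩ h2
    rw [h2, ← hβ0] at h1
    have h4 : 0 = t - l := hinj' ⟨le_rfl, hm⟩ (hsub ht) h1
    linarith
  refine ⟨F, l + m, by linarith, ?_, ?_, ?_, ?_, ?_⟩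
  · rw [hU]
    exact (hγ.congr hF1).union_of_isClosed
      ((hβ.comp (by fun_prop) hsub).congr hF2) isClosed_Icc isClosed_Icc
  · rw [hU]
    rintro s (hs | hs) t (ht | ht) hst
    · rw [hF1 hs, hF1 ht] at hst
      exact hinj hs ht hst
    · exact cross s hs t ht hst
    · exact (cross t ht s hs hst.symm).symm
    · rw [hF2 hs, hF2 ht] at hst
      have := hinj' (hsub hs) (hsub ht) hst
      linarith
  · rw [hU, Set.image_union, hF1.image_eq, hF2.image_eq, ← hsub', Set.image_image]
  · rw [hF1 ⟨le_rfl, hl⟩]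
  · rw [hF2 ⟨by linarith, le_rfl⟩]; simp

theorem ArcFromTo.image (h : ArcFromTo a b S) {f : ℂ → ℂ} (hf : ContinuousOn f S)
    (hinj : Set.InjOn f S) : ArcFromTo (f a) (f b) (f '' S) := by
  obtain ⟨γ, l, hl, hγ, hi, rfl, rfl, rfl⟩ := h
  refine ⟨f ∘ γ, l, hl, hf.comp hγ (Set.mapsTo_image _ _), ?_, Set.image_comp _ _ _, rfl, rfl⟩
  exact hinj.comp hi (Set.mapsTo_image _ _)

theorem ArcFromTo.symm (h : ArcFromTo a b S) : ArcFromTo b a S := by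
  obtain ⟨γ, l, hl, hγ, hi, rfl, rfl, rfl⟩ := h
  have hm : Set.MapsTo (fun t => l - t) (Set.Icc 0 l) (Set.Icc 0 l) := fun t ht =>
    ⟨by linarith [ht.2], by linarith [ht.1]⟩
  refine ⟨fun t => γ (l - t), l, hl, hγ.comp (by fun_prop) hm, ?_, ?_, by simp, by simp⟩
  · intro s hs t ht hst
    have := hi (hm hs) (hm ht) hst
    linarith
  · have : (fun t => γ (l - t)) '' Set.Icc 0 l = γ '' ((fun t => l - t) '' Set.Icc 0 l) :=
      (Set.image_image _ _ _).symm
    rw [this]; simp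

theorem arcFromTo_segment (a b : ℂ) : ArcFromTo a b (segment ℝ a b) := by
  by_cases hab : a = b
  · subst hab
    exact ⟨fun _ => a, 0, le_rfl, continuousOn_const, by simp, by simp, rfl, rfl⟩
  · refine ⟨AffineMap.lineMap a b, 1, zero_le_one, AffineMap.lineMap_continuous.continuousOn,
      (AffineMap.lineMap_injective ℝ hab).injOn, (segment_eq_image_lineMap ℝ a b).symm, by simp, by simp⟩

theorem ArcFromTo.exists_unit (h : ArcFromTo a b S) (hab : a ≠ b) : ∃ γ : ℝ → ℂ,
    ContinuousOn γ (Set.Icc 0 1) ∧ Set.InjOn γ (Set.Icc 0 1) ∧ γ '' Set.Icc 0 1 = S ∧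
      γ 0 = a ∧ γ 1 = b := by
  obtain ⟨γ, l, hl, hγ, hi, rfl, rfl, rfl⟩ := h
  have hl0 : 0 < l := hl.lt_of_ne fun h => hab (by rw [h])
  have hm : Set.MapsTo (fun t => l * t) (Set.Icc 0 1) (Set.Icc 0 l) := fun t ht =>
    ⟨mul_nonneg hl ht.1, by nlinarith [ht.2]⟩
  refine ⟨fun t => γ (l * t), hγ.comp (by fun_prop) hm, ?_, ?_, by simp, by simp⟩
  · intro s hs t ht hst
    exact mul_left_cancel₀ hl0.ne' (hi (hm hs) (hm ht) hst)
  · have : (fun t => γ (l * t)) '' Set.Icc 0 1 = γ '' ((fun t => l * t) '' Set.Icc 0 1) :=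
      (Set.image_image _ _ _).symm
    rw [this, Set.image_mul_left_Icc hl0.le zero_le_one, mul_zero, mul_one]

/-- Both arcs are parametrised on consecutive unit intervals. The combined path has equal ends and
descends to an injective map on the circle of length `2`. -/
theorem ArcFromTo.isJordanCurve_union (h₁ : ArcFromTo a b S) (h₂ : ArcFromTo b a T)
    (hab : a ≠ b) (hST : S ∩ T ⊆ {a, b}) : IsJordanCurve (((↑) : ℂ → OnePoint ℂ) '' (S ∪ T)) := by
  obtain ⟨γ, hγ, hi, rfl, rfl, rfl⟩ := h₁.exists_unit hab
  obtain ⟨β, hβ, hi', rfl, hβ0, hβ1⟩ := h₂.exists_unit hab.symm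
  have : Fact ((0 : ℝ) < 2) := ⟨two_pos⟩
  set F : ℝ → ℂ := fun t => if t ≤ 1 then γ t else β (t - 1)
  have hF1 : Set.EqOn F γ (Set.Icc 0 1) := fun t ht => if_pos ht.2
  have hF2 : Set.EqOn F (fun t => β (t - 1)) (Set.Icc 1 2) := fun t ht => by
    rcases ht.1.eq_or_lt with rfl | h
    · simp [F, hβ0]
    · exact if_neg h.not_ge
  have hU : Set.Icc (0 : ℝ) 2 = Set.Icc 0 1 ∪ Set.Icc 1 2 :=
    (Set.Icc_union_Icc_eq_Icc zero_le_one one_le_two).symm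
  have hsub : Set.MapsTo (fun t : ℝ => t - 1) (Set.Icc 1 2) (Set.Icc 0 1) := fun t ht =>
    ⟨by linarith [ht.1], by linarith [ht.2]⟩
  have hsub' : (fun t : ℝ => t - 1) '' Set.Icc 1 2 = Set.Icc 0 1 := by
    simp; norm_num
  have hFc : ContinuousOn F (Set.Icc 0 2) := by
    rw [hU]
    exact (hγ.congr hF1).union_of_isClosed
      ((hβ.comp (by fun_prop) hsub).congr hF2) isClosed_Icc isClosed_Icc
  have hFimg : F '' Set.Icc 0 2 = γ '' Set.Icc 0 1 ∪ β '' Set.Icc 0 1 := by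
    rw [hU, Set.image_union, hF1.image_eq, hF2.image_eq]
    congr 1
    rw [← hsub', Set.image_image]
  have hF02 : F 0 = F 2 := by
    rw [hF1 ⟨le_rfl, zero_le_one⟩, hF2 ⟨one_le_two, le_rfl⟩, ← hβ1]; norm_num
  -- The half-open interval excludes the closing point, where the path returns to `a`.
  have cross : ∀ s ∈ Set.Icc (0 : ℝ) 1, ∀ t ∈ Set.Ico (1 : ℝ) 2, F s = F t → s = t := by
    intro s hs t ht hst
    have ht' : t ∈ Set.Icc (1 : ℝ) 2 := ⟨ht.1, ht.2.le⟩
    rw [hF1 hs, hF2 ht'] at hst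
    rcases hST ⟨⟨s, hs, rfl⟩, hst ▸ ⟨_, hsub ht', rfl⟩⟩ with h2 | h2
    · rw [h2, ← hβ1] at hst
      have := hi' ⟨zero_le_one, le_rfl⟩ (hsub ht') hst
      simp only at this
      linarith [ht.2]
    · have h2 : γ s = γ 1 := h2
      have h3 := hi hs ⟨zero_le_one, le_rfl⟩ h2
      rw [h2, ← hβ0] at hst
      have := hi' ⟨le_rfl, zero_le_one⟩ (hsub ht') hst
      simp only at this
      linarith
  have hFi : Set.InjOn F (Set.Ico 0 2) := by
    intro s hs t ht hst
    rcases le_total s 1 with h1 | h1 <;> rcases le_total t 1 with h2 | h2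
    · have h3 : s ∈ Set.Icc (0 : ℝ) 1 := ⟨hs.1, h1⟩
      have h4 : t ∈ Set.Icc (0 : ℝ) 1 := ⟨ht.1, h2⟩
      rw [hF1 h3, hF1 h4] at hst
      exact hi h3 h4 hst
    · exact cross s ⟨hs.1, h1⟩ t ⟨h2, ht.2⟩ hst
    · exact (cross t ⟨ht.1, h2⟩ s ⟨h1, hs.2⟩ hst.symm).symm
    · have h3 : s ∈ Set.Icc (1 : ℝ) 2 := ⟨h1, hs.2.le⟩
      have h4 : t ∈ Set.Icc (1 : ℝ) 2 := ⟨h2, ht.2.le⟩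
      rw [hF2 h3, hF2 h4] at hst
      have := hi' (hsub h3) (hsub h4) hst
      simp only at this
      linarith
  let G : AddCircle (2 : ℝ) → ℂ := AddCircle.liftIco 2 0 F
  have hG : ∀ t ∈ Set.Ico (0 : ℝ) 2, G (t : AddCircle (2 : ℝ)) = F t := fun t ht =>
    AddCircle.liftIco_zero_coe_apply ht
  have hrep : ∀ x : AddCircle (2 : ℝ), ∃ t ∈ Set.Ico (0 : ℝ) 2, (t : AddCircle (2 : ℝ)) = x := fun x =>
    ⟨AddCircle.equivIco 2 0 x, by simpa using (AddCircle.equivIco 2 0 x).2,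
      (AddCircle.equivIco 2 0).symm_apply_apply x⟩
  have hGi : Function.Injective G := by
    intro x y hxy
    obtain ⟨s, hs, rfl⟩ := hrep x
    obtain ⟨t, ht, rfl⟩ := hrep y
    rw [hG s hs, hG t ht] at hxy
    rw [hFi hs ht hxy]
  have hGr : Set.range G = γ '' Set.Icc 0 1 ∪ β '' Set.Icc 0 1 := by
    rw [← hFimg]
    refine Set.Subset.antisymm ?_ ?_
    · rintro _ ⟨x, rfl⟩
      obtain ⟨t, ht, rfl⟩ := hrep x
      exact ⟨t, ⟨ht.1, ht.2.le⟩, (hG t ht).symm⟩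
    · rintro _ ⟨t, ht, rfl⟩
      rcases ht.2.eq_or_lt with rfl | h
      · rw [← hF02]; exact ⟨_, hG 0 ⟨le_rfl, two_pos⟩⟩
      · exact ⟨_, hG t ⟨ht.1, h⟩⟩
  have hGc : Continuous G := AddCircle.liftIco_zero_continuous hF02 hFc
  let e := AddCircle.homeomorphCircle (T := 2) two_ne_zero
  refine ⟨fun c => (G (e.symm c) : OnePoint ℂ), OnePoint.continuous_coe.comp (hGc.comp e.symm.continuous),
    (OnePoint.coe_injective.comp hGi).comp e.symm.injective, ?_⟩
  rw [← hGr]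
  have : (fun c => (G (e.symm c) : OnePoint ℂ)) = (((↑) : ℂ → OnePoint ℂ) ∘ G) ∘ e.symm := rfl
  rw [this, Set.range_comp, e.symm.surjective.range_eq, Set.image_univ, Set.range_comp]

end

/-! ### The smoothed crosses are Jordan curves -/

section
variable {e n : ℝ} {z w : ℂ}

/-- The quarter circle in the first quadrant. -/
def innerArc (e : ℝ) : Set ℂ := {z | (z.re - e) ^ 2 + (z.im - e) ^ 2 = e ^ 2 ∧ z.re + z.im ≤ e}

/-- The three-quarter circle around the second quadrant. -/
def outerArc (n : ℝ) : Set ℂ := {z | (z.re + n) ^ 2 + (z.im - n) ^ 2 = n ^ 2 ∧ n ≤ z.im - z.re}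

theorem innerArc_nonneg (he : 0 < e) (hz : z ∈ innerArc e) :
    0 ≤ z.re ∧ z.re ≤ e ∧ 0 ≤ z.im ∧ z.im ≤ e := by
  obtain ⟨h1, h2⟩ := hz
  have h3 : 0 ≤ z.re := by nlinarith [sq_nonneg (z.im - e)]
  have h4 : 0 ≤ z.im := by nlinarith [sq_nonneg (z.re - e)]
  exact ⟨h3, by linarith, h4, by linarith⟩

theorem outerArc_sign (hn : 0 < n) (hz : z ∈ outerArc n) : z.re ≤ 0 ∧ 0 ≤ z.im := by
  obtain ⟨h1, h2⟩ := hz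
  exact ⟨by nlinarith [sq_nonneg (z.im - n)], by nlinarith [sq_nonneg (z.re + n)]⟩

theorem arcFromTo_innerArc (he : 0 < e) : ArcFromTo ⟨0, e⟩ ⟨e, 0⟩ (innerArc e) := by
  have hs : ∀ x, 0 ≤ x → x ≤ e → √(e ^ 2 - (x - e) ^ 2) ^ 2 = e ^ 2 - (x - e) ^ 2 := fun x h1 h2 =>
    Real.sq_sqrt (by nlinarith)
  refine ⟨fun x => ⟨x, e - √(e ^ 2 - (x - e) ^ 2)⟩, e, he.le, ?_, ?_, ?_, ?_, ?_⟩
  · have : (fun x : ℝ => (⟨x, e - √(e ^ 2 - (x - e) ^ 2)⟩ : ℂ)) =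
        fun x : ℝ => (x : ℂ) + ((e - √(e ^ 2 - (x - e) ^ 2) : ℝ) : ℂ) * Complex.I := by
      funext x; exact Complex.mk_eq_add_mul_I _ _
    rw [this]
    exact Continuous.continuousOn (by fun_prop)
  · intro s _ t _ hst
    exact congrArg Complex.re hst
  · ext z
    constructor
    · rintro ⟨x, ⟨h1, h2⟩, rfl⟩
      have h3 := hs x h1 h2
      refine ⟨?_, ?_⟩
      · simp only; nlinarith
      · simp only
        have : x ≤ √(e ^ 2 - (x - e) ^ 2) := Real.le_sqrt_of_sq_le (by nlinarith)
        linarith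
    · intro hz
      obtain ⟨h1, h2, h3, h4⟩ := innerArc_nonneg he hz
      refine ⟨z.re, ⟨h1, h2⟩, Complex.ext rfl ?_⟩
      have : e ^ 2 - (z.re - e) ^ 2 = (e - z.im) ^ 2 := by linarith [hz.1]
      simp only
      rw [this, Real.sqrt_sq (by linarith)]; ring
  · simp
  · simp [Real.sqrt_sq he.le]

/-- The map `z ↦ -1/z` preserves the axes and turns the inner circle into the outer one, so the
three-quarter circle, which is not a graph over an axis, needs no parametrisation of its own. -/
theorem neg_inv_mem_innerArc (he : 0 < e) (h1 : e * n = 1) (hw : w ≠ 0) :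
    -w⁻¹ ∈ innerArc e ↔ w ∈ outerArc n := by
  have hN : 0 < w.re ^ 2 + w.im ^ 2 := by
    by_contra! h
    exact hw (Complex.ext (by rw [Complex.zero_re]; nlinarith [sq_nonneg w.im, sq_nonneg w.re])
      (by rw [Complex.zero_im]; nlinarith [sq_nonneg w.im, sq_nonneg w.re]))
  have hn : n = 1 / e := by field_simp; linarith
  rw [innerArc, outerArc, Set.mem_ofPred_eq, Set.mem_ofPred_eq, Complex.neg_re, Complex.neg_im, inv_re',
    inv_im']
  set x := w.re
  set y := w.im
  have e1 : (-(x / (x ^ 2 + y ^ 2)) - e) ^ 2 + (-(-y / (x ^ 2 + y ^ 2)) - e) ^ 2 - e ^ 2 =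
      e ^ 2 / (x ^ 2 + y ^ 2) * ((x + n) ^ 2 + (y - n) ^ 2 - n ^ 2) := by
    rw [hn]; field_simp; ring
  have e2 : -(x / (x ^ 2 + y ^ 2)) + -(-y / (x ^ 2 + y ^ 2)) - e =
      e / (x ^ 2 + y ^ 2) * (-((x + n) ^ 2 + (y - n) ^ 2 - n ^ 2) + n * (n - (y - x))) := by
    rw [hn]; field_simp; ring
  have hc1 : 0 < e ^ 2 / (x ^ 2 + y ^ 2) := by positivity
  have hc2 : 0 < e / (x ^ 2 + y ^ 2) * n := by rw [hn]; positivity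
  rw [← sub_eq_zero, e1, mul_eq_zero, or_iff_right hc1.ne', ← sub_nonpos, e2, sub_eq_zero]
  refine and_congr_right fun h => ?_
  rw [h, sub_self, neg_zero, zero_add, ← mul_assoc, mul_nonpos_iff_pos_imp_nonpos]
  constructor
  · intro h; linarith [h.1 hc2]
  · intro h; exact ⟨fun _ => by linarith, fun h' => by linarith⟩

theorem arcFromTo_outerArc (he : 0 < e) (h1 : e * n = 1) :
    ArcFromTo ⟨0, n⟩ ⟨-n, 0⟩ (outerArc n) := by
  have hn : 0 < n := by by_contra! h; nlinarith
  have h0 : ∀ z ∈ innerArc e, z ≠ 0 := by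
    rintro z hz rfl
    have := hz.1
    simp at this
    exact he.ne' this
  have h0' : ∀ z ∈ outerArc n, z ≠ 0 := by
    rintro z hz rfl
    have := hz.1
    simp at this
    exact hn.ne' this
  have h := (arcFromTo_innerArc he).image (f := fun z => -z⁻¹)
    (ContinuousOn.neg (continuousOn_id.inv₀ h0))
    (Function.Injective.injOn fun x y hxy => inv_injective (neg_injective hxy))
  have e1 : -(⟨0, e⟩ : ℂ)⁻¹ = ⟨0, n⟩ := by
    apply Complex.ext
    · rw [Complex.neg_re, inv_re']; simp
    · rw [Complex.neg_im, inv_im']; simp only; field_simp; linear_combination (-e) * h1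
  have e2 : -(⟨e, 0⟩ : ℂ)⁻¹ = ⟨-n, 0⟩ := by
    apply Complex.ext
    · rw [Complex.neg_re, inv_re']; simp only; field_simp; linear_combination e * h1
    · rw [Complex.neg_im, inv_im']; simp
  have e3 : (fun z : ℂ => -z⁻¹) '' innerArc e = outerArc n := by
    ext w
    constructor
    · rintro ⟨z, hz, rfl⟩
      refine (neg_inv_mem_innerArc he h1 (neg_ne_zero.2 (inv_ne_zero (h0 z hz)))).1 ?_
      rwa [inv_neg, inv_inv, neg_neg]
    · intro hw
      exact ⟨-w⁻¹, (neg_inv_mem_innerArc he h1 (h0' w hw)).2 hw, by simp only; rw [inv_neg, inv_inv, neg_neg]⟩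
  simp only [e1, e2, e3] at h
  exact h

theorem mem_segment_re {a b : ℝ} (hab : a ≤ b) : z ∈ segment ℝ (⟨a, 0⟩ : ℂ) ⟨b, 0⟩ ↔
    z.im = 0 ∧ a ≤ z.re ∧ z.re ≤ b := by
  rw [segment_eq_image]
  constructor
  · rintro ⟨s, ⟨h1, h2⟩, rfl⟩
    simp
    constructor <;> nlinarith
  · rintro ⟨h1, h2, h3⟩
    rcases hab.eq_or_lt with rfl | hab
    · refine ⟨0, by simp, Complex.ext (by simp; linarith) (by simp [h1])⟩
    · refine ⟨(z.re - a) / (b - a), ⟨div_nonneg (by linarith) (by linarith),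
        (div_le_one (by linarith)).2 (by linarith)⟩, ?_⟩
      obtain ⟨s, hs⟩ : ∃ s, s = (z.re - a) / (b - a) := ⟨_, rfl⟩
      have hs' : s * (b - a) = z.re - a := by rw [hs, div_mul_cancel₀]; linarith
      rw [← hs]
      apply Complex.ext
      · simp; linarith
      · simp [h1]

theorem mem_segment_im {a b : ℝ} (hab : a ≤ b) : z ∈ segment ℝ (⟨0, a⟩ : ℂ) ⟨0, b⟩ ↔
    z.re = 0 ∧ a ≤ z.im ∧ z.im ≤ b := by
  rw [segment_eq_image]
  constructor
  · rintro ⟨s, ⟨h1, h2⟩, rfl⟩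
    simp
    constructor <;> nlinarith
  · rintro ⟨h1, h2, h3⟩
    rcases hab.eq_or_lt with rfl | hab
    · refine ⟨0, by simp, Complex.ext (by simp [h1]) (by simp; linarith)⟩
    · refine ⟨(z.im - a) / (b - a), ⟨div_nonneg (by linarith) (by linarith),
        (div_le_one (by linarith)).2 (by linarith)⟩, ?_⟩
      obtain ⟨s, hs⟩ : ∃ s, s = (z.im - a) / (b - a) := ⟨_, rfl⟩
      have hs' : s * (b - a) = z.im - a := by rw [hs, div_mul_cancel₀]; linarith
      rw [← hs]
      apply Complex.ext
      · simp [h1]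
      · simp; linarith

/-- The part of the smoothed cross above the real axis, from `e` to `-n`. -/
def upperArc (e n : ℝ) : Set ℂ := innerArc e ∪ segment ℝ ⟨0, e⟩ ⟨0, n⟩ ∪ outerArc n

theorem arcFromTo_upperArc (he : 0 < e) (hen : e ≤ n) (h1 : e * n = 1) :
    ArcFromTo ⟨e, 0⟩ ⟨-n, 0⟩ (upperArc e n) := by
  have hn := he.trans_le hen
  refine ((arcFromTo_innerArc he).symm.trans (arcFromTo_segment _ _) ?_).trans
    (arcFromTo_outerArc he h1) ?_
  · rintro z ⟨h2, h3⟩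
    rw [mem_segment_im hen] at h3
    have := innerArc_nonneg he h2
    exact Complex.ext h3.1 (le_antisymm this.2.2.2 h3.2.1)
  · rintro z ⟨h2, h3⟩
    have h4 := outerArc_sign hn h3
    have h5 : z.re = 0 := by
      rcases h2 with h2 | h2
      · exact le_antisymm h4.1 (innerArc_nonneg he h2).1
      · exact ((mem_segment_im hen).1 h2).1
    refine Complex.ext h5 ?_
    have := h3.1
    rw [h5] at this
    have : (z.im - n) ^ 2 = 0 := by linarith
    have := pow_eq_zero_iff (two_ne_zero) |>.1 this
    simp only
    linarith

theorem upperArc_im (he : 0 < e) (hen : e ≤ n) (hz : z ∈ upperArc e n) :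
    0 ≤ z.im ∧ (z.im = 0 → z.re = e ∨ z.re = -n) := by
  have hn := he.trans_le hen
  rcases hz with (h | h) | h
  · refine ⟨(innerArc_nonneg he h).2.2.1, fun h0 => Or.inl ?_⟩
    have := h.1
    rw [h0] at this
    have : (z.re - e) ^ 2 = 0 := by linarith
    linarith [pow_eq_zero_iff (two_ne_zero) |>.1 this]
  · rw [mem_segment_im hen] at h
    exact ⟨by linarith, fun h0 => by linarith⟩
  · refine ⟨(outerArc_sign hn h).2, fun h0 => Or.inr ?_⟩
    have := h.1
    rw [h0] at this
    have : (z.re + n) ^ 2 = 0 := by linarith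
    linarith [pow_eq_zero_iff (two_ne_zero) |>.1 this]

theorem mem_crossSet_iff (he : 0 < e) (hen : e ≤ n) : z ∈ crossSet e n ↔
    z ∈ upperArc e n ∨ -z ∈ upperArc e n ∨ (z.im = 0 ∧ e ≤ z.re ∧ z.re ≤ n) ∨
      (z.im = 0 ∧ -n ≤ z.re ∧ z.re ≤ -e) := by
  have hn := he.trans_le hen
  simp only [upperArc, Set.mem_union, mem_segment_im hen, innerArc, outerArc, Set.mem_ofPred_eq,
    Complex.neg_re, Complex.neg_im, crossSet]
  rw [show (-z.re - e) ^ 2 + (-z.im - e) ^ 2 = (z.re + e) ^ 2 + (z.im + e) ^ 2 by ring,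
    show (-z.re + n) ^ 2 + (-z.im - n) ^ 2 = (z.re - n) ^ 2 + (z.im + n) ^ 2 by ring]
  constructor
  · rintro (⟨h1 | h1, h2⟩ | h | h | h | h)
    · rw [h1, abs_zero] at h2
      push Not at h2
      have h3 := h2 (Or.inl he)
      rcases le_total 0 z.im with h4 | h4
      · rw [abs_of_nonneg h4] at h3
        exact Or.inl (Or.inl (Or.inr ⟨h1, h3⟩))
      · rw [abs_of_nonpos h4] at h3
        exact Or.inr (Or.inl (Or.inl (Or.inr ⟨by simpa using h1, h3⟩)))
    · rw [h1, abs_zero] at h2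
      have h3 : e ≤ |z.re| ∧ |z.re| ≤ n := by
        by_contra h
        rw [not_and_or, not_le, not_le] at h
        exact h2 ⟨h, Or.inl he⟩
      rcases le_total 0 z.re with h4 | h4
      · rw [abs_of_nonneg h4] at h3
        exact Or.inr (Or.inr (Or.inl ⟨h1, h3⟩))
      · rw [abs_of_nonpos h4] at h3
        exact Or.inr (Or.inr (Or.inr ⟨h1, by linarith, by linarith⟩))
    · exact Or.inl (Or.inl (Or.inl h))
    · exact Or.inr (Or.inl (Or.inl (Or.inl ⟨h.1, by linarith⟩)))
    · exact Or.inl (Or.inr h)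
    · exact Or.inr (Or.inl (Or.inr ⟨h.1, by linarith⟩))
  · have aux : ∀ x : ℝ, e ≤ |x| → |x| ≤ n → ¬(|x| < e ∨ n < |x|) := fun x h1 h2 h => by
      rcases h with h | h <;> linarith
    rintro (((h | h) | h) | ((h | h) | h) | h | h)
    · exact Or.inr (Or.inl h)
    · refine Or.inl ⟨Or.inl h.1, fun h' => ?_⟩
      have : |z.im| = z.im := abs_of_pos (by linarith)
      exact aux z.im (by linarith) (by linarith) h'.2
    · exact Or.inr (Or.inr (Or.inr (Or.inl h)))
    · exact Or.inr (Or.inr (Or.inl ⟨h.1, by linarith⟩))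
    · refine Or.inl ⟨Or.inl (by linarith), fun h' => ?_⟩
      have : |z.im| = -z.im := abs_of_neg (by linarith)
      exact aux z.im (by linarith) (by linarith) h'.2
    · exact Or.inr (Or.inr (Or.inr (Or.inr ⟨h.1, by linarith⟩)))
    · refine Or.inl ⟨Or.inr h.1, fun h' => ?_⟩
      have : |z.re| = z.re := abs_of_pos (by linarith)
      exact aux z.re (by linarith) (by linarith) h'.1
    · refine Or.inl ⟨Or.inr h.1, fun h' => ?_⟩
      have : |z.re| = -z.re := abs_of_neg (by linarith)
      exact aux z.re (by linarith) (by linarith) h'.1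

/-- The part of the smoothed cross from `-e` to `e` that runs below the real axis. -/
def lowerArc (e n : ℝ) : Set ℂ := (fun z => -z) '' upperArc e n ∪ segment ℝ ⟨n, 0⟩ ⟨e, 0⟩

theorem mem_lowerArc (hen : e ≤ n) : z ∈ lowerArc e n ↔
    -z ∈ upperArc e n ∨ (z.im = 0 ∧ e ≤ z.re ∧ z.re ≤ n) := by
  rw [lowerArc, Set.mem_union, segment_symm, mem_segment_re hen, Set.image_neg_eq_neg, Set.mem_neg]

theorem arcFromTo_lowerArc (he : 0 < e) (hen : e ≤ n) (h1 : e * n = 1) :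
    ArcFromTo ⟨-e, 0⟩ ⟨e, 0⟩ (lowerArc e n) := by
  have hn := he.trans_le hen
  have h := (arcFromTo_upperArc he hen h1).image (f := fun z => -z) continuous_neg.continuousOn
    neg_injective.injOn
  rw [show -(⟨e, 0⟩ : ℂ) = ⟨-e, 0⟩ from Complex.ext rfl (by simp),
    show -(⟨-n, 0⟩ : ℂ) = ⟨n, 0⟩ from Complex.ext (by simp) (by simp)] at h
  refine h.trans (arcFromTo_segment _ _) ?_
  rintro z ⟨⟨w, hw, rfl⟩, hz⟩
  rw [segment_symm, mem_segment_re hen] at hz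
  simp only [Complex.neg_re, Complex.neg_im, neg_eq_zero] at hz
  have := (upperArc_im he hen hw).2 hz.1
  refine Complex.ext ?_ (by simpa using hz.1)
  simp only [Complex.neg_re]
  rcases this with h | h <;> linarith

theorem lowerArc_im (he : 0 < e) (hen : e ≤ n) (hz : z ∈ lowerArc e n) :
    z.im ≤ 0 ∧ (z.im = 0 → z.re = -e ∨ (e ≤ z.re ∧ z.re ≤ n)) := by
  rcases (mem_lowerArc hen).1 hz with h | h
  · have := upperArc_im he hen h
    simp only [Complex.neg_im, Complex.neg_re] at this
    refine ⟨by linarith, fun h0 => ?_⟩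
    rcases this.2 (by linarith) with h | h
    · exact Or.inl (by linarith)
    · exact Or.inr ⟨by linarith, by linarith⟩
  · exact ⟨h.1.le, fun _ => Or.inr h.2⟩

/-- The curve is cut at `±e` into two arcs. One stays in the closed upper and the other in the
closed lower half plane, so their intersection is found on the real axis. -/
theorem isJordanCurve_cross (he : 0 < e) (hen : e ≤ n) (h1 : e * n = 1) :
    IsJordanCurve (((↑) : ℂ → OnePoint ℂ) '' crossSet e n) := by
  have hn := he.trans_le hen
  have hU : crossSet e n = lowerArc e n ∪ (upperArc e n ∪ segment ℝ ⟨-n, 0⟩ ⟨-e, 0⟩) := by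
    ext z
    rw [mem_crossSet_iff he hen, Set.mem_union, Set.mem_union, mem_lowerArc hen,
      mem_segment_re (by linarith : -n ≤ -e)]
    tauto
  rw [hU]
  refine (arcFromTo_lowerArc he hen h1).isJordanCurve_union
    ((arcFromTo_upperArc he hen h1).trans (arcFromTo_segment _ _) ?_) ?_ ?_
  · rintro z ⟨h2, h3⟩
    rw [mem_segment_re (by linarith : -n ≤ -e)] at h3
    refine Complex.ext ?_ h3.1
    rcases (upperArc_im he hen h2).2 h3.1 with h | h
    · linarith
    · exact h
  · intro h
    have := congrArg Complex.re h
    simp only at this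
    linarith
  · rintro z ⟨h2, h3⟩
    have h4 := lowerArc_im he hen h2
    rw [Set.mem_union, mem_segment_re (by linarith : -n ≤ -e)] at h3
    have h5 : z.im = 0 := by
      rcases h3 with h3 | h3
      · exact le_antisymm h4.1 (upperArc_im he hen h3).1
      · exact h3.1
    have h6 : z.re = -e ∨ z.re = e := by
      have h4 := h4.2 h5
      rcases h3 with h3 | h3
      · rcases (upperArc_im he hen h3).2 h5 with h | h
        · exact Or.inr h
        · rcases h4 with h4 | h4
          · exact Or.inl h4
          · linarith
      · rcases h4 with h4 | h4
        · exact Or.inl h4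
        · linarith
    exact h6.imp (fun h => Complex.ext h h5) fun h => Complex.ext h h5

theorem isJordanCurve_smoothedCross {n : ℕ} (hn : 1 ≤ n) : IsJordanCurve (smoothedCross n) := by
  have h : (1 : ℝ) ≤ n := by exact_mod_cast hn
  have h0 : (0 : ℝ) < n := by linarith
  rw [smoothedCross_eq]
  refine isJordanCurve_cross (one_div_pos.2 h0) ?_ (by field_simp)
  rw [div_le_iff₀ h0]; nlinarith

end

/-! ### The chain is a Jordan curve -/

/-- Bounded displacement of the real part makes the line proper, so it extends to the one-point
compactification of `ℝ`, which is a circle. -/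
theorem isJordanCurve_of_line {γ : ℝ → ℂ} (hγ : Continuous γ) (hi : Function.Injective γ)
    (hd : ∀ t, |(γ t).re - t| ≤ 2) :
    IsJordanCurve (insert OnePoint.infty (((↑) : ℂ → OnePoint ℂ) '' Set.range γ)) := by
  have htend : Tendsto γ (coclosedCompact ℝ) (coclosedCompact ℂ) := by
    rw [coclosedCompact_eq_cocompact, coclosedCompact_eq_cocompact, ← Metric.cobounded_eq_cocompact,
      ← Metric.cobounded_eq_cocompact, ← tendsto_norm_atTop_iff_cobounded]
    refine tendsto_atTop_mono (f := fun t : ℝ => ‖t‖ + (-2)) (fun t => ?_)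
      (tendsto_atTop_add_const_right _ _ tendsto_norm_cobounded_atTop)
    rw [Real.norm_eq_abs]
    have h1 := Complex.abs_re_le_norm (γ t)
    have h2 := abs_sub_abs_le_abs_sub t (γ t).re
    have h3 := hd t
    rw [abs_sub_comm] at h3
    linarith
  let e : OnePoint ℝ ≃ₜ Metric.sphere (0 : EuclideanSpace ℝ (Fin 2)) 1 :=
    onePointEquivSphereOfFinrankEq (by simp)
  let j : Circle → Metric.sphere (0 : EuclideanSpace ℝ (Fin 2)) 1 := fun c =>
    ⟨Complex.orthonormalBasisOneI.repr (c : ℂ), by simpa using c.norm_coe⟩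
  have hjc : Continuous j := by
    refine Continuous.subtype_mk ?_ _
    exact Complex.orthonormalBasisOneI.repr.continuous.comp continuous_subtype_val
  have hji : Function.Injective j := fun c d h =>
    Circle.ext (Complex.orthonormalBasisOneI.repr.injective (congrArg Subtype.val h))
  have hjs : Function.Surjective j := fun v => by
    refine ⟨⟨Complex.orthonormalBasisOneI.repr.symm v.1, ?_⟩, ?_⟩
    · have := mem_sphere_zero_iff_norm.1 v.2
      exact mem_sphere_zero_iff_norm.2 (by rw [LinearIsometryEquiv.norm_map, this])
    · exact Subtype.ext (Complex.orthonormalBasisOneI.repr.apply_symm_apply v.1)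
  refine ⟨fun c => OnePoint.map γ (e.symm (j c)),
    (OnePoint.continuous_map hγ htend).comp (e.symm.continuous.comp hjc),
    (Option.map_injective hi).comp (e.symm.injective.comp hji), ?_⟩
  have : (fun c => OnePoint.map γ (e.symm (j c))) = OnePoint.map γ ∘ (e.symm ∘ j) := rfl
  rw [this, Set.range_comp, (e.symm.surjective.comp hjs).range_eq, Set.image_univ]
  ext q
  constructor
  · rintro ⟨x, rfl⟩
    induction x using OnePoint.rec with
    | infty => exact Or.inl rfl
    | coe t => exact Or.inr ⟨_, ⟨t, rfl⟩, rfl⟩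
  · rintro (rfl | ⟨_, ⟨t, rfl⟩, rfl⟩)
    · exact ⟨OnePoint.infty, rfl⟩
    · exact ⟨(t : OnePoint ℝ), rfl⟩

/-- A chain of arcs, one in each vertical strip of width one, is a Jordan curve through infinity. -/
theorem isJordanCurve_iUnion_arcs {A : ℤ → Set ℂ}
    (hA : ∀ k : ℤ, ArcFromTo ⟨k - 1 / 2, 0⟩ ⟨k + 1 / 2, 0⟩ (A k))
    (hs : ∀ k : ℤ, ∀ z ∈ A k, |z.re - k| ≤ 1 / 2)
    (hs' : ∀ k : ℤ, ∀ z ∈ A k, |z.re - k| = 1 / 2 → z.im = 0) :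
    IsJordanCurve (insert OnePoint.infty (((↑) : ℂ → OnePoint ℂ) '' ⋃ k, A k)) := by
  choose p hpc hpi hpA hp0 hp1 using fun k => (hA k).exists_unit fun h => by
    have := congrArg Complex.re h
    simp only at this
    linarith
  -- The integer part of the parameter selects the arc, its fractional part the point on it.
  set γ : ℝ → ℂ := fun t => p ⌊t⌋ (Int.fract t)
  have hmem : ∀ t, γ t ∈ A ⌊t⌋ := fun t =>
    hpA ⌊t⌋ ▸ ⟨_, ⟨Int.fract_nonneg t, (Int.fract_lt_one t).le⟩, rfl⟩
  have hEq : ∀ k : ℤ, Set.EqOn γ (fun t => p k (t - k)) (Set.Icc (k : ℝ) (k + 1)) := by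
    intro k t ht
    rcases ht.2.eq_or_lt with rfl | h
    · have : ⌊(k : ℝ) + 1⌋ = k + 1 := by
        rw [Int.floor_add_one, Int.floor_intCast]
      simp only [γ, Int.fract, this]
      push_cast
      rw [sub_self, hp0, add_sub_cancel_left, hp1]
      refine Complex.ext ?_ rfl
      simp only; push_cast; ring
    · have : ⌊t⌋ = k := Int.floor_eq_iff.2 ⟨ht.1, h⟩
      simp only [γ, Int.fract, this]
  have hcIcc : ∀ k : ℤ, ContinuousOn γ (Set.Icc (k : ℝ) (k + 1)) := fun k =>
    ContinuousOn.congr ((hpc k).comp (by fun_prop) fun t ht => ⟨by linarith [ht.1], by linarith [ht.2]⟩)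
      (hEq k)
  have hγ : Continuous γ := by
    rw [continuous_iff_continuousAt]
    intro t
    have h := (hcIcc (⌊t⌋ - 1)).union_of_isClosed (hcIcc ⌊t⌋) isClosed_Icc isClosed_Icc
    refine h.continuousAt ?_
    push_cast
    rw [sub_add_cancel, Set.Icc_union_Icc_eq_Icc (by linarith) (by linarith)]
    exact Icc_mem_nhds (by linarith [Int.floor_le t]) (Int.lt_floor_add_one t)
  -- Points of different arcs can agree only on a common border of the strips, hence at the right
  -- end of the first arc. That end has parameter `1`, which a fractional part never attains.
  have hlt : ∀ s t : ℝ, ⌊s⌋ < ⌊t⌋ → γ s ≠ γ t := by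
    intro s t hst h
    have h1 := hs _ _ (hmem s)
    have h2 := hs _ _ (hmem t)
    rw [abs_le] at h1 h2
    have h3 : (⌊s⌋ : ℝ) + 1 ≤ ⌊t⌋ := by exact_mod_cast hst
    rw [← h] at h2
    have h4 : (γ s).re - ⌊s⌋ = 1 / 2 := by linarith
    have h5 : (γ s).im = 0 := hs' _ _ (hmem s) (by rw [h4]; norm_num)
    have h6 : p ⌊s⌋ (Int.fract s) = p ⌊s⌋ 1 := by
      rw [hp1]
      exact Complex.ext (by simp only; linarith) h5
    have := hpi _ ⟨Int.fract_nonneg s, (Int.fract_lt_one s).le⟩ ⟨zero_le_one, le_rfl⟩ h6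
    exact (Int.fract_lt_one s).ne this
  have hi : Function.Injective γ := by
    intro s t h
    rcases lt_trichotomy ⌊s⌋ ⌊t⌋ with h1 | h1 | h1
    · exact (hlt s t h1 h).elim
    · have h2 : p ⌊s⌋ (Int.fract s) = p ⌊s⌋ (Int.fract t) := by
        rw [show p ⌊s⌋ (Int.fract t) = γ t by rw [h1]]; exact h
      have h3 := hpi _ ⟨Int.fract_nonneg s, (Int.fract_lt_one s).le⟩
        ⟨Int.fract_nonneg t, (Int.fract_lt_one t).le⟩ h2
      rw [← Int.floor_add_fract s, ← Int.floor_add_fract t, h1, h3]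
    · exact (hlt t s h1 h.symm).elim
  have hr : Set.range γ = ⋃ k, A k := by
    refine Set.Subset.antisymm ?_ (Set.iUnion_subset fun k => ?_)
    · rintro _ ⟨t, rfl⟩
      exact Set.mem_iUnion.2 ⟨_, hmem t⟩
    · rw [← hpA k]
      rintro _ ⟨t, ht, rfl⟩
      refine ⟨k + t, ?_⟩
      rw [hEq k ⟨by linarith [ht.1], by linarith [ht.2]⟩]
      simp only [add_sub_cancel_left]
  rw [← hr]
  refine isJordanCurve_of_line hγ hi fun t => ?_
  have h1 := hs _ _ (hmem t)
  rw [abs_le] at h1 ⊢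
  constructor <;> linarith [Int.floor_le t, Int.lt_floor_add_one t]

section
variable {e n a b δ : ℝ} {z w : ℂ} {k : ℤ}

/-- The smoothed cross without a gap around `-1`. -/
theorem arcFromTo_gap (he : 0 < e) (hen : e < n) (h1 : e * n = 1) (hab : a < b) (ha : -n ≤ a)
    (hb : b ≤ -e) : ArcFromTo ⟨b, 0⟩ ⟨a, 0⟩ (crossSet e n \ {z | z.im = 0 ∧ a < z.re ∧ z.re < b}) := by
  have hn := he.trans hen
  have hU : crossSet e n \ {z | z.im = 0 ∧ a < z.re ∧ z.re < b} =
      (segment ℝ ⟨b, 0⟩ ⟨-e, 0⟩ ∪ lowerArc e n) ∪ (upperArc e n ∪ segment ℝ ⟨-n, 0⟩ ⟨a, 0⟩) := by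
    ext z
    rw [Set.mem_sdiff, mem_crossSet_iff he hen.le, Set.mem_union, Set.mem_union, Set.mem_union,
      mem_lowerArc hen.le, mem_segment_re hb, mem_segment_re ha]
    have h2 : z ∈ upperArc e n → ¬(z.im = 0 ∧ a < z.re ∧ z.re < b) := fun h h' => by
      rcases (upperArc_im he hen.le h).2 h'.1 with h3 | h3 <;> linarith [h'.2.1, h'.2.2]
    have h3 : -z ∈ upperArc e n → ¬(z.im = 0 ∧ a < z.re ∧ z.re < b) := fun h h' => by
      have h4 := (upperArc_im he hen.le h).2 (by simpa using h'.1)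
      rw [Complex.neg_re] at h4
      rcases h4 with h3 | h3 <;> linarith [h'.2.1, h'.2.2]
    constructor
    · rintro ⟨h | h | h | h, h'⟩
      · exact Or.inr (Or.inl h)
      · exact Or.inl (Or.inr (Or.inl h))
      · exact Or.inl (Or.inr (Or.inr h))
      · rcases le_or_gt z.re a with h4 | h4
        · exact Or.inr (Or.inr ⟨h.1, h.2.1, h4⟩)
        · refine Or.inl (Or.inl ⟨h.1, ?_, h.2.2⟩)
          by_contra! h5
          exact h' ⟨h.1, h4, h5⟩
    · rintro ((h | h | h) | h | h)
      · exact ⟨Or.inr (Or.inr (Or.inr ⟨h.1, by linarith [h.2.1], h.2.2⟩)),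
          fun h' => by linarith [h.2.1, h'.2.2]⟩
      · exact ⟨Or.inr (Or.inl h), h3 h⟩
      · exact ⟨Or.inr (Or.inr (Or.inl h)), fun h' => by linarith [h.2.1, h'.2.2]⟩
      · exact ⟨Or.inl h, h2 h⟩
      · exact ⟨Or.inr (Or.inr (Or.inr ⟨h.1, h.2.1, by linarith [h.2.2]⟩)),
          fun h' => by linarith [h.2.2, h'.2.1]⟩
  rw [hU]
  refine ((arcFromTo_segment _ _).trans (arcFromTo_lowerArc he hen.le h1) ?_).trans
    ((arcFromTo_upperArc he hen.le h1).trans (arcFromTo_segment _ _) ?_) ?_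
  · rintro z ⟨h2, h3⟩
    rw [mem_segment_re hb] at h2
    refine Complex.ext ?_ h2.1
    rcases (lowerArc_im he hen.le h3).2 h2.1 with h | h
    · exact h
    · linarith [h2.2.2, h.1]
  · rintro z ⟨h2, h3⟩
    rw [mem_segment_re ha] at h3
    refine Complex.ext ?_ h3.1
    rcases (upperArc_im he hen.le h2).2 h3.1 with h | h
    · linarith [h3.2.2]
    · exact h
  · rintro z ⟨h2, h3⟩
    rw [Set.mem_union, mem_segment_re hb] at h2
    rw [Set.mem_union, mem_segment_re ha] at h3
    have h5 : z.im = 0 := by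
      rcases h2 with h2 | h2
      · exact h2.1
      rcases h3 with h3 | h3
      · exact le_antisymm (lowerArc_im he hen.le h2).1 (upperArc_im he hen.le h3).1
      · exact h3.1
    have h6 : b ≤ z.re := by
      rcases h2 with h2 | h2
      · exact h2.2.1
      · rcases (lowerArc_im he hen.le h2).2 h5 with h | h
        · linarith
        · linarith [h.1]
    have h7 : z.re = e := by
      rcases h3 with h3 | h3
      · rcases (upperArc_im he hen.le h3).2 h5 with h | h
        · exact h
        · linarith
      · linarith [h3.2.2]
    exact Complex.ext h7 h5

/-- Near `-1` the smoothed cross consists of real points only, so all other points of a copy remain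
strictly inside its strip. -/
theorem half_le_of_mem_crossSet (he : 0 < e) (he2 : e ≤ 1 / 6) (hn : 6 ≤ n) (hz : z ∈ crossSet e n)
    (h0 : z.im ≠ 0) : 1 / 2 ≤ (z.re + 1) ^ 2 + z.im ^ 2 := by
  have hen : e ≤ n := by linarith
  have hre : -(1 / 4) ≤ z.re → 1 / 2 ≤ (z.re + 1) ^ 2 + z.im ^ 2 := fun h => by
    nlinarith [sq_nonneg z.im]
  rcases (mem_crossSet_iff he hen).1 hz with ((h | h) | h) | ((h | h) | h) | h | h
  · exact hre (by linarith [(innerArc_nonneg he h).1])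
  · exact hre (by linarith [((mem_segment_im hen).1 h).1])
  · by_contra! h1
    have h2 : |z.re + 1| < 3 / 4 := abs_lt_of_sq_lt_sq (by nlinarith [sq_nonneg z.im]) (by norm_num)
    have h3 : |z.im| < 3 / 4 := abs_lt_of_sq_lt_sq (by nlinarith [sq_nonneg (z.re + 1)]) (by norm_num)
    rw [abs_lt] at h2 h3
    have h4 := h.1
    have h5 : (n - 7 / 4) ^ 2 ≤ (z.re + n) ^ 2 := by
      apply pow_le_pow_left₀ <;> linarith
    have h6 : (n - 3 / 4) ^ 2 ≤ (z.im - n) ^ 2 := by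
      rw [← neg_sq (z.im - n)]
      apply pow_le_pow_left₀ <;> linarith
    nlinarith
  · have := (innerArc_nonneg he h).2.1
    rw [Complex.neg_re] at this
    exact hre (by linarith)
  · have := ((mem_segment_im hen).1 h).1
    rw [Complex.neg_re] at this
    exact hre (by linarith)
  · have := (outerArc_sign (by linarith) h).1
    rw [Complex.neg_re] at this
    exact hre (by linarith)
  · exact (h0 h.1).elim
  · exact (h0 h.1).elim

theorem gadgetInv_sub (δ : ℝ) (k : ℤ) (w : ℂ) :
    (gadgetInv δ k w).re - k = δ * ((w - 1) / (w + 1)).re := by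
  rw [gadgetInv, Complex.add_re, Complex.intCast_re, Complex.re_ofReal_mul]; ring

theorem abs_gadgetInv_re_sub_le {L : ℝ} (hδ : 0 < δ) (hL : 0 ≤ L) (hw : w ≠ -1)
    (h : (w.re - 1) ^ 2 + w.im ^ 2 ≤ L ^ 2 * ((w.re + 1) ^ 2 + w.im ^ 2)) :
    |(gadgetInv δ k w).re - k| ≤ δ * L := by
  have hw1 : 0 < ‖w + 1‖ := norm_pos_iff.2 fun h => hw (eq_neg_of_add_eq_zero_left h)
  rw [gadgetInv_sub, abs_mul, abs_of_pos hδ]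
  gcongr
  refine (Complex.abs_re_le_norm _).trans ?_
  rw [norm_div, div_le_iff₀ hw1]
  refine abs_le_of_sq_le_sq' ?_ (by positivity) |>.2
  rw [mul_pow, Complex.sq_norm, Complex.sq_norm, Complex.normSq_apply, Complex.normSq_apply]
  simp only [Complex.sub_re, Complex.sub_im, Complex.add_re, Complex.add_im, Complex.one_re,
    Complex.one_im]
  linarith

theorem gadgetInv_ofReal (δ : ℝ) (k : ℤ) (x : ℝ) :
    gadgetInv δ k (⟨x, 0⟩ : ℂ) = ⟨k + δ * ((x - 1) / (x + 1)), 0⟩ := by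
  have h : (⟨x, 0⟩ : ℂ) = (x : ℂ) := rfl
  have h' : (⟨k + δ * ((x - 1) / (x + 1)), 0⟩ : ℂ) = ((k + δ * ((x - 1) / (x + 1)) : ℝ) : ℂ) := rfl
  rw [h, h', gadgetInv]; push_cast; rfl

theorem isJordanCurve_chainCurve (hδ : 0 < δ) (hδ1 : δ ≤ 1 / 100) : IsJordanCurve (chainCurve δ) := by
  -- `a` and `b` are the points of the cross that correspond to `k + 1/2` and `k - 1/2`. The gap
  -- between them contains `-1`, the point at infinity of the copy.
  obtain ⟨a, ha⟩ : ∃ a, a = (2 * δ + 1) / (2 * δ - 1) := ⟨_, rfl⟩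
  obtain ⟨b, hb⟩ : ∃ b, b = (2 * δ - 1) / (2 * δ + 1) := ⟨_, rfl⟩
  have hd1 : 0 < 2 * δ + 1 := by linarith
  have hd2 : 2 * δ - 1 < 0 := by linarith
  have ha1 : a < -1 := by rw [ha, div_lt_iff_of_neg hd2]; linarith
  have ha2 : -6 ≤ a := by rw [ha, le_div_iff_of_neg hd2]; linarith
  have hb1 : -1 < b := by rw [hb, lt_div_iff₀ hd1]; linarith
  have hb2 : b ≤ -(1 / 6) := by rw [hb, div_le_iff₀ hd1]; linarith
  obtain ⟨B, hB⟩ : ∃ B : ℤ → Set ℂ, B = fun k =>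
    crossSet (1 / neck k) (neck k) \ {z | z.im = 0 ∧ a < z.re ∧ z.re < b} := ⟨_, rfl⟩
  have hne : ∀ k, ∀ w ∈ B k, w ≠ -1 := by
    rintro k w hw rfl
    rw [hB] at hw
    exact hw.2 ⟨by simp, by simpa using ha1, by simpa using hb1⟩
  have hlt : ∀ k, ∀ w ∈ B k, w.im ≠ 0 → |(gadgetInv δ k w).re - k| < 1 / 2 := by
    intro k w hw h0
    have h1 := hw
    rw [hB] at h1
    have h2 := half_le_of_mem_crossSet (one_div_neck_pos k) (one_div_neck_le k) (six_le_neck k) h1.1 h0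
    have h3 := mem_awayFromNegOne_of_le (L := 4) h2 (by norm_num) (by norm_num)
    have := abs_gadgetInv_re_sub_le (k := k) hδ (by norm_num) (hne k w hw)
      (coe_mem_awayFromNegOne.1 h3).le
    linarith
  have hle : ∀ k, ∀ w ∈ B k, w.im = 0 → |(gadgetInv δ k w).re - k| ≤ 1 / 2 := by
    intro k w hw h0
    have h1 := hw
    rw [hB] at h1
    have h2 : 0 ≤ ((1 - 2 * δ) * w.re + (1 + 2 * δ)) * ((1 + 2 * δ) * w.re + (1 - 2 * δ)) := by
      rcases le_or_gt w.re a with h | h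
      · rw [ha, le_div_iff_of_neg hd2] at h
        exact mul_nonneg_of_nonpos_of_nonpos (by linarith) (by nlinarith)
      · have h : b ≤ w.re := by by_contra! h'; exact h1.2 ⟨h0, h, h'⟩
        rw [hb, div_le_iff₀ hd1] at h
        exact mul_nonneg (by nlinarith) (by linarith)
    have h3 := abs_gadgetInv_re_sub_le (k := k) (L := 1 / (2 * δ)) hδ (by positivity) (hne k w hw) (by
      rw [h0, div_pow, one_pow, div_mul_eq_mul_div, le_div_iff₀ (by positivity)]
      linarith)
    calc _ ≤ _ := h3
      _ = 1 / 2 := by field_simp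
  have harc : ∀ k : ℤ, ArcFromTo ⟨k - 1 / 2, 0⟩ ⟨k + 1 / 2, 0⟩ (gadgetInv δ k '' B k) := by
    intro k
    have h6 := six_le_neck k
    have h1 := arcFromTo_gap (e := 1 / neck k) (n := neck k) (a := a) (b := b) (one_div_neck_pos k)
      (by linarith [one_div_neck_le k]) (one_div_neck_mul k) (by linarith) (by linarith)
      (by linarith [one_div_neck_le k])
    have h2 := h1.image (f := gadgetInv δ k) (fun w hw => ContinuousAt.continuousWithinAt (by
        have : w + 1 ≠ 0 := fun h => hne k w (hB ▸ hw) (eq_neg_of_add_eq_zero_left h)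
        unfold gadgetInv
        fun_prop (disch := assumption)))
      (fun v hv w hw hvw => OnePoint.coe_injective (by
        rw [← gadgetMap_gadgetInv hδ (hne k v (hB ▸ hv)), ← gadgetMap_gadgetInv hδ (hne k w (hB ▸ hw)),
          hvw]))
    rw [gadgetInv_ofReal, gadgetInv_ofReal] at h2
    have e1 : (k : ℝ) + δ * ((b - 1) / (b + 1)) = k - 1 / 2 := by
      have : (b - 1) / (b + 1) = -(1 / (2 * δ)) := by
        rw [div_eq_iff (by linarith), hb]; field_simp; ring
      rw [this]; field_simp; ring
    have e2 : (k : ℝ) + δ * ((a - 1) / (a + 1)) = k + 1 / 2 := by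
      have : (a - 1) / (a + 1) = 1 / (2 * δ) := by
        have := hd2.ne
        rw [div_eq_iff (by linarith), ha]; field_simp; ring
      rw [this]; field_simp
    rw [e1, e2] at h2
    rw [hB]
    exact h2
  have hcurve : insert OnePoint.infty (((↑) : ℂ → OnePoint ℂ) '' ⋃ k, gadgetInv δ k '' B k) =
      chainCurve δ := by
    ext q
    induction q using OnePoint.rec with
    | infty => exact ⟨fun _ => infty_mem_chainCurve δ, fun _ => Or.inl rfl⟩
    | coe z =>
      rw [Set.mem_insert_iff, or_iff_right (OnePoint.coe_ne_infty z),
        OnePoint.coe_injective.mem_set_image, Set.mem_iUnion]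
      constructor
      · rintro ⟨k, w, hw, rfl⟩
        have h1 : |(gadgetInv δ k w).re - k| ≤ 1 / 2 := by
          by_cases h0 : w.im = 0
          · exact hle k w hw h0
          · exact (hlt k w hw h0).le
        refine (coe_mem_chainCurve (k := k) hδ hδ1 (by linarith)).2
          ⟨w, ?_, (gadgetMap_gadgetInv hδ (hne k w hw)).symm⟩
        rw [hB] at hw
        exact hw.1
      · intro hz
        obtain ⟨k, hk⟩ := exists_abs_sub_le z.re
        obtain ⟨w, hw, hwz⟩ := (coe_mem_chainCurve (k := k) hδ hδ1 (by linarith)).1 hz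
        have h1 := gadgetInv_eq hδ hwz.symm
        refine ⟨k, w, ?_, h1⟩
        rw [hB]
        -- A real point in the gap would correspond to a real point farther than `1/2` from `k`; the
        -- point `-1` itself is no value of the coordinate at a finite point.
        refine ⟨hw, fun ⟨h2, h3, h4⟩ => ?_⟩
        have hw1 : w.re + 1 ≠ 0 := by
          intro h5
          have h6 : w = -1 := Complex.ext (by simp; linarith) (by simp [h2])
          have h7 : gadgetCoord δ k z = 0 := by
            rw [← h1, h6]; simp [gadgetInv, gadgetCoord]; field_simp; ring
          rw [gadgetMap_coe, h7, sphereMob_coe (by norm_num), h6] at hwz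
          have := OnePoint.coe_injective hwz
          norm_num at this
        rw [← h1, show w = ⟨w.re, 0⟩ from Complex.ext rfl h2, gadgetInv_ofReal] at hk
        simp only [add_sub_cancel_left] at hk
        rw [abs_mul, abs_of_pos hδ, abs_div, mul_div_assoc', div_le_iff₀ (abs_pos.2 hw1)] at hk
        have h5 : (2 * δ * |w.re - 1|) ^ 2 ≤ |w.re + 1| ^ 2 :=
          pow_le_pow_left₀ (by positivity) (by linarith) 2
        rw [mul_pow, sq_abs, sq_abs] at h5
        rw [ha, div_lt_iff_of_neg hd2] at h3
        rw [hb, lt_div_iff₀ hd1] at h4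
        have : 0 < ((1 - 2 * δ) * w.re + (1 + 2 * δ)) * -((1 + 2 * δ) * w.re + (1 - 2 * δ)) :=
          mul_pos (by linarith) (by linarith)
        linarith
  rw [← hcurve]
  refine isJordanCurve_iUnion_arcs harc ?_ ?_
  · rintro k _ ⟨w, hw, rfl⟩
    by_cases h0 : w.im = 0
    · exact hle k w hw h0
    · exact (hlt k w hw h0).le
  · rintro k _ ⟨w, hw, rfl⟩ h
    by_cases h0 : w.im = 0
    · rw [show w = ⟨w.re, 0⟩ from Complex.ext rfl h0, gadgetInv_ofReal]
    · exact ((hlt k w hw h0).ne h).elim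

end

theorem mainTheorem6 :
    (∀ n : ℕ, 1 ≤ n → IsJordanCurve (smoothedCross n)) ∧
    Tendsto (fun n : ℕ => boundaryWidth (smoothedCross n)) atTop
      (𝓝 (ENNReal.ofReal (Real.arsinh (Real.sqrt 2)))) ∧
    Tendsto (fun n : ℕ => Metric.hausdorffEDist (toSphere '' smoothedCross n)
      (toSphere '' crossCurve)) atTop (𝓝 0) ∧
    ¬ IsQuasicircle crossCurve ∧
    (∀ w : ℝ, (∀ C : Set (OnePoint ℂ), IsJordanCurve C →
        boundaryWidth C < ENNReal.ofReal w → IsQuasicircle C) →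
      w ≤ Real.arsinh (Real.sqrt 2)) := by
  refine ⟨fun n hn => isJordanCurve_smoothedCross hn, tendsto_boundaryWidth_smoothedCross,
    tendsto_hausdorffEDist_smoothedCross, not_isQuasicircle_crossCurve, fun w hw => ?_⟩
  by_contra! h
  -- Room between `arsinh √2` and `w` is needed because the chain has width at most `arsinh κ = v`
  -- with `κ = sinh v > √2`.
  obtain ⟨v, hv, hvw⟩ := exists_between h
  have hκ : Real.sqrt 2 < Real.sinh v := by
    rwa [← Real.arsinh_lt_arsinh, Real.arsinh_sinh]
  obtain ⟨δ, hδ, hδ1, hwidth⟩ := exists_chainCurve_boundaryWidth_le hκ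
  rw [Real.arsinh_sinh] at hwidth
  have h0 : 0 < w := (Real.arsinh_nonneg_iff.2 (Real.sqrt_nonneg 2)).trans_lt h
  exact not_isQuasicircle_chainCurve hδ hδ1 (hw _ (isJordanCurve_chainCurve hδ hδ1)
    (hwidth.trans_lt ((ENNReal.ofReal_lt_ofReal_iff h0).2 hvw)))
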